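/- **Notation.** Throughout, $p$ denotes a prime. Let $\varpi(n)=\log n$ if $n$ is prime and $\varpi(n)=0$ otherwise, and $\varpi*\varpi(n)=\sum_{d\mid n}\varpi(d)\varpi(n/d)$. Put $C_0=2\log 2-2\gamma-1-2\sum_p\frac{\log p}{p(p-1)}$, where $\gamma$ is Euler's constant. For $(a,q)=1$ and real $x\ge 1$ define $E(x;q,a)$ and $E_2(x;q,a)$ by $$\sum_{\substack{x<n\le 2x\\ n\equiv a\,(q)}}\varpi(n)=\frac{x}{\phi(q)}+E(x;q,a),\qquad \sum_{\substack{x<n\le 2x\\ n\equiv a\,(q)}}\varpi*\varpi(n)=\frac{x}{\phi(q)}\Big(\log x+C_0-2\sum_{p\mid q}\frac{\log p}{p}\Big)+E_2(x;q,a),$$ and let $E^*(N,q)=\sup_{1\le x\le N}\max_{(a,q)=1}|E(x;q,a)|$, $E_2^*(N,q)=\sup_{1\le x\le N}\max_{(a,q)=1}|E_2(x;q,a)|$. Hypothesis $BV(\theta)$ says that for all $A,\epsilon>0$, $\sum_{q\le N^{\theta-\epsilon}}E^*(N,q)\ll_{A,\epsilon}N(\log N)^{-A}$ as $N\to\infty$;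 hypothesis $BV_2(\theta)$ is the same statement with $E_2^*$ in place of $E^*$. For a finite set $\mathcal H$ of $k$ distinct integers let $\nu_p=\nu_p(\mathcal H)$ be the number of residue classes mod $p$ in $\mathcal H$; $\mathcal H$ is admissible if $\nu_p<p$ for all $p$. Let $$\mathfrak S(\mathcal H)=\prod_p\Big(1-\frac{\nu_p}{p}\Big)\Big(1-\frac1p\Big)^{-k},\qquad \beta(\mathcal H)=\sum_p\frac{(k-\nu_p)\log p}{p},\qquad P(n;\mathcal H)=\prod_{h\in\mathcal H}(n+h).$$ For squarefree $d$ let $\nu_d$ be the number of $a$ mod $d$ with $P(a;\mathcal H)\equiv 0 \pmod d$, $f(d)=d/\nu_d$ and $f_1=f*\mu$. For $R>1$ and integers $\ell\ge 0$, $d\ge1$ let $$\lambda_{d,\ell}=\mu(d)\frac{f(d)}{f_1(d)}\frac{\mathfrak S(\mathcal H)}{\ell!}\sum_{\substack{r<R/d\\(r,d)=1}}\frac{\mu^2(r)}{f_1(r)}\Big(\log\frac{R}{rd}\Big)^{\ell}$$ (so $\lambda_{d,\ell}=0$ if $d\ge R$ or $d$ is not squarefree), and $\Lambda_R(n;\mathcal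 H,\ell)=\sum_{d\mid P(n;\mathcal H)}\lambda_{d,\ell}$. **Theorem.** Let $k\ge 2$. There is a constant $C>0$ depending only on $k$ with the following property. Let $0<\theta\le 1$ be such that $BV(\theta)$ and $BV_2(\theta)$ hold, and let $\epsilon>0$. Then there is $N_0$ such that for all real $N\ge N_0$, all real $R$ with $2\le R\le N^{(\theta-\epsilon)/2}$, all admissible sets $\mathcal H$ of $k$ integers with $|h|\le\log N$ for every $h\in\mathcal H$, all $h_0\in\mathcal H$ and all integers $0\le\ell_1,\ell_2\le k$, $$\sum_{N<n\le 2N}\varpi*\varpi(n+h_0)\,\Lambda_R(n;\mathcal H,\ell_1)\,\Lambda_R(n;\mathcal H,\ell_2)=M\,(1+\vartheta),\qquad |\vartheta|\le C\,\frac{\beta(\mathcal H)\,\mathfrak S(\mathcal H)}{\log R},$$ where $$M=\binom{\ell_1+\ell_2+2}{\ell_1+1}(N\log N)\,\mathfrak S(\mathcal H)\frac{(\log R)^{k+\ell_1+\ell_2+1}}{(k+\ell_1+\ell_2+1)!}+2T(k,\ell_1,\ell_2)\,N\,\mathfrak S(\mathcal H)\frac{(\log R)^{k+\ell_1+\ell_2+2}}{(k+\ell_1+\ell_2+2)!}$$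 and $$T(k,\ell_1,\ell_2)=-\binom{\ell_1+\ell_2+3}{\ell_2+1}-\binom{\ell_1+\ell_2+3}{\ell_1+1}+\binom{\ell_1+\ell_2+2}{\ell_1+1}.$$ -/

import Mathlib

open Finset

namespace SmallGaps

noncomputable section

/-! ### Arithmetic functions -/

/-- `ϖ(n) = log n` if `n` is prime, and `0` otherwise. -/
def varpi : ArithmeticFunction ℝ :=
  ⟨fun n => if n.Prime then Real.log n else 0, by simp⟩

/-- The Dirichlet convolution `ϖ * ϖ`. -/
def varpi2 : ArithmeticFunction ℝ := varpi * varpi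

/-! ### Distribution of `ϖ` and `ϖ * ϖ` in arithmetic progressions -/

/-- `E(x; q, a)`: the sum of `ϖ(n)` over `x < n ≤ 2x`, `n ≡ a (mod q)`, minus `x / φ(q)`. -/
def E (x : ℝ) (q : ℕ) (a : ZMod q) : ℝ :=
  (∑ n ∈ Ioc ⌊x⌋₊ ⌊2 * x⌋₊ with (((n : ℕ) : ZMod q) = a), varpi n) - x / (Nat.totient q : ℝ)

/-- `E(x, q)`: the maximum of `|E(x; q, a)|` over reduced residue classes `a` mod `q`. -/
def Emax (x : ℝ) (q : ℕ) : ℝ := ⨆ a : (ZMod q)ˣ, |E x q (a : ZMod q)|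

/-- `E*(N, q)`: the supremum of `E(x, q)` over real `1 ≤ x ≤ N`. -/
def Estar (N : ℝ) (q : ℕ) : ℝ := ⨆ x : Set.Icc (1 : ℝ) N, Emax x q

/-- `C₀ = 2 log 2 - 2γ - 1 - 2 ∑_p log p / (p (p - 1))`. -/
def C0 : ℝ :=
  2 * Real.log 2 - 2 * Real.eulerMascheroniConstant - 1
    - 2 * ∑' p : Nat.Primes, Real.log (p : ℕ) / (((p : ℕ) : ℝ) * (((p : ℕ) : ℝ) - 1))

/-- `E₂(x; q, a)`: the sum of `ϖ * ϖ(n)` over `x < n ≤ 2x`, `n ≡ a (mod q)`, minus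
`(x / φ(q)) (log x + C₀ - 2 ∑_{p ∣ q} log p / p)`. -/
def E2 (x : ℝ) (q : ℕ) (a : ZMod q) : ℝ :=
  (∑ n ∈ Ioc ⌊x⌋₊ ⌊2 * x⌋₊ with (((n : ℕ) : ZMod q) = a), varpi2 n)
    - x / (Nat.totient q : ℝ)
      * (Real.log x + C0 - 2 * ∑ p ∈ q.primeFactors, Real.log (p : ℝ) / (p : ℝ))

/-- `E₂(x, q)`: the maximum of `|E₂(x; q, a)|` over reduced residue classes `a` mod `q`. -/
def E2max (x : ℝ) (q : ℕ) : ℝ := ⨆ a : (ZMod q)ˣ, |E2 x q (a : ZMod q)|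

/-- `E₂*(N, q)`: the supremum of `E₂(x, q)` over real `1 ≤ x ≤ N`. -/
def E2star (N : ℝ) (q : ℕ) : ℝ := ⨆ x : Set.Icc (1 : ℝ) N, E2max x q

/-- Hypothesis `BV(θ)`: for all `A, ε > 0`,
`∑_{q ≤ N^(θ-ε)} E*(N, q) ≪_{A, ε} N (log N)^(-A)` as `N → ∞` through real values. -/
def BV (θ : ℝ) : Prop :=
  ∀ A : ℝ, 0 < A → ∀ ε : ℝ, 0 < ε →
    (fun N : ℝ => ∑ q ∈ Icc 1 ⌊N ^ (θ - ε)⌋₊, Estar N q)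
      =O[Filter.atTop] (fun N : ℝ => N * Real.log N ^ (-A))

/-- Hypothesis `BV₂(θ)`: for all `A, ε > 0`,
`∑_{q ≤ N^(θ-ε)} E₂*(N, q) ≪_{A, ε} N (log N)^(-A)` as `N → ∞` through real values. -/
def BV2 (θ : ℝ) : Prop :=
  ∀ A : ℝ, 0 < A → ∀ ε : ℝ, 0 < ε →
    (fun N : ℝ => ∑ q ∈ Icc 1 ⌊N ^ (θ - ε)⌋₊, E2star N q)
      =O[Filter.atTop] (fun N : ℝ => N * Real.log N ^ (-A))

/-! ### Tuples and the singular series -/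

/-- `ν_p(H)`: the number of distinct residue classes mod `p` in `H`. -/
def nuP (H : Finset ℤ) (p : ℕ) : ℕ := (H.image (fun h : ℤ => (h : ZMod p))).card

/-- `H` is admissible if `ν_p(H) < p` for all primes `p`. -/
def Admissible (H : Finset ℤ) : Prop := ∀ p : ℕ, p.Prime → nuP H p < p

/-- The singular series `𝔖(H) = ∏_p (1 - ν_p(H)/p) (1 - 1/p)^(-k)`, with `k = |H|`. -/
def singularSeries (H : Finset ℤ) : ℝ :=
  ∏' p : Nat.Primes,
    (1 - (nuP H p : ℝ) / ((p : ℕ) : ℝ)) * ((1 - 1 / ((p : ℕ) : ℝ)) ^ H.card)⁻¹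

/-- `β(H) = ∑_p (k - ν_p(H)) log p / p`, with `k = |H|`. -/
def beta (H : Finset ℤ) : ℝ :=
  ∑' p : Nat.Primes,
    ((H.card : ℝ) - (nuP H p : ℝ)) * Real.log (p : ℕ) / ((p : ℕ) : ℝ)

/-! ### The sieve weights -/

/-- `P(n; H) = ∏_{h ∈ H} (n + h)`. -/
def P (n : ℤ) (H : Finset ℤ) : ℤ := ∏ h ∈ H, (n + h)

/-- `ν_d(H)`: the number of `a` mod `d` with `P(a; H) ≡ 0 (mod d)`. -/
def nu (H : Finset ℤ) (d : ℕ) : ℕ :=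
  Nat.card {a : ZMod d // ∏ h ∈ H, (a + (h : ZMod d)) = 0}

/-- `f(d) = d / ν_d(H)` (used at squarefree `d`). -/
def f (H : Finset ℤ) : ArithmeticFunction ℝ :=
  ⟨fun d => (d : ℝ) / (nu H d : ℝ), by simp⟩

/-- `f₁ = f * μ` (Dirichlet convolution). -/
def f1 (H : Finset ℤ) : ArithmeticFunction ℝ :=
  f H * ((ArithmeticFunction.moebius : ArithmeticFunction ℤ) : ArithmeticFunction ℝ)

/-- The sieve coefficients
`λ_{d,ℓ} = μ(d) (f(d) / f₁(d)) (𝔖(H) / ℓ!) ∑_{r < R/d, (r,d) = 1} (μ(r)² / f₁(r)) (log (R/(rd)))^ℓ`.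
For `d ≥ R` the sum is empty, and `λ_{d,ℓ} = 0`. -/
def lam (R : ℝ) (H : Finset ℤ) (ℓ : ℕ) (d : ℕ) : ℝ :=
  (ArithmeticFunction.moebius d : ℝ) * (f H d / f1 H d)
    * (singularSeries H / (Nat.factorial ℓ : ℝ))
    * ∑ r ∈ Icc 1 ⌊R⌋₊ with (((r : ℕ) : ℝ) < R / (d : ℝ) ∧ Nat.Coprime r d),
        (ArithmeticFunction.moebius r : ℝ) ^ 2 / f1 H r
          * Real.log (R / ((r : ℝ) * (d : ℝ))) ^ ℓ

/-- `Λ_R(n; H, ℓ) = ∑_{d ∣ P(n; H)} λ_{d,ℓ}`. The sum may be restricted to `d ≤ R`, since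
`λ_{d,ℓ} = 0` for `d ≥ R`. -/
def LambdaR (R : ℝ) (n : ℤ) (H : Finset ℤ) (ℓ : ℕ) : ℝ :=
  ∑ d ∈ Icc 1 ⌊R⌋₊ with (((d : ℕ) : ℤ) ∣ P n H), lam R H ℓ d

/-! ### The main term -/

/-- `T(k, ℓ₁, ℓ₂)`; it does not depend on `k`. -/
def T (ℓ₁ ℓ₂ : ℕ) : ℝ :=
  - (Nat.choose (ℓ₁ + ℓ₂ + 3) (ℓ₂ + 1) : ℝ)
    - (Nat.choose (ℓ₁ + ℓ₂ + 3) (ℓ₁ + 1) : ℝ)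
    + (Nat.choose (ℓ₁ + ℓ₂ + 2) (ℓ₁ + 1) : ℝ)

/-- The main term, with `k = |H|`. -/
def mainTerm (N R : ℝ) (H : Finset ℤ) (ℓ₁ ℓ₂ : ℕ) : ℝ :=
  (Nat.choose (ℓ₁ + ℓ₂ + 2) (ℓ₁ + 1) : ℝ) * (N * Real.log N) * singularSeries H
      * (Real.log R ^ (H.card + ℓ₁ + ℓ₂ + 1) / (Nat.factorial (H.card + ℓ₁ + ℓ₂ + 1) : ℝ))
    + 2 * T ℓ₁ ℓ₂ * N * singularSeries H
      * (Real.log R ^ (H.card + ℓ₁ + ℓ₂ + 2) / (Nat.factorial (H.card + ℓ₁ + ℓ₂ + 2) : ℝ))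

/-- The sum of `ϖ * ϖ(n + h₀) Λ_R(n; H, ℓ₁) Λ_R(n; H, ℓ₂)` over `N < n ≤ 2N`. -/
def sieveSum (N R : ℝ) (H : Finset ℤ) (h₀ : ℤ) (ℓ₁ ℓ₂ : ℕ) : ℝ :=
  ∑ n ∈ Ioc ⌊N⌋₊ ⌊2 * N⌋₊,
    varpi2 ((n : ℤ) + h₀).toNat * LambdaR R n H ℓ₁ * LambdaR R n H ℓ₂

/-! ### Consistency of the definitions -/

/-- For prime `p` the two descriptions of `ν_p(H)` agree. -/
theorem nu_prime (H : Finset ℤ) {p : ℕ} (hp : p.Prime) : nu H p = nuP H p := by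
  have : Fact p.Prime := ⟨hp⟩
  have e : {a : ZMod p | ∏ h ∈ H, (a + (h : ZMod p)) = 0}
      = ((H.image (fun h : ℤ => (h : ZMod p))).image (fun a => -a) : Finset (ZMod p)) := by
    ext a
    simp only [Set.mem_ofPred_eq, Finset.prod_eq_zero_iff, Finset.coe_image, Set.mem_image,
      Finset.mem_coe, exists_exists_and_eq_and]
    constructor
    · rintro ⟨h, hh, e⟩
      exact ⟨h, hh, (eq_neg_of_add_eq_zero_left e).symm⟩
    · rintro ⟨h, hh, e⟩
      exact ⟨h, hh, by rw [← e]; ring⟩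
  have : nu H p = Set.ncard {a : ZMod p | ∏ h ∈ H, (a + (h : ZMod p)) = 0} := rfl
  rw [this, e, Set.ncard_coe_finset, Finset.card_image_of_injective _ neg_injective]
  rfl

theorem varpi_nonneg (n : ℕ) : 0 ≤ varpi n := by
  change 0 ≤ (if n.Prime then Real.log n else 0)
  split_ifs
  · exact Real.log_natCast_nonneg n
  · exact le_rfl

theorem varpi2_nonneg (n : ℕ) : 0 ≤ varpi2 n := by
  unfold varpi2
  rw [ArithmeticFunction.mul_apply]
  exact Finset.sum_nonneg fun x _ => mul_nonneg (varpi_nonneg _) (varpi_nonneg _)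

theorem sum_progression_le {g : ℕ → ℝ} (hg : ∀ n, 0 ≤ g n) {x N : ℝ} (hx : x ≤ N) (q : ℕ)
    (a : ZMod q) :
    |∑ n ∈ Ioc ⌊x⌋₊ ⌊2 * x⌋₊ with (((n : ℕ) : ZMod q) = a), g n|
      ≤ ∑ n ∈ range (⌊2 * N⌋₊ + 1), g n := by
  rw [abs_of_nonneg (Finset.sum_nonneg fun n _ => hg n)]
  refine Finset.sum_le_sum_of_subset_of_nonneg ?_ fun n _ _ => hg n
  intro n hn
  have h1 := (Finset.mem_Ioc.1 (Finset.mem_filter.1 hn).1).2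
  have h2 : ⌊2 * x⌋₊ ≤ ⌊2 * N⌋₊ := Nat.floor_le_floor (by linarith)
  exact Finset.mem_range.2 (by omega)

/-- The suprema defining `E*(N, q)` are suprema of bounded families. -/
theorem bddAbove_E (N : ℝ) (q : ℕ) :
    ∃ B : ℝ, ∀ x ∈ Set.Icc (1 : ℝ) N, ∀ a : ZMod q, |E x q a| ≤ B := by
  refine ⟨(∑ n ∈ range (⌊2 * N⌋₊ + 1), varpi n) + N / (Nat.totient q : ℝ), ?_⟩
  rintro x ⟨hx1, hx2⟩ a
  refine (abs_sub _ _).trans (add_le_add (sum_progression_le varpi_nonneg hx2 q a) ?_)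
  rw [abs_of_nonneg (by positivity)]
  gcongr

/-- The suprema defining `E₂*(N, q)` are suprema of bounded families. -/
theorem bddAbove_E2 (N : ℝ) (q : ℕ) :
    ∃ B : ℝ, ∀ x ∈ Set.Icc (1 : ℝ) N, ∀ a : ZMod q, |E2 x q a| ≤ B := by
  refine ⟨(∑ n ∈ range (⌊2 * N⌋₊ + 1), varpi2 n) + N / (Nat.totient q : ℝ)
    * (Real.log N + |C0 - 2 * ∑ p ∈ q.primeFactors, Real.log (p : ℝ) / (p : ℝ)|), ?_⟩
  rintro x ⟨hx1, hx2⟩ a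
  refine (abs_sub _ _).trans (add_le_add (sum_progression_le varpi2_nonneg hx2 q a) ?_)
  have hx0 : 0 < x := by linarith
  have hl : 0 ≤ Real.log x := Real.log_nonneg hx1
  rw [abs_mul, abs_of_nonneg (by positivity : 0 ≤ x / (Nat.totient q : ℝ)), add_sub_assoc]
  have h1 : |Real.log x + (C0 - 2 * ∑ p ∈ q.primeFactors, Real.log (p : ℝ) / (p : ℝ))|
      ≤ Real.log N + |C0 - 2 * ∑ p ∈ q.primeFactors, Real.log (p : ℝ) / (p : ℝ)| := by
    refine (abs_add_le _ _).trans ?_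
    rw [abs_of_nonneg hl]
    gcongr
  have hN : 0 ≤ N := by linarith
  exact mul_le_mul (by gcongr) h1 (abs_nonneg _) (by positivity)

end

end SmallGaps

/-! Expanding the two sieve weights turns the sum into a form Σ λ_d λ'_e S([d,e]), where S(D) is the
sum of ϖ*ϖ(m) over m = n + h₀ with D ∣ P(m - h₀). The reduced classes mod D that occur number
∏_{p∣D}(ν_p - 1), and BV₂ evaluates each. An m sharing a prime p with D contributes only if it is p
times a large prime; then the congruence mod p holds automatically through the factor h = h₀, and BV
evaluates ϖ(m/p) in reduced classes mod D/p. With g(p) = (ν_p - 1)/(p - 1) extended multiplicatively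
and x = N + h₀, the expected value of S(D) is x(log x + C₀)g(D) + 2x Σ_{p∣D} (log p/p)(g(D/p) -
g(D)); see `abs_sum_varpi2_sub_le` and `progressionMain_eq`. The accumulated errors carry weights
c^{ω(D)}, which Cauchy–Schwarz against a trivial bound removes (`exists_weighted_sum_le`).

Since g(D/p) is g(D) with the local value at p replaced by 1, the main term is expressed by the
Selberg form Q(g) = Σ λ_d λ'_e g([d,e]) and its modifications Q(g_p). Apart from the factor 𝔖²
carried by the weights, diagonalization (`qform_eq`) gives Q(g) = Σ_r h(r) z_r z'_r with h(p) = (ν_p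
- 1)/(p - ν_p), and Q(g_p) is the same sum over p ∤ r with z_r replaced by z_r - z_{rp} and likewise
for z'. The variable z_r is a sum over integers coprime to r, and its factor r/φ(r) is exactly what
makes z_r ≈ (log(R/r))^{ℓ+1}/(ℓ+1)! free of arithmetic dependence on r. Averaging Q(g_p) - Q(g) over
p with weight log p/p is, by Mertens, one integration; the three cross terms produce the three
binomials of T. Summation over r against h, a function of dimension k - 1, yields 𝔖⁻¹ times a power
of log R.

The summation theorem behind all this (`exists_W_asymptotic`) comes from log n = Σ_{p∣n} log p,
which relates a sum to its logarithmic integral and makes a normalized integral converge. The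
leading constant is found by comparing the Dirichlet series with ζ(1+s)^κ as s → 0⁺
(`W_constant_eq_tprod`). In the summation against h the quantity β(H) bounds the error in Σ_{p ≤
e^u} h(p) log p = (k-1)u + O(β).

For a relative error the main term must not cancel: θ ≤ 1 forces 2 log R ≤ log N, and then the
negative part of T loses against the first term (`le_mainTerm`). Errors lacking a factor β𝔖 are
absorbed because β and 𝔖 are bounded below in terms of k alone (`log_two_div_two_le_beta`,
`exists_le_singularSeries`). -/

namespace SmallGaps
noncomputable section

/-! ### Products over prime factors and sums over squarefree integers -/

/-- `∏_{p ∣ n} g p`. -/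
def pf (g : ℕ → ℝ) (n : ℕ) : ℝ := ∏ p ∈ n.primeFactors, g p

/-- The squarefree integers in `[1, M]`. -/
def sqf (M : ℕ) : Finset ℕ := (Icc 1 M).filter Squarefree

/-- The primes in `[1, M]`. -/
def pr (M : ℕ) : Finset ℕ := (Icc 1 M).filter Nat.Prime

theorem mem_sqf {M n : ℕ} : n ∈ sqf M ↔ n ≤ M ∧ Squarefree n := by
  simp only [sqf, mem_filter, mem_Icc]
  constructor
  · rintro ⟨⟨_, h⟩, h'⟩; exact ⟨h, h'⟩
  · rintro ⟨h, h'⟩; exact ⟨⟨Nat.pos_of_ne_zero h'.ne_zero, h⟩, h'⟩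

theorem mem_pr {M n : ℕ} : n ∈ pr M ↔ n ≤ M ∧ n.Prime := by
  simp only [pr, mem_filter, mem_Icc]
  constructor
  · rintro ⟨⟨_, h⟩, h'⟩; exact ⟨h, h'⟩
  · rintro ⟨h, h'⟩; exact ⟨⟨h'.one_le, h⟩, h'⟩

@[simp] theorem pf_one (g : ℕ → ℝ) : pf g 1 = 1 := by simp [pf]

theorem pf_prime (g : ℕ → ℝ) {p : ℕ} (hp : p.Prime) : pf g p = g p := by
  simp [pf, hp.primeFactors]

theorem pf_mul (g : ℕ → ℝ) {m n : ℕ} (h : m.Coprime n) : pf g (m * n) = pf g m * pf g n := by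
  unfold pf
  rw [h.primeFactors_mul, prod_union h.disjoint_primeFactors]

theorem pf_mul_fun (g g' : ℕ → ℝ) (n : ℕ) : pf (fun p => g p * g' p) n = pf g n * pf g' n := by
  simp [pf, prod_mul_distrib]

theorem pf_congr {g g' : ℕ → ℝ} {n : ℕ} (h : ∀ p, p.Prime → p ∣ n → g p = g' p) :
    pf g n = pf g' n :=
  prod_congr rfl fun p hp => h p (Nat.prime_of_mem_primeFactors hp) (Nat.dvd_of_mem_primeFactors hp)

theorem pf_nonneg {g : ℕ → ℝ} (h : ∀ p, p.Prime → 0 ≤ g p) (n : ℕ) : 0 ≤ pf g n :=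
  prod_nonneg fun p hp => h p (Nat.prime_of_mem_primeFactors hp)

theorem pf_le_pf {g g' : ℕ → ℝ} (h : ∀ p, p.Prime → 0 ≤ g p) (h' : ∀ p, p.Prime → g p ≤ g' p)
    (n : ℕ) : pf g n ≤ pf g' n :=
  prod_le_prod (fun p hp => h p (Nat.prime_of_mem_primeFactors hp))
    fun p hp => h' p (Nat.prime_of_mem_primeFactors hp)

theorem one_le_pf {g : ℕ → ℝ} (h : ∀ p, p.Prime → 1 ≤ g p) (n : ℕ) : 1 ≤ pf g n := by
  have := pf_le_pf (g := fun _ => 1) (g' := g) (fun _ _ => zero_le_one) h n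
  simpa [pf] using this

theorem coprime_div_of_squarefree {t d : ℕ} (ht : Squarefree t) (hd : d ∣ t) :
    d.Coprime (t / d) := by
  obtain ⟨c, rfl⟩ := hd
  have hd0 : d ≠ 0 := by rintro rfl; simp at ht
  rw [Nat.mul_div_cancel_left _ (Nat.pos_of_ne_zero hd0)]
  exact Nat.coprime_of_squarefree_mul ht

theorem pf_div (g : ℕ → ℝ) {t d : ℕ} (ht : Squarefree t) (hd : d ∣ t) :
    pf g t = pf g d * pf g (t / d) := by
  rw [← pf_mul g (coprime_div_of_squarefree ht hd), Nat.mul_div_cancel' hd]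

theorem sum_divisors_pf_mul_pf (a b : ℕ → ℝ) {n : ℕ} (hn : Squarefree n) :
    ∑ r ∈ n.divisors, pf a r * pf b (n / r) = pf (fun p => a p + b p) n := by
  have h := (ArithmeticFunction.IsMultiplicative.prodPrimeFactors
    a).prodPrimeFactors_add_of_squarefree (ArithmeticFunction.IsMultiplicative.prodPrimeFactors b) hn
  rw [ArithmeticFunction.prodPrimeFactors_apply hn.ne_zero, ArithmeticFunction.mul_apply,
    Nat.sum_divisorsAntidiagonal (fun x y => ArithmeticFunction.prodPrimeFactors a x *
      ArithmeticFunction.prodPrimeFactors b y)] at h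
  have e : pf (fun p => a p + b p) n = ∏ p ∈ n.primeFactors,
      (ArithmeticFunction.prodPrimeFactors a + ArithmeticFunction.prodPrimeFactors b) p := by
    refine prod_congr rfl fun p hp => ?_
    have hp' := Nat.prime_of_mem_primeFactors hp
    rw [ArithmeticFunction.add_apply, ArithmeticFunction.prodPrimeFactors_apply hp'.ne_zero,
      ArithmeticFunction.prodPrimeFactors_apply hp'.ne_zero, hp'.primeFactors]
    simp
  rw [e, h]
  refine sum_congr rfl fun r hr => ?_
  have hr' := Nat.dvd_of_mem_divisors hr
  have h1 : r ≠ 0 := fun h => hn.ne_zero (by simpa [h] using hr')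
  have h2 : n / r ≠ 0 := (Nat.div_pos (Nat.le_of_dvd (Nat.pos_of_ne_zero hn.ne_zero) hr')
    (Nat.pos_of_ne_zero h1)).ne'
  rw [ArithmeticFunction.prodPrimeFactors_apply h1, ArithmeticFunction.prodPrimeFactors_apply h2]
  rfl

theorem sum_divisors_pf (a : ℕ → ℝ) {n : ℕ} (hn : Squarefree n) :
    ∑ r ∈ n.divisors, pf a r = pf (fun p => a p + 1) n := by
  rw [← sum_divisors_pf_mul_pf a (fun _ => 1) hn]
  simp [pf]

theorem moebius_eq_pf {n : ℕ} (hn : Squarefree n) :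
    (ArithmeticFunction.moebius n : ℝ) = pf (fun _ => -1) n := by
  rw [ArithmeticFunction.moebius_apply_of_squarefree hn]
  simp only [pf, prod_const]
  rw [← (ArithmeticFunction.cardDistinctFactors_eq_cardFactors_iff_squarefree hn.ne_zero).2 hn]
  rw [ArithmeticFunction.cardDistinctFactors_apply, ← List.card_toFinset, Nat.toFinset_factors]
  push_cast
  rfl

theorem squarefree_lcm {d e : ℕ} (hd : Squarefree d) (he : Squarefree e) :
    Squarefree (Nat.lcm d e) := by
  rw [Nat.squarefree_iff_factorization_le_one (Nat.lcm_ne_zero hd.ne_zero he.ne_zero)]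
  intro p
  rw [Nat.factorization_lcm hd.ne_zero he.ne_zero, Finsupp.sup_apply]
  exact sup_le (hd.natFactorization_le_one p) (he.natFactorization_le_one p)

theorem lcm_eq_mul_div_gcd (d e : ℕ) : Nat.lcm d e = d * (e / Nat.gcd d e) := by
  rw [Nat.lcm, Nat.mul_div_assoc _ (Nat.gcd_dvd_right d e)]

/-- At a prime dividing both d and e the local factor is g = g(1 - g) + g·g. Expanding this over the
divisors r of the gcd separates the variables d and e, which is what diagonalizes the quadratic
form. -/
theorem pf_lcm (g : ℕ → ℝ) {d e : ℕ} (hd : Squarefree d) (he : Squarefree e) :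
    pf g (Nat.lcm d e) = ∑ r ∈ (Nat.gcd d e).divisors,
      pf (fun p => g p * (1 - g p)) r * (pf g (d / r) * pf g (e / r)) := by
  set m := Nat.gcd d e with hm
  have hmd : m ∣ d := Nat.gcd_dvd_left d e
  have hme : m ∣ e := Nat.gcd_dvd_right d e
  have hmsq : Squarefree m := hd.squarefree_of_dvd hmd
  have h1 : pf g (Nat.lcm d e) = pf g m * pf g (d / m) * pf g (e / m) := by
    have hs := squarefree_lcm hd he
    rw [lcm_eq_mul_div_gcd, ← hm] at hs ⊢
    rw [pf_mul g (Nat.coprime_of_squarefree_mul hs), pf_div g hd hmd]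
  have h2 : ∀ c : ℕ, Squarefree c → m ∣ c → ∀ r ∈ m.divisors,
      pf g (c / r) = pf g (m / r) * pf g (c / m) := by
    intro c hc hmc r hr
    have hr' := Nat.dvd_of_mem_divisors hr
    have h0 : 0 < r := Nat.pos_of_mem_divisors hr
    rw [pf_div g (hc.squarefree_of_dvd (Nat.div_dvd_of_dvd (hr'.trans hmc)))
      (Nat.div_dvd_div hr' hmc)]
    congr 2
    rw [Nat.div_div_eq_div_mul, Nat.mul_div_cancel' hr']
  rw [h1]
  have h3 := sum_divisors_pf_mul_pf (fun p => g p * (1 - g p)) (fun p => g p * g p) hmsq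
  have h4 : pf (fun p => g p * (1 - g p) + g p * g p) m = pf g m :=
    pf_congr fun p _ _ => by ring
  rw [h4] at h3
  rw [← h3, sum_mul, sum_mul]
  refine sum_congr rfl fun r hr => ?_
  rw [h2 d hd hmd r hr, h2 e he hme r hr, pf_mul_fun g g]
  ring

/-- Expanding the product over p ≤ M runs through all sets of primes up to M, and n ↦ its set of
prime factors embeds the squarefree n ≤ M among them. -/
theorem sum_sqf_pf_le {h : ℕ → ℝ} (h0 : ∀ p, p.Prime → 0 ≤ h p) (M : ℕ) :
    ∑ n ∈ sqf M, pf h n ≤ ∏ p ∈ pr M, (1 + h p) := by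
  rw [prod_one_add]
  have hinj : Set.InjOn Nat.primeFactors (sqf M : Set ℕ) := by
    intro a ha b hb hab
    have ha' := (mem_sqf.1 (mem_coe.1 ha)).2
    have hb' := (mem_sqf.1 (mem_coe.1 hb)).2
    rw [← Nat.prod_primeFactors_of_squarefree ha', ← Nat.prod_primeFactors_of_squarefree hb', hab]
  have : ∑ n ∈ sqf M, pf h n = ∑ s ∈ (sqf M).image Nat.primeFactors, ∏ p ∈ s, h p := by
    rw [sum_image hinj]; rfl
  rw [this]
  refine sum_le_sum_of_subset_of_nonneg ?_ ?_
  · intro s hs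
    obtain ⟨n, hn, rfl⟩ := mem_image.1 hs
    rw [mem_powerset]
    intro p hp
    have h1 := (mem_sqf.1 hn)
    exact mem_pr.2 ⟨(Nat.le_of_dvd (Nat.pos_of_ne_zero h1.2.ne_zero)
      (Nat.dvd_of_mem_primeFactors hp)).trans h1.1, Nat.prime_of_mem_primeFactors hp⟩
  · intro s hs _
    exact prod_nonneg fun p hp => h0 p (mem_pr.1 (mem_powerset.1 hs hp)).2

/-- The pairs (n, p) with p ∣ n correspond to the pairs (m, p) with n = pm and p ∤ m. This exchange
serves every argument that extracts one prime from a squarefree integer. -/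
theorem sum_sqf_sum_primeFactors (M : ℕ) (G : ℕ → ℕ → ℝ) :
    ∑ n ∈ sqf M, ∑ p ∈ n.primeFactors, G p (n / p)
      = ∑ m ∈ sqf M, ∑ p ∈ (pr M).filter (fun p => ¬ p ∣ m ∧ p * m ≤ M), G p m := by
  rw [sum_sigma', sum_sigma']
  refine sum_bij' (fun x _ => ⟨x.1 / x.2, x.2⟩) (fun x _ => ⟨x.2 * x.1, x.2⟩) ?_ ?_ ?_ ?_ ?_
  · rintro ⟨n, p⟩ hx
    obtain ⟨hn, hp⟩ := mem_sigma.1 hx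
    simp only at hn hp
    obtain ⟨hn1, hn2⟩ := mem_sqf.1 hn
    have hpp := Nat.prime_of_mem_primeFactors hp
    have hpd := Nat.dvd_of_mem_primeFactors hp
    have hpn := Nat.le_of_dvd (Nat.pos_of_ne_zero hn2.ne_zero) hpd
    simp only [mem_sigma, mem_filter]
    refine ⟨mem_sqf.2 ⟨(Nat.div_le_self n p).trans hn1,
      hn2.squarefree_of_dvd (Nat.div_dvd_of_dvd hpd)⟩, mem_pr.2 ⟨hpn.trans hn1, hpp⟩, ?_, ?_⟩
    · exact (Nat.Prime.coprime_iff_not_dvd hpp).1 (coprime_div_of_squarefree hn2 hpd)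
    · rw [Nat.mul_div_cancel' hpd]; exact hn1
  · rintro ⟨m, p⟩ hx
    simp only [mem_sigma, mem_filter] at hx ⊢
    obtain ⟨hm, hp, hpm, hle⟩ := hx
    have hpp := (mem_pr.1 hp).2
    have hm2 := (mem_sqf.1 hm).2
    refine ⟨mem_sqf.2 ⟨hle, ?_⟩, ?_⟩
    · rw [Nat.squarefree_mul ((Nat.Prime.coprime_iff_not_dvd hpp).2 hpm)]
      exact ⟨hpp.squarefree, hm2⟩
    · exact Nat.mem_primeFactors.2 ⟨hpp, dvd_mul_right _ _, mul_ne_zero hpp.ne_zero hm2.ne_zero⟩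
  · rintro ⟨n, p⟩ hx
    obtain ⟨hn, hp⟩ := mem_sigma.1 hx
    simp only at hn hp ⊢
    rw [Nat.mul_div_cancel' (Nat.dvd_of_mem_primeFactors hp)]
  · rintro ⟨m, p⟩ hx
    simp only [mem_sigma, mem_filter] at hx ⊢
    rw [Nat.mul_div_cancel_left _ (mem_pr.1 hx.2.1).2.pos]
  · rintro ⟨n, p⟩ hx
    rfl


/-! ### Mertens' first theorem -/

theorem log_factorial_eq (N : ℕ) :
    Real.log (N.factorial : ℝ) = ∑ p ∈ pr N, (N.factorial.factorization p : ℝ) * Real.log p := by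
  conv_lhs => rw [← Nat.prod_factorization_pow_eq_self (Nat.factorial_ne_zero N)]
  rw [Finsupp.prod, Nat.cast_prod, Real.log_prod]
  · rw [Nat.support_factorization]
    have : N.factorial.primeFactors = pr N := by
      ext p
      rw [Nat.mem_primeFactors, mem_pr]
      constructor
      · rintro ⟨hp, hd, _⟩
        exact ⟨(hp.dvd_factorial).1 hd, hp⟩
      · rintro ⟨h, hp⟩
        exact ⟨hp, (hp.dvd_factorial).2 h, Nat.factorial_ne_zero N⟩
    rw [this]
    refine sum_congr rfl fun p _ => ?_
    push_cast
    rw [Real.log_pow]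
  · intro p hp
    have := (Nat.prime_of_mem_primeFactors (Nat.support_factorization _ ▸ hp)).ne_zero
    positivity

theorem log_factorial_le (N : ℕ) : Real.log (N.factorial : ℝ) ≤ N * Real.log N := by
  have h : (N.factorial : ℝ) ≤ (N : ℝ) ^ N := by exact_mod_cast Nat.factorial_le_pow N
  calc _ ≤ Real.log ((N : ℝ) ^ N) := Real.log_le_log (by positivity) h
    _ = _ := by rw [Real.log_pow]

theorem le_log_factorial (N : ℕ) : N * Real.log N - N ≤ Real.log (N.factorial : ℝ) := by
  rcases Nat.eq_zero_or_pos N with rfl | hN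
  · simp
  have hN' : (0 : ℝ) < N := by exact_mod_cast hN
  have h := Real.pow_div_factorial_le_exp (N : ℝ) hN'.le N
  have h2 : (N : ℝ) ^ N ≤ Real.exp N * N.factorial := by
    rwa [div_le_iff₀ (by positivity)] at h
  have h3 := Real.log_le_log (by positivity) h2
  rw [Real.log_pow, Real.log_mul (by positivity) (by positivity), Real.log_exp] at h3
  linarith

theorem factorization_factorial_ge {N p : ℕ} (hp : p.Prime) (hN : p ≤ N) :
    (N : ℝ) / p - 1 ≤ (N.factorial.factorization p : ℝ) := by
  rw [Nat.factorization_factorial hp (Nat.lt_succ_self _)]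
  have h1 : N / p ^ 1 ≤ ∑ i ∈ Ico 1 (Nat.log p N).succ, N / p ^ i := by
    refine single_le_sum (f := fun i => N / p ^ i) (fun _ _ => Nat.zero_le _) ?_
    rw [mem_Ico]
    exact ⟨le_rfl, Nat.succ_lt_succ (Nat.log_pos hp.one_lt hN)⟩
  rw [pow_one] at h1
  have h2 : (N : ℝ) / p - 1 < ((N / p : ℕ) : ℝ) := by
    have h4 : N < p * (N / p + 1) := by
      have := Nat.div_add_mod N p
      have := Nat.mod_lt N hp.pos
      nlinarith
    have h5 : (N : ℝ) < p * ((N / p : ℕ) + 1) := by exact_mod_cast h4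
    have hp0 : (0 : ℝ) < p := by exact_mod_cast hp.pos
    have : (N : ℝ) / p < (N / p : ℕ) + 1 := by
      rw [div_lt_iff₀ hp0]; linarith
    linarith
  have h3 : ((N / p : ℕ) : ℝ) ≤ ((∑ i ∈ Ico 1 (Nat.log p N).succ, N / p ^ i : ℕ) : ℝ) := by
    exact_mod_cast h1
  linarith

theorem factorization_factorial_le {N p : ℕ} (hp : p.Prime) :
    (N.factorial.factorization p : ℝ) ≤ (N : ℝ) / ((p : ℝ) - 1) := by
  have h := Nat.factorization_factorial_le_div_pred hp N
  have h' : (N.factorial.factorization p : ℝ) ≤ ((N / (p - 1) : ℕ) : ℝ) := by exact_mod_cast h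
  refine h'.trans (Nat.cast_div_le.trans ?_)
  rw [Nat.cast_sub hp.one_le, Nat.cast_one]

theorem log_le_two_mul_sqrt {x : ℝ} (hx : 0 < x) : Real.log x ≤ 2 * Real.sqrt x := by
  have h := Real.add_one_le_exp (Real.log (Real.sqrt x))
  rw [Real.exp_log (Real.sqrt_pos.2 hx), Real.log_sqrt hx.le] at h
  linarith

/-- Every convergent remainder over primes below is reduced to p^{-3/2}: the bound log p ≤ 2√p
brings log p/p² under it as well, so a single constant serves all of them. -/
theorem summable_one_div_mul_sqrt :
    Summable (fun n : ℕ => 1 / ((n : ℝ) * Real.sqrt n)) := by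
  have h := Real.summable_one_div_nat_rpow.2 (by norm_num : (1 : ℝ) < 3 / 2)
  refine h.congr fun n => ?_
  rcases Nat.eq_zero_or_pos n with rfl | hn
  · simp
  · have hn' : (0 : ℝ) < n := by exact_mod_cast hn
    rw [Real.sqrt_eq_rpow, show (3 / 2 : ℝ) = 1 + 1 / 2 by norm_num, Real.rpow_add hn',
      Real.rpow_one]

/-- A bound for `∑_p p^{-3/2}` over any finite set. -/
theorem exists_sum_one_div_mul_sqrt_le :
    ∃ C : ℝ, 0 < C ∧ ∀ s : Finset ℕ, ∑ n ∈ s, 1 / ((n : ℝ) * Real.sqrt n) ≤ C := by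
  refine ⟨(∑' n : ℕ, 1 / ((n : ℝ) * Real.sqrt n)) + 1, ?_, fun s => ?_⟩
  · have : 0 ≤ ∑' n : ℕ, 1 / ((n : ℝ) * Real.sqrt n) := tsum_nonneg fun n => by positivity
    linarith
  · have := summable_one_div_mul_sqrt.sum_le_tsum s fun n _ => by positivity
    linarith

theorem log_div_sq_le {p : ℕ} (hp : p.Prime) :
    Real.log p / ((p : ℝ) - 1) - Real.log p / p ≤ 4 * (1 / ((p : ℝ) * Real.sqrt p)) := by
  have hp2 : (2 : ℝ) ≤ p := by exact_mod_cast hp.two_le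
  have hs : 0 < Real.sqrt p := Real.sqrt_pos.2 (by linarith)
  have hss : Real.sqrt p * Real.sqrt p = p := Real.mul_self_sqrt (by linarith)
  have h := log_le_two_mul_sqrt (x := p) (by linarith)
  have h1 : Real.log p / ((p : ℝ) - 1) - Real.log p / p = Real.log p / (((p : ℝ) - 1) * p) := by
    field_simp [show (p : ℝ) - 1 ≠ 0 by linarith]
    ring
  rw [h1, mul_one_div, div_le_div_iff₀ (by nlinarith) (by positivity)]
  calc Real.log p * (p * Real.sqrt p) ≤ (2 * Real.sqrt p) * (p * Real.sqrt p) := by gcongr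
    _ = 2 * p * p := by linear_combination 2 * (p : ℝ) * hss
    _ ≤ _ := by nlinarith

theorem theta_le (N : ℕ) : ∑ p ∈ pr N, Real.log p ≤ Real.log 4 * N := by
  have h := Chebyshev.theta_le_log4_mul_x (x := (N : ℝ)) (Nat.cast_nonneg N)
  rw [Chebyshev.theta_eq_sum_Icc, Nat.floor_natCast] at h
  refine le_trans (le_of_eq ?_) h
  refine sum_subset ?_ ?_
  · intro p hp
    rw [mem_filter, mem_Icc]
    exact ⟨⟨Nat.zero_le _, (mem_pr.1 hp).1⟩, (mem_pr.1 hp).2⟩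
  · intro p hp hp'
    rw [mem_filter, mem_Icc] at hp
    exact absurd (mem_pr.2 ⟨hp.1.2, hp.2⟩) hp'

/-- Chebyshev's argument: compare log N! = Σ v_p(N!) log p with N log N + O(N). Higher powers of
primes cost N Σ log p/(p(p-1)) = O(N), and rounding N/p costs θ(N) ≤ N log 4. -/
theorem exists_mertens_nat :
    ∃ C : ℝ, 0 < C ∧ ∀ N : ℕ, 1 ≤ N → |∑ p ∈ pr N, Real.log p / p - Real.log N| ≤ C := by
  obtain ⟨C, hC, hC'⟩ := exists_sum_one_div_mul_sqrt_le
  have hl4 : 0 < Real.log 4 := Real.log_pos (by norm_num)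
  -- The upper bound needs log 4 from θ(N); the lower bound needs 1 from N log N - N ≤ log N! and 4C
  -- from the higher prime powers.
  refine ⟨Real.log 4 + 1 + 4 * C, by positivity, fun N hN => ?_⟩
  have hN' : (0 : ℝ) < N := by exact_mod_cast hN
  rw [abs_le]
  constructor
  · have h1 := le_log_factorial N
    rw [log_factorial_eq] at h1
    have h2 : ∑ p ∈ pr N, (N.factorial.factorization p : ℝ) * Real.log p
        ≤ ∑ p ∈ pr N, N * (Real.log p / p + 4 * (1 / ((p : ℝ) * Real.sqrt p))) := by
      refine sum_le_sum fun p hp => ?_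
      have hp := (mem_pr.1 hp).2
      have hlog : 0 ≤ Real.log p := Real.log_natCast_nonneg p
      have := log_div_sq_le hp
      calc _ ≤ (N : ℝ) / ((p : ℝ) - 1) * Real.log p := by
            gcongr; exact factorization_factorial_le hp
        _ = N * (Real.log p / ((p : ℝ) - 1)) := by ring
        _ ≤ _ := by gcongr; linarith
    rw [← mul_sum, sum_add_distrib, ← mul_sum] at h2
    have h3 := hC' (pr N)
    have h4 : (N : ℝ) * (Real.log N - 1) ≤ N * (∑ p ∈ pr N, Real.log p / p + 4 * C) := by
      calc _ = N * Real.log N - N := by ring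
        _ ≤ _ := h1.trans h2
        _ ≤ _ := by gcongr
    have h5 := le_of_mul_le_mul_left h4 hN'
    linarith
  · have h1 := log_factorial_le N
    rw [log_factorial_eq] at h1
    have h2 : ∑ p ∈ pr N, (N * (Real.log p / p) - Real.log p)
        ≤ ∑ p ∈ pr N, (N.factorial.factorization p : ℝ) * Real.log p := by
      refine sum_le_sum fun p hp => ?_
      have hp := mem_pr.1 hp
      have hlog : 0 ≤ Real.log p := Real.log_natCast_nonneg p
      calc _ = ((N : ℝ) / p - 1) * Real.log p := by ring
        _ ≤ _ := by gcongr; exact factorization_factorial_ge hp.2 hp.1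
    rw [sum_sub_distrib, ← mul_sum] at h2
    have h3 := theta_le N
    have h4 : (N : ℝ) * ∑ p ∈ pr N, Real.log p / p ≤ N * (Real.log N + Real.log 4) := by
      linarith
    have h5 := le_of_mul_le_mul_left h4 hN'
    linarith

theorem one_le_floor_exp {u : ℝ} (hu : 0 ≤ u) : 1 ≤ ⌊Real.exp u⌋₊ :=
  Nat.le_floor (by simpa using Real.one_le_exp hu)

theorem log_floor_exp_le {u : ℝ} (hu : 0 ≤ u) : Real.log ⌊Real.exp u⌋₊ ≤ u := by
  have h1 : (0 : ℝ) < ⌊Real.exp u⌋₊ := by exact_mod_cast one_le_floor_exp hu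
  calc _ ≤ Real.log (Real.exp u) := Real.log_le_log h1 (Nat.floor_le (Real.exp_pos u).le)
    _ = u := Real.log_exp u

theorem le_log_floor_exp {u : ℝ} (hu : 0 ≤ u) : u - 1 ≤ Real.log ⌊Real.exp u⌋₊ := by
  have h1 : (1 : ℝ) ≤ ⌊Real.exp u⌋₊ := by exact_mod_cast one_le_floor_exp hu
  have h2 := (Nat.lt_floor_add_one (Real.exp u)).le
  have h3 : Real.exp u ≤ 2 * ⌊Real.exp u⌋₊ := by linarith
  have h4 := Real.log_le_log (Real.exp_pos u) h3
  rw [Real.log_exp, Real.log_mul (by norm_num) (by linarith)] at h4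
  have := Real.log_two_lt_d9
  linarith

theorem exists_mertens :
    ∃ C : ℝ, 0 < C ∧ ∀ u : ℝ, 0 ≤ u → |∑ p ∈ pr ⌊Real.exp u⌋₊, Real.log p / p - u| ≤ C := by
  obtain ⟨C, hC, h⟩ := exists_mertens_nat
  refine ⟨C + 1, by linarith, fun u hu => ?_⟩
  have h1 := abs_le.1 (h _ (one_le_floor_exp hu))
  have h2 := log_floor_exp_le hu
  have h3 := le_log_floor_exp hu
  rw [abs_le]
  constructor <;> linarith [h1.1, h1.2]


/-! ### Logarithmically weighted sums -/

/-- `∑_{log n ≤ u} a(n) (u - log n)^m / m!`. -/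
def W (a : ℕ → ℝ) (m : ℕ) (u : ℝ) : ℝ :=
  ∑ n ∈ Icc 1 ⌊Real.exp u⌋₊, a n * ((u - Real.log n) ^ m / (m.factorial : ℝ))

theorem mem_Icc_floor_exp {n : ℕ} {u : ℝ} :
    n ∈ Icc 1 ⌊Real.exp u⌋₊ ↔ 1 ≤ n ∧ Real.log n ≤ u := by
  rw [mem_Icc, Nat.le_floor_iff (Real.exp_pos u).le]
  refine and_congr_right fun h => ?_
  rw [Real.log_le_iff_le_exp (by exact_mod_cast h)]

/-- With truncated powers the range of summation no longer depends on u, so continuity and one-sided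
differentiability can be read off a fixed finite sum. -/
theorem W_succ_eq (a : ℕ → ℝ) (m : ℕ) {u b : ℝ} (hub : u ≤ b) :
    W a (m + 1) u = ∑ n ∈ Icc 1 ⌊Real.exp b⌋₊,
      a n * (max (u - Real.log n) 0 ^ (m + 1) / ((m + 1).factorial : ℝ)) := by
  unfold W
  refine (sum_congr rfl fun n hn => ?_).trans (sum_subset (s₁ := Icc 1 ⌊Real.exp u⌋₊) ?_ ?_)
  · rw [max_eq_left (by linarith [(mem_Icc_floor_exp.1 hn).2])]
  · intro n hn
    rw [mem_Icc_floor_exp] at hn ⊢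
    exact ⟨hn.1, hn.2.trans hub⟩
  · intro n hn hn'
    rw [mem_Icc_floor_exp] at hn hn'
    have : u < Real.log n := by
      by_contra h
      exact hn' ⟨hn.1, not_lt.1 h⟩
    rw [max_eq_right (by linarith)]
    simp

theorem continuousOn_W_succ (a : ℕ → ℝ) (m : ℕ) (b : ℝ) :
    ContinuousOn (W a (m + 1)) (Set.Iic b) := by
  have : ContinuousOn (fun u => ∑ n ∈ Icc 1 ⌊Real.exp b⌋₊,
      a n * (max (u - Real.log n) 0 ^ (m + 1) / ((m + 1).factorial : ℝ))) (Set.Iic b) := by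
    fun_prop
  exact this.congr fun u hu => W_succ_eq a m hu

theorem hasDerivWithinAt_max_pow (m : ℕ) (c t : ℝ) :
    HasDerivWithinAt (fun u : ℝ => max (u - c) 0 ^ (m + 1) / ((m + 1).factorial : ℝ))
      (if c ≤ t then (t - c) ^ m / (m.factorial : ℝ) else 0) (Set.Ici t) t := by
  have hm : (m.factorial : ℝ) ≠ 0 := by positivity
  split_ifs with h
  · have h1 : HasDerivAt (fun u : ℝ => (u - c) ^ (m + 1) / ((m + 1).factorial : ℝ))
        ((t - c) ^ m / (m.factorial : ℝ)) t := by
      refine ((((hasDerivAt_id' t).sub_const c).fun_pow (m + 1)).div_const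
        ((m + 1).factorial : ℝ)).congr_deriv ?_
      rw [Nat.factorial_succ]
      push_cast
      field_simp
    refine h1.hasDerivWithinAt.congr (fun u hu => ?_) ?_
    · rw [max_eq_left (by have : t ≤ u := hu; linarith)]
    · rw [max_eq_left (by linarith)]
  · have h' : t < c := not_le.1 h
    have h1 : HasDerivAt (fun u : ℝ => max (u - c) 0 ^ (m + 1) / ((m + 1).factorial : ℝ)) 0 t := by
      refine (hasDerivAt_const t (0 : ℝ)).congr_of_eventuallyEq ?_
      filter_upwards [Iio_mem_nhds h'] with u hu
      rw [max_eq_right (by have : u < c := hu; linarith)]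
      simp
    exact h1.hasDerivWithinAt

/-- Raising the order of the weight is integration in u. Only right derivatives are claimed: `W a 0`
jumps at each log n with a(n) ≠ 0, so `W a 1` has a corner there. -/
theorem hasDerivWithinAt_W_succ (a : ℕ → ℝ) (m : ℕ) (t : ℝ) :
    HasDerivWithinAt (W a (m + 1)) (W a m t) (Set.Ici t) t := by
  have h1 : HasDerivWithinAt (fun u => ∑ n ∈ Icc 1 ⌊Real.exp (t + 1)⌋₊,
      a n * (max (u - Real.log n) 0 ^ (m + 1) / ((m + 1).factorial : ℝ)))
      (∑ n ∈ Icc 1 ⌊Real.exp (t + 1)⌋₊, a n * (if Real.log n ≤ t then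
        (t - Real.log n) ^ m / (m.factorial : ℝ) else 0)) (Set.Ici t) t :=
    HasDerivWithinAt.fun_sum fun n _ => (hasDerivWithinAt_max_pow m (Real.log n) t).const_mul (a n)
  have h2 : ∑ n ∈ Icc 1 ⌊Real.exp (t + 1)⌋₊, a n * (if Real.log n ≤ t then
        (t - Real.log n) ^ m / (m.factorial : ℝ) else 0) = W a m t := by
    unfold W
    rw [← sum_subset (s₁ := Icc 1 ⌊Real.exp t⌋₊)]
    · refine sum_congr rfl fun n hn => ?_
      rw [if_pos (mem_Icc_floor_exp.1 hn).2]
    · intro n hn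
      rw [mem_Icc_floor_exp] at hn ⊢
      exact ⟨hn.1, by linarith [hn.2]⟩
    · intro n hn hn'
      rw [mem_Icc_floor_exp] at hn hn'
      rw [if_neg fun h => hn' ⟨hn.1, h⟩, mul_zero]
  rw [h2] at h1
  refine h1.congr_of_eventuallyEq ?_ (W_succ_eq a m (by linarith))
  have : Set.Iio (t + 1) ∈ nhds t := Iio_mem_nhds (by linarith)
  filter_upwards [mem_nhdsWithin_of_mem_nhds this] with u hu
  exact W_succ_eq a m (le_of_lt hu)

theorem W_succ_zero (a : ℕ → ℝ) (m : ℕ) : W a (m + 1) 0 = 0 := by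
  simp [W]

/-- Both sides are integrated m times from 0, where `W a (m + 1)` vanishes. Integrating E(1+u)^{i+m}
only gains a factor 1/(i+m+1), so the same E survives and is uniform in m. -/
theorem abs_W_sub_le {a : ℕ → ℝ} {c E : ℝ} {i j : ℕ} (hE : 0 ≤ E)
    (h : ∀ u : ℝ, 0 ≤ u → |W a 0 u - c * (u ^ j / (j.factorial : ℝ))| ≤ E * (1 + u) ^ i) (m : ℕ) :
    ∀ u : ℝ, 0 ≤ u →
      |W a m u - c * (u ^ (j + m) / ((j + m).factorial : ℝ))| ≤ E * (1 + u) ^ (i + m) := by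
  induction m with
  | zero => exact h
  | succ m ih =>
    intro u hu
    have key := image_norm_le_of_norm_deriv_right_le_deriv_boundary (a := 0) (b := u)
      (f := fun u => W a (m + 1) u - c * (u ^ (j + m + 1) / ((j + m + 1).factorial : ℝ)))
      (f' := fun u => W a m u - c * (u ^ (j + m) / ((j + m).factorial : ℝ)))
      (B := fun u => E * (1 + u) ^ (i + m + 1))
      (B' := fun u => E * (((i + m + 1 : ℕ) : ℝ) * (1 + u) ^ (i + m)))
      ?_ ?_ ?_ ?_ ?_
    · exact key ⟨hu, le_rfl⟩
    · refine ContinuousOn.sub ((continuousOn_W_succ a m u).mono fun x hx => hx.2) ?_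
      fun_prop
    · intro x _
      refine (hasDerivWithinAt_W_succ a m x).sub (HasDerivWithinAt.const_mul _ ?_)
      refine (((hasDerivAt_pow (j + m + 1) x).div_const
        ((j + m + 1).factorial : ℝ)).congr_deriv ?_).hasDerivWithinAt
      rw [Nat.factorial_succ]
      push_cast
      field_simp
    · simp only [W_succ_zero]
      simp [hE]
    · intro x
      refine ((((hasDerivAt_id' x).const_add 1).fun_pow (i + m + 1)).const_mul E).congr_deriv ?_
      simp
    · intro x hx
      have hx0 : 0 ≤ x := hx.1
      rw [Real.norm_eq_abs]
      refine (ih x hx0).trans ?_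
      have : (1 : ℝ) ≤ ((i + m + 1 : ℕ) : ℝ) := by push_cast; linarith [(Nat.cast_nonneg (α := ℝ) i), (Nat.cast_nonneg (α := ℝ) m)]
      have h2 : 0 ≤ (1 + x) ^ (i + m) := by positivity
      exact mul_le_mul_of_nonneg_left (by nlinarith) hE

/-! ### Sums of reciprocals of primes and upper bounds for multiplicative functions -/

theorem pr_succ_sum (g : ℕ → ℝ) (N : ℕ) :
    ∑ p ∈ pr (N + 1), g p = ∑ p ∈ pr N, g p + if (N + 1).Prime then g (N + 1) else 0 := by
  unfold pr
  rw [sum_filter, sum_filter, sum_Icc_succ_top (by omega)]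

/-- Partial summation, run as an induction on N. From N to N + 1 the difference Σ 1/p - (Σ log
p/p)/log N changes by A(1/l - 1/l') with A ≤ l + C, and 1 - l/l' ≤ log(l'/l) makes the bounds
telescope to log log N. -/
theorem exists_sum_one_div_prime_le :
    ∃ K : ℝ, 0 < K ∧ ∀ u : ℝ, 0 ≤ u →
      ∑ p ∈ pr ⌊Real.exp u⌋₊, 1 / (p : ℝ) ≤ Real.log (1 + u) + K := by
  obtain ⟨C, hC, h⟩ := exists_mertens_nat
  have hl2 : 0 < Real.log 2 := Real.log_pos (by norm_num)
  -- Chosen so that both sides of `key` vanish at N = 2.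
  set K := C / Real.log 2 - Real.log (Real.log 2) with hK
  have key : ∀ N : ℕ, 2 ≤ N → ∑ p ∈ pr N, 1 / (p : ℝ) - (∑ p ∈ pr N, Real.log p / p) / Real.log N
      ≤ Real.log (Real.log N) - C / Real.log N + K := by
    intro N hN
    induction N, hN using Nat.le_induction with
    | base =>
      have : pr 2 = {2} := by decide
      rw [this, sum_singleton, sum_singleton, hK]
      push_cast
      have : (1 : ℝ) / 2 - Real.log 2 / 2 / Real.log 2 = 0 := by field_simp; norm_num
      linarith
    | succ N hN ih =>
      have hN1 : (1 : ℝ) < N := by exact_mod_cast hN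
      have hl : 0 < Real.log N := Real.log_pos hN1
      have hll : Real.log N ≤ Real.log (N + 1 : ℕ) :=
        Real.log_le_log (by linarith) (by push_cast; linarith)
      set l := Real.log N with hl_def
      set l' := Real.log (N + 1 : ℕ) with hl'_def
      have hl' : 0 < l' := by linarith
      rw [pr_succ_sum (fun p => 1 / (p : ℝ)), pr_succ_sum (fun p => Real.log p / (p : ℝ))]
      set A := ∑ p ∈ pr N, Real.log p / p with hA
      have hAle : A ≤ l + C := by linarith [(abs_le.1 (h N (by omega))).2]
      have h1 : (if (N + 1).Prime then 1 / ((N + 1 : ℕ) : ℝ) else 0)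
          = (if (N + 1).Prime then Real.log (N + 1 : ℕ) / ((N + 1 : ℕ) : ℝ) else 0) / l' := by
        split_ifs
        · rw [← hl'_def]; field_simp
        · simp
      rw [h1, add_div]
      have h2 : A / l - A / l' ≤ Real.log l' - Real.log l + (C / l - C / l') := by
        have h3 : A / l - A / l' = A * (1 / l - 1 / l') := by ring
        have h4 : 0 ≤ 1 / l - 1 / l' := by
          have := one_div_le_one_div_of_le hl hll
          linarith
        have h5 : A * (1 / l - 1 / l') ≤ (l + C) * (1 / l - 1 / l') := by gcongr
        have h6 : (l + C) * (1 / l - 1 / l') = 1 - l / l' + (C / l - C / l') := by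
          field_simp
        have h7 := Real.log_le_sub_one_of_pos (div_pos hl hl')
        rw [Real.log_div hl.ne' hl'.ne'] at h7
        linarith
      linarith
  refine ⟨|1 + C / Real.log 2 + K| + 1, by positivity, fun u hu => ?_⟩
  rcases Nat.lt_or_ge ⌊Real.exp u⌋₊ 2 with h2 | h2
  · have : ⌊Real.exp u⌋₊ = 1 := le_antisymm (by omega) (one_le_floor_exp hu)
    have e : pr 1 = ∅ := by decide
    rw [this, e, sum_empty]
    have := Real.log_nonneg (by linarith : (1 : ℝ) ≤ 1 + u)
    positivity
  · set N := ⌊Real.exp u⌋₊ with hN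
    have h3 := key N h2
    have hN2 : (2 : ℝ) ≤ N := by exact_mod_cast h2
    have hl : Real.log 2 ≤ Real.log N := Real.log_le_log (by norm_num) hN2
    have hlu := log_floor_exp_le hu
    have hA : ∑ p ∈ pr N, Real.log p / p ≤ Real.log N + C := by
      linarith [(abs_le.1 (h N (by omega))).2]
    have h4 : (∑ p ∈ pr N, Real.log p / p) / Real.log N ≤ 1 + C / Real.log N := by
      rw [div_le_iff₀ (by linarith)]
      have : C / Real.log N * Real.log N = C := by field_simp [(by linarith : Real.log N ≠ 0)]
      nlinarith
    have h5 : Real.log (Real.log N) ≤ Real.log (1 + u) :=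
      Real.log_le_log (by linarith) (by linarith)
    have h6 := le_abs_self (1 + C / Real.log 2 + K)
    have h7 : 0 ≤ C / Real.log 2 := by positivity
    linarith

/-- Rankin's bound: the sum is at most exp(Σ h(p)), and Σ_{p ≤ e^u} 1/p ≤ log(1+u) + O(1). The
constant depends on κ and B only, which is what uniformity in the tuple requires. -/
theorem exists_sum_pf_le (κ : ℕ) (B : ℝ) (hB : 0 ≤ B) :
    ∃ C : ℝ, 0 < C ∧ ∀ h : ℕ → ℝ, (∀ p, p.Prime → 0 ≤ h p) →
      (∀ p : ℕ, p.Prime → h p ≤ κ / p + B * (1 / ((p : ℝ) * Real.sqrt p))) →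
      ∀ u : ℝ, 0 ≤ u → ∑ n ∈ sqf ⌊Real.exp u⌋₊, pf h n ≤ C * (1 + u) ^ κ := by
  obtain ⟨K, hK, h1⟩ := exists_sum_one_div_prime_le
  obtain ⟨C, hC, h2⟩ := exists_sum_one_div_mul_sqrt_le
  refine ⟨Real.exp (κ * K + B * C), Real.exp_pos _, fun h h0 hle u hu => ?_⟩
  refine (sum_sqf_pf_le h0 _).trans ?_
  calc ∏ p ∈ pr ⌊Real.exp u⌋₊, (1 + h p) ≤ ∏ p ∈ pr ⌊Real.exp u⌋₊, Real.exp (h p) := by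
        refine prod_le_prod (fun p hp => ?_) fun p _ => ?_
        · linarith [h0 p (mem_pr.1 hp).2]
        · linarith [Real.add_one_le_exp (h p)]
    _ = Real.exp (∑ p ∈ pr ⌊Real.exp u⌋₊, h p) := (Real.exp_sum _ _).symm
    _ ≤ Real.exp (κ * (Real.log (1 + u) + K) + B * C) := by
        refine Real.exp_le_exp.2 ?_
        calc _ ≤ ∑ p ∈ pr ⌊Real.exp u⌋₊, (κ * (1 / (p : ℝ)) + B * (1 / ((p : ℝ) * Real.sqrt p))) :=
              sum_le_sum fun p hp => by
                have := hle p (mem_pr.1 hp).2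
                rwa [mul_one_div]
          _ ≤ _ := by
              rw [sum_add_distrib, ← mul_sum, ← mul_sum]
              have := h1 u hu
              have := h2 (pr ⌊Real.exp u⌋₊)
              gcongr
    _ = _ := by
        rw [show (κ : ℝ) * (Real.log (1 + u) + K) + B * C
          = κ * Real.log (1 + u) + (κ * K + B * C) by ring, Real.exp_add, mul_comm (κ : ℝ),
          Real.exp_mul, Real.exp_log (by linarith), Real.rpow_natCast]
        ring


/-! ### Sums of multiplicative functions of integral sieve dimension -/

/-- `μ(n)² ∏_{p ∣ n} h p`. -/
def sqfun (h : ℕ → ℝ) (n : ℕ) : ℝ := if Squarefree n then pf h n else 0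

theorem W_sqfun (h : ℕ → ℝ) (m : ℕ) (u : ℝ) :
    W (sqfun h) m u
      = ∑ n ∈ sqf ⌊Real.exp u⌋₊, pf h n * ((u - Real.log n) ^ m / (m.factorial : ℝ)) := by
  unfold W sqfun sqf
  rw [sum_filter]
  exact sum_congr rfl fun n _ => by split_ifs <;> simp

theorem W_sqfun_zero (h : ℕ → ℝ) (u : ℝ) :
    W (sqfun h) 0 u = ∑ n ∈ sqf ⌊Real.exp u⌋₊, pf h n := by
  rw [W_sqfun]; simp

theorem mem_sqf_floor_exp {n : ℕ} {u : ℝ} :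
    n ∈ sqf ⌊Real.exp u⌋₊ ↔ Squarefree n ∧ Real.log n ≤ u := by
  unfold sqf
  rw [mem_filter, mem_Icc_floor_exp]
  constructor
  · rintro ⟨⟨_, h⟩, h'⟩; exact ⟨h', h⟩
  · rintro ⟨h', h⟩; exact ⟨⟨Nat.pos_of_ne_zero h'.ne_zero, h⟩, h'⟩

theorem mem_pr_floor_exp {n : ℕ} {u : ℝ} :
    n ∈ pr ⌊Real.exp u⌋₊ ↔ n.Prime ∧ Real.log n ≤ u := by
  unfold pr
  rw [mem_filter, mem_Icc_floor_exp]
  constructor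
  · rintro ⟨⟨_, h⟩, h'⟩; exact ⟨h', h⟩
  · rintro ⟨h', h⟩; exact ⟨⟨h'.one_le, h⟩, h'⟩

theorem sum_log_primeFactors {n : ℕ} (hn : Squarefree n) :
    ∑ p ∈ n.primeFactors, Real.log p = Real.log n := by
  conv_rhs => rw [← Nat.prod_primeFactors_of_squarefree hn]
  rw [Nat.cast_prod, Real.log_prod]
  intro p hp
  exact_mod_cast (Nat.prime_of_mem_primeFactors hp).ne_zero

theorem sum_pf_mul_log (h : ℕ → ℝ) (M : ℕ) :
    ∑ n ∈ sqf M, pf h n * Real.log n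
      = ∑ m ∈ sqf M, ∑ p ∈ (pr M).filter (fun p => ¬ p ∣ m ∧ p * m ≤ M),
          pf h m * (h p * Real.log p) := by
  rw [← sum_sqf_sum_primeFactors M (fun p m => pf h m * (h p * Real.log p))]
  refine sum_congr rfl fun n hn => ?_
  have hn' := (mem_sqf.1 hn).2
  rw [← sum_log_primeFactors hn', mul_sum]
  refine sum_congr rfl fun p hp => ?_
  have hpp := Nat.prime_of_mem_primeFactors hp
  rw [pf_div h hn' (Nat.dvd_of_mem_primeFactors hp), pf_prime h hpp]
  ring

/-- Here u W₀ = W₁ + Σ h(n) log n. Writing log n as a sum over its primes turns the last sum into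
Σ_m h(m) Σ_{p ≤ e^u/m, p ∤ m} h(p) log p, and the hypothesis evaluates the inner sum over all p as
κ(u - log m) + O(Λ), so that κW₁ appears. The term K pays for the primes p ∣ m. -/
theorem exists_abs_mul_W_sub_le (κ : ℕ) (B : ℝ) (hB : 0 ≤ B) :
    ∃ K : ℝ, 0 < K ∧ ∀ (h : ℕ → ℝ) (Λ : ℝ), (∀ p, p.Prime → 0 ≤ h p) →
      (∀ p : ℕ, p.Prime → h p ≤ κ / p + B * (1 / ((p : ℝ) * Real.sqrt p))) →
      (∀ u : ℝ, 0 ≤ u → |∑ p ∈ pr ⌊Real.exp u⌋₊, h p * Real.log p - κ * u| ≤ Λ) →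
      ∀ u : ℝ, 0 ≤ u → |u * W (sqfun h) 0 u - (κ + 1) * W (sqfun h) 1 u|
        ≤ (Λ + K) * W (sqfun h) 0 u := by
  obtain ⟨C, hC, hC'⟩ := exists_sum_one_div_mul_sqrt_le
  refine ⟨2 * (κ + B) ^ 2 * C + 1, by positivity, fun h Λ h0 hle hM u hu => ?_⟩
  set M := ⌊Real.exp u⌋₊ with hMdef
  have hpf := pf_nonneg h0
  have hlog : ∀ p : ℕ, 0 ≤ Real.log p := fun p => Real.log_natCast_nonneg p
  have hsum : ∑ p ∈ pr M, h p ^ 2 * Real.log p ≤ 2 * (κ + B) ^ 2 * C := by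
    calc _ ≤ ∑ p ∈ pr M, 2 * (κ + B) ^ 2 * (1 / ((p : ℝ) * Real.sqrt p)) := by
          refine sum_le_sum fun p hp => ?_
          have hp := (mem_pr.1 hp).2
          have hp1 : (1 : ℝ) ≤ p := by exact_mod_cast hp.one_le
          have hs : 1 ≤ Real.sqrt p := Real.one_le_sqrt.2 hp1
          have hss : Real.sqrt p * Real.sqrt p = p := Real.mul_self_sqrt (by linarith)
          have h1 : h p ≤ (κ + B) / p := by
            refine (hle p hp).trans ?_
            rw [add_div]
            have : (1 : ℝ) / (p * Real.sqrt p) ≤ 1 / p :=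
              one_div_le_one_div_of_le (by linarith) (by nlinarith)
            have := mul_le_mul_of_nonneg_left this hB
            rw [mul_one_div B (p : ℝ)] at this
            linarith
          have h2 : h p ^ 2 ≤ ((κ + B) / p) ^ 2 := by
            have := h0 p hp
            gcongr
          calc h p ^ 2 * Real.log p ≤ ((κ + B) / p) ^ 2 * (2 * Real.sqrt p) :=
                mul_le_mul h2 (log_le_two_mul_sqrt (by linarith)) (hlog p) (by positivity)
            _ = _ := by
                field_simp
                linear_combination (κ + B) ^ 2 * hss
      _ ≤ _ := by
          rw [← mul_sum]
          gcongr
          exact hC' _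
  have e1 : u * W (sqfun h) 0 u = W (sqfun h) 1 u + ∑ n ∈ sqf M, pf h n * Real.log n := by
    rw [W_sqfun, W_sqfun, mul_sum, ← sum_add_distrib]
    refine sum_congr rfl fun n _ => ?_
    simp only [pow_zero, pow_one, Nat.factorial_zero, Nat.factorial_one, Nat.cast_one]
    ring
  have e2 : W (sqfun h) 1 u = ∑ m ∈ sqf M, pf h m * (u - Real.log m) := by
    rw [W_sqfun]
    simp [hMdef]
  -- The pairs with p ∣ m, added so that the inner sums run over all primes up to e^u/m. Splitting
  -- such m as p·m' turns h(m)h(p) into h(m')h(p)², and Σ h(p)² log p converges.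
  set D := ∑ m ∈ sqf M, ∑ p ∈ m.primeFactors.filter (fun p => p * m ≤ M),
    pf h m * (h p * Real.log p) with hD
  have hD0 : 0 ≤ D := sum_nonneg fun m _ => sum_nonneg fun p hp =>
    mul_nonneg (hpf m) (mul_nonneg (h0 p (Nat.prime_of_mem_primeFactors (mem_filter.1 hp).1)) (hlog p))
  have hD1 : D ≤ 2 * (κ + B) ^ 2 * C * W (sqfun h) 0 u := by
    calc D ≤ ∑ m ∈ sqf M, ∑ p ∈ m.primeFactors, pf h (m / p) * (h p ^ 2 * Real.log p) := by
          refine sum_le_sum fun m hm => ?_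
          refine (sum_le_sum_of_subset_of_nonneg (filter_subset _ _) fun p hp _ =>
            mul_nonneg (hpf m) (mul_nonneg (h0 p (Nat.prime_of_mem_primeFactors hp)) (hlog p))).trans
            (le_of_eq ?_)
          refine sum_congr rfl fun p hp => ?_
          have hpp := Nat.prime_of_mem_primeFactors hp
          rw [pf_div h (mem_sqf.1 hm).2 (Nat.dvd_of_mem_primeFactors hp), pf_prime h hpp]
          ring
      _ = ∑ m ∈ sqf M, ∑ p ∈ (pr M).filter (fun p => ¬ p ∣ m ∧ p * m ≤ M),
            pf h m * (h p ^ 2 * Real.log p) :=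
          sum_sqf_sum_primeFactors M (fun p m => pf h m * (h p ^ 2 * Real.log p))
      _ ≤ ∑ m ∈ sqf M, pf h m * (2 * (κ + B) ^ 2 * C) := by
          refine sum_le_sum fun m hm => ?_
          rw [← mul_sum]
          refine mul_le_mul_of_nonneg_left (le_trans ?_ hsum) (hpf m)
          exact sum_le_sum_of_subset_of_nonneg (filter_subset _ _) fun p _ _ =>
            mul_nonneg (sq_nonneg _) (hlog p)
      _ = _ := by rw [← sum_mul, W_sqfun_zero, mul_comm]
  have e3 : ∑ n ∈ sqf M, pf h n * Real.log n
      = ∑ m ∈ sqf M, pf h m * ∑ p ∈ pr ⌊Real.exp (u - Real.log m)⌋₊, h p * Real.log p - D := by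
    rw [sum_pf_mul_log, hD, ← sum_sub_distrib]
    refine sum_congr rfl fun m hm => ?_
    have hm' := (mem_sqf.1 hm)
    have hm0 : (0 : ℝ) < m := by exact_mod_cast Nat.pos_of_ne_zero hm'.2.ne_zero
    rw [mul_sum, eq_sub_iff_add_eq]
    have e4 : pr ⌊Real.exp (u - Real.log m)⌋₊
        = (pr M).filter (fun p => ¬ p ∣ m ∧ p * m ≤ M) ∪ m.primeFactors.filter (fun p => p * m ≤ M) := by
      ext p
      rw [mem_pr_floor_exp, mem_union, mem_filter, mem_filter, mem_pr, Nat.mem_primeFactors]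
      have key : p.Prime → (Real.log p ≤ u - Real.log m ↔ p * m ≤ M) := by
        intro hp
        have hp0 : (0 : ℝ) < p := by exact_mod_cast hp.pos
        rw [hMdef, Nat.le_floor_iff (Real.exp_pos u).le, Nat.cast_mul,
          ← Real.log_le_iff_le_exp (by positivity), Real.log_mul hp0.ne' hm0.ne', le_sub_iff_add_le]
      constructor
      · rintro ⟨hp, h1⟩
        have h2 := (key hp).1 h1
        by_cases hd : p ∣ m
        · exact Or.inr ⟨⟨hp, hd, hm'.2.ne_zero⟩, h2⟩
        · refine Or.inl ⟨⟨le_trans ?_ h2, hp⟩, hd, h2⟩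
          exact Nat.le_mul_of_pos_right p (Nat.pos_of_ne_zero hm'.2.ne_zero)
      · rintro (⟨⟨_, hp⟩, _, h2⟩ | ⟨⟨hp, _⟩, h2⟩)
        · exact ⟨hp, (key hp).2 h2⟩
        · exact ⟨hp, (key hp).2 h2⟩
    rw [e4, sum_union]
    rw [disjoint_left]
    intro p hp hp'
    exact (mem_filter.1 hp).2.1 (Nat.dvd_of_mem_primeFactors (mem_filter.1 hp').1)
  have e5 : u * W (sqfun h) 0 u - (κ + 1) * W (sqfun h) 1 u
      = ∑ m ∈ sqf M, pf h m * (∑ p ∈ pr ⌊Real.exp (u - Real.log m)⌋₊, h p * Real.log p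
          - κ * (u - Real.log m)) - D := by
    simp only [mul_sub]
    rw [sum_sub_distrib, e1, e3]
    have : ∑ m ∈ sqf M, (pf h m * (κ * u) - pf h m * (κ * Real.log m)) = κ * W (sqfun h) 1 u := by
      rw [e2, mul_sum]
      exact sum_congr rfl fun m _ => by ring
    rw [this]
    ring
  rw [e5]
  have h6 : |∑ m ∈ sqf M, pf h m * (∑ p ∈ pr ⌊Real.exp (u - Real.log m)⌋₊, h p * Real.log p
          - κ * (u - Real.log m))| ≤ Λ * W (sqfun h) 0 u := by
    refine (abs_sum_le_sum_abs _ _).trans ?_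
    rw [W_sqfun_zero, mul_sum]
    refine sum_le_sum fun m hm => ?_
    rw [abs_mul, abs_of_nonneg (hpf m), mul_comm Λ]
    refine mul_le_mul_of_nonneg_left (hM _ ?_) (hpf m)
    linarith [(mem_sqf_floor_exp.1 hm).2]
  have h7 : 0 ≤ W (sqfun h) 0 u := by
    rw [W_sqfun_zero]
    exact sum_nonneg fun n _ => hpf n
  refine (abs_sub _ _).trans ?_
  rw [abs_of_nonneg hD0]
  nlinarith

/-- With κ = j + 1, the derivative of W₁/u^{κ+1} is (uW₀ - (κ+1)W₁)/u^{κ+2}, which by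
`exists_abs_mul_W_sub_le` and the upper bound W₀ ≪ (1+u)^κ is O(Λ/u²). So this quotient has a limit,
approached at rate Λ/u, and the same relation returns the asymptotics of W₀. The error is linear in
Λ. -/
theorem exists_W_asymptotic (j : ℕ) (B : ℝ) (hB : 0 ≤ B) :
    ∃ C : ℝ, 0 < C ∧ ∀ (h : ℕ → ℝ) (Λ : ℝ), 1 ≤ Λ → (∀ p, p.Prime → 0 ≤ h p) →
      (∀ p : ℕ, p.Prime → h p ≤ (j + 1 : ℕ) / p + B * (1 / ((p : ℝ) * Real.sqrt p))) →
      (∀ u : ℝ, 0 ≤ u → |∑ p ∈ pr ⌊Real.exp u⌋₊, h p * Real.log p - (j + 1 : ℕ) * u| ≤ Λ) →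
      ∃ c : ℝ, ∀ u : ℝ, 0 ≤ u →
        |W (sqfun h) 0 u - c * (u ^ (j + 1) / ((j + 1).factorial : ℝ))|
          ≤ C * Λ * (1 + u) ^ j := by
  obtain ⟨K, hK, hΔ⟩ := exists_abs_mul_W_sub_le (j + 1) B hB
  obtain ⟨G, hG, hG'⟩ := exists_sum_pf_le (j + 1) B hB
  set A := (1 + K) * G * 2 ^ (j + 1) with hA
  have hA0 : 0 < A := by positivity
  refine ⟨(j + 2) * A + A + G * 2 ^ (j + 1) + (j + 2) * (G * 2 ^ (j + 1) + A), by positivity,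
    fun h Λ hΛ h0 hle hM => ?_⟩
  have hW0 : ∀ u : ℝ, 0 ≤ u → W (sqfun h) 0 u ≤ G * (1 + u) ^ (j + 1) := fun u hu => by
    rw [W_sqfun_zero]; exact hG' h h0 hle u hu
  have hW0' : ∀ u : ℝ, 0 ≤ W (sqfun h) 0 u := fun u => by
    rw [W_sqfun_zero]; exact sum_nonneg fun n _ => pf_nonneg h0 n
  have hΔ' : ∀ u : ℝ, 1 ≤ u →
      |u * W (sqfun h) 0 u - (j + 2) * W (sqfun h) 1 u| ≤ A * Λ * u ^ (j + 1) := by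
    intro u hu
    have h1 := hΔ h Λ h0 hle hM u (by linarith)
    push_cast at h1
    rw [show (j : ℝ) + 1 + 1 = j + 2 by ring] at h1
    refine h1.trans ?_
    calc (Λ + K) * W (sqfun h) 0 u ≤ (Λ * (1 + K)) * (G * (u + u) ^ (j + 1)) := by
          refine mul_le_mul (by nlinarith) ((hW0 u (by linarith)).trans ?_) (hW0' u) (by positivity)
          gcongr
      _ = _ := by rw [← two_mul, mul_pow, hA]; ring
  set F : ℝ → ℝ := fun u => W (sqfun h) 1 u / u ^ (j + 2) with hF
  have hFder : ∀ a b : ℝ, 1 ≤ a → a ≤ b → |F b - F a| ≤ A * Λ * (1 / a - 1 / b) := by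
    intro a b ha hab
    have key := image_norm_le_of_norm_deriv_right_le_deriv_boundary' (a := a) (b := b)
      (f := fun u => F u - F a)
      (f' := fun u => (u * W (sqfun h) 0 u - (j + 2) * W (sqfun h) 1 u) / u ^ (j + 3))
      (B := fun u => A * Λ * (1 / a - 1 / u)) (B' := fun u => A * Λ * (1 / u ^ 2)) ?_ ?_ ?_ ?_ ?_ ?_
    · exact key ⟨hab, le_rfl⟩
    · refine ContinuousOn.sub (ContinuousOn.div ?_ (by fun_prop) ?_) continuousOn_const
      · exact (continuousOn_W_succ (sqfun h) 0 b).mono fun x hx => hx.2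
      · intro x hx
        have : 0 < x := by linarith [hx.1]
        positivity
    · intro x hx
      have hx0 : 0 < x := by linarith [hx.1]
      have h1 := (hasDerivWithinAt_W_succ (sqfun h) 0 x)
      have h2 := (hasDerivAt_pow (j + 2) x).hasDerivWithinAt (s := Set.Ici x)
      refine ((h1.fun_div h2 (by positivity)).sub_const (F a)).congr_deriv ?_
      push_cast
      rw [div_eq_div_iff (by positivity) (by positivity)]
      ring
    · simp
    · refine ContinuousOn.mul continuousOn_const (continuousOn_const.sub
        (ContinuousOn.div continuousOn_const continuousOn_id ?_))
      intro x hx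
      have : 0 < x := by linarith [hx.1]
      exact this.ne'
    · intro x hx
      have hx0 : 0 < x := by linarith [hx.1]
      have h1 := ((hasDerivAt_inv hx0.ne').const_sub (1 / a)).const_mul (A * Λ)
      simp only [one_div] at h1 ⊢
      refine (h1.congr_deriv ?_).hasDerivWithinAt
      simp
    · intro x hx
      have hx0 : 0 < x := by linarith [hx.1]
      rw [Real.norm_eq_abs, abs_div, abs_of_pos (by positivity : 0 < x ^ (j + 3)),
        div_le_iff₀ (by positivity)]
      refine (hΔ' x (by linarith [hx.1])).trans (le_of_eq ?_)
      rw [show x ^ (j + 3) = x ^ (j + 1) * x ^ 2 by ring]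
      field_simp
  have hcauchy : CauchySeq (fun n : ℕ => F ((n : ℝ) + 1)) := by
    refine cauchySeq_of_le_tendsto_0' (fun n : ℕ => A * Λ * (1 / ((n : ℝ) + 1))) ?_ ?_
    · intro n m hnm
      have hnm' : (n : ℝ) ≤ m := by exact_mod_cast hnm
      rw [dist_comm, Real.dist_eq]
      refine (hFder _ _ (by linarith [Nat.cast_nonneg (α := ℝ) n]) (by linarith)).trans ?_
      have : 0 ≤ 1 / ((m : ℝ) + 1) := by positivity
      gcongr
      linarith
    · have := (tendsto_one_div_add_atTop_nhds_zero_nat (𝕜 := ℝ)).const_mul (A * Λ)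
      simpa using this
  obtain ⟨c1, hc1⟩ := cauchySeq_tendsto_of_complete hcauchy
  have hlim : ∀ a : ℝ, 1 ≤ a → |c1 - F a| ≤ A * Λ * (1 / a) := by
    intro a ha
    refine le_of_tendsto ((hc1.sub_const (F a)).abs) ?_
    filter_upwards [Filter.eventually_ge_atTop ⌈a⌉₊] with n hn
    have hn' : a ≤ n := Nat.ceil_le.1 hn
    refine (hFder a _ ha (by linarith)).trans ?_
    have : 0 ≤ 1 / ((n : ℝ) + 1) := by positivity
    gcongr
    linarith
  have hAΛ : 0 < A * Λ := by positivity
  have hfac : ((j + 1).factorial : ℝ) ≠ 0 := by positivity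
  -- From W₀ ≈ (j+2) W₁/u and W₁ ≈ c1·u^{j+2}; the factorial undoes the normalization of the
  -- statement.
  refine ⟨(j + 1).factorial * ((j + 2) * c1), fun u hu => ?_⟩
  have hce : ((j + 1).factorial * ((j + 2) * c1) : ℝ) * (u ^ (j + 1) / ((j + 1).factorial : ℝ))
      = (j + 2) * c1 * u ^ (j + 1) := by
    field_simp
  rw [hce]
  rcases le_total 1 u with h1 | h1
  · have hu0 : 0 < u := by linarith
    have h2 := hΔ' u h1
    have h3 := hlim u h1
    have e1 : W (sqfun h) 1 u = F u * u ^ (j + 2) := by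
      rw [hF]; field_simp
    have e2 : W (sqfun h) 0 u - (j + 2) * c1 * u ^ (j + 1)
        = (u * W (sqfun h) 0 u - (j + 2) * W (sqfun h) 1 u) / u
          - (j + 2) * (c1 - F u) * u ^ (j + 1) := by
      rw [e1]; field_simp; ring
    rw [e2]
    have h4 : |(u * W (sqfun h) 0 u - (j + 2) * W (sqfun h) 1 u) / u| ≤ A * Λ * u ^ j := by
      rw [abs_div, abs_of_pos hu0, div_le_iff₀ hu0]
      refine h2.trans (le_of_eq (by ring))
    have h5 : |(j + 2) * (c1 - F u) * u ^ (j + 1)| ≤ (j + 2) * (A * Λ) * u ^ j := by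
      rw [abs_mul, abs_mul, abs_of_pos (by positivity : (0 : ℝ) < j + 2),
        abs_of_pos (by positivity : (0 : ℝ) < u ^ (j + 1))]
      calc _ ≤ (j + 2) * (A * Λ * (1 / u)) * u ^ (j + 1) := by gcongr
        _ = _ := by
          rw [pow_succ]
          field_simp
    have h6 : u ^ j ≤ (1 + u) ^ j := by gcongr; linarith
    calc _ ≤ A * Λ * u ^ j + (j + 2) * (A * Λ) * u ^ j := (abs_sub _ _).trans (add_le_add h4 h5)
      _ = ((j + 2) * A + A) * Λ * u ^ j := by ring
      _ ≤ ((j + 2) * A + A) * Λ * (1 + u) ^ j := by gcongr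
      _ ≤ _ := by
          refine mul_le_mul_of_nonneg_right (mul_le_mul_of_nonneg_right ?_ (by linarith))
            (by positivity)
          have : 0 ≤ G * 2 ^ (j + 1) + (j + 2) * (G * 2 ^ (j + 1) + A) := by positivity
          linarith
  -- For u ≤ 1 nothing asymptotic is needed: each term is O(Λ), with c1 bounded by comparison with
  -- `F 1`.
  · have h2 : |W (sqfun h) 0 u| ≤ G * 2 ^ (j + 1) := by
      rw [abs_of_nonneg (hW0' u)]
      refine (hW0 u hu).trans ?_
      gcongr
      linarith
    have h3 : |F 1| ≤ G * 2 ^ (j + 1) := by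
      rw [hF]
      simp only [one_pow, div_one]
      have e : W (sqfun h) 1 1 ≤ W (sqfun h) 0 1 := by
        rw [W_sqfun, W_sqfun]
        refine sum_le_sum fun n hn => mul_le_mul_of_nonneg_left ?_ (pf_nonneg h0 n)
        simp
        exact Real.log_natCast_nonneg n
      have e' : 0 ≤ W (sqfun h) 1 1 := by
        rw [W_sqfun]
        refine sum_nonneg fun n hn => mul_nonneg (pf_nonneg h0 n) ?_
        have := (mem_sqf_floor_exp.1 hn).2
        simp
        linarith
      rw [abs_of_nonneg e']
      refine (e.trans (hW0 1 zero_le_one)).trans (le_of_eq ?_)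
      norm_num
    have h4 : |c1| ≤ G * 2 ^ (j + 1) + A * Λ := by
      have := hlim 1 le_rfl
      rw [div_one, mul_one] at this
      calc |c1| = |(c1 - F 1) + F 1| := by ring_nf
        _ ≤ _ := (abs_add_le _ _).trans (by linarith)
    have h5 : |(j + 2) * c1 * u ^ (j + 1)| ≤ (j + 2) * (G * 2 ^ (j + 1) + A * Λ) := by
      rw [abs_mul, abs_mul, abs_of_pos (by positivity : (0 : ℝ) < j + 2),
        abs_of_nonneg (by positivity : (0 : ℝ) ≤ u ^ (j + 1))]
      calc _ ≤ (j + 2) * (G * 2 ^ (j + 1) + A * Λ) * 1 := by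
            gcongr
            exact pow_le_one₀ hu h1
        _ = _ := mul_one _
    have h6 : (1 : ℝ) ≤ (1 + u) ^ j := one_le_pow₀ (by linarith)
    have hGp : 0 < G * 2 ^ (j + 1) := by positivity
    generalize G * 2 ^ (j + 1) = X at *
    calc _ ≤ X + (j + 2) * (X + A * Λ) :=
          (abs_sub _ _).trans (add_le_add h2 h5)
      _ ≤ X * Λ + (j + 2) * (X * Λ + A * Λ) := by
          gcongr <;> exact le_mul_of_one_le_right hGp.le hΛ
      _ = (X + (j + 2) * (X + A)) * Λ * 1 := by ring
      _ ≤ ((j + 2) * A + A + X + (j + 2) * (X + A)) * Λ * (1 + u) ^ j := by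
          gcongr
          have : 0 ≤ (j + 2) * A + A := by positivity
          linarith


/-! ### The leading constant as an Euler product -/

-- For n ≥ 1, n^{-s} is the integral of s·e^{-su} over u ≥ log n; sum and integral may be exchanged
-- because all terms are nonnegative. The Dirichlet series thus becomes a Laplace transform of the
-- counting sum.
open MeasureTheory in
theorem tsum_mul_rpow_eq_integral {a : ℕ → ℝ} (ha : ∀ n, 0 ≤ a n) (ha0 : a 0 = 0) {s : ℝ}
    (hs : 0 < s) (hsum : Summable fun n : ℕ => a n * (n : ℝ) ^ (-s)) :
    ∑' n : ℕ, a n * (n : ℝ) ^ (-s)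
      = ∫ u in Set.Ici (0 : ℝ), s * Real.exp (-s * u) * W a 0 u := by
  set F : ℕ → ℝ → ℝ := fun n =>
    (Set.Ici (Real.log n)).indicator (fun u => a n * (s * Real.exp (-s * u))) with hF
  have hexp : ∀ c : ℝ, IntegrableOn (fun u : ℝ => s * Real.exp (-s * u)) (Set.Ici c) := fun c => by
    rw [integrableOn_Ici_iff_integrableOn_Ioi]
    exact (integrableOn_exp_mul_Ioi (by linarith : -s < 0) c).const_mul s
  have hint : ∀ n, IntegrableOn (F n) (Set.Ici 0) := fun n =>
    ((hexp 0).const_mul (a n)).indicator measurableSet_Ici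
  have hval : ∀ n, ∫ u in Set.Ici (0 : ℝ), F n u = a n * (n : ℝ) ^ (-s) := by
    intro n
    rcases Nat.eq_zero_or_pos n with rfl | hn
    · simp [hF, ha0]
    have hn' : (0 : ℝ) < n := by exact_mod_cast hn
    have hl : 0 ≤ Real.log n := Real.log_natCast_nonneg n
    have e : Set.Ici (0 : ℝ) ∩ Set.Ici (Real.log n) = Set.Ici (Real.log n) := by
      rw [Set.Ici_inter_Ici, sup_eq_right.2 hl]
    rw [hF, setIntegral_indicator measurableSet_Ici, e, integral_Ici_eq_integral_Ioi,
      integral_const_mul, integral_const_mul, integral_exp_mul_Ioi (by linarith),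
      Real.rpow_def_of_pos hn', mul_comm (-s) (Real.log n)]
    field_simp
  have hFn : ∀ n u, 0 ≤ F n u := fun n u =>
    Set.indicator_nonneg (fun u _ => by have := ha n; positivity) u
  have h := hasSum_integral_of_summable_integral_norm (F := F)
    (μ := volume.restrict (Set.Ici (0 : ℝ))) hint ?_
  · rw [funext hval] at h
    rw [h.tsum_eq]
    refine setIntegral_congr_fun measurableSet_Ici fun u _ => ?_
    change ∑' n, F n u = _
    rw [tsum_eq_sum (s := Icc 1 ⌊Real.exp u⌋₊)]
    · unfold W
      rw [mul_sum]
      refine sum_congr rfl fun n hn => ?_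
      rw [hF]
      simp only
      rw [Set.indicator_of_mem (by exact (mem_Icc_floor_exp.1 hn).2)]
      simp
      ring
    · intro n hn
      rw [mem_Icc_floor_exp] at hn
      rcases Nat.eq_zero_or_pos n with rfl | hn'
      · simp [hF, ha0]
      · exact Set.indicator_of_notMem (fun h => hn ⟨hn', h⟩) _
  · have : (fun n => ∫ u in Set.Ici (0 : ℝ), ‖F n u‖) = fun n : ℕ => a n * (n : ℝ) ^ (-s) := by
      funext n
      rw [← hval n]
      refine integral_congr_ae (Filter.Eventually.of_forall fun u => ?_)
      exact Real.norm_of_nonneg (hFn n u)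
    rw [this]
    exact hsum

open MeasureTheory in
theorem integral_pow_mul_exp (m : ℕ) {s : ℝ} (hs : 0 < s) :
    IntegrableOn (fun u : ℝ => s * Real.exp (-s * u) * u ^ m) (Set.Ici 0) ∧
      ∫ u in Set.Ici (0 : ℝ), s * Real.exp (-s * u) * u ^ m = m.factorial / s ^ m := by
  constructor
  · rw [integrableOn_Ici_iff_integrableOn_Ioi]
    have h : IntegrableOn (fun x : ℝ => s * (x ^ (m : ℝ) * Real.exp (-s * x ^ (1 : ℝ))))
        (Set.Ioi 0) := (integrableOn_rpow_mul_exp_neg_mul_rpow (p := 1) (s := m) (b := s)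
      (by have := Nat.cast_nonneg (α := ℝ) m; linarith) one_pos hs).const_mul s
    refine h.congr_fun (fun u _ => ?_) measurableSet_Ioi
    simp only [Real.rpow_one, Real.rpow_natCast]
    ring
  · rw [integral_Ici_eq_integral_Ioi]
    have h := Real.integral_rpow_mul_exp_neg_mul_Ioi (a := m + 1) (r := s) (by positivity) hs
    rw [Real.Gamma_nat_eq_factorial] at h
    have e : ∫ u in Set.Ioi (0 : ℝ), s * Real.exp (-s * u) * u ^ m
        = s * ∫ t in Set.Ioi (0 : ℝ), t ^ ((m : ℝ) + 1 - 1) * Real.exp (-(s * t)) := by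
      rw [← integral_const_mul]
      refine setIntegral_congr_fun measurableSet_Ioi fun u _ => ?_
      simp only [add_sub_cancel_right, Real.rpow_natCast]
      ring_nf
    rw [e, h, show ((m : ℝ) + 1) = ((m + 1 : ℕ) : ℝ) by push_cast; ring, Real.rpow_natCast, pow_succ]
    field_simp
    rw [← mul_pow, one_div, inv_mul_cancel₀ hs.ne', one_pow]

theorem monotone_W_zero {a : ℕ → ℝ} (ha : ∀ n, 0 ≤ a n) : Monotone (W a 0) := by
  intro u v huv
  unfold W
  refine sum_le_sum_of_subset_of_nonneg ?_ fun n _ _ => by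
    have := ha n
    simpa using this
  intro n hn
  rw [mem_Icc_floor_exp] at hn ⊢
  exact ⟨hn.1, hn.2.trans huv⟩

-- An Abelian theorem. In the Laplace transform the main term integrates to c/s^{j+1} exactly, while
-- the error E(1+u)^j gives O(1 + s^{-j}), which s^{j+1} kills as s → 0⁺.
open MeasureTheory in
theorem tendsto_pow_mul_tsum {a : ℕ → ℝ} (ha : ∀ n, 0 ≤ a n) (ha0 : a 0 = 0)
    (hsum : ∀ s : ℝ, 0 < s → Summable fun n : ℕ => a n * (n : ℝ) ^ (-s)) {c E : ℝ} {j : ℕ}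
    (hW : ∀ u : ℝ, 0 ≤ u →
      |W a 0 u - c * (u ^ (j + 1) / ((j + 1).factorial : ℝ))| ≤ E * (1 + u) ^ j) :
    Filter.Tendsto (fun s : ℝ => s ^ (j + 1) * ∑' n : ℕ, a n * (n : ℝ) ^ (-s))
      (nhdsWithin 0 (Set.Ioi 0)) (nhds c) := by
  have hE : 0 ≤ E := by
    have := (abs_nonneg _).trans (hW 0 le_rfl)
    simpa using this
  have key : ∀ s : ℝ, 0 < s → |s ^ (j + 1) * ∑' n : ℕ, a n * (n : ℝ) ^ (-s) - c|
      ≤ E * 2 ^ j * (s ^ (j + 1) + j.factorial * s) := by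
    intro s hs
    rw [tsum_mul_rpow_eq_integral ha ha0 hs (hsum s hs)]
    obtain ⟨i0, v0⟩ := integral_pow_mul_exp 0 hs
    obtain ⟨i1, v1⟩ := integral_pow_mul_exp j hs
    obtain ⟨i2, v2⟩ := integral_pow_mul_exp (j + 1) hs
    have hbd : ∀ u ∈ Set.Ici (0 : ℝ), ‖s * Real.exp (-s * u) *
        (W a 0 u - c * (u ^ (j + 1) / ((j + 1).factorial : ℝ)))‖
        ≤ E * 2 ^ j * (s * Real.exp (-s * u) * u ^ 0 + s * Real.exp (-s * u) * u ^ j) := by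
      intro u hu
      have hu0 : 0 ≤ u := hu
      have hp : 0 < s * Real.exp (-s * u) := by positivity
      rw [norm_mul, Real.norm_of_nonneg hp.le, Real.norm_eq_abs]
      have h2 : (1 + u) ^ j ≤ 2 ^ j * (1 + u ^ j) := by
        rcases le_total u 1 with h | h
        · calc (1 + u) ^ j ≤ 2 ^ j := by gcongr; linarith
            _ ≤ 2 ^ j * (1 + u ^ j) := le_mul_of_one_le_right (by positivity)
                (by have : 0 ≤ u ^ j := by positivity
                    linarith)
        · calc (1 + u) ^ j ≤ (2 * u) ^ j := by gcongr; linarith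
            _ = 2 ^ j * u ^ j := mul_pow _ _ _
            _ ≤ _ := by gcongr; linarith
      calc _ ≤ s * Real.exp (-s * u) * (E * (2 ^ j * (1 + u ^ j))) := by
            gcongr
            exact (hW u hu0).trans (by gcongr)
        _ = _ := by ring
    have hgi := (i0.add i1).const_mul (E * 2 ^ j)
    have hfi : IntegrableOn (fun u : ℝ => s * Real.exp (-s * u) *
        (W a 0 u - c * (u ^ (j + 1) / ((j + 1).factorial : ℝ)))) (Set.Ici 0) := by
      refine Integrable.mono' hgi ?_ ((ae_restrict_iff' measurableSet_Ici).2
        (Filter.Eventually.of_forall hbd))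
      have := (monotone_W_zero ha).measurable
      have hm : Measurable (fun u : ℝ => s * Real.exp (-s * u) *
        (W a 0 u - c * (u ^ (j + 1) / ((j + 1).factorial : ℝ)))) := by fun_prop
      exact hm.aestronglyMeasurable
    have hdiff : ∫ u in Set.Ici (0 : ℝ), s * Real.exp (-s * u) * W a 0 u
        = (∫ u in Set.Ici (0 : ℝ), s * Real.exp (-s * u) *
          (W a 0 u - c * (u ^ (j + 1) / ((j + 1).factorial : ℝ)))) + c / s ^ (j + 1) := by
      have : c / s ^ (j + 1) = ∫ u in Set.Ici (0 : ℝ),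
          c / ((j + 1).factorial : ℝ) * (s * Real.exp (-s * u) * u ^ (j + 1)) := by
        rw [integral_const_mul, v2]
        field_simp
      rw [this, ← integral_add hfi (i2.const_mul _)]
      refine setIntegral_congr_fun measurableSet_Ici fun u _ => ?_
      ring
    rw [hdiff, mul_add]
    have e : s ^ (j + 1) * (c / s ^ (j + 1)) = c := by field_simp
    rw [e, add_sub_cancel_right, abs_mul, abs_of_pos (by positivity)]
    have hn := norm_integral_le_of_norm_le hgi ((ae_restrict_iff' measurableSet_Ici).2
        (Filter.Eventually.of_forall hbd))
    rw [Real.norm_eq_abs, integral_const_mul, integral_add' i0 i1, v0, v1] at hn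
    calc _ ≤ s ^ (j + 1) * (E * 2 ^ j * (((0 : ℕ).factorial : ℝ) / s ^ 0 + j.factorial / s ^ j)) := by
          gcongr
      _ = _ := by
          simp only [Nat.factorial_zero, Nat.cast_one, pow_zero, div_one, pow_succ]
          field_simp
  rw [tendsto_iff_norm_sub_tendsto_zero]
  have hlim : Filter.Tendsto (fun s : ℝ => E * 2 ^ j * (s ^ (j + 1) + j.factorial * s))
      (nhdsWithin 0 (Set.Ioi 0)) (nhds 0) := by
    have : Continuous (fun s : ℝ => E * 2 ^ j * (s ^ (j + 1) + j.factorial * s)) := by fun_prop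
    have h := this.tendsto 0
    simp only [ne_eq, Nat.add_eq_zero_iff, one_ne_zero, and_false, not_false_eq_true, zero_pow,
      mul_zero, add_zero] at h
    exact h.mono_left nhdsWithin_le_nhds
  refine squeeze_zero' (Filter.Eventually.of_forall fun _ => norm_nonneg _) ?_ hlim
  filter_upwards [self_mem_nhdsWithin] with s hs
  exact key s hs

theorem rpow_eq_pf (s : ℝ) {n : ℕ} (hn : Squarefree n) :
    (n : ℝ) ^ s = pf (fun p => (p : ℝ) ^ s) n := by
  conv_lhs => rw [← Nat.prod_primeFactors_of_squarefree hn]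
  rw [Nat.cast_prod, ← Real.finsetProd_rpow _ _ fun p _ => Nat.cast_nonneg p]
  rfl

theorem sqfun_mul_rpow (h : ℕ → ℝ) (s : ℝ) (n : ℕ) :
    sqfun h n * (n : ℝ) ^ s = sqfun (fun p => h p * (p : ℝ) ^ s) n := by
  unfold sqfun
  split_ifs with hn
  · rw [pf_mul_fun, rpow_eq_pf s hn]
  · simp

theorem summable_sqfun {h : ℕ → ℝ} (h0 : ∀ p, p.Prime → 0 ≤ h p) {b : ℕ → ℝ}
    (hb0 : ∀ n, 0 ≤ b n) (hb : Summable b) (hle : ∀ p, p.Prime → h p ≤ b p) :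
    Summable (sqfun h) := by
  refine summable_of_sum_range_le (c := Real.exp (∑' n, b n)) (fun n => ?_) fun N => ?_
  · unfold sqfun
    split_ifs
    · exact pf_nonneg h0 n
    · exact le_rfl
  · calc ∑ n ∈ range N, sqfun h n ≤ ∑ n ∈ sqf N, pf h n := by
          unfold sqfun
          rw [← sum_filter]
          refine sum_le_sum_of_subset_of_nonneg ?_ fun n _ _ => pf_nonneg h0 n
          intro n hn
          rw [mem_filter, mem_range] at hn
          exact mem_sqf.2 ⟨hn.1.le, hn.2⟩
      _ ≤ ∏ p ∈ pr N, (1 + h p) := sum_sqf_pf_le h0 N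
      _ ≤ ∏ p ∈ pr N, Real.exp (b p) := by
          refine prod_le_prod (fun p hp => ?_) fun p hp => ?_
          · linarith [h0 p (mem_pr.1 hp).2]
          · linarith [Real.add_one_le_exp (b p), hle p (mem_pr.1 hp).2]
      _ = Real.exp (∑ p ∈ pr N, b p) := (Real.exp_sum _ _).symm
      _ ≤ _ := Real.exp_le_exp.2 (hb.sum_le_tsum _ fun n _ => hb0 n)

theorem hasProd_sqfun {h : ℕ → ℝ} (hsum : Summable fun n => ‖sqfun h n‖) :
    HasProd (fun p : Nat.Primes => 1 + h p) (∑' n, sqfun h n) := by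
  have key := EulerProduct.eulerProduct_hasProd (f := sqfun h) (by simp [sqfun]) ?_ hsum
    (by simp [sqfun])
  · refine key.congr_fun fun p => ?_
    rw [tsum_eq_sum (s := range 2)]
    · rw [sum_range_succ, sum_range_one, pow_zero, pow_one]
      unfold sqfun
      rw [if_pos squarefree_one, if_pos p.2.squarefree, pf_one, pf_prime h p.2]
    · intro e he
      rw [mem_range, not_lt] at he
      unfold sqfun
      rw [if_neg]
      intro hsq
      have h1 : ((p : ℕ) * p) ∣ (p : ℕ) ^ e := by
        rw [← pow_two]; exact pow_dvd_pow _ he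
      exact p.2.one_lt.ne' (Nat.isUnit_iff.1 (hsq _ h1))
  · intro m n hmn
    unfold sqfun
    by_cases hm : Squarefree m
    · by_cases hn : Squarefree n
      · rw [if_pos hm, if_pos hn, if_pos ((Nat.squarefree_mul hmn).2 ⟨hm, hn⟩), pf_mul h hmn]
      · rw [if_neg hn, if_neg fun h => hn ((Nat.squarefree_mul hmn).1 h).2, mul_zero]
    · rw [if_neg hm, if_neg fun h => hm ((Nat.squarefree_mul hmn).1 h).1, zero_mul]

theorem hasProd_zeta {s : ℝ} (hs : 0 < s) :
    HasProd (fun p : Nat.Primes => (1 - ((p : ℕ) : ℝ) ^ (-(1 + s)))⁻¹)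
      (∑' n : ℕ, 1 / (n : ℝ) ^ (1 + s)) := by
  let f : ℕ →*₀ ℝ :=
    { toFun := fun n => (n : ℝ) ^ (-(1 + s))
      map_zero' := by
        rw [Nat.cast_zero, Real.zero_rpow (by linarith)]
      map_one' := by simp
      map_mul' := fun m n => by
        rw [Nat.cast_mul, Real.mul_rpow (Nat.cast_nonneg m) (Nat.cast_nonneg n)] }
  have hf : ∀ n : ℕ, f n = 1 / (n : ℝ) ^ (1 + s) := fun n => by
    change (n : ℝ) ^ (-(1 + s)) = _
    rw [Real.rpow_neg (Nat.cast_nonneg n), one_div]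
  have h := EulerProduct.eulerProduct_completely_multiplicative_hasProd (f := f) ?_
  · simp_rw [hf] at h
    refine h.congr_fun fun p => ?_
    rw [← hf]
    rfl
  · have := (Real.summable_one_div_nat_rpow (p := 1 + s)).2 (by linarith)
    refine this.congr fun n => ?_
    rw [hf, Real.norm_of_nonneg (by positivity)]

theorem hasProd_pow {ι : Type*} {f : ι → ℝ} {a : ℝ} (h : HasProd f a) (n : ℕ) :
    HasProd (fun i => f i ^ n) (a ^ n) := by
  induction n with
  | zero => simp
  | succ n ih => simpa [pow_succ] using ih.mul h

/-- Bernoulli's inequality and its second-order counterpart bound (1 - y)^κ between 1 - κy and 1 -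
κy + κ²y². With x = h(p)p^{-s} and y = p^{-1-s} the first-order parts nearly cancel, which gives a
majorant uniform in s. -/
theorem abs_one_add_mul_pow_sub_one_le {x y : ℝ} (hx : 0 ≤ x) (hy : 0 ≤ y) (hy1 : y ≤ 1) (κ : ℕ) :
    |(1 + x) * (1 - y) ^ κ - 1| ≤ |x - κ * y| + κ * x * y + (1 + x) * (κ ^ 2 * y ^ 2) := by
  have h1 : 1 - κ * y ≤ (1 - y) ^ κ := by
    have := one_add_mul_le_pow (a := -y) (by linarith) κ
    rw [show (1 : ℝ) + -y = 1 - y by ring] at this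
    linarith
  have h2 : (1 - y) ^ κ ≤ 1 - κ * y + κ ^ 2 * y ^ 2 := by
    clear h1
    induction κ with
    | zero => simp
    | succ n ih =>
      rw [pow_succ]
      have h3 : 0 ≤ 1 - y := by linarith
      calc (1 - y) ^ n * (1 - y) ≤ (1 - n * y + n ^ 2 * y ^ 2) * (1 - y) := by gcongr
        _ ≤ _ := by
          push_cast
          have : 0 ≤ (n : ℝ) ^ 2 * y ^ 3 := by positivity
          have : 0 ≤ (n : ℝ) * y ^ 2 := by positivity
          nlinarith
  have e : (1 + x) * (1 - y) ^ κ - 1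
      = (x - κ * y) - κ * x * y + (1 + x) * ((1 - y) ^ κ - (1 - κ * y)) := by ring
  rw [e]
  refine (abs_add_le _ _).trans (add_le_add ((abs_sub _ _).trans (add_le_add le_rfl ?_)) ?_)
  · rw [abs_of_nonneg (by positivity)]
  · rw [abs_mul, abs_of_nonneg (by linarith), abs_of_nonneg (by linarith)]
    gcongr
    linarith

/-- The Dirichlet series of h is ζ(1+s)^{j+1} times an Euler product that is dominated uniformly for
s ≥ 0. As s → 0⁺ that product tends to its value at 0 and sζ(1+s) → 1; the Abelian theorem gives c
for the same limit. -/
theorem W_constant_eq_tprod {j : ℕ} {B : ℝ} (hB : 0 ≤ B) {h : ℕ → ℝ}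
    (h0 : ∀ p, p.Prime → 0 ≤ h p)
    (hle : ∀ p : ℕ, p.Prime → h p ≤ (j + 1 : ℕ) / p + B * (1 / ((p : ℝ) * Real.sqrt p)))
    (hdiff : Summable fun p : Nat.Primes => |h p - (j + 1 : ℕ) / ((p : ℕ) : ℝ)|) {c E : ℝ}
    (hW : ∀ u : ℝ, 0 ≤ u →
      |W (sqfun h) 0 u - c * (u ^ (j + 1) / ((j + 1).factorial : ℝ))| ≤ E * (1 + u) ^ j) :
    Summable (fun p : Nat.Primes => (1 + h p) * (1 - 1 / ((p : ℕ) : ℝ)) ^ (j + 1) - 1) ∧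
    c = ∏' p : Nat.Primes, (1 + h p) * (1 - 1 / ((p : ℕ) : ℝ)) ^ (j + 1) := by
  set D : ℝ := (j + 1 : ℕ) + B with hD
  have hD0 : 0 ≤ D := by positivity
  have hle' : ∀ p : ℕ, p.Prime → h p ≤ D / p := by
    intro p hp
    have hp1 : (1 : ℝ) ≤ p := by exact_mod_cast hp.one_le
    have hs : 1 ≤ Real.sqrt p := Real.one_le_sqrt.2 hp1
    refine (hle p hp).trans ?_
    rw [hD, add_div]
    have : (1 : ℝ) / (p * Real.sqrt p) ≤ 1 / p :=
      one_div_le_one_div_of_le (by linarith) (by nlinarith)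
    have := mul_le_mul_of_nonneg_left this hB
    rw [mul_one_div B (p : ℝ)] at this
    linarith
  set A : ℝ → Nat.Primes → ℝ := fun s p =>
    (1 + h p * ((p : ℕ) : ℝ) ^ (-s)) * (1 - ((p : ℕ) : ℝ) ^ (-(1 + s))) ^ (j + 1) - 1 with hA
  -- Independent of s, so it serves the convergence at s = 0 as well as the dominated passage to the
  -- limit.
  set bound : Nat.Primes → ℝ := fun p => |h p - (j + 1 : ℕ) / ((p : ℕ) : ℝ)|
    + ((j + 1 : ℕ) * D + (1 + D) * (j + 1 : ℕ) ^ 2) * (1 / ((p : ℕ) : ℝ) ^ 2) with hbound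
  have hbs : Summable bound := by
    refine hdiff.add (Summable.mul_left _ ?_)
    have := (Real.summable_one_div_nat_pow (p := 2)).2 (by norm_num)
    exact this.comp_injective Nat.Primes.coe_nat_injective
  have hAb : ∀ s : ℝ, 0 ≤ s → ∀ p : Nat.Primes, |A s p| ≤ bound p := by
    intro s hs p
    have hp1 : (1 : ℝ) ≤ (p : ℕ) := by exact_mod_cast p.2.one_le
    have hp0 : (0 : ℝ) < (p : ℕ) := by linarith
    set x := h p * ((p : ℕ) : ℝ) ^ (-s) with hx
    set y := ((p : ℕ) : ℝ) ^ (-(1 + s)) with hy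
    have hps : ((p : ℕ) : ℝ) ^ (-s) ≤ 1 := Real.rpow_le_one_of_one_le_of_nonpos hp1 (by linarith)
    have hps0 : 0 ≤ ((p : ℕ) : ℝ) ^ (-s) := by positivity
    have hye : y = ((p : ℕ) : ℝ) ^ (-s) * (1 / (p : ℕ)) := by
      rw [hy, neg_add, add_comm, Real.rpow_add hp0, Real.rpow_neg_one, one_div]
    have hx0 : 0 ≤ x := mul_nonneg (h0 p p.2) hps0
    have hy0 : 0 ≤ y := by positivity
    have hy1 : y ≤ 1 / (p : ℕ) := by
      rw [hye]
      exact mul_le_of_le_one_left (by positivity) hps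
    have hx1 : x ≤ D * (1 / (p : ℕ)) := by
      have := hle' p p.2
      rw [mul_one_div]
      exact (mul_le_of_le_one_right (h0 p p.2) hps).trans this
    have hpi : 1 / ((p : ℕ) : ℝ) ≤ 1 := by rw [div_le_one hp0]; exact hp1
    have h1 := abs_one_add_mul_pow_sub_one_le hx0 hy0 (hy1.trans hpi) (j + 1)
    refine h1.trans ?_
    have h2 : |x - (j + 1 : ℕ) * y| ≤ |h p - (j + 1 : ℕ) / ((p : ℕ) : ℝ)| := by
      have : x - (j + 1 : ℕ) * y
          = (h p - (j + 1 : ℕ) / ((p : ℕ) : ℝ)) * ((p : ℕ) : ℝ) ^ (-s) := by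
        rw [hye, hx]; ring
      rw [this, abs_mul, abs_of_nonneg hps0]
      exact mul_le_of_le_one_right (abs_nonneg _) hps
    have h3 : (j + 1 : ℕ) * x * y ≤ (j + 1 : ℕ) * (D * (1 / (p : ℕ))) * (1 / (p : ℕ)) := by
      gcongr
    have h4 : (1 + x) * ((j + 1 : ℕ) ^ 2 * y ^ 2) ≤ (1 + D) * ((j + 1 : ℕ) ^ 2 * (1 / (p : ℕ)) ^ 2) := by
      gcongr
      exact hx1.trans (mul_le_of_le_one_right hD0 hpi)
    calc _ ≤ _ := add_le_add (add_le_add h2 h3) h4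
      _ = _ := by rw [hbound]; ring
  have hA0 : ∀ p : Nat.Primes, 1 + A 0 p = (1 + h p) * (1 - 1 / ((p : ℕ) : ℝ)) ^ (j + 1) := by
    intro p
    rw [hA]
    simp [Real.rpow_neg_one]
  have hmult : ∀ s : ℝ, 0 ≤ s → Multipliable (fun p => 1 + A s p) := fun s hs =>
    multipliable_one_add_of_summable
      (hbs.of_nonneg_of_le (fun _ => norm_nonneg _) fun p => hAb s hs p)
  refine ⟨Summable.of_norm_bounded hbs fun p => ?_, ?_⟩
  · rw [← hA0, add_sub_cancel_left, Real.norm_eq_abs]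
    exact hAb 0 le_rfl p
  have hsum : ∀ s : ℝ, 0 < s → Summable (sqfun (fun p => h p * (p : ℝ) ^ (-s))) := by
    intro s hs
    refine summable_sqfun (b := fun n : ℕ => D * (1 / (n : ℝ) ^ (1 + s)))
      (fun p hp => mul_nonneg (h0 p hp) (by positivity)) (fun n => by positivity)
      (((Real.summable_one_div_nat_rpow (p := 1 + s)).2 (by linarith)).mul_left D) fun p hp => ?_
    have hp0 : (0 : ℝ) < p := by exact_mod_cast hp.pos
    calc h p * (p : ℝ) ^ (-s) ≤ D / p * (p : ℝ) ^ (-s) := by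
          gcongr; exact hle' p hp
      _ = _ := by
          rw [Real.rpow_add hp0, Real.rpow_neg hp0.le, Real.rpow_one]
          field_simp
  have hsn : ∀ (g : ℕ → ℝ), (∀ p, p.Prime → 0 ≤ g p) → ∀ n, 0 ≤ sqfun g n := by
    intro g hg n
    unfold sqfun
    split_ifs
    · exact pf_nonneg hg n
    · exact le_rfl
  have hT := tendsto_pow_mul_tsum (a := sqfun h) (hsn h h0) (by simp [sqfun])
    (fun s hs => by simp_rw [sqfun_mul_rpow]; exact hsum s hs) hW
  have hid : ∀ s : ℝ, 0 < s → ∑' n : ℕ, sqfun h n * (n : ℝ) ^ (-s)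
      = (∏' p, (1 + A s p)) * (∑' n : ℕ, 1 / (n : ℝ) ^ (1 + s)) ^ (j + 1) := by
    intro s hs
    simp_rw [sqfun_mul_rpow]
    have hp := hasProd_sqfun (h := fun p => h p * (p : ℝ) ^ (-s)) (by
      refine (hsum s hs).congr fun n => ?_
      rw [Real.norm_of_nonneg (hsn _ (fun p hp => mul_nonneg (h0 p hp) (by positivity)) n)])
    have hp2 := (hmult s hs.le).hasProd.mul (hasProd_pow (hasProd_zeta hs) (j + 1))
    refine hp.unique (hp2.congr_fun ?_)
    intro p
    simp only [hA]
    have hp1 : (1 : ℝ) < (p : ℕ) := by exact_mod_cast p.2.one_lt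
    have hlt : ((p : ℕ) : ℝ) ^ (-(1 + s)) < 1 :=
      Real.rpow_lt_one_of_one_lt_of_neg hp1 (by linarith)
    have hne : (1 - ((p : ℕ) : ℝ) ^ (-(1 + s))) ≠ 0 := by linarith
    rw [add_sub_cancel, mul_assoc, ← mul_pow, mul_inv_cancel₀ hne, one_pow, mul_one]
  have hzeta : Filter.Tendsto (fun s : ℝ => s * ∑' n : ℕ, 1 / (n : ℝ) ^ (1 + s))
      (nhdsWithin 0 (Set.Ioi 0)) (nhds 1) := by
    have hmap : Filter.Tendsto (fun s : ℝ => 1 + s) (nhdsWithin 0 (Set.Ioi 0))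
        (nhdsWithin 1 (Set.Ioi 1)) := by
      refine tendsto_nhdsWithin_iff.2 ⟨?_, ?_⟩
      · have : Filter.Tendsto (fun s : ℝ => 1 + s) (nhds 0) (nhds (1 + 0)) :=
          (continuous_const.add continuous_id).tendsto 0
        rw [add_zero] at this
        exact this.mono_left nhdsWithin_le_nhds
      · filter_upwards [self_mem_nhdsWithin] with s hs
        have : 0 < s := hs
        show 1 < 1 + s
        linarith
    refine (tendsto_sub_mul_tsum_nat_rpow.comp hmap).congr fun s => ?_
    simp
  have hprod : Filter.Tendsto (fun s : ℝ => ∏' p, (1 + A s p)) (nhdsWithin 0 (Set.Ioi 0))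
      (nhds (∏' p, (1 + A 0 p))) := by
    refine tendsto_tprod_one_add_of_dominated_convergence hbs (fun p => ?_) ?_
    · have hp0 : ((p : ℕ) : ℝ) ≠ 0 := by exact_mod_cast p.2.ne_zero
      have : Continuous (fun s => A s p) := by
        simp only [hA]
        have h1 : Continuous fun s : ℝ => ((p : ℕ) : ℝ) ^ (-s) :=
          (Real.continuous_const_rpow hp0).comp continuous_neg
        have h2 : Continuous fun s : ℝ => ((p : ℕ) : ℝ) ^ (-(1 + s)) :=
          (Real.continuous_const_rpow hp0).comp (by fun_prop)
        fun_prop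
      exact (this.tendsto 0).mono_left nhdsWithin_le_nhds
    · filter_upwards [self_mem_nhdsWithin] with s hs
      exact hAb s (le_of_lt hs)
  have hfin := hprod.mul (hzeta.pow (j + 1))
  rw [one_pow, mul_one] at hfin
  simp_rw [hA0] at hfin
  refine tendsto_nhds_unique hT (hfin.congr' ?_)
  filter_upwards [self_mem_nhdsWithin] with s hs
  rw [hid s hs, mul_pow]
  ring


/-! ### Sums of `μ²(m)/φ(m)` over `m` coprime to `r` -/

/-- `1/(p-1)` for `p ∤ r`, and `0` for `p ∣ r`. -/
def hcop (r p : ℕ) : ℝ := if p ∣ r then 0 else 1 / ((p : ℝ) - 1)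

theorem hcop_nonneg (r : ℕ) {p : ℕ} (hp : p.Prime) : 0 ≤ hcop r p := by
  have : (2 : ℝ) ≤ p := by exact_mod_cast hp.two_le
  unfold hcop
  split_ifs
  · exact le_rfl
  · exact div_nonneg zero_le_one (by linarith)

theorem one_div_sub_one_le {p : ℕ} (hp : p.Prime) :
    1 / ((p : ℝ) - 1) ≤ 1 / p + 2 * (1 / ((p : ℝ) * Real.sqrt p)) := by
  have hp2 : (2 : ℝ) ≤ p := by exact_mod_cast hp.two_le
  have hs : 0 < Real.sqrt p := Real.sqrt_pos.2 (by linarith)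
  have hss : Real.sqrt p * Real.sqrt p = p := Real.mul_self_sqrt (by linarith)
  have h1 : 1 / ((p : ℝ) - 1) = 1 / p + 1 / (((p : ℝ) - 1) * p) := by
    field_simp [show (p : ℝ) - 1 ≠ 0 by linarith]
    ring
  have hs1 : 1 ≤ Real.sqrt p := Real.one_le_sqrt.2 (by linarith)
  rw [h1, mul_one_div]
  gcongr 1 / (p : ℝ) + ?_
  rw [div_le_div_iff₀ (by nlinarith) (by positivity)]
  have : Real.sqrt p ≤ p := by nlinarith
  nlinarith

theorem sum_filter_dvd_le (r : ℕ) (hr : r ≠ 0) (N : ℕ) {g : ℕ → ℝ}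
    (hg : ∀ p, p.Prime → 0 ≤ g p) :
    ∑ p ∈ (pr N).filter (fun p => p ∣ r), g p ≤ ∑ p ∈ r.primeFactors, g p := by
  refine sum_le_sum_of_subset_of_nonneg ?_ fun p hp _ => hg p (Nat.prime_of_mem_primeFactors hp)
  intro p hp
  obtain ⟨h1, h2⟩ := mem_filter.1 hp
  exact Nat.mem_primeFactors.2 ⟨(mem_pr.1 h1).2, h2, hr⟩

theorem log_div_sub_one_nonneg {p : ℕ} (hp : p.Prime) : 0 ≤ Real.log p / ((p : ℝ) - 1) := by
  have : (2 : ℝ) ≤ p := by exact_mod_cast hp.two_le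
  exact div_nonneg (Real.log_natCast_nonneg p) (by linarith)

/-- Mertens with 1/(p-1) in place of 1/p, a bounded change; deleting the primes that divide r costs
at most the sum on the right. This fixes how the error depends on r. -/
theorem exists_sum_hcop_log_le :
    ∃ K : ℝ, 1 ≤ K ∧ ∀ r : ℕ, r ≠ 0 → ∀ u : ℝ, 0 ≤ u →
      |∑ p ∈ pr ⌊Real.exp u⌋₊, hcop r p * Real.log p - u|
        ≤ K * (1 + ∑ p ∈ r.primeFactors, Real.log p / ((p : ℝ) - 1)) := by
  obtain ⟨C, hC, h1⟩ := exists_mertens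
  obtain ⟨C', hC', h2⟩ := exists_sum_one_div_mul_sqrt_le
  refine ⟨1 + C + 4 * C', by linarith, fun r hr u hu => ?_⟩
  set N := ⌊Real.exp u⌋₊
  set s := ∑ p ∈ r.primeFactors, Real.log p / ((p : ℝ) - 1) with hs
  have hs0 : 0 ≤ s := sum_nonneg fun p hp =>
    log_div_sub_one_nonneg (Nat.prime_of_mem_primeFactors hp)
  have e1 : ∑ p ∈ pr N, hcop r p * Real.log p
      = ∑ p ∈ pr N, Real.log p / ((p : ℝ) - 1)
        - ∑ p ∈ (pr N).filter (fun p => p ∣ r), Real.log p / ((p : ℝ) - 1) := by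
    rw [sum_filter, ← sum_sub_distrib]
    refine sum_congr rfl fun p _ => ?_
    unfold hcop
    split_ifs <;> ring
  have h3 := sum_filter_dvd_le r hr N (g := fun p => Real.log p / ((p : ℝ) - 1))
    (fun p hp => log_div_sub_one_nonneg hp)
  have h4 : 0 ≤ ∑ p ∈ (pr N).filter (fun p => p ∣ r), Real.log p / ((p : ℝ) - 1) :=
    sum_nonneg fun p hp => log_div_sub_one_nonneg (mem_pr.1 (mem_filter.1 hp).1).2
  have h5 : ∑ p ∈ pr N, Real.log p / ((p : ℝ) - 1) ≤ ∑ p ∈ pr N, Real.log p / p + 4 * C' := by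
    calc _ ≤ ∑ p ∈ pr N, (Real.log p / p + 4 * (1 / ((p : ℝ) * Real.sqrt p))) :=
          sum_le_sum fun p hp => by linarith [log_div_sq_le (mem_pr.1 hp).2]
      _ ≤ _ := by
          rw [sum_add_distrib, ← mul_sum]
          have := h2 (pr N)
          gcongr
  have h6 : ∑ p ∈ pr N, Real.log p / p ≤ ∑ p ∈ pr N, Real.log p / ((p : ℝ) - 1) := by
    refine sum_le_sum fun p hp => ?_
    have : (2 : ℝ) ≤ p := by exact_mod_cast (mem_pr.1 hp).2.two_le
    have := Real.log_natCast_nonneg p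
    gcongr
    · linarith
    · linarith
  have h7 := abs_le.1 (h1 u hu)
  rw [e1, abs_le]
  have h8 : 0 ≤ (C + 4 * C') * s := by positivity
  constructor <;> nlinarith [h7.1, h7.2]

/-- The one-dimensional case. For p ∤ r the local factor (1 + 1/(p-1))(1 - 1/p) is 1, so the Euler
product is finite and equals ∏_{p∣r}(1 - 1/p). -/
theorem exists_W_hcop_asymptotic :
    ∃ C : ℝ, 0 < C ∧ ∀ r : ℕ, r ≠ 0 → ∀ m : ℕ, ∀ u : ℝ, 0 ≤ u →
      |W (sqfun (hcop r)) m u - pf (fun p => 1 - 1 / (p : ℝ)) r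
          * (u ^ (1 + m) / ((1 + m).factorial : ℝ))|
        ≤ C * (1 + ∑ p ∈ r.primeFactors, Real.log p / ((p : ℝ) - 1)) * (1 + u) ^ m := by
  obtain ⟨C, hC, h1⟩ := exists_W_asymptotic 0 2 (by norm_num)
  obtain ⟨K, hK, h2⟩ := exists_sum_hcop_log_le
  refine ⟨C * K, by positivity, fun r hr m u hu => ?_⟩
  set s := ∑ p ∈ r.primeFactors, Real.log p / ((p : ℝ) - 1) with hs
  have hs0 : 0 ≤ s := sum_nonneg fun p hp =>
    log_div_sub_one_nonneg (Nat.prime_of_mem_primeFactors hp)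
  have hle : ∀ p : ℕ, p.Prime →
      hcop r p ≤ ((0 + 1 : ℕ) : ℝ) / p + 2 * (1 / ((p : ℝ) * Real.sqrt p)) := by
    intro p hp
    rw [zero_add, Nat.cast_one]
    have := one_div_sub_one_le hp
    unfold hcop
    split_ifs
    · positivity
    · exact this
  have hΛ : 1 ≤ K * (1 + s) := by nlinarith
  obtain ⟨c, hc⟩ := h1 (hcop r) (K * (1 + s)) hΛ (fun p hp => hcop_nonneg r hp) hle
    (fun u hu => by simpa using h2 r hr u hu)
  have hdiff : Summable fun p : Nat.Primes => |hcop r p - ((0 + 1 : ℕ) : ℝ) / ((p : ℕ) : ℝ)| := by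
    have hb : Summable (fun p : Nat.Primes => 2 * (1 / (((p : ℕ) : ℝ) * Real.sqrt (p : ℕ)))) :=
      (summable_one_div_mul_sqrt.comp_injective Nat.Primes.coe_nat_injective).mul_left 2
    refine Summable.of_norm_bounded_eventually hb ?_
    have hfin : {p : Nat.Primes | (p : ℕ) ∣ r}.Finite := by
      refine Set.Finite.preimage (f := fun p : Nat.Primes => (p : ℕ))
        (s := {n : ℕ | n ∣ r}) Nat.Primes.coe_nat_injective.injOn ?_
      exact (Set.finite_Iic r).subset fun n hn => Nat.le_of_dvd (Nat.pos_of_ne_zero hr) hn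
    refine (hfin.subset fun p hp => ?_ : Set.Finite _)
    by_contra hnd
    refine hp ?_
    have hnd' : ¬ (p : ℕ) ∣ r := hnd
    have hp2 : (2 : ℝ) ≤ (p : ℕ) := by exact_mod_cast p.2.two_le
    show ‖|hcop r p - ((0 + 1 : ℕ) : ℝ) / ((p : ℕ) : ℝ)|‖ ≤ _
    rw [Real.norm_eq_abs, abs_abs, abs_le]
    have h3 := one_div_sub_one_le p.2
    have h4 : 1 / ((p : ℕ) : ℝ) ≤ 1 / (((p : ℕ) : ℝ) - 1) :=
      one_div_le_one_div_of_le (by linarith) (by linarith)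
    have h5 : 0 ≤ 2 * (1 / (((p : ℕ) : ℝ) * Real.sqrt (p : ℕ))) := by positivity
    unfold hcop
    rw [if_neg hnd', zero_add, Nat.cast_one]
    constructor <;> linarith
  obtain ⟨_, hce⟩ := W_constant_eq_tprod (by norm_num) (fun p hp => hcop_nonneg r hp) hle hdiff hc
  have hcval : c = pf (fun p => 1 - 1 / (p : ℝ)) r := by
    rw [hce]
    refine (tprod_eq_prod (β := Nat.Primes)
      (s := (r.primeFactors.subtype Nat.Prime : Finset Nat.Primes)) fun p hp => ?_).trans ?_
    · have hnd : ¬ (p : ℕ) ∣ r := fun h =>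
        hp (mem_subtype.2 (Nat.mem_primeFactors.2 ⟨p.2, h, hr⟩))
      have hp2 : (2 : ℝ) ≤ (p : ℕ) := by exact_mod_cast p.2.two_le
      unfold hcop
      rw [if_neg hnd, zero_add, pow_one]
      have hp0 : ((p : ℕ) : ℝ) ≠ 0 := by linarith
      have hp1 : ((p : ℕ) : ℝ) - 1 ≠ 0 := by linarith
      field_simp
      ring
    · refine (prod_subtype_of_mem (p := Nat.Prime)
        (fun p : ℕ => (1 + hcop r p) * (1 - 1 / (p : ℝ)) ^ (0 + 1))
        (fun p hp => Nat.prime_of_mem_primeFactors hp)).trans ?_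
      refine prod_congr rfl fun p hp => ?_
      unfold hcop
      rw [if_pos (Nat.dvd_of_mem_primeFactors hp)]
      ring
  rw [← hcval]
  have h3 := abs_W_sub_le (a := sqfun (hcop r)) (c := c) (E := C * (K * (1 + s))) (i := 0) (j := 1)
    (by positivity) hc m u hu
  rw [zero_add] at h3
  refine h3.trans (le_of_eq (by ring))

/-- The asymptotic formula for `W` persists when the condition `log n ≤ u` becomes strict. -/
theorem abs_strict_sub_le {a : ℕ → ℝ} {c E : ℝ} {m i j : ℕ}
    (hW : ∀ v : ℝ, 0 ≤ v → |W a m v - c * (v ^ i / (i.factorial : ℝ))| ≤ E * (1 + v) ^ j)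
    {u : ℝ} (hu : 0 < u) :
    |∑ n ∈ (Icc 1 ⌊Real.exp u⌋₊).filter (fun n : ℕ => Real.log n < u),
        a n * ((u - Real.log n) ^ m / (m.factorial : ℝ)) - c * (u ^ i / (i.factorial : ℝ))|
      ≤ E * (1 + u) ^ j := by
  set S := (Icc 1 ⌊Real.exp u⌋₊).filter (fun n : ℕ => Real.log n < u) with hS
  set T : ℝ → ℝ := fun v => ∑ n ∈ S, a n * ((v - Real.log n) ^ m / (m.factorial : ℝ)) with hT
  have hTc : Continuous (fun v => |T v - c * (v ^ i / (i.factorial : ℝ))|) := by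
    simp only [hT]
    fun_prop
  have hRc : Continuous (fun v : ℝ => E * (1 + v) ^ j) := by fun_prop
  -- Let v increase to u. For v close enough below u, the integers with log n ≤ v are exactly those
  -- with log n < u, so the strict sum inherits the inequality in the limit.
  refine le_of_tendsto_of_tendsto (b := nhdsWithin u (Set.Iio u))
    ((hTc.tendsto u).mono_left nhdsWithin_le_nhds)
    ((hRc.tendsto u).mono_left nhdsWithin_le_nhds) ?_
  have h1 : ∀ᶠ v in nhdsWithin u (Set.Iio u), ∀ n ∈ S, Real.log n ≤ v := by
    rw [Filter.eventually_all_finset]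
    intro n hn
    have : Real.log n < u := (mem_filter.1 hn).2
    exact (mem_nhdsWithin_of_mem_nhds (Ici_mem_nhds this))
  have h2 : ∀ᶠ v in nhdsWithin u (Set.Iio u), (0 : ℝ) ≤ v :=
    mem_nhdsWithin_of_mem_nhds (Ici_mem_nhds hu)
  filter_upwards [h1, h2, self_mem_nhdsWithin] with v hv1 hv2 hv3
  have hv3' : v < u := hv3
  have e : W a m v = T v := by
    simp only [hT, W]
    refine sum_congr ?_ fun _ _ => rfl
    ext n
    rw [hS, mem_filter, mem_Icc_floor_exp, mem_Icc_floor_exp]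
    constructor
    · rintro ⟨h, h'⟩
      exact ⟨⟨h, by linarith⟩, by linarith⟩
    · rintro ⟨⟨h, h'⟩, h''⟩
      exact ⟨h, hv1 n (mem_filter.2 ⟨mem_Icc_floor_exp.2 ⟨h, h'⟩, h''⟩)⟩
  have := hW v hv2
  rwa [e] at this

/-! ### The diagonal variables -/

/-- `(log (R/t))^ℓ / ℓ!` for `t < R`, and `0` otherwise. -/
def Y (R : ℝ) (ℓ t : ℕ) : ℝ :=
  if (t : ℝ) < R then (Real.log R - Real.log t) ^ ℓ / (ℓ.factorial : ℝ) else 0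

/-- `∑_t ∏_{p ∣ t/r} ψ(p) · Y(t)` over squarefree multiples `t` of `r`. -/
def Zsum (R : ℝ) (ψ : ℕ → ℝ) (ℓ r : ℕ) : ℝ :=
  ∑ t ∈ (sqf ⌊R⌋₊).filter (fun t => r ∣ t), pf ψ (t / r) * Y R ℓ t

/-- The diagonalizing variables `z_r = (r/φ(r)) ∑_{(m,r)=1} μ(m)²/φ(m) Y(rm)`. -/
def zvar (R : ℝ) (ℓ r : ℕ) : ℝ :=
  pf (fun p => (p : ℝ) / ((p : ℝ) - 1)) r * Zsum R (fun p => 1 / ((p : ℝ) - 1)) ℓ r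

/-- A multiplicative majorant for the error terms in `z_r`. -/
def evar (r : ℕ) : ℝ :=
  pf (fun p => (p : ℝ) / ((p : ℝ) - 1) * (1 + Real.log p / ((p : ℝ) - 1))) r

/-- Substitute t = rn. The coprimality of n and r, forced by squarefreeness of t, is carried by
`hcop r` vanishing at the primes of r; the cut-off t < R becomes the strict condition log n < u. -/
theorem Zsum_eq {R : ℝ} (hR : 1 ≤ R) (ℓ : ℕ) {r : ℕ} (hr : Squarefree r) {u : ℝ}
    (hu : u = Real.log R - Real.log r) :
    Zsum R (fun p => 1 / ((p : ℝ) - 1)) ℓ r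
      = ∑ n ∈ (Icc 1 ⌊Real.exp u⌋₊).filter (fun n : ℕ => Real.log n < u),
        sqfun (hcop r) n * ((u - Real.log n) ^ ℓ / (ℓ.factorial : ℝ)) := by
  have hr0 : (0 : ℝ) < r := by exact_mod_cast Nat.pos_of_ne_zero hr.ne_zero
  have hR0 : 0 < R := by linarith
  have key : ∀ n : ℕ, 0 < n → (Real.log n < u ↔ ((r * n : ℕ) : ℝ) < R) := by
    intro n hn
    have hn0 : (0 : ℝ) < n := by exact_mod_cast hn
    rw [hu, lt_sub_iff_add_lt, add_comm, ← Real.log_mul hr0.ne' hn0.ne',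
      Real.log_lt_log_iff (by positivity) hR0, Nat.cast_mul]
  unfold Zsum
  have e1 : ∑ t ∈ (sqf ⌊R⌋₊).filter (fun t => r ∣ t), pf (fun p => 1 / ((p : ℝ) - 1)) (t / r) * Y R ℓ t
      = ∑ t ∈ ((sqf ⌊R⌋₊).filter (fun t => r ∣ t)).filter (fun t : ℕ => (t : ℝ) < R),
        pf (fun p => 1 / ((p : ℝ) - 1)) (t / r) * Y R ℓ t := by
    rw [sum_filter (p := fun t : ℕ => (t : ℝ) < R)]
    refine sum_congr rfl fun t _ => ?_
    unfold Y
    split_ifs <;> simp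
  have e2 : ∑ n ∈ (Icc 1 ⌊Real.exp u⌋₊).filter (fun n : ℕ => Real.log n < u),
        sqfun (hcop r) n * ((u - Real.log n) ^ ℓ / (ℓ.factorial : ℝ))
      = ∑ n ∈ ((Icc 1 ⌊Real.exp u⌋₊).filter (fun n : ℕ => Real.log n < u)).filter
          (fun n => Squarefree (r * n)),
        pf (fun p => 1 / ((p : ℝ) - 1)) n * ((u - Real.log n) ^ ℓ / (ℓ.factorial : ℝ)) := by
    rw [sum_filter (p := fun n : ℕ => Squarefree (r * n))]
    refine sum_congr rfl fun n hn => ?_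
    have hn1 : n ≠ 0 := by
      have := (mem_Icc.1 (mem_filter.1 hn).1).1
      omega
    by_cases hrn : Squarefree (r * n)
    · have hcop := Nat.coprime_of_squarefree_mul hrn
      rw [if_pos hrn]
      unfold sqfun
      rw [if_pos ((Nat.squarefree_mul hcop).1 hrn).2]
      congr 1
      refine pf_congr fun p hp hpn => ?_
      unfold SmallGaps.hcop
      rw [if_neg]
      intro hpr
      exact hp.one_lt.ne' (Nat.eq_one_of_dvd_coprimes hcop hpr hpn)
    · rw [if_neg hrn]
      unfold sqfun
      by_cases hn' : Squarefree n
      · rw [if_pos hn']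
        have hnc : ¬ r.Coprime n := fun h => hrn ((Nat.squarefree_mul h).2 ⟨hr, hn'⟩)
        obtain ⟨p, hp, hpr, hpn⟩ := Nat.Prime.not_coprime_iff_dvd.1 hnc
        have : pf (hcop r) n = 0 := by
          refine prod_eq_zero (Nat.mem_primeFactors.2 ⟨hp, hpn, hn1⟩) ?_
          unfold hcop
          rw [if_pos hpr]
        rw [this, zero_mul]
      · rw [if_neg hn', zero_mul]
  rw [e1, e2]
  refine sum_bij' (fun t _ => t / r) (fun n _ => r * n) ?_ ?_ ?_ ?_ ?_
  · intro t ht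
    simp only [mem_filter, mem_sqf] at ht
    obtain ⟨⟨⟨_, hsq⟩, hd⟩, hlt⟩ := ht
    obtain ⟨n, rfl⟩ := hd
    have hn : 0 < n := Nat.pos_of_ne_zero fun h => hsq.ne_zero (by simp [h])
    rw [Nat.mul_div_cancel_left _ (Nat.pos_of_ne_zero hr.ne_zero)]
    have h1 := (key n hn).2 hlt
    simp only [mem_filter, mem_Icc_floor_exp]
    exact ⟨⟨⟨hn, h1.le⟩, h1⟩, hsq⟩
  · intro n hn
    simp only [mem_filter, mem_Icc_floor_exp] at hn
    obtain ⟨⟨⟨hn1, _⟩, hlt⟩, hsq⟩ := hn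
    have h1 := (key n hn1).1 hlt
    simp only [mem_filter, mem_sqf]
    exact ⟨⟨⟨Nat.le_floor h1.le, hsq⟩, dvd_mul_right r n⟩, h1⟩
  · intro t ht
    simp only [mem_filter] at ht
    exact Nat.mul_div_cancel' ht.1.2
  · intro n _
    exact Nat.mul_div_cancel_left _ (Nat.pos_of_ne_zero hr.ne_zero)
  · intro t ht
    simp only [mem_filter, mem_sqf] at ht
    obtain ⟨⟨⟨_, hsq⟩, hd⟩, hlt⟩ := ht
    obtain ⟨n, rfl⟩ := hd
    have hn : 0 < n := Nat.pos_of_ne_zero fun h => hsq.ne_zero (by simp [h])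
    have hn0 : (0 : ℝ) < n := by exact_mod_cast hn
    rw [Nat.mul_div_cancel_left _ (Nat.pos_of_ne_zero hr.ne_zero)]
    unfold Y
    rw [if_pos hlt, hu, Nat.cast_mul, Real.log_mul hr0.ne' hn0.ne', sub_sub]

theorem Zsum_eq_zero {R : ℝ} (ψ : ℕ → ℝ) (ℓ : ℕ) {r : ℕ} (hr : R ≤ r) : Zsum R ψ ℓ r = 0 := by
  unfold Zsum
  refine sum_eq_zero fun t ht => ?_
  obtain ⟨h1, h2⟩ := mem_filter.1 ht
  have h3 : r ≤ t := Nat.le_of_dvd (Nat.pos_of_ne_zero (mem_sqf.1 h1).2.ne_zero) h2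
  have h4 : (r : ℝ) ≤ t := by exact_mod_cast h3
  unfold Y
  rw [if_neg (by linarith), mul_zero]

theorem zvar_eq_zero {R : ℝ} (ℓ : ℕ) {r : ℕ} (hr : R ≤ r) : zvar R ℓ r = 0 := by
  unfold zvar
  rw [Zsum_eq_zero _ ℓ hr, mul_zero]

theorem one_add_sum_le_prod {s : Finset ℕ} {g : ℕ → ℝ} (hg : ∀ i ∈ s, 0 ≤ g i) :
    1 + ∑ i ∈ s, g i ≤ ∏ i ∈ s, (1 + g i) := by
  induction s using Finset.induction_on with
  | empty => simp
  | insert a s ha ih =>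
    rw [sum_insert ha, prod_insert ha]
    have h1 := ih fun i hi => hg i (mem_insert_of_mem hi)
    have h2 := hg a (mem_insert_self a s)
    have h3 : 0 ≤ ∑ i ∈ s, g i := sum_nonneg fun i hi => hg i (mem_insert_of_mem hi)
    nlinarith

theorem evar_nonneg (r : ℕ) : 0 ≤ evar r := by
  refine pf_nonneg (fun p hp => ?_) r
  have h1 := log_div_sub_one_nonneg hp
  have : (2 : ℝ) ≤ p := by exact_mod_cast hp.two_le
  have : 0 ≤ (p : ℝ) / ((p : ℝ) - 1) := div_nonneg (by linarith) (by linarith)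
  positivity

/-- The factor r/φ(r) in `zvar` cancels the density φ(r)/r of the coprime sum, so the main term
depends on r only through its size. The error picks up r/φ(r) times 1 + Σ_{p∣r} log p/(p-1), which
the multiplicative `evar` dominates. For r ≥ R both terms on the left vanish. -/
theorem exists_zvar_asymptotic :
    ∃ C : ℝ, 0 < C ∧ ∀ R : ℝ, 1 ≤ R → ∀ ℓ r : ℕ, Squarefree r →
      |zvar R ℓ r - max (Real.log R - Real.log r) 0 ^ (ℓ + 1) / ((ℓ + 1).factorial : ℝ)|
        ≤ C * evar r * (1 + Real.log R) ^ ℓ := by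
  obtain ⟨C, hC, h⟩ := exists_W_hcop_asymptotic
  refine ⟨C, hC, fun R hR ℓ r hr => ?_⟩
  have hL : 0 ≤ Real.log R := Real.log_nonneg hR
  have hr1 : (1 : ℝ) ≤ r := by exact_mod_cast Nat.pos_of_ne_zero hr.ne_zero
  have hlr : 0 ≤ Real.log r := Real.log_nonneg hr1
  rcases le_or_gt R r with hRr | hRr
  · have : Real.log R ≤ Real.log r := Real.log_le_log (by linarith) hRr
    rw [zvar_eq_zero ℓ hRr, max_eq_right (by linarith)]
    have := evar_nonneg r
    simp
    positivity
  · set u := Real.log R - Real.log r with hu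
    have hu0 : 0 < u := by
      have := Real.log_lt_log (by linarith) hRr
      linarith
    rw [max_eq_left hu0.le]
    have h1 := abs_strict_sub_le (fun v hv => h r hr.ne_zero ℓ v hv) hu0
    rw [← Zsum_eq hR ℓ hr hu] at h1
    set q := pf (fun p => (p : ℝ) / ((p : ℝ) - 1)) r with hq
    have hq0 : 0 ≤ q := by
      refine pf_nonneg (fun p hp => ?_) r
      have : (2 : ℝ) ≤ p := by exact_mod_cast hp.two_le
      exact div_nonneg (by linarith) (by linarith)
    have hq1 : q * pf (fun p => 1 - 1 / (p : ℝ)) r = 1 := by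
      rw [hq, ← pf_mul_fun]
      refine prod_eq_one fun p hp => ?_
      have : (2 : ℝ) ≤ p := by exact_mod_cast (Nat.prime_of_mem_primeFactors hp).two_le
      field_simp [show (p : ℝ) - 1 ≠ 0 by linarith]
    have e : zvar R ℓ r - u ^ (ℓ + 1) / ((ℓ + 1).factorial : ℝ)
        = q * (Zsum R (fun p => 1 / ((p : ℝ) - 1)) ℓ r - pf (fun p => 1 - 1 / (p : ℝ)) r
          * (u ^ (1 + ℓ) / ((1 + ℓ).factorial : ℝ))) := by
      rw [mul_sub, ← mul_assoc, hq1, one_mul, add_comm 1 ℓ]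
      rfl
    rw [e, abs_mul, abs_of_nonneg hq0]
    set s := ∑ p ∈ r.primeFactors, Real.log p / ((p : ℝ) - 1) with hs
    have hev : q * (1 + s) ≤ evar r := by
      unfold evar
      rw [pf_mul_fun]
      refine mul_le_mul_of_nonneg_left ?_ hq0
      exact one_add_sum_le_prod fun p hp =>
        log_div_sub_one_nonneg (Nat.prime_of_mem_primeFactors hp)
    calc _ ≤ q * (C * (1 + s) * (1 + u) ^ ℓ) := by gcongr
      _ = C * (q * (1 + s)) * (1 + u) ^ ℓ := by ring
      _ ≤ C * evar r * (1 + Real.log R) ^ ℓ := by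
          gcongr
          · exact mul_nonneg hC.le (evar_nonneg r)
          · linarith


/-! ### The multiplicative function of dimension `k - 1` attached to a tuple -/

/-- `h(p) = (ν_p - 1)/(p - ν_p)`. -/
def hH (H : Finset ℤ) (p : ℕ) : ℝ := ((nuP H p : ℝ) - 1) / ((p : ℝ) - nuP H p)

theorem nuP_le_card (H : Finset ℤ) (p : ℕ) : nuP H p ≤ H.card := card_image_le

theorem one_le_nuP {H : Finset ℤ} (hH : H.Nonempty) (p : ℕ) : 1 ≤ nuP H p :=
  card_pos.2 (hH.image _)

theorem one_le_nuP' {H : Finset ℤ} {k : ℕ} (hk : H.card = k) (hk2 : 2 ≤ k) (p : ℕ) :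
    (1 : ℝ) ≤ nuP H p := by
  exact_mod_cast one_le_nuP (card_pos.1 (by omega)) p

theorem nuP_le_card' {H : Finset ℤ} {k : ℕ} (hk : H.card = k) (p : ℕ) : (nuP H p : ℝ) ≤ k := by
  exact_mod_cast hk ▸ nuP_le_card H p

theorem nuP_add_one_le {H : Finset ℤ} (hA : Admissible H) {p : ℕ} (hp : p.Prime) :
    (nuP H p : ℝ) + 1 ≤ p := by
  exact_mod_cast hA p hp

/-- For p ≤ k + 1 admissibility gives p - ν_p ≥ 1; for larger p, p - ν_p ≥ p - k ≥ p/(k+1). This is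
the source of uniformity in the tuple at small primes. -/
theorem le_mul_sub_nuP {H : Finset ℤ} {k : ℕ} (hk : H.card = k) (hA : Admissible H) {p : ℕ}
    (hp : p.Prime) : (p : ℝ) ≤ (k + 1) * ((p : ℝ) - nuP H p) := by
  have h1 := nuP_le_card' hk p
  have h2 := nuP_add_one_le hA hp
  have hk0 : (0 : ℝ) ≤ k := Nat.cast_nonneg k
  rcases le_total (p : ℝ) (k + 1) with h | h
  · nlinarith
  · nlinarith

theorem exists_nuP_eq_card (H : Finset ℤ) : ∃ D : ℕ, ∀ p : ℕ, D < p → nuP H p = H.card := by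
  refine ⟨2 * ∑ h ∈ H, h.natAbs, fun p hp => card_image_of_injOn ?_⟩
  intro a ha b hb hab
  have h1 : ((p : ℕ) : ℤ) ∣ b - a := (ZMod.intCast_eq_intCast_iff_dvd_sub a b p).1 hab
  have h2 : a.natAbs ≤ ∑ h ∈ H, h.natAbs :=
    single_le_sum (f := Int.natAbs) (fun _ _ => Nat.zero_le _) ha
  have h3 : b.natAbs ≤ ∑ h ∈ H, h.natAbs :=
    single_le_sum (f := Int.natAbs) (fun _ _ => Nat.zero_le _) hb
  have h4 : b - a = 0 := Int.eq_zero_of_abs_lt_dvd h1 (by rw [abs_lt]; constructor <;> omega)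
  omega

theorem finite_primes_le (D : ℕ) : {p : Nat.Primes | (p : ℕ) ≤ D}.Finite :=
  Set.Finite.preimage (f := fun p : Nat.Primes => (p : ℕ)) (s := Set.Iic D)
    Nat.Primes.coe_nat_injective.injOn (Set.finite_Iic D)

theorem beta_term_nonneg (H : Finset ℤ) (p : ℕ) :
    0 ≤ ((H.card : ℝ) - (nuP H p : ℝ)) * Real.log p / (p : ℝ) := by
  have := nuP_le_card' (H := H) rfl p
  have := Real.log_natCast_nonneg p
  exact div_nonneg (mul_nonneg (by linarith) this) (Nat.cast_nonneg p)

theorem summable_beta (H : Finset ℤ) : Summable fun p : Nat.Primes =>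
    ((H.card : ℝ) - (nuP H p : ℝ)) * Real.log (p : ℕ) / ((p : ℕ) : ℝ) := by
  obtain ⟨D, hD⟩ := exists_nuP_eq_card H
  refine summable_of_hasFiniteSupport ((finite_primes_le D).subset fun p hp => ?_)
  by_contra h
  have h' : D < (p : ℕ) := not_le.1 h
  refine hp ?_
  simp only
  rw [hD p h']
  simp

theorem sum_beta_le (H : Finset ℤ) (N : ℕ) :
    ∑ p ∈ pr N, ((H.card : ℝ) - (nuP H p : ℝ)) * Real.log p / (p : ℝ) ≤ beta H := by
  let s : Finset Nat.Primes := (pr N).subtype Nat.Prime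
  have h := (summable_beta H).sum_le_tsum s
    fun p _ => beta_term_nonneg H p
  refine le_trans (le_of_eq ?_) h
  exact (sum_subtype_of_mem (p := Nat.Prime)
    (fun p : ℕ => ((H.card : ℝ) - (nuP H p : ℝ)) * Real.log p / (p : ℝ))
    (fun p hp => (mem_pr.1 hp).2)).symm

/-- Admissibility at 2 forces ν_2 ≤ 1, so the prime 2 alone contributes this much. Bounded errors
can therefore be written as multiples of β. -/
theorem log_two_div_two_le_beta {H : Finset ℤ} {k : ℕ} (hk : H.card = k) (hk2 : 2 ≤ k)
    (hA : Admissible H) : Real.log 2 / 2 ≤ beta H := by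
  have h := sum_beta_le H 2
  have e : pr 2 = {2} := by decide
  rw [e, sum_singleton] at h
  refine le_trans ?_ h
  have h1 := nuP_add_one_le hA Nat.prime_two
  have h2 : (2 : ℝ) ≤ (H.card : ℝ) := by rw [hk]; exact_mod_cast hk2
  have h3 : 0 < Real.log 2 := Real.log_pos (by norm_num)
  push_cast at h1 ⊢
  have : 1 * Real.log 2 ≤ ((H.card : ℝ) - (nuP H 2 : ℝ)) * Real.log 2 := by
    gcongr; linarith
  linarith

section
variable {H : Finset ℤ} {k : ℕ}

theorem sub_nuP_pos (hA : Admissible H) {p : ℕ} (hp : p.Prime) : 0 < (p : ℝ) - nuP H p := by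
  linarith [nuP_add_one_le hA hp]

theorem hH_nonneg (hk : H.card = k) (hk2 : 2 ≤ k) (hA : Admissible H) {p : ℕ} (hp : p.Prime) :
    0 ≤ hH H p :=
  div_nonneg (by linarith [one_le_nuP' hk hk2 p]) (sub_nuP_pos hA hp).le

/-- The first part is nonzero only where ν_p < k and is comparable with the summand of β; the second
is O(1/p²) with a constant depending on k. -/
theorem hH_sub_eq (hA : Admissible H) {p : ℕ} (hp : p.Prime) :
    hH H p - ((k : ℝ) - 1) / p = - (((k : ℝ) - nuP H p) / ((p : ℝ) - nuP H p))
      + ((k : ℝ) - 1) * nuP H p / (p * ((p : ℝ) - nuP H p)) := by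
  have h1 := sub_nuP_pos hA hp
  have h2 : (0 : ℝ) < p := by exact_mod_cast hp.pos
  unfold hH
  field_simp
  ring

theorem one_div_sub_nuP_le (hk : H.card = k) (hA : Admissible H) {p : ℕ} (hp : p.Prime) :
    1 / ((p : ℝ) - nuP H p) ≤ ((k : ℝ) + 1) * (1 / p) := by
  have h1 := sub_nuP_pos hA hp
  have h2 : (0 : ℝ) < p := by exact_mod_cast hp.pos
  have h3 := le_mul_sub_nuP hk hA hp
  rw [mul_one_div, div_le_div_iff₀ h1 h2]
  linarith

theorem one_div_sq_le {p : ℕ} (hp : p.Prime) :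
    1 / ((p : ℝ) * p) ≤ 1 / ((p : ℝ) * Real.sqrt p) := by
  have h2 : (1 : ℝ) ≤ p := by exact_mod_cast hp.one_le
  have hs1 : 1 ≤ Real.sqrt p := Real.one_le_sqrt.2 h2
  have hss : Real.sqrt p * Real.sqrt p = p := Real.mul_self_sqrt (by linarith)
  exact one_div_le_one_div_of_le (by positivity) (by nlinarith)

theorem second_term_nonneg (hk2 : 2 ≤ k) (hA : Admissible H) {p : ℕ}
    (hp : p.Prime) : 0 ≤ ((k : ℝ) - 1) * nuP H p / (p * ((p : ℝ) - nuP H p)) := by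
  have h1 := sub_nuP_pos hA hp
  have h5 : (2 : ℝ) ≤ k := by exact_mod_cast hk2
  exact div_nonneg (mul_nonneg (by linarith) (Nat.cast_nonneg _))
    (mul_nonneg (Nat.cast_nonneg _) h1.le)

theorem second_term_le (hk : H.card = k) (hk2 : 2 ≤ k) (hA : Admissible H) {p : ℕ}
    (hp : p.Prime) : ((k : ℝ) - 1) * nuP H p / (p * ((p : ℝ) - nuP H p))
      ≤ (k : ℝ) * k * (k + 1) * (1 / ((p : ℝ) * p)) := by
  have h1 := sub_nuP_pos hA hp
  have h2 : (0 : ℝ) < p := by exact_mod_cast hp.pos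
  have h3 := one_div_sub_nuP_le hk hA hp
  have h4 := nuP_le_card' hk p
  have h5 : (2 : ℝ) ≤ k := by exact_mod_cast hk2
  calc _ = ((k : ℝ) - 1) * nuP H p * (1 / p) * (1 / ((p : ℝ) - nuP H p)) := by
        field_simp
    _ ≤ (k * k) * (1 / p) * (((k : ℝ) + 1) * (1 / p)) := by
        gcongr
        linarith
    _ = _ := by field_simp

theorem first_term_nonneg (hk : H.card = k) (hA : Admissible H) {p : ℕ}
    (hp : p.Prime) : 0 ≤ ((k : ℝ) - nuP H p) / ((p : ℝ) - nuP H p) :=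
  div_nonneg (by linarith [nuP_le_card' hk p]) (sub_nuP_pos hA hp).le

theorem first_term_le (hk : H.card = k) (hA : Admissible H) {p : ℕ}
    (hp : p.Prime) : ((k : ℝ) - nuP H p) / ((p : ℝ) - nuP H p)
      ≤ ((k : ℝ) + 1) * (((k : ℝ) - nuP H p) / p) := by
  have h3 := one_div_sub_nuP_le hk hA hp
  have h4 := nuP_le_card' hk p
  calc _ = ((k : ℝ) - nuP H p) * (1 / ((p : ℝ) - nuP H p)) := by ring
    _ ≤ ((k : ℝ) - nuP H p) * (((k : ℝ) + 1) * (1 / p)) := by gcongr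
    _ = _ := by ring

theorem hH_le (hk : H.card = k) (hk2 : 2 ≤ k) (hA : Admissible H) {p : ℕ} (hp : p.Prime) :
    hH H p ≤ ((k : ℝ) - 1) / p + (k : ℝ) * k * (k + 1) * (1 / ((p : ℝ) * Real.sqrt p)) := by
  have h1 := hH_sub_eq (k := k) hA hp
  have h2 := first_term_nonneg hk hA hp
  have h3 := second_term_le hk hk2 hA hp
  have h4 := one_div_sq_le hp
  have h5 : (k : ℝ) * k * (k + 1) * (1 / ((p : ℝ) * p))
    ≤ (k : ℝ) * k * (k + 1) * (1 / ((p : ℝ) * Real.sqrt p)) := by gcongr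
  linarith

end

/-- The point where β enters: up to a bounded amount, h(p) log p deviates from (k-1) log p/p by at
most (k+1) times the summand of β. The clause 1 ≤ Kβ lets Kβ serve as the parameter Λ of
`exists_W_asymptotic`. -/
theorem exists_sum_hH_log_le (k : ℕ) (hk2 : 2 ≤ k) :
    ∃ K : ℝ, 0 < K ∧ ∀ H : Finset ℤ, H.card = k → Admissible H → 1 ≤ K * beta H ∧
      ∀ u : ℝ, 0 ≤ u →
      |∑ p ∈ pr ⌊Real.exp u⌋₊, hH H p * Real.log p - ((k : ℝ) - 1) * u| ≤ K * beta H := by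
  obtain ⟨C, hC, h1⟩ := exists_mertens
  obtain ⟨C', hC', h2⟩ := exists_sum_one_div_mul_sqrt_le
  have hl2 : 0 < Real.log 2 := Real.log_pos (by norm_num)
  have hk0 : (2 : ℝ) ≤ k := by exact_mod_cast hk2
  set A : ℝ := (k : ℝ) * k * (k + 1) * 2 * C' + ((k : ℝ) - 1) * C + 1 with hAdef
  have hA0 : 1 ≤ A := by
    have : 0 ≤ (k : ℝ) * k * (k + 1) * 2 * C' := by positivity
    have : 0 ≤ ((k : ℝ) - 1) * C := mul_nonneg (by linarith) hC.le
    linarith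
  -- The factor 2/log 2 turns the bounded error A into a multiple of β.
  refine ⟨(k : ℝ) + 1 + A * (2 / Real.log 2), by positivity, fun H hk hA => ?_⟩
  have hβ := log_two_div_two_le_beta hk hk2 hA
  have hAβ : A ≤ A * (2 / Real.log 2) * beta H := by
    have : 1 ≤ 2 / Real.log 2 * beta H := by
      calc 1 = 2 / Real.log 2 * (Real.log 2 / 2) := by field_simp
        _ ≤ _ := by gcongr
    nlinarith
  have hβ0 : 0 < beta H := by linarith
  have hkβ : 0 ≤ ((k : ℝ) + 1) * beta H := by positivity
  refine ⟨by nlinarith, fun u hu => ?_⟩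
  set N := ⌊Real.exp u⌋₊
  have e : ∑ p ∈ pr N, hH H p * Real.log p - ((k : ℝ) - 1) * u
      = - ∑ p ∈ pr N, ((k : ℝ) - nuP H p) / ((p : ℝ) - nuP H p) * Real.log p
        + ∑ p ∈ pr N, ((k : ℝ) - 1) * nuP H p / (p * ((p : ℝ) - nuP H p)) * Real.log p
        + ((k : ℝ) - 1) * (∑ p ∈ pr N, Real.log p / p - u) := by
    rw [mul_sub, mul_sum, ← sum_neg_distrib, ← sum_add_distrib, add_sub_assoc', ← sum_add_distrib]
    congr 1
    refine sum_congr rfl fun p hp => ?_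
    have := hH_sub_eq (k := k) hA (mem_pr.1 hp).2
    have h3 : hH H p = - (((k : ℝ) - nuP H p) / ((p : ℝ) - nuP H p))
      + ((k : ℝ) - 1) * nuP H p / (p * ((p : ℝ) - nuP H p)) + ((k : ℝ) - 1) / p := by linarith
    rw [h3]
    ring
  have hb1 : ∑ p ∈ pr N, ((k : ℝ) - nuP H p) / ((p : ℝ) - nuP H p) * Real.log p
      ≤ ((k : ℝ) + 1) * beta H := by
    calc _ ≤ ∑ p ∈ pr N, ((k : ℝ) + 1) * (((H.card : ℝ) - (nuP H p : ℝ)) * Real.log p / (p : ℝ)) := by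
          refine sum_le_sum fun p hp => ?_
          have h3 := first_term_le hk hA (mem_pr.1 hp).2
          have h4 := Real.log_natCast_nonneg p
          calc _ ≤ ((k : ℝ) + 1) * (((k : ℝ) - nuP H p) / p) * Real.log p := by gcongr
            _ = _ := by rw [hk]; ring
      _ ≤ _ := by
          rw [← mul_sum]
          gcongr
          exact sum_beta_le H N
  have hb1' : 0 ≤ ∑ p ∈ pr N, ((k : ℝ) - nuP H p) / ((p : ℝ) - nuP H p) * Real.log p :=
    sum_nonneg fun p hp => mul_nonneg (first_term_nonneg hk hA (mem_pr.1 hp).2)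
      (Real.log_natCast_nonneg p)
  have hb2 : ∑ p ∈ pr N, ((k : ℝ) - 1) * nuP H p / (p * ((p : ℝ) - nuP H p)) * Real.log p
      ≤ (k : ℝ) * k * (k + 1) * 2 * C' := by
    calc _ ≤ ∑ p ∈ pr N, (k : ℝ) * k * (k + 1) * 2 * (1 / ((p : ℝ) * Real.sqrt p)) := by
          refine sum_le_sum fun p hp => ?_
          have hp' := (mem_pr.1 hp).2
          have h3 := second_term_le hk hk2 hA hp'
          have h4 := Real.log_natCast_nonneg p
          have hp0 : (0 : ℝ) < p := by exact_mod_cast hp'.pos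
          have h5 := log_le_two_mul_sqrt hp0
          have hss : Real.sqrt p * Real.sqrt p = p := Real.mul_self_sqrt (by linarith)
          have hs0 := Real.sqrt_pos.2 hp0
          calc _ ≤ (k : ℝ) * k * (k + 1) * (1 / ((p : ℝ) * p)) * (2 * Real.sqrt p) := by gcongr
            _ = _ := by
              field_simp
              linear_combination hss
      _ ≤ _ := by
          rw [← mul_sum]
          have := h2 (pr N)
          gcongr
  have hb2' : 0 ≤ ∑ p ∈ pr N, ((k : ℝ) - 1) * nuP H p / (p * ((p : ℝ) - nuP H p)) * Real.log p :=
    sum_nonneg fun p hp => mul_nonneg (second_term_nonneg hk2 hA (mem_pr.1 hp).2)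
      (Real.log_natCast_nonneg p)
  have hb3 : |((k : ℝ) - 1) * (∑ p ∈ pr N, Real.log p / p - u)| ≤ ((k : ℝ) - 1) * C := by
    rw [abs_mul, abs_of_nonneg (by linarith)]
    exact mul_le_mul_of_nonneg_left (h1 u hu) (by linarith)
  have hb3' := abs_le.1 hb3
  have hq : 0 ≤ (k : ℝ) * k * (k + 1) * 2 * C' := by positivity
  rw [e, abs_le]
  constructor <;> nlinarith [hb3'.1, hb3'.2]

/-- Since 1 + h(p) = (p-1)/(p-ν_p), the local factors of the two products are reciprocal. Passing to
sums of logarithms yields both the positivity and the product identity. -/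
theorem singularSeries_mul_eq_one {H : Finset ℤ} {j : ℕ} (hk : H.card = j + 2)
    (hA : Admissible H)
    (hs : Summable (fun p : Nat.Primes => (1 + hH H p) * (1 - 1 / ((p : ℕ) : ℝ)) ^ (j + 1) - 1)) :
    0 < singularSeries H ∧ singularSeries H *
      ∏' p : Nat.Primes, (1 + hH H p) * (1 - 1 / ((p : ℕ) : ℝ)) ^ (j + 1) = 1 := by
  set F : Nat.Primes → ℝ := fun p => (1 + hH H p) * (1 - 1 / ((p : ℕ) : ℝ)) ^ (j + 1) with hF
  have hfac : ∀ p : Nat.Primes, 0 < F p ∧ (1 - (nuP H p : ℝ) / ((p : ℕ) : ℝ))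
      * ((1 - 1 / ((p : ℕ) : ℝ)) ^ H.card)⁻¹ = (F p)⁻¹ := by
    intro p
    have h1 := sub_nuP_pos hA p.2
    have hp2 : (2 : ℝ) ≤ (p : ℕ) := by exact_mod_cast p.2.two_le
    have hp0 : ((p : ℕ) : ℝ) ≠ 0 := by linarith
    have hp1 : (0 : ℝ) < ((p : ℕ) : ℝ) - 1 := by linarith
    have h2 : (0 : ℝ) < 1 - 1 / ((p : ℕ) : ℝ) := by
      rw [sub_pos, div_lt_one (by linarith)]; linarith
    have h3 : 1 + hH H p = (((p : ℕ) : ℝ) - 1) / (((p : ℕ) : ℝ) - nuP H p) := by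
      unfold hH
      field_simp
      ring
    have h4 : 1 - 1 / ((p : ℕ) : ℝ) = (((p : ℕ) : ℝ) - 1) / (p : ℕ) := by field_simp
    have h5 : 1 - (nuP H p : ℝ) / ((p : ℕ) : ℝ) = (((p : ℕ) : ℝ) - nuP H p) / (p : ℕ) := by
      field_simp
    simp only [hF]
    rw [h3]
    refine ⟨by positivity, ?_⟩
    rw [hk, h5, pow_succ _ (j + 1)]
    set X := (1 - 1 / ((p : ℕ) : ℝ)) ^ (j + 1) with hX
    have hX0 : X ≠ 0 := by positivity
    rw [h4]
    field_simp
  have hlog : Summable fun p => Real.log (F p) := by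
    have := Real.summable_log_one_add_of_summable hs
    simpa [hF] using this
  have he := Real.rexp_tsum_eq_tprod (fun p => (hfac p).1) hlog
  have he' := Real.rexp_tsum_eq_tprod (f := fun p => (F p)⁻¹)
    (fun p => inv_pos.2 (hfac p).1) (by simpa [Real.log_inv] using hlog.neg)
  have hS : singularSeries H = Real.exp (∑' p, Real.log (F p)⁻¹) := by
    rw [he']
    unfold singularSeries
    exact tprod_congr fun p => (hfac p).2
  refine ⟨by rw [hS]; exact Real.exp_pos _, ?_⟩
  rw [hS, ← he, ← Real.exp_add]
  simp only [Real.log_inv]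
  rw [tsum_neg]
  simp

/-- The general summation theorem in dimension k - 1 = j + 1, with leading constant identified as
1/𝔖 and error parameter Λ a multiple of β. -/
theorem exists_W_hH_asymptotic (j : ℕ) :
    ∃ C : ℝ, 0 < C ∧ ∀ H : Finset ℤ, H.card = j + 2 → Admissible H →
      0 < singularSeries H ∧ ∀ m : ℕ, ∀ u : ℝ, 0 ≤ u →
      |singularSeries H * W (sqfun (hH H)) m u - u ^ (j + 1 + m) / ((j + 1 + m).factorial : ℝ)|
        ≤ C * (singularSeries H * beta H) * (1 + u) ^ (j + m) := by
  set B : ℝ := ((j + 2 : ℕ) : ℝ) * ((j + 2 : ℕ) : ℝ) * (((j + 2 : ℕ) : ℝ) + 1) with hB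
  have hB0 : 0 ≤ B := by positivity
  obtain ⟨C, hC, h1⟩ := exists_W_asymptotic j B hB0
  obtain ⟨K, hK, h2⟩ := exists_sum_hH_log_le (j + 2) (by omega)
  refine ⟨C * K, by positivity, fun H hk hA => ?_⟩
  obtain ⟨hβ1, h3⟩ := h2 H hk hA
  have hk1 : (((j + 2 : ℕ) : ℝ) - 1) = ((j + 1 : ℕ) : ℝ) := by push_cast; ring
  have h0 : ∀ p : ℕ, p.Prime → 0 ≤ hH H p := fun p hp => hH_nonneg hk (by omega) hA hp
  have hle : ∀ p : ℕ, p.Prime →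
      hH H p ≤ ((j + 1 : ℕ) : ℝ) / p + B * (1 / ((p : ℝ) * Real.sqrt p)) := fun p hp => by
    rw [← hk1]
    exact hH_le hk (by omega) hA hp
  rw [hk1] at h3
  obtain ⟨c, hc⟩ := h1 (hH H) (K * beta H) hβ1 h0 hle h3
  have hdiff : Summable fun p : Nat.Primes => |hH H p - (j + 1 : ℕ) / ((p : ℕ) : ℝ)| := by
    have hb : Summable (fun p : Nat.Primes => B * (1 / (((p : ℕ) : ℝ) * Real.sqrt (p : ℕ)))) :=
      (summable_one_div_mul_sqrt.comp_injective Nat.Primes.coe_nat_injective).mul_left B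
    refine Summable.of_norm_bounded_eventually hb ?_
    obtain ⟨D, hD⟩ := exists_nuP_eq_card H
    refine ((finite_primes_le D).subset fun p hp => ?_ : Set.Finite _)
    by_contra hnd
    refine hp ?_
    have hnd' : D < (p : ℕ) := not_le.1 hnd
    show ‖|hH H p - (j + 1 : ℕ) / ((p : ℕ) : ℝ)|‖ ≤ _
    rw [Real.norm_eq_abs, abs_abs]
    have e := hH_sub_eq (k := j + 2) hA p.2
    rw [hk1, hD p hnd', hk, sub_self, zero_div, neg_zero, zero_add] at e
    rw [e]
    have h4 := second_term_nonneg (k := j + 2) (by omega) hA p.2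
    have h5 := second_term_le (k := j + 2) hk (by omega) hA p.2
    rw [hD p hnd', hk] at h4 h5
    rw [hk1] at h4 h5
    rw [abs_of_nonneg h4]
    exact h5.trans (mul_le_mul_of_nonneg_left (one_div_sq_le p.2) hB0)
  obtain ⟨hsum, hce⟩ := W_constant_eq_tprod hB0 h0 hle hdiff hc
  obtain ⟨hS, hSc⟩ := singularSeries_mul_eq_one hk hA hsum
  refine ⟨hS, fun m u hu => ?_⟩
  rw [← hce] at hSc
  have hβ0 : 0 ≤ K * beta H := by linarith
  have h4 := abs_W_sub_le (mul_nonneg hC.le hβ0) hc m u hu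
  have e : singularSeries H * W (sqfun (hH H)) m u - u ^ (j + 1 + m) / ((j + 1 + m).factorial : ℝ)
      = singularSeries H * (W (sqfun (hH H)) m u
        - c * (u ^ (j + 1 + m) / ((j + 1 + m).factorial : ℝ))) := by
    rw [mul_sub, ← mul_assoc, hSc, one_mul]
  rw [e, abs_mul, abs_of_pos hS]
  calc _ ≤ singularSeries H * (C * (K * beta H) * (1 + u) ^ (j + m)) := by gcongr
    _ = _ := by ring

/-- Upper bounds for `∑ μ²(r) h(r) e(r)²`. -/
theorem exists_sum_hH_evar_le (j : ℕ) :
    ∃ C : ℝ, 0 < C ∧ ∀ H : Finset ℤ, H.card = j + 2 → Admissible H → ∀ u : ℝ, 0 ≤ u →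
      ∑ r ∈ sqf ⌊Real.exp u⌋₊, pf (hH H) r * evar r ^ 2 ≤ C * (1 + u) ^ (j + 1) := by
  set B : ℝ := ((j + 2 : ℕ) : ℝ) * ((j + 2 : ℕ) : ℝ) * (((j + 2 : ℕ) : ℝ) + 1) with hB
  have hB0 : 0 ≤ B := by positivity
  set A : ℝ := ((j + 1 : ℕ) : ℝ) + B with hAdef
  -- The factor ε(p) of `evar` satisfies ε ≤ 1 + 14/√p and ε ≤ 4, hence ε² ≤ 1 + 80/√p. With h(p) ≤
  -- A/p the correction is 80A·p^{-3/2}, so weighting by `evar` squared keeps the dimension.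
  obtain ⟨C, hC, h1⟩ := exists_sum_pf_le (j + 1) (B + A * 80) (by positivity)
  refine ⟨C, hC, fun H hk hA u hu => ?_⟩
  set ε : ℕ → ℝ := fun p => (p : ℝ) / ((p : ℝ) - 1) * (1 + Real.log p / ((p : ℝ) - 1)) with hε
  have hk1 : (((j + 2 : ℕ) : ℝ) - 1) = ((j + 1 : ℕ) : ℝ) := by push_cast; ring
  have h0 : ∀ p : ℕ, p.Prime → 0 ≤ hH H p := fun p hp => hH_nonneg hk (by omega) hA hp
  have e : ∀ r, pf (hH H) r * evar r ^ 2 = pf (fun p => hH H p * (ε p * ε p)) r := fun r => by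
    rw [pf_mul_fun, pf_mul_fun, pow_two]
    rfl
  simp_rw [e]
  refine h1 _ (fun p hp => mul_nonneg (h0 p hp) (mul_self_nonneg _)) (fun p hp => ?_) u hu
  have hp2 : (2 : ℝ) ≤ p := by exact_mod_cast hp.two_le
  have hp0 : (0 : ℝ) < p := by linarith
  set s := Real.sqrt p with hs
  have hs0 : 0 < s := Real.sqrt_pos.2 hp0
  have hss : s * s = p := Real.mul_self_sqrt hp0.le
  have hs1 : 1 ≤ s := Real.one_le_sqrt.2 (by linarith)
  have hle := hH_le hk (by omega) hA hp
  rw [hk1] at hle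
  have hinv : 1 / ((p : ℝ) * s) ≤ 1 / p := one_div_le_one_div_of_le hp0 (by nlinarith)
  have hle2 : hH H p ≤ A * (1 / p) := by
    have := mul_le_mul_of_nonneg_left hinv hB0
    rw [hAdef, add_mul, mul_one_div]
    linarith
  have hlog : Real.log p / ((p : ℝ) - 1) ≤ 4 * (1 / s) := by
    rw [mul_one_div, div_le_div_iff₀ (by linarith) hs0]
    have := log_le_two_mul_sqrt hp0
    have h2 : Real.log p * s ≤ 2 * s * s := by gcongr
    nlinarith
  have hp1 : (p : ℝ) / ((p : ℝ) - 1) ≤ 1 + 2 * (1 / s) := by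
    have : (p : ℝ) / ((p : ℝ) - 1) = 1 + 1 / ((p : ℝ) - 1) := by
      field_simp [show (p : ℝ) - 1 ≠ 0 by linarith]
      ring
    rw [this, mul_one_div]
    gcongr 1 + ?_
    rw [div_le_div_iff₀ (by linarith) hs0]
    nlinarith
  have hx : 1 / s ≤ 1 := by rw [div_le_one hs0]; exact hs1
  have hx0 : 0 < 1 / s := by positivity
  have hp10 : 0 ≤ (p : ℝ) / ((p : ℝ) - 1) := div_nonneg hp0.le (by linarith)
  have hε0 : 0 ≤ ε p := mul_nonneg hp10 (by linarith [log_div_sub_one_nonneg hp])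
  have hε1 : ε p ≤ 1 + 14 * (1 / s) := by
    calc ε p ≤ (1 + 2 * (1 / s)) * (1 + 4 * (1 / s)) := by
          refine mul_le_mul hp1 (by linarith) (by linarith [log_div_sub_one_nonneg hp]) (by positivity)
      _ ≤ _ := by nlinarith
  have hε4 : ε p ≤ 4 := by
    refine le_trans (mul_le_mul (b := (2 : ℝ)) (d := 2) ?_ ?_
      (by linarith [log_div_sub_one_nonneg hp]) (by norm_num)) (by norm_num)
    · rw [div_le_iff₀ (by linarith)]; linarith
    · have : Real.log p ≤ (p : ℝ) - 1 := Real.log_le_sub_one_of_pos hp0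
      have : Real.log p / ((p : ℝ) - 1) ≤ 1 := (div_le_one (by linarith)).2 this
      linarith
  have hεε : ε p * ε p ≤ 1 + 80 * (1 / s) := by nlinarith
  calc hH H p * (ε p * ε p) ≤ hH H p * (1 + 80 * (1 / s)) :=
        mul_le_mul_of_nonneg_left hεε (h0 p hp)
    _ = hH H p + hH H p * (80 * (1 / s)) := by ring
    _ ≤ (((j + 1 : ℕ) : ℝ) / p + B * (1 / ((p : ℝ) * s))) + A * (1 / p) * (80 * (1 / s)) := by
        gcongr
    _ = _ := by field_simp; ring


/-! ### Diagonalization of the quadratic forms -/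

/-- The form `∏_{p ∣ d} (-F p) ∑_{d ∣ t} ∏_{p ∣ t} w(p) Y(t)` of the sieve coefficients. -/
def lamForm (F w : ℕ → ℝ) (R : ℝ) (ℓ d : ℕ) : ℝ :=
  pf (fun p => - F p) d * ∑ t ∈ (sqf ⌊R⌋₊).filter (fun t => d ∣ t), pf w t * Y R ℓ t

theorem sum_divisors_between (F g : ℕ → ℝ) {M t r : ℕ} (ht : t ∈ sqf M) (hr : r ∣ t) :
    ∑ d ∈ (sqf M).filter (fun d => r ∣ d ∧ d ∣ t), pf (fun p => - F p) d * pf g (d / r)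
      = pf (fun p => - F p) r * pf (fun p => 1 - g p * F p) (t / r) := by
  obtain ⟨htM, hts⟩ := mem_sqf.1 ht
  have ht0 := Nat.pos_of_ne_zero hts.ne_zero
  have hr0 : 0 < r := Nat.pos_of_dvd_of_pos hr ht0
  have htr : Squarefree (t / r) := hts.squarefree_of_dvd (Nat.div_dvd_of_dvd hr)
  have h1 : pf (fun p => 1 - g p * F p) (t / r) = pf (fun p => -F p * g p + 1) (t / r) :=
    pf_congr fun p _ _ => by ring
  rw [h1, ← sum_divisors_pf _ htr, mul_sum]
  refine sum_bij' (fun d _ => d / r) (fun j _ => r * j) ?_ ?_ ?_ ?_ ?_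
  · intro d hd
    obtain ⟨_, h2, h3⟩ := mem_filter.1 hd
    exact Nat.mem_divisors.2 ⟨Nat.div_dvd_div h2 h3, htr.ne_zero⟩
  · intro j hj
    have hj' := Nat.dvd_of_mem_divisors hj
    have h4 : r * j ∣ t := by
      rw [← Nat.mul_div_cancel' hr]; exact Nat.mul_dvd_mul_left r hj'
    rw [mem_filter]
    exact ⟨mem_sqf.2 ⟨(Nat.le_of_dvd ht0 h4).trans htM, hts.squarefree_of_dvd h4⟩,
      dvd_mul_right r j, h4⟩
  · intro d hd
    exact Nat.mul_div_cancel' (mem_filter.1 hd).2.1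
  · intro j _
    exact Nat.mul_div_cancel_left j hr0
  · intro d hd
    obtain ⟨h1, h2, h3⟩ := mem_filter.1 hd
    rw [pf_div _ (mem_sqf.1 h1).2 h2, pf_mul_fun]
    ring

/-- Exchanging the sums leaves, for each t, a sum over d with r ∣ d ∣ t that factors into local
terms 1 - gF. It produces the linear forms in which the quadratic form is diagonal. -/
theorem sum_lamForm_mul_pf (F w g : ℕ → ℝ) (R : ℝ) (ℓ : ℕ) {r : ℕ} :
    ∑ d ∈ (sqf ⌊R⌋₊).filter (fun d => r ∣ d), lamForm F w R ℓ d * pf g (d / r)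
      = pf (fun p => - F p * w p) r * Zsum R (fun p => w p * (1 - g p * F p)) ℓ r := by
  set S := sqf ⌊R⌋₊ with hS
  have e1 : ∑ d ∈ S.filter (fun d => r ∣ d), lamForm F w R ℓ d * pf g (d / r)
      = ∑ d ∈ S, ∑ t ∈ S, if r ∣ d ∧ d ∣ t then
          (pf (fun p => - F p) d * pf g (d / r)) * (pf w t * Y R ℓ t) else 0 := by
    rw [sum_filter]
    refine sum_congr rfl fun d _ => ?_
    unfold lamForm
    rw [sum_filter, mul_sum, sum_mul]
    split_ifs with h
    · refine sum_congr rfl fun t _ => ?_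
      by_cases h2 : d ∣ t
      · rw [if_pos h2, if_pos ⟨h, h2⟩]; ring
      · rw [if_neg h2, if_neg fun h3 => h2 h3.2]; ring
    · symm
      exact sum_eq_zero fun t _ => if_neg fun h3 => h h3.1
  rw [e1, sum_comm]
  unfold Zsum
  rw [sum_filter, mul_sum]
  refine sum_congr rfl fun t ht => ?_
  by_cases hrt : r ∣ t
  · rw [if_pos hrt, ← sum_filter, ← sum_mul, sum_divisors_between F g ht hrt,
      pf_div w (mem_sqf.1 ht).2 hrt, pf_mul_fun, pf_mul_fun]
    ring
  · rw [if_neg hrt, mul_zero]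
    exact sum_eq_zero fun d _ => if_neg fun h => hrt (h.1.trans h.2)

/-- The quadratic form `∑ λ_d λ'_e ∏_{p ∣ [d, e]} g(p)`. -/
def qform (F w g : ℕ → ℝ) (R : ℝ) (ℓ₁ ℓ₂ : ℕ) : ℝ :=
  ∑ d ∈ sqf ⌊R⌋₊, ∑ e ∈ sqf ⌊R⌋₊,
    lamForm F w R ℓ₁ d * lamForm F w R ℓ₂ e * pf g (Nat.lcm d e)

/-- Selberg's diagonalization. `pf_lcm` decouples d and e at the price of a common divisor r, and
for fixed r each variable sums to the linear form of `sum_lamForm_mul_pf`. -/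
theorem qform_eq (F w g : ℕ → ℝ) (R : ℝ) (ℓ₁ ℓ₂ : ℕ) :
    qform F w g R ℓ₁ ℓ₂ = ∑ r ∈ sqf ⌊R⌋₊, pf (fun p => g p * (1 - g p)) r *
      ((pf (fun p => - F p * w p) r * Zsum R (fun p => w p * (1 - g p * F p)) ℓ₁ r) *
       (pf (fun p => - F p * w p) r * Zsum R (fun p => w p * (1 - g p * F p)) ℓ₂ r)) := by
  set S := sqf ⌊R⌋₊ with hS
  have e1 : ∀ r, (pf (fun p => - F p * w p) r * Zsum R (fun p => w p * (1 - g p * F p)) ℓ₁ r) *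
      (pf (fun p => - F p * w p) r * Zsum R (fun p => w p * (1 - g p * F p)) ℓ₂ r)
      = ∑ d ∈ S, ∑ e ∈ S, if r ∣ d ∧ r ∣ e then lamForm F w R ℓ₁ d * lamForm F w R ℓ₂ e *
        (pf g (d / r) * pf g (e / r)) else 0 := by
    intro r
    rw [← sum_lamForm_mul_pf F w g R ℓ₁, ← sum_lamForm_mul_pf F w g R ℓ₂, ← hS,
      sum_filter, sum_filter, sum_mul_sum]
    refine sum_congr rfl fun d _ => sum_congr rfl fun e _ => ?_
    by_cases h1 : r ∣ d
    · by_cases h2 : r ∣ e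
      · rw [if_pos h1, if_pos h2, if_pos ⟨h1, h2⟩]; ring
      · rw [if_neg h2, if_neg (fun h : r ∣ d ∧ r ∣ e => h2 h.2), mul_zero]
    · rw [if_neg h1, if_neg (fun h : r ∣ d ∧ r ∣ e => h1 h.1), zero_mul]
  simp_rw [e1, mul_sum]
  unfold qform
  rw [← hS]
  rw [sum_comm (s := S) (t := S) (f := fun r d => ∑ e ∈ S, _)]
  refine sum_congr rfl fun d hd => ?_
  rw [sum_comm (s := S) (t := S) (f := fun r e => _)]
  refine sum_congr rfl fun e he => ?_
  obtain ⟨hd1, hd2⟩ := mem_sqf.1 hd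
  obtain ⟨he1, he2⟩ := mem_sqf.1 he
  rw [pf_lcm g hd2 he2, mul_sum]
  have e2 : ∀ r, (pf (fun p => g p * (1 - g p)) r * if r ∣ d ∧ r ∣ e then
      lamForm F w R ℓ₁ d * lamForm F w R ℓ₂ e * (pf g (d / r) * pf g (e / r)) else 0)
      = if r ∣ d ∧ r ∣ e then lamForm F w R ℓ₁ d * lamForm F w R ℓ₂ e *
        (pf (fun p => g p * (1 - g p)) r * (pf g (d / r) * pf g (e / r))) else 0 := by
    intro r
    split_ifs <;> ring
  simp_rw [e2]
  rw [← sum_filter]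
  refine sum_congr ?_ fun _ _ => rfl
  ext r
  rw [Nat.mem_divisors, mem_filter, Nat.dvd_gcd_iff]
  constructor
  · rintro ⟨h, _⟩
    exact ⟨mem_sqf.2 ⟨(Nat.le_of_dvd (Nat.pos_of_ne_zero hd2.ne_zero) h.1).trans hd1,
      hd2.squarefree_of_dvd h.1⟩, h⟩
  · rintro ⟨_, h⟩
    exact ⟨h, Nat.gcd_ne_zero_left hd2.ne_zero⟩

/-! ### The form of the tuple, and the form with one local value replaced by 1 -/

/-- `ν*_p/φ(p) = (ν_p - 1)/(p - 1)`. -/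
def gH (H : Finset ℤ) (p : ℕ) : ℝ := ((nuP H p : ℝ) - 1) / ((p : ℝ) - 1)

/-- `p/ν_p`. -/
def fH (H : Finset ℤ) (p : ℕ) : ℝ := (p : ℝ) / nuP H p

/-- `1/f₁(p) = ν_p/(p - ν_p)`. -/
def wH (H : Finset ℤ) (p : ℕ) : ℝ := (nuP H p : ℝ) / ((p : ℝ) - nuP H p)

section
variable {H : Finset ℤ}

theorem wH_mul_one_sub (hν : ∀ p : ℕ, p.Prime → (1 : ℝ) ≤ nuP H p ∧ (nuP H p : ℝ) + 1 ≤ p)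
    {p : ℕ} (hp : p.Prime) :
    wH H p * (1 - gH H p * fH H p) = 1 / ((p : ℝ) - 1) := by
  obtain ⟨h1, h2⟩ := hν p hp
  have h3 : (p : ℝ) - nuP H p ≠ 0 := by linarith
  have h4 : (p : ℝ) - 1 ≠ 0 := by linarith
  have h5 : (nuP H p : ℝ) ≠ 0 := by linarith
  unfold wH gH fH
  field_simp
  ring

theorem wH_mul_one_sub_fH (hν : ∀ p : ℕ, p.Prime → (1 : ℝ) ≤ nuP H p ∧ (nuP H p : ℝ) + 1 ≤ p)
    {p : ℕ} (hp : p.Prime) : wH H p * (1 - 1 * fH H p) = -1 := by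
  obtain ⟨h1, h2⟩ := hν p hp
  have h3 : (p : ℝ) - nuP H p ≠ 0 := by linarith
  have h5 : (nuP H p : ℝ) ≠ 0 := by linarith
  unfold wH fH
  field_simp
  ring

/-- The factors p/(p-1) are those built into `zvar`; what remains as the coefficient of the diagonal
form is h(p), a function of dimension k - 1. -/
theorem diag_coefficient (hν : ∀ p : ℕ, p.Prime → (1 : ℝ) ≤ nuP H p ∧ (nuP H p : ℝ) + 1 ≤ p)
    {p : ℕ} (hp : p.Prime) :
    gH H p * (1 - gH H p) * ((-fH H p * wH H p) * (-fH H p * wH H p))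
      = hH H p * (((p : ℝ) / ((p : ℝ) - 1)) * ((p : ℝ) / ((p : ℝ) - 1))) := by
  obtain ⟨h1, h2⟩ := hν p hp
  have h3 : (p : ℝ) - nuP H p ≠ 0 := by linarith
  have h4 : (p : ℝ) - 1 ≠ 0 := by linarith
  have h5 : (nuP H p : ℝ) ≠ 0 := by linarith
  unfold gH wH fH hH
  field_simp
  ring

theorem qform_gH_eq (hν : ∀ p : ℕ, p.Prime → (1 : ℝ) ≤ nuP H p ∧ (nuP H p : ℝ) + 1 ≤ p)
    (R : ℝ) (ℓ₁ ℓ₂ : ℕ) :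
    qform (fH H) (wH H) (gH H) R ℓ₁ ℓ₂
      = ∑ r ∈ sqf ⌊R⌋₊, pf (hH H) r * (zvar R ℓ₁ r * zvar R ℓ₂ r) := by
  rw [qform_eq]
  refine sum_congr rfl fun r _ => ?_
  have hz : ∀ ℓ, Zsum R (fun p => wH H p * (1 - gH H p * fH H p)) ℓ r
      = Zsum R (fun p => 1 / ((p : ℝ) - 1)) ℓ r := fun ℓ => by
    unfold Zsum
    refine sum_congr rfl fun t _ => ?_
    rw [pf_congr fun p hp _ => wH_mul_one_sub hν hp]
  have h1 : pf (fun p => gH H p * (1 - gH H p)) r * (pf (fun p => -fH H p * wH H p) r *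
      pf (fun p => -fH H p * wH H p) r) = pf (hH H) r * (pf (fun p => (p : ℝ) / ((p : ℝ) - 1)) r *
      pf (fun p => (p : ℝ) / ((p : ℝ) - 1)) r) := by
    rw [← pf_mul_fun (fun p => -fH H p * wH H p), ← pf_mul_fun (fun p => gH H p * (1 - gH H p)),
      ← pf_mul_fun (fun p : ℕ => (p : ℝ) / ((p : ℝ) - 1)), ← pf_mul_fun (hH H)]
    exact pf_congr fun p hp _ => diag_coefficient hν hp
  rw [hz, hz]
  unfold zvar
  linear_combination (Zsum R (fun p => 1 / ((p : ℝ) - 1)) ℓ₁ r *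
    Zsum R (fun p => 1 / ((p : ℝ) - 1)) ℓ₂ r) * h1

/-- Setting g(q) = 1 changes the local weight at q from 1/(q-1) to -1 = 1/(q-1) -
q/(q-1)·(1/(q-1))·(q-1), that is, it subtracts q/(q-1) once on the multiples of q; removing q from t
leaves precisely the sum attached to rq. -/
theorem Zsum_update (hν : ∀ p : ℕ, p.Prime → (1 : ℝ) ≤ nuP H p ∧ (nuP H p : ℝ) + 1 ≤ p)
    {q : ℕ} (hq : q.Prime) (R : ℝ) (ℓ : ℕ) {r : ℕ} (hqr : ¬ q ∣ r) :
    Zsum R (fun p => wH H p * (1 - Function.update (gH H) q 1 p * fH H p)) ℓ r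
      = Zsum R (fun p => 1 / ((p : ℝ) - 1)) ℓ r
        - (q : ℝ) / ((q : ℝ) - 1) * Zsum R (fun p => 1 / ((p : ℝ) - 1)) ℓ (r * q) := by
  have hq2 : (2 : ℝ) ≤ q := by exact_mod_cast hq.two_le
  have hq1 : (q : ℝ) - 1 ≠ 0 := by linarith
  have hcop : r.Coprime q := ((Nat.Prime.coprime_iff_not_dvd hq).2 hqr).symm
  unfold Zsum
  rw [mul_sum, sum_filter, sum_filter, sum_filter, ← sum_sub_distrib]
  refine sum_congr rfl fun t ht => ?_
  by_cases hrt : r ∣ t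
  · rw [if_pos hrt, if_pos hrt]
    have hts := (mem_sqf.1 ht).2
    have htr : Squarefree (t / r) := hts.squarefree_of_dvd (Nat.div_dvd_of_dvd hrt)
    have hiff : r * q ∣ t ↔ q ∣ t / r := by
      obtain ⟨c, rfl⟩ := hrt
      have hr0 : 0 < r := Nat.pos_of_ne_zero fun h => hts.ne_zero (by simp [h])
      rw [Nat.mul_div_cancel_left _ hr0]
      exact Nat.mul_dvd_mul_iff_left hr0
    by_cases hqt : q ∣ t / r
    · rw [if_pos (hiff.2 hqt), ← Nat.div_div_eq_div_mul, pf_div _ htr hqt,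
        pf_div (fun p : ℕ => 1 / ((p : ℝ) - 1)) htr hqt, pf_prime _ hq, pf_prime _ hq,
        Function.update_self, wH_mul_one_sub_fH hν hq]
      have : pf (fun p => wH H p * (1 - Function.update (gH H) q 1 p * fH H p)) (t / r / q)
          = pf (fun p => 1 / ((p : ℝ) - 1)) (t / r / q) := by
        refine pf_congr fun p hp hpd => ?_
        have hpq : p ≠ q := by
          rintro rfl
          have h1 := coprime_div_of_squarefree htr hqt
          exact hp.one_lt.ne' (Nat.eq_one_of_dvd_coprimes h1 dvd_rfl hpd)
        rw [Function.update_of_ne hpq, wH_mul_one_sub hν hp]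
      rw [this]
      field_simp
      ring
    · rw [if_neg fun h => hqt (hiff.1 h), sub_zero]
      congr 1
      refine pf_congr fun p hp hpd => ?_
      have hpq : p ≠ q := by rintro rfl; exact hqt hpd
      rw [Function.update_of_ne hpq, wH_mul_one_sub hν hp]
  · have : ¬ r * q ∣ t := fun h => hrt ((dvd_mul_right r q).trans h)
    rw [if_neg hrt, if_neg hrt, if_neg this, sub_zero]

/-- If q ∣ r the coefficient contains g(q)(1 - g(q)) = 0. If q ∤ r the coefficient is unchanged, and
the factor q/(q-1) in `Zsum_update` is the local factor of `zvar` at q, so z_r becomes z_r - z_{rq}.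
-/
theorem qform_update_eq (hν : ∀ p : ℕ, p.Prime → (1 : ℝ) ≤ nuP H p ∧ (nuP H p : ℝ) + 1 ≤ p)
    {q : ℕ} (hq : q.Prime) (R : ℝ) (ℓ₁ ℓ₂ : ℕ) :
    qform (fH H) (wH H) (Function.update (gH H) q 1) R ℓ₁ ℓ₂
      = ∑ r ∈ (sqf ⌊R⌋₊).filter (fun r => ¬ q ∣ r), pf (hH H) r *
        ((zvar R ℓ₁ r - zvar R ℓ₁ (r * q)) * (zvar R ℓ₂ r - zvar R ℓ₂ (r * q))) := by
  rw [qform_eq, sum_filter]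
  refine sum_congr rfl fun r hr => ?_
  have hr0 := (mem_sqf.1 hr).2.ne_zero
  by_cases hqr : q ∣ r
  · rw [if_neg (not_not.2 hqr)]
    have : pf (fun p => Function.update (gH H) q 1 p * (1 - Function.update (gH H) q 1 p)) r = 0 := by
      refine prod_eq_zero (Nat.mem_primeFactors.2 ⟨hq, hqr, hr0⟩) ?_
      rw [Function.update_self]; ring
    rw [this, zero_mul]
  · rw [if_pos hqr, Zsum_update hν hq R ℓ₁ hqr, Zsum_update hν hq R ℓ₂ hqr]
    have hcop : r.Coprime q := ((Nat.Prime.coprime_iff_not_dvd hq).2 hqr).symm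
    have h0 : pf (fun p => Function.update (gH H) q 1 p * (1 - Function.update (gH H) q 1 p)) r
        = pf (fun p => gH H p * (1 - gH H p)) r := by
      refine pf_congr fun p hp hpd => ?_
      have hpq : p ≠ q := by rintro rfl; exact hqr hpd
      rw [Function.update_of_ne hpq]
    have h1 : pf (fun p => gH H p * (1 - gH H p)) r * (pf (fun p => -fH H p * wH H p) r *
        pf (fun p => -fH H p * wH H p) r) = pf (hH H) r * (pf (fun p => (p : ℝ) / ((p : ℝ) - 1)) r *
        pf (fun p => (p : ℝ) / ((p : ℝ) - 1)) r) := by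
      rw [← pf_mul_fun (fun p => -fH H p * wH H p), ← pf_mul_fun (fun p => gH H p * (1 - gH H p)),
        ← pf_mul_fun (fun p : ℕ => (p : ℝ) / ((p : ℝ) - 1)), ← pf_mul_fun (hH H)]
      exact pf_congr fun p hp _ => diag_coefficient hν hp
    rw [h0]
    unfold zvar
    rw [pf_mul _ hcop, pf_prime _ hq]
    set a := Zsum R (fun p => 1 / ((p : ℝ) - 1)) ℓ₁ r
    set b := Zsum R (fun p => 1 / ((p : ℝ) - 1)) ℓ₁ (r * q)
    set a' := Zsum R (fun p => 1 / ((p : ℝ) - 1)) ℓ₂ r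
    set b' := Zsum R (fun p => 1 / ((p : ℝ) - 1)) ℓ₂ (r * q)
    linear_combination ((a - (q : ℝ) / ((q : ℝ) - 1) * b) * (a' - (q : ℝ) / ((q : ℝ) - 1) * b')) * h1

/-- In the unmodified form the terms with q ∣ r are rewritten with r = r'q and contribute h(q)
z_{r'q} z'_{r'q}; expanding (z_r - z_{rq})(z'_r - z'_{rq}) and subtracting leaves three cross terms.
-/
theorem qform_update_sub (hν : ∀ p : ℕ, p.Prime → (1 : ℝ) ≤ nuP H p ∧ (nuP H p : ℝ) + 1 ≤ p)
    {q : ℕ} (hq : q.Prime) (R : ℝ) (ℓ₁ ℓ₂ : ℕ) :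
    qform (fH H) (wH H) (Function.update (gH H) q 1) R ℓ₁ ℓ₂
        - qform (fH H) (wH H) (gH H) R ℓ₁ ℓ₂
      = ∑ r ∈ (sqf ⌊R⌋₊).filter (fun r => ¬ q ∣ r), pf (hH H) r *
        (- (zvar R ℓ₁ r * zvar R ℓ₂ (r * q)) - zvar R ℓ₁ (r * q) * zvar R ℓ₂ r
          + (1 - hH H q) * (zvar R ℓ₁ (r * q) * zvar R ℓ₂ (r * q))) := by
  rw [qform_update_eq hν hq, qform_gH_eq hν]
  rw [← sum_filter_add_sum_filter_not (sqf ⌊R⌋₊) (fun r => ¬ q ∣ r)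
    (fun r => pf (hH H) r * (zvar R ℓ₁ r * zvar R ℓ₂ r))]
  have h1 : ∑ r ∈ (sqf ⌊R⌋₊).filter (fun r => ¬ ¬ q ∣ r), pf (hH H) r * (zvar R ℓ₁ r * zvar R ℓ₂ r)
      = ∑ r ∈ (sqf ⌊R⌋₊).filter (fun r => ¬ q ∣ r),
        pf (hH H) r * hH H q * (zvar R ℓ₁ (r * q) * zvar R ℓ₂ (r * q)) := by
    -- The extra condition rq ≤ ⌊R⌋ costs nothing, because `zvar` vanishes from R on.
    have h2 : ∑ r ∈ (sqf ⌊R⌋₊).filter (fun r => ¬ q ∣ r),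
        pf (hH H) r * hH H q * (zvar R ℓ₁ (r * q) * zvar R ℓ₂ (r * q))
        = ∑ r ∈ (sqf ⌊R⌋₊).filter (fun r => ¬ q ∣ r ∧ r * q ≤ ⌊R⌋₊),
        pf (hH H) r * hH H q * (zvar R ℓ₁ (r * q) * zvar R ℓ₂ (r * q)) := by
      symm
      refine sum_subset (fun r hr => ?_) fun r hr hr' => ?_
      · rw [mem_filter] at hr ⊢
        exact ⟨hr.1, hr.2.1⟩
      · rw [mem_filter] at hr hr'
        have h3 : ⌊R⌋₊ < r * q := by
          by_contra h
          exact hr' ⟨hr.1, hr.2, not_lt.1 h⟩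
        rw [zvar_eq_zero ℓ₁ ((Nat.lt_of_floor_lt h3).le)]
        ring
    rw [h2]
    refine sum_bij' (fun r _ => r / q) (fun r _ => r * q) ?_ ?_ ?_ ?_ ?_
    · intro r hr
      obtain ⟨h3, h4⟩ := mem_filter.1 hr
      obtain ⟨h5, h6⟩ := mem_sqf.1 h3
      have h4' : q ∣ r := not_not.1 h4
      rw [mem_filter]
      refine ⟨mem_sqf.2 ⟨(Nat.div_le_self r q).trans h5,
        h6.squarefree_of_dvd (Nat.div_dvd_of_dvd h4')⟩, ?_, ?_⟩
      · exact (Nat.Prime.coprime_iff_not_dvd hq).1 (coprime_div_of_squarefree h6 h4')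
      · rw [Nat.div_mul_cancel h4']; exact h5
    · intro r hr
      obtain ⟨h3, h4, h5⟩ := mem_filter.1 hr
      have h6 := (mem_sqf.1 h3).2
      rw [mem_filter]
      refine ⟨mem_sqf.2 ⟨h5, ?_⟩, not_not.2 (dvd_mul_left q r)⟩
      rw [Nat.squarefree_mul ((Nat.Prime.coprime_iff_not_dvd hq).2 h4).symm]
      exact ⟨h6, hq.squarefree⟩
    · intro r hr
      exact Nat.div_mul_cancel (not_not.1 (mem_filter.1 hr).2)
    · intro r _
      exact Nat.mul_div_cancel r hq.pos
    · intro r hr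
      obtain ⟨h3, h4⟩ := mem_filter.1 hr
      have h4' : q ∣ r := not_not.1 h4
      rw [Nat.div_mul_cancel h4', pf_div (hH H) (mem_sqf.1 h3).2 h4', pf_prime _ hq]
      ring
  rw [h1, ← sum_add_distrib, ← sum_sub_distrib]
  exact sum_congr rfl fun r _ => by ring

end


/-! ### Asymptotics of the diagonalized forms -/

theorem abs_mul_sub_mul_le {x X y Z e C U : ℝ} {l m : ℕ} (hC : 0 ≤ C) (he : 1 ≤ e) (hU : 1 ≤ U)
    (hx : |x - X| ≤ C * e * U ^ l) (hX : |X| ≤ U ^ (l + 1))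
    (hy : |y - Z| ≤ C * e * U ^ m) (hZ : |Z| ≤ U ^ (m + 1)) :
    |x * y - X * Z| ≤ (2 * C + C ^ 2) * e ^ 2 * U ^ (l + m + 1) := by
  have e1 : x * y - X * Z = (x - X) * Z + X * (y - Z) + (x - X) * (y - Z) := by ring
  have b1 : |(x - X) * Z| ≤ C * e * U ^ l * U ^ (m + 1) := by
    rw [abs_mul]; gcongr
  have b2 : |X * (y - Z)| ≤ U ^ (l + 1) * (C * e * U ^ m) := by
    rw [abs_mul]; gcongr
  have b3 : |(x - X) * (y - Z)| ≤ C * e * U ^ l * (C * e * U ^ m) := by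
    rw [abs_mul]; gcongr
  have h1 : C * e * U ^ (l + m + 1) ≤ C * e ^ 2 * U ^ (l + m + 1) := by
    have : e ≤ e ^ 2 := by nlinarith
    gcongr
  have h2 : C ^ 2 * e ^ 2 * U ^ (l + m) ≤ C ^ 2 * e ^ 2 * U ^ (l + m + 1) := by
    exact mul_le_mul_of_nonneg_left (pow_le_pow_right₀ hU (by omega)) (by positivity)
  rw [e1]
  refine (abs_add_three _ _ _).trans ((add_le_add_three b1 b2 b3).trans ?_)
  have : C * e * U ^ l * U ^ (m + 1) + U ^ (l + 1) * (C * e * U ^ m)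
      + C * e * U ^ l * (C * e * U ^ m)
      = 2 * (C * e * U ^ (l + m + 1)) + C ^ 2 * e ^ 2 * U ^ (l + m) := by ring
  rw [this]
  linarith

/-- Summation of a function of `r` that is approximately a power of `log (R/r)`. -/
theorem exists_sum_hH_asymptotic (j : ℕ) :
    ∃ C : ℝ, 0 < C ∧ ∀ H : Finset ℤ, H.card = j + 2 → Admissible H → ∀ m : ℕ, ∀ u : ℝ, 0 ≤ u →
      ∀ (G : ℕ → ℝ) (c K : ℝ), 0 ≤ K →
      (∀ r ∈ sqf ⌊Real.exp u⌋₊, |G r - c * ((u - Real.log r) ^ (m + 1) / ((m + 1).factorial : ℝ))|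
        ≤ K * evar r ^ 2 * (1 + u) ^ m) →
      |singularSeries H * ∑ r ∈ sqf ⌊Real.exp u⌋₊, pf (hH H) r * G r
          - c * (u ^ (j + m + 2) / ((j + m + 2).factorial : ℝ))|
        ≤ C * (|c| + K) * (singularSeries H * beta H) * (1 + u) ^ (j + m + 1) := by
  obtain ⟨C₁, hC₁, h1⟩ := exists_W_hH_asymptotic j
  obtain ⟨C₂, hC₂, h2⟩ := exists_sum_hH_evar_le j
  have hl2 : 0 < Real.log 2 := Real.log_pos (by norm_num)
  refine ⟨C₁ + C₂ * (2 / Real.log 2), by positivity, fun H hk hA m u hu G c K hK hG => ?_⟩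
  obtain ⟨hS, hW⟩ := h1 H hk hA
  have hβ := log_two_div_two_le_beta hk (by omega) hA
  -- The remainder of G contributes an error without β; this inequality supplies the missing factor.
  have hβ1 : 1 ≤ 2 / Real.log 2 * beta H := by
    rw [div_mul_eq_mul_div, le_div_iff₀ hl2]; linarith
  have hβ0 : 0 < beta H := by linarith
  have hW' := hW (m + 1) u hu
  have hh : ∀ r, 0 ≤ pf (hH H) r := pf_nonneg fun p hp => hH_nonneg hk (by omega) hA hp
  set S := singularSeries H
  have e1 : ∑ r ∈ sqf ⌊Real.exp u⌋₊, pf (hH H) r * G r - c * W (sqfun (hH H)) (m + 1) u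
      = ∑ r ∈ sqf ⌊Real.exp u⌋₊, pf (hH H) r *
        (G r - c * ((u - Real.log r) ^ (m + 1) / ((m + 1).factorial : ℝ))) := by
    rw [W_sqfun, mul_sum, ← sum_sub_distrib]
    exact sum_congr rfl fun r _ => by ring
  have b1 : |∑ r ∈ sqf ⌊Real.exp u⌋₊, pf (hH H) r * G r - c * W (sqfun (hH H)) (m + 1) u|
      ≤ K * (1 + u) ^ m * (C₂ * (1 + u) ^ (j + 1)) := by
    rw [e1]
    refine (abs_sum_le_sum_abs _ _).trans ?_
    refine le_trans ?_ (mul_le_mul_of_nonneg_left (h2 H hk hA u hu) (by positivity))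
    rw [mul_sum]
    refine sum_le_sum fun r hr => ?_
    rw [abs_mul, abs_of_nonneg (hh r)]
    exact (mul_le_mul_of_nonneg_left (hG r hr) (hh r)).trans (le_of_eq (by ring))
  have e2 : S * ∑ r ∈ sqf ⌊Real.exp u⌋₊, pf (hH H) r * G r
        - c * (u ^ (j + m + 2) / ((j + m + 2).factorial : ℝ))
      = c * (S * W (sqfun (hH H)) (m + 1) u
          - u ^ (j + 1 + (m + 1)) / ((j + 1 + (m + 1)).factorial : ℝ))
        + S * (∑ r ∈ sqf ⌊Real.exp u⌋₊, pf (hH H) r * G r - c * W (sqfun (hH H)) (m + 1) u) := by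
    rw [show j + 1 + (m + 1) = j + m + 2 by ring]; ring
  rw [e2]
  refine (abs_add_le _ _).trans ?_
  rw [abs_mul, abs_mul, abs_of_pos hS]
  have b2 : S * |∑ r ∈ sqf ⌊Real.exp u⌋₊, pf (hH H) r * G r - c * W (sqfun (hH H)) (m + 1) u|
      ≤ C₂ * (2 / Real.log 2) * K * (S * beta H) * (1 + u) ^ (j + m + 1) := by
    refine (mul_le_mul_of_nonneg_left b1 hS.le).trans ?_
    calc S * (K * (1 + u) ^ m * (C₂ * (1 + u) ^ (j + 1)))
        = C₂ * K * S * (1 + u) ^ (j + m + 1) * 1 := by ring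
      _ ≤ C₂ * K * S * (1 + u) ^ (j + m + 1) * (2 / Real.log 2 * beta H) := by gcongr
      _ = _ := by ring
  have b3 : |c| * |S * W (sqfun (hH H)) (m + 1) u
          - u ^ (j + 1 + (m + 1)) / ((j + 1 + (m + 1)).factorial : ℝ)|
      ≤ C₁ * |c| * (S * beta H) * (1 + u) ^ (j + m + 1) := by
    refine (mul_le_mul_of_nonneg_left hW' (abs_nonneg c)).trans (le_of_eq ?_)
    rw [show j + (m + 1) = j + m + 1 by ring]; ring
  refine (add_le_add b3 b2).trans ?_
  have h3 : 0 ≤ C₁ * K * (S * beta H) * (1 + u) ^ (j + m + 1) := by positivity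
  have h4 : 0 ≤ C₂ * (2 / Real.log 2) * |c| * (S * beta H) * (1 + u) ^ (j + m + 1) := by positivity
  linarith

/-! ### Truncated powers and their averages over primes -/

/-- The truncated power `max(x, 0)^(l+1) / (l+1)!`. -/
def trunc (l : ℕ) (x : ℝ) : ℝ := max x 0 ^ (l + 1) / ((l + 1).factorial : ℝ)

theorem trunc_nonneg (l : ℕ) (x : ℝ) : 0 ≤ trunc l x := by
  unfold trunc; positivity

theorem trunc_of_nonneg (l : ℕ) {x : ℝ} (hx : 0 ≤ x) :
    trunc l x = x ^ (l + 1) / ((l + 1).factorial : ℝ) := by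
  unfold trunc; rw [max_eq_left hx]

theorem trunc_of_nonpos (l : ℕ) {x : ℝ} (hx : x ≤ 0) : trunc l x = 0 := by
  unfold trunc; rw [max_eq_right hx]; simp

theorem trunc_le (l : ℕ) {x U : ℝ} (hU : 0 ≤ U) (hx : x ≤ U) : trunc l x ≤ U ^ (l + 1) := by
  unfold trunc
  refine (div_le_self (by positivity) (by exact_mod_cast Nat.factorial_pos _)).trans ?_
  gcongr
  exact max_le hx hU

theorem abs_trunc_le (l : ℕ) {x U : ℝ} (hU : 0 ≤ U) (hx : x ≤ U) : |trunc l x| ≤ U ^ (l + 1) := by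
  rw [abs_of_nonneg (trunc_nonneg l x)]; exact trunc_le l hU hx

/-- The origin of all binomial coefficients in the main term: a product of two normalized powers is
a binomial multiple of a normalized power. -/
theorem trunc_mul_trunc (l m : ℕ) (x : ℝ) :
    trunc l x * trunc m x = (Nat.choose (l + m + 2) (l + 1) : ℝ) * trunc (l + m + 1) x := by
  have h := Nat.add_choose_mul_factorial_mul_factorial (m + 1) (l + 1)
  have h' : (Nat.choose (l + m + 2) (l + 1) : ℝ) * ((m + 1).factorial : ℝ)
      * ((l + 1).factorial : ℝ) = ((l + m + 1 + 1).factorial : ℝ) := by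
    rw [show m + 1 + (l + 1) = l + m + 2 by ring] at h
    exact_mod_cast h
  have h1 : ((l + 1).factorial : ℝ) ≠ 0 := by positivity
  have h2 : ((m + 1).factorial : ℝ) ≠ 0 := by positivity
  have h3 : (Nat.choose (l + m + 2) (l + 1) : ℝ) ≠ 0 := by
    have : 0 < Nat.choose (l + m + 2) (l + 1) := Nat.choose_pos (by omega)
    positivity
  have h4 : max x 0 ^ (l + 1) * max x 0 ^ (m + 1) = max x 0 ^ (l + m + 1 + 1) := by
    rw [← pow_add]; congr 1; ring
  unfold trunc
  rw [← h', ← h4, div_mul_div_comm]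
  generalize max x 0 ^ (l + 1) * max x 0 ^ (m + 1) = y
  field_simp

theorem one_le_evar (r : ℕ) : 1 ≤ evar r := by
  refine one_le_pf (fun p hp => ?_) r
  have h1 := log_div_sub_one_nonneg hp
  have h2 : (2 : ℝ) ≤ p := by exact_mod_cast hp.two_le
  have h3 : 1 ≤ (p : ℝ) / ((p : ℝ) - 1) := by
    rw [le_div_iff₀ (by linarith)]; linarith
  nlinarith

theorem evar_mul_prime_le {r p : ℕ} (hp : p.Prime) (hpr : ¬ p ∣ r) :
    evar (r * p) ≤ 4 * evar r := by
  have hcop : r.Coprime p := ((Nat.Prime.coprime_iff_not_dvd hp).2 hpr).symm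
  have h2 : (2 : ℝ) ≤ p := by exact_mod_cast hp.two_le
  have h3 : (p : ℝ) / ((p : ℝ) - 1) ≤ 2 := by
    rw [div_le_iff₀ (by linarith)]; linarith
  have h4 : Real.log p / ((p : ℝ) - 1) ≤ 1 := by
    rw [div_le_one (by linarith)]; exact Real.log_le_sub_one_of_pos (by linarith)
  have h5 := log_div_sub_one_nonneg hp
  have h6 := evar_nonneg r
  unfold evar at h6 ⊢
  rw [pf_mul _ hcop, pf_prime _ hp]
  have : (p : ℝ) / ((p : ℝ) - 1) * (1 + Real.log p / ((p : ℝ) - 1)) ≤ 2 * 2 := by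
    have : 0 ≤ (p : ℝ) / ((p : ℝ) - 1) := div_nonneg (by linarith) (by linarith)
    gcongr; linarith
  nlinarith

theorem sum_primeFactors_log_div_le (r : ℕ) :
    ∑ p ∈ r.primeFactors, Real.log p / p ≤ evar r := by
  have h1 : ∑ p ∈ r.primeFactors, Real.log p / p ≤ ∑ p ∈ r.primeFactors, Real.log p / ((p : ℝ) - 1) := by
    refine sum_le_sum fun p hp => ?_
    have hp' := Nat.prime_of_mem_primeFactors hp
    have h2 : (2 : ℝ) ≤ p := by exact_mod_cast hp'.two_le
    exact div_le_div_of_nonneg_left (Real.log_natCast_nonneg p) (by linarith) (by linarith)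
  have h2 := one_add_sum_le_prod (s := r.primeFactors) (g := fun p : ℕ => Real.log p / ((p : ℝ) - 1))
    fun p hp => log_div_sub_one_nonneg (Nat.prime_of_mem_primeFactors hp)
  have h3 : pf (fun p : ℕ => 1 + Real.log p / ((p : ℝ) - 1)) r ≤ evar r := by
    refine pf_le_pf (fun p hp => ?_) (fun p hp => ?_) r
    · linarith [log_div_sub_one_nonneg hp]
    · have h1 := log_div_sub_one_nonneg hp
      have h2 : (2 : ℝ) ≤ p := by exact_mod_cast hp.two_le
      have h3 : 1 ≤ (p : ℝ) / ((p : ℝ) - 1) := by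
        rw [le_div_iff₀ (by linarith)]; linarith
      nlinarith
  have h4 : (∏ i ∈ r.primeFactors, (1 + Real.log i / ((i : ℝ) - 1))) ≤ evar r := h3
  linarith

/-- `log p / p` at primes. -/
def lp (n : ℕ) : ℝ := if n.Prime then Real.log n / n else 0

theorem exists_W_lp_asymptotic :
    ∃ C : ℝ, 0 < C ∧ ∀ m : ℕ, ∀ u : ℝ, 0 ≤ u →
      |W lp m u - u ^ (m + 1) / ((m + 1).factorial : ℝ)| ≤ C * (1 + u) ^ m := by
  obtain ⟨C, hC, h⟩ := exists_mertens
  refine ⟨C, hC, fun m u hu => ?_⟩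
  have := abs_W_sub_le (a := lp) (c := 1) (E := C) (i := 0) (j := 1) hC.le (fun u hu => ?_) m u hu
  · rw [one_mul, zero_add, add_comm 1 m] at this
    exact this
  · have e : W lp 0 u = ∑ p ∈ pr ⌊Real.exp u⌋₊, Real.log p / p := by
      unfold W lp pr
      rw [sum_filter]
      exact sum_congr rfl fun n _ => by simp
    rw [e]
    simpa using h u hu

/-- By Mertens, averaging over p with weight log p/p integrates once and raises the order of the
truncated power by one. The excluded primes p ∣ r cost Σ_{p∣r} log p/p, which is at most `evar r`.
-/
theorem exists_sum_primes_trunc :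
    ∃ C : ℝ, 0 < C ∧ ∀ m : ℕ, ∀ u : ℝ, 0 ≤ u → ∀ r ∈ sqf ⌊Real.exp u⌋₊,
      |∑ p ∈ (pr ⌊Real.exp u⌋₊).filter (fun p => ¬ p ∣ r),
          Real.log p / p * trunc m (u - Real.log r - Real.log p) - trunc (m + 1) (u - Real.log r)|
        ≤ C * evar r * (1 + u) ^ (m + 1) := by
  obtain ⟨C, hC, h⟩ := exists_W_lp_asymptotic
  refine ⟨C + 1, by positivity, fun m u hu r hr => ?_⟩
  obtain ⟨hrs, hru⟩ := mem_sqf_floor_exp.1 hr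
  have hlr : 0 ≤ Real.log r := Real.log_natCast_nonneg r
  set a := u - Real.log r with ha
  have ha0 : 0 ≤ a := by linarith
  have hau : a ≤ u := by linarith
  have e1 : ∑ p ∈ pr ⌊Real.exp u⌋₊, Real.log p / p * trunc m (a - Real.log p) = W lp (m + 1) a := by
    have e2 : W lp (m + 1) a = ∑ p ∈ pr ⌊Real.exp a⌋₊, Real.log p / p * trunc m (a - Real.log p) := by
      unfold W lp
      rw [pr, sum_filter]
      refine sum_congr rfl fun n hn => ?_
      have := (mem_Icc_floor_exp.1 hn).2
      rw [trunc_of_nonneg m (by linarith)]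
      split_ifs <;> simp
    rw [e2]
    symm
    refine sum_subset (fun p hp => ?_) fun p hp hp' => ?_
    · rw [mem_pr_floor_exp] at hp ⊢
      exact ⟨hp.1, hp.2.trans hau⟩
    · rw [mem_pr_floor_exp] at hp hp'
      have : a < Real.log p := by
        by_contra h
        exact hp' ⟨hp.1, not_lt.1 h⟩
      rw [trunc_of_nonpos m (by linarith), mul_zero]
  have b1 : |∑ p ∈ (pr ⌊Real.exp u⌋₊).filter (fun p => ¬ ¬ p ∣ r),
      Real.log p / p * trunc m (a - Real.log p)| ≤ evar r * (1 + u) ^ (m + 1) := by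
    have hnn : ∀ p : ℕ, 0 ≤ Real.log p / p * trunc m (a - Real.log p) := fun p =>
      mul_nonneg (div_nonneg (Real.log_natCast_nonneg p) (Nat.cast_nonneg p)) (trunc_nonneg _ _)
    rw [abs_of_nonneg (sum_nonneg fun p _ => hnn p)]
    calc _ ≤ ∑ p ∈ r.primeFactors, Real.log p / p * trunc m (a - Real.log p) := by
          refine sum_le_sum_of_subset_of_nonneg (fun p hp => ?_) fun p _ _ => hnn p
          obtain ⟨h1, h2⟩ := mem_filter.1 hp
          exact Nat.mem_primeFactors.2 ⟨(mem_pr.1 h1).2, not_not.1 h2, hrs.ne_zero⟩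
      _ ≤ ∑ p ∈ r.primeFactors, Real.log p / p * (1 + u) ^ (m + 1) := by
          refine sum_le_sum fun p hp => ?_
          have h1 : 0 ≤ Real.log p := Real.log_natCast_nonneg p
          have h2 := trunc_le m (x := a - Real.log p) (U := 1 + u) (by linarith) (by linarith)
          gcongr
      _ = (∑ p ∈ r.primeFactors, Real.log p / p) * (1 + u) ^ (m + 1) := (sum_mul _ _ _).symm
      _ ≤ _ := by
          have := sum_primeFactors_log_div_le r
          gcongr
  have b2 := h (m + 1) a ha0
  rw [← e1, ← sum_filter_add_sum_filter_not _ (fun p => ¬ p ∣ r), ← trunc_of_nonneg (m + 1) ha0] at b2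
  have b3 : C * (1 + a) ^ (m + 1) ≤ C * evar r * (1 + u) ^ (m + 1) := by
    have h1 : (1 + a) ^ (m + 1) ≤ (1 + u) ^ (m + 1) := by gcongr
    have h2 := one_le_evar r
    have h3 : 0 ≤ (1 + a) ^ (m + 1) := by positivity
    rw [mul_assoc]
    gcongr
    nlinarith
  rw [abs_le] at b1 b2 ⊢
  constructor <;> linarith [b1.1, b1.2, b2.1, b2.2]

/-- Replace each z_r by its truncated power and multiply; the resulting binomial multiple of a
single power is summed against h. -/
theorem exists_qform_asymptotic (j l₁ l₂ : ℕ) :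
    ∃ C : ℝ, 0 < C ∧ ∀ H : Finset ℤ, H.card = j + 2 → Admissible H → ∀ R : ℝ, 1 ≤ R →
      |singularSeries H * qform (fH H) (wH H) (gH H) R l₁ l₂
          - (Nat.choose (l₁ + l₂ + 2) (l₁ + 1) : ℝ) * (Real.log R ^ (j + 2 + l₁ + l₂ + 1) /
            ((j + 2 + l₁ + l₂ + 1).factorial : ℝ))|
        ≤ C * (singularSeries H * beta H) * (1 + Real.log R) ^ (j + 2 + l₁ + l₂) := by
  obtain ⟨C₁, hC₁, h1⟩ := exists_zvar_asymptotic
  obtain ⟨C₂, hC₂, h2⟩ := exists_sum_hH_asymptotic j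
  set c : ℝ := (Nat.choose (l₁ + l₂ + 2) (l₁ + 1) : ℝ) with hc
  refine ⟨C₂ * (|c| + (2 * C₁ + C₁ ^ 2)), by positivity, fun H hk hA R hR => ?_⟩
  have hν : ∀ p : ℕ, p.Prime → (1 : ℝ) ≤ nuP H p ∧ (nuP H p : ℝ) + 1 ≤ p := fun p hp =>
    ⟨one_le_nuP' hk (by omega) p, nuP_add_one_le hA hp⟩
  have hL : 0 ≤ Real.log R := Real.log_nonneg hR
  have hexp : Real.exp (Real.log R) = R := Real.exp_log (by linarith)
  have key := h2 H hk hA (l₁ + l₂ + 1) (Real.log R) hL (fun r => zvar R l₁ r * zvar R l₂ r) c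
    (2 * C₁ + C₁ ^ 2) (by positivity) ?_
  · rw [hexp, ← qform_gH_eq hν] at key
    rw [show j + 2 + l₁ + l₂ + 1 = j + (l₁ + l₂ + 1) + 2 by ring,
      show j + 2 + l₁ + l₂ = j + (l₁ + l₂ + 1) + 1 by ring]
    exact key
  · intro r hr
    obtain ⟨hrs, hru⟩ := mem_sqf_floor_exp.1 hr
    have hlr : 0 ≤ Real.log r := Real.log_natCast_nonneg r
    rw [← trunc_of_nonneg _ (by linarith), hc, ← trunc_mul_trunc]
    exact abs_mul_sub_mul_le hC₁.le (one_le_evar r) (by linarith) (h1 R hR l₁ r hrs)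
      (abs_trunc_le _ (by linarith) (by linarith)) (h1 R hR l₂ r hrs)
      (abs_trunc_le _ (by linarith) (by linarith))


/-- Since h(p) is O(1/p), the sum of log p/p · h(p) converges, so the part -h(p) of the factor 1 -
h(p) in the cross term is negligible after averaging over p. -/
theorem log_div_mul_hH_le {H : Finset ℤ} {k : ℕ} (hk : H.card = k) (hk2 : 2 ≤ k)
    (hA : Admissible H) {p : ℕ} (hp : p.Prime) :
    Real.log p / p * hH H p ≤ 2 * (k * (k + 1)) * (1 / ((p : ℝ) * Real.sqrt p)) := by
  have h1 := one_div_sub_nuP_le hk hA hp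
  have h2 := nuP_le_card' hk p
  have h3 : (2 : ℝ) ≤ p := by exact_mod_cast hp.two_le
  have h4 := log_le_two_mul_sqrt (x := p) (by linarith)
  have h5 := one_le_nuP' hk hk2 p
  have h6 : 0 ≤ Real.log p := Real.log_natCast_nonneg p
  have hs : 0 < Real.sqrt p := Real.sqrt_pos.2 (by linarith)
  have hss : Real.sqrt p * Real.sqrt p = p := Real.mul_self_sqrt (by linarith)
  have h8 := hH_nonneg hk hk2 hA hp
  have h7 : hH H p ≤ k * (k + 1) * (1 / p) := by
    unfold hH
    calc ((nuP H p : ℝ) - 1) / ((p : ℝ) - nuP H p)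
        = ((nuP H p : ℝ) - 1) * (1 / ((p : ℝ) - nuP H p)) := by ring
      _ ≤ k * (((k : ℝ) + 1) * (1 / p)) := by
          have : 0 ≤ 1 / ((p : ℝ) - nuP H p) := (one_div_pos.2 (sub_nuP_pos hA hp)).le
          gcongr; linarith
      _ = _ := by ring
  calc Real.log p / p * hH H p ≤ 2 * Real.sqrt p / p * (k * (k + 1) * (1 / p)) := by gcongr
    _ = 2 * (k * (k + 1)) * (1 / ((p : ℝ) * Real.sqrt p)) := by
        have : 1 / ((p : ℝ) * Real.sqrt p) = Real.sqrt p / (p * p) := by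
          rw [div_eq_div_iff (by positivity) (by positivity)]
          linear_combination (- (p : ℝ)) * hss
        rw [this]; ring

/-- The summand attached to `r` and `p` in the difference of the forms for `gH` and its
update at `p`. -/
def crossTerm (H : Finset ℤ) (R : ℝ) (l₁ l₂ r p : ℕ) : ℝ :=
  - (zvar R l₁ r * zvar R l₂ (r * p)) - zvar R l₁ (r * p) * zvar R l₂ r
    + (1 - hH H p) * (zvar R l₁ (r * p) * zvar R l₂ (r * p))

/-- Each of the three products is approximated by truncated powers with e = 4·`evar r` as common
majorant at r and rp; three products with (4·evar)² give the 48. The term with h(p) is kept whole as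
an error, one power of log R larger but summable in p. -/
theorem abs_crossTerm_sub_le {H : Finset ℤ} {C R : ℝ} (hC : 0 ≤ C) (hR : 1 ≤ R)
    (hz : ∀ l r : ℕ, Squarefree r → |zvar R l r - trunc l (Real.log R - Real.log r)|
      ≤ C * evar r * (1 + Real.log R) ^ l)
    (l₁ l₂ : ℕ) {r p : ℕ} (hr : Squarefree r) (hp : p.Prime) (hpr : ¬ p ∣ r) (hh : 0 ≤ hH H p) :
    |crossTerm H R l₁ l₂ r p
      - (- (trunc l₁ (Real.log R - Real.log r) * trunc l₂ (Real.log R - Real.log r - Real.log p))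
         - trunc l₁ (Real.log R - Real.log r - Real.log p) * trunc l₂ (Real.log R - Real.log r)
         + trunc l₁ (Real.log R - Real.log r - Real.log p)
           * trunc l₂ (Real.log R - Real.log r - Real.log p))|
      ≤ 48 * (2 * C + C ^ 2) * (evar r ^ 2 * (1 + Real.log R) ^ (l₁ + l₂ + 1))
        + hH H p * (16 * (1 + 2 * C + C ^ 2) * (evar r ^ 2 * (1 + Real.log R) ^ (l₁ + l₂ + 2))) := by
  have hL : 0 ≤ Real.log R := Real.log_nonneg hR
  have hlr : 0 ≤ Real.log r := Real.log_natCast_nonneg r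
  have hlp : 0 ≤ Real.log p := Real.log_natCast_nonneg p
  have hcop : r.Coprime p := ((Nat.Prime.coprime_iff_not_dvd hp).2 hpr).symm
  have hrp : Squarefree (r * p) := (Nat.squarefree_mul hcop).2 ⟨hr, hp.squarefree⟩
  have hlog : Real.log ((r * p : ℕ) : ℝ) = Real.log r + Real.log p := by
    push_cast
    exact Real.log_mul (by exact_mod_cast hr.ne_zero) (by exact_mod_cast hp.ne_zero)
  have he1 := one_le_evar r
  have he4 := evar_mul_prime_le hp hpr
  set U := 1 + Real.log R with hU
  have hU1 : 1 ≤ U := by linarith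
  set a := Real.log R - Real.log r with ha
  set b := a - Real.log p with hb
  set e := 4 * evar r with he
  have z1 : ∀ l, |zvar R l r - trunc l a| ≤ C * e * U ^ l := fun l => by
    refine (hz l r hr).trans ?_
    gcongr; linarith
  have z2 : ∀ l, |zvar R l (r * p) - trunc l b| ≤ C * e * U ^ l := fun l => by
    have := hz l (r * p) hrp
    rw [hlog, ← sub_sub] at this
    refine this.trans ?_
    gcongr
  have t1 : ∀ l, |trunc l a| ≤ U ^ (l + 1) := fun l =>
    abs_trunc_le l (by linarith) (by linarith)
  have t2 : ∀ l, |trunc l b| ≤ U ^ (l + 1) := fun l =>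
    abs_trunc_le l (by linarith) (by linarith)
  have m1 := abs_mul_sub_mul_le hC (by linarith) hU1 (z1 l₁) (t1 l₁) (z2 l₂) (t2 l₂)
  have m2 := abs_mul_sub_mul_le hC (by linarith) hU1 (z2 l₁) (t2 l₁) (z1 l₂) (t1 l₂)
  have m3 := abs_mul_sub_mul_le hC (by linarith) hU1 (z2 l₁) (t2 l₁) (z2 l₂) (t2 l₂)
  have m4 : |zvar R l₁ (r * p) * zvar R l₂ (r * p)|
      ≤ (1 + 2 * C + C ^ 2) * e ^ 2 * U ^ (l₁ + l₂ + 2) := by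
    have h1 : |trunc l₁ b * trunc l₂ b| ≤ 1 * e ^ 2 * U ^ (l₁ + l₂ + 2) := by
      rw [abs_mul]
      have : 1 ≤ e ^ 2 := one_le_pow₀ (by linarith)
      calc |trunc l₁ b| * |trunc l₂ b| ≤ U ^ (l₁ + 1) * U ^ (l₂ + 1) :=
            mul_le_mul (t2 l₁) (t2 l₂) (abs_nonneg _) (by positivity)
        _ = 1 * U ^ (l₁ + l₂ + 2) := by ring
        _ ≤ e ^ 2 * U ^ (l₁ + l₂ + 2) := by gcongr
        _ = _ := by ring
    have h2 : (2 * C + C ^ 2) * e ^ 2 * U ^ (l₁ + l₂ + 1)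
        ≤ (2 * C + C ^ 2) * e ^ 2 * U ^ (l₁ + l₂ + 2) :=
      mul_le_mul_of_nonneg_left (pow_le_pow_right₀ hU1 (by omega)) (by positivity)
    have h3 := abs_add_le (zvar R l₁ (r * p) * zvar R l₂ (r * p) - trunc l₁ b * trunc l₂ b)
      (trunc l₁ b * trunc l₂ b)
    rw [sub_add_cancel] at h3
    linarith
  have m5 := mul_le_mul_of_nonneg_left m4 hh
  have h5 : |hH H p * (zvar R l₁ (r * p) * zvar R l₂ (r * p))|
      = hH H p * |zvar R l₁ (r * p) * zvar R l₂ (r * p)| := by rw [abs_mul, abs_of_nonneg hh]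
  rw [← h5] at m5
  have e2 : e ^ 2 = 16 * evar r ^ 2 := by rw [he]; ring
  rw [e2] at m1 m2 m3 m5
  unfold crossTerm
  rw [abs_le] at m1 m2 m3 m5 ⊢
  constructor <;> linarith [m1.1, m1.2, m2.1, m2.2, m3.1, m3.2, m5.1, m5.2]

/-- After exchanging p and r, Mertens raises by one the truncated power at rp. In -z_r z'_{rp} and
-z_{rp} z'_r this happens before the multiplication, giving the two binomials with ℓ₁+ℓ₂+3; in
z_{rp} z'_{rp} it happens after, giving the one with ℓ₁+ℓ₂+2. Together these are T, and the sum over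
r is then evaluated against h. -/
theorem exists_sum_qform_update_asymptotic (j l₁ l₂ : ℕ) :
    ∃ C : ℝ, 0 < C ∧ ∀ H : Finset ℤ, H.card = j + 2 → Admissible H → ∀ R : ℝ, 1 ≤ R →
      |singularSeries H * ∑ p ∈ pr ⌊R⌋₊, Real.log p / p *
            (qform (fH H) (wH H) (Function.update (gH H) p 1) R l₁ l₂
              - qform (fH H) (wH H) (gH H) R l₁ l₂)
          - T l₁ l₂ * (Real.log R ^ (j + 2 + l₁ + l₂ + 2) /
            ((j + 2 + l₁ + l₂ + 2).factorial : ℝ))|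
        ≤ C * (singularSeries H * beta H) * (1 + Real.log R) ^ (j + 2 + l₁ + l₂ + 1) := by
  obtain ⟨C₁, hC₁, h1⟩ := exists_zvar_asymptotic
  obtain ⟨C₂, hC₂, h2⟩ := exists_sum_hH_asymptotic j
  obtain ⟨C₃, hC₃, h3⟩ := exists_mertens
  obtain ⟨C₄, hC₄, h4⟩ := exists_sum_one_div_mul_sqrt_le
  obtain ⟨C₅, hC₅, h5⟩ := exists_sum_primes_trunc
  set c : ℝ := (Nat.choose (l₁ + l₂ + 2) (l₁ + 1) : ℝ) with hc
  have hc0 : 0 ≤ c := Nat.cast_nonneg _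
  -- The three summands come from approximating the cross term (with Σ log p/p ≪ log R), from its
  -- part with h(p) (with the convergent sum), and from applying Mertens to the three products.
  set K : ℝ := 48 * (2 * C₁ + C₁ ^ 2) * (1 + C₃)
    + 2 * (((j + 2 : ℕ) : ℝ) * (((j + 2 : ℕ) : ℝ) + 1)) * C₄ * (16 * (1 + 2 * C₁ + C₁ ^ 2))
    + (2 + c) * C₅ with hK
  have hK0 : 0 < K := by positivity
  refine ⟨C₂ * (|T l₁ l₂| + K), by positivity, fun H hk hA R hR => ?_⟩
  have hν : ∀ p : ℕ, p.Prime → (1 : ℝ) ≤ nuP H p ∧ (nuP H p : ℝ) + 1 ≤ p := fun p hp =>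
    ⟨one_le_nuP' hk (by omega) p, nuP_add_one_le hA hp⟩
  have hL : 0 ≤ Real.log R := Real.log_nonneg hR
  have hexp : Real.exp (Real.log R) = R := Real.exp_log (by linarith)
  have eG : ∑ p ∈ pr ⌊R⌋₊, Real.log p / p *
            (qform (fH H) (wH H) (Function.update (gH H) p 1) R l₁ l₂
              - qform (fH H) (wH H) (gH H) R l₁ l₂)
      = ∑ r ∈ sqf ⌊R⌋₊, pf (hH H) r * ∑ p ∈ (pr ⌊R⌋₊).filter (fun p => ¬ p ∣ r),
        Real.log p / p * crossTerm H R l₁ l₂ r p := by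
    calc _ = ∑ p ∈ pr ⌊R⌋₊, ∑ r ∈ (sqf ⌊R⌋₊).filter (fun r => ¬ p ∣ r),
          pf (hH H) r * (Real.log p / p * crossTerm H R l₁ l₂ r p) := by
          refine sum_congr rfl fun p hp => ?_
          rw [qform_update_sub hν (mem_pr.1 hp).2, mul_sum]
          exact sum_congr rfl fun r _ => by unfold crossTerm; ring
      _ = ∑ r ∈ sqf ⌊R⌋₊, ∑ p ∈ (pr ⌊R⌋₊).filter (fun p => ¬ p ∣ r),
          pf (hH H) r * (Real.log p / p * crossTerm H R l₁ l₂ r p) := by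
          refine sum_comm' fun p r => ?_
          simp only [mem_filter]
          tauto
      _ = _ := sum_congr rfl fun r _ => (mul_sum _ _ _).symm
  rw [eG]
  have key := h2 H hk hA (l₁ + l₂ + 2) (Real.log R) hL
    (fun r => ∑ p ∈ (pr ⌊R⌋₊).filter (fun p => ¬ p ∣ r), Real.log p / p * crossTerm H R l₁ l₂ r p)
    (T l₁ l₂) K hK0.le ?_
  · rw [hexp] at key
    rw [show j + 2 + l₁ + l₂ + 2 = j + (l₁ + l₂ + 2) + 2 by ring,
      show j + 2 + l₁ + l₂ + 1 = j + (l₁ + l₂ + 2) + 1 by ring]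
    exact key
  · intro r hr
    obtain ⟨hrs, hru⟩ := mem_sqf_floor_exp.1 hr
    have hlr : 0 ≤ Real.log r := Real.log_natCast_nonneg r
    have he1 := one_le_evar r
    have q1 := h5 l₁ (Real.log R) hL r hr
    have q2 := h5 l₂ (Real.log R) hL r hr
    have q3 := h5 (l₁ + l₂ + 1) (Real.log R) hL r hr
    rw [hexp] at q1 q2 q3
    have w1 := (abs_le.1 (h3 (Real.log R) hL)).2
    rw [hexp] at w1
    have hTeq : T l₁ l₂ * trunc (l₁ + l₂ + 2) (Real.log R - Real.log r)
        = - (trunc l₁ (Real.log R - Real.log r) * trunc (l₂ + 1) (Real.log R - Real.log r))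
          - trunc (l₁ + 1) (Real.log R - Real.log r) * trunc l₂ (Real.log R - Real.log r)
          + c * trunc (l₁ + l₂ + 2) (Real.log R - Real.log r) := by
      rw [mul_comm (trunc (l₁ + 1) _), trunc_mul_trunc, trunc_mul_trunc,
        show l₂ + (l₁ + 1) + 2 = l₁ + l₂ + 3 by ring, show l₁ + (l₂ + 1) + 2 = l₁ + l₂ + 3 by ring,
        show l₂ + (l₁ + 1) + 1 = l₁ + l₂ + 2 by ring, show l₁ + (l₂ + 1) + 1 = l₁ + l₂ + 2 by ring]
      unfold T
      ring
    rw [← trunc_of_nonneg _ (by linarith), hTeq]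
    set a := Real.log R - Real.log r with ha
    set U := 1 + Real.log R with hU
    have hU1 : 1 ≤ U := by linarith
    set s := (pr ⌊R⌋₊).filter (fun p => ¬ p ∣ r) with hs
    have hsP : ∀ p ∈ s, p.Prime ∧ ¬ p ∣ r := fun p hp =>
      ⟨(mem_pr.1 (mem_filter.1 hp).1).2, (mem_filter.1 hp).2⟩
    have hw : ∀ p : ℕ, 0 ≤ Real.log p / p := fun p =>
      div_nonneg (Real.log_natCast_nonneg p) (Nat.cast_nonneg p)
    have sw : ∑ p ∈ s, Real.log p / p ≤ (1 + C₃) * U := by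
      have : ∑ p ∈ s, Real.log p / p ≤ ∑ p ∈ pr ⌊R⌋₊, Real.log p / p :=
        sum_le_sum_of_subset_of_nonneg (filter_subset _ _) fun p _ _ => hw p
      nlinarith
    have swh : ∑ p ∈ s, Real.log p / p * hH H p
        ≤ 2 * (((j + 2 : ℕ) : ℝ) * (((j + 2 : ℕ) : ℝ) + 1)) * C₄ := by
      calc _ ≤ ∑ p ∈ s, 2 * (((j + 2 : ℕ) : ℝ) * (((j + 2 : ℕ) : ℝ) + 1)) *
            (1 / ((p : ℝ) * Real.sqrt p)) :=
            sum_le_sum fun p hp => log_div_mul_hH_le hk (by omega) hA (hsP p hp).1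
        _ ≤ _ := by rw [← mul_sum]; exact mul_le_mul_of_nonneg_left (h4 s) (by positivity)
    set V := evar r ^ 2 * U ^ (l₁ + l₂ + 2) with hV
    have hV0 : 0 ≤ V := by positivity
    have g1 : |∑ p ∈ s, Real.log p / p * crossTerm H R l₁ l₂ r p
        - (- (trunc l₁ a * ∑ p ∈ s, Real.log p / p * trunc l₂ (a - Real.log p))
           - (∑ p ∈ s, Real.log p / p * trunc l₁ (a - Real.log p)) * trunc l₂ a
           + c * ∑ p ∈ s, Real.log p / p * trunc (l₁ + l₂ + 1) (a - Real.log p))|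
        ≤ 48 * (2 * C₁ + C₁ ^ 2) * (1 + C₃) * V
          + 2 * (((j + 2 : ℕ) : ℝ) * (((j + 2 : ℕ) : ℝ) + 1)) * C₄
            * (16 * (1 + 2 * C₁ + C₁ ^ 2)) * V := by
      have e1 : ∑ p ∈ s, Real.log p / p * crossTerm H R l₁ l₂ r p
          - (- (trunc l₁ a * ∑ p ∈ s, Real.log p / p * trunc l₂ (a - Real.log p))
           - (∑ p ∈ s, Real.log p / p * trunc l₁ (a - Real.log p)) * trunc l₂ a
           + c * ∑ p ∈ s, Real.log p / p * trunc (l₁ + l₂ + 1) (a - Real.log p))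
          = ∑ p ∈ s, Real.log p / p * (crossTerm H R l₁ l₂ r p -
            (- (trunc l₁ a * trunc l₂ (a - Real.log p)) - trunc l₁ (a - Real.log p) * trunc l₂ a
              + trunc l₁ (a - Real.log p) * trunc l₂ (a - Real.log p))) := by
        rw [mul_sum, sum_mul, mul_sum, ← sum_neg_distrib, ← sum_sub_distrib, ← sum_add_distrib,
          ← sum_sub_distrib]
        refine sum_congr rfl fun p _ => ?_
        rw [trunc_mul_trunc l₁ l₂ (a - Real.log p)]
        ring
      rw [e1]
      refine (abs_sum_le_sum_abs _ _).trans ?_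
      have e2 : ∀ p ∈ s, |Real.log p / p * (crossTerm H R l₁ l₂ r p -
            (- (trunc l₁ a * trunc l₂ (a - Real.log p)) - trunc l₁ (a - Real.log p) * trunc l₂ a
              + trunc l₁ (a - Real.log p) * trunc l₂ (a - Real.log p)))|
          ≤ Real.log p / p * (48 * (2 * C₁ + C₁ ^ 2) * (evar r ^ 2 * U ^ (l₁ + l₂ + 1)))
            + Real.log p / p * hH H p * (16 * (1 + 2 * C₁ + C₁ ^ 2) * V) := by
        intro p hp
        obtain ⟨hp1, hp2⟩ := hsP p hp
        rw [abs_mul, abs_of_nonneg (hw p)]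
        have := abs_crossTerm_sub_le hC₁.le hR (fun l r hr => h1 R hR l r hr) l₁ l₂ hrs hp1 hp2
          (hH_nonneg hk (by omega) hA hp1)
        refine (mul_le_mul_of_nonneg_left this (hw p)).trans (le_of_eq ?_)
        ring
      refine (sum_le_sum e2).trans ?_
      rw [sum_add_distrib, ← sum_mul, ← sum_mul]
      have f1 : (∑ p ∈ s, Real.log p / p) *
          (48 * (2 * C₁ + C₁ ^ 2) * (evar r ^ 2 * U ^ (l₁ + l₂ + 1)))
          ≤ (1 + C₃) * U * (48 * (2 * C₁ + C₁ ^ 2) * (evar r ^ 2 * U ^ (l₁ + l₂ + 1))) :=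
        mul_le_mul_of_nonneg_right sw (by positivity)
      have f2 : (∑ p ∈ s, Real.log p / p * hH H p) * (16 * (1 + 2 * C₁ + C₁ ^ 2) * V)
          ≤ 2 * (((j + 2 : ℕ) : ℝ) * (((j + 2 : ℕ) : ℝ) + 1)) * C₄ *
            (16 * (1 + 2 * C₁ + C₁ ^ 2) * V) :=
        mul_le_mul_of_nonneg_right swh (by positivity)
      refine (add_le_add f1 f2).trans (le_of_eq ?_)
      rw [hV]; ring
    have hT1 : |trunc l₁ a| ≤ U ^ (l₁ + 1) := abs_trunc_le l₁ (by linarith) (by linarith)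
    have hT2 : |trunc l₂ a| ≤ U ^ (l₂ + 1) := abs_trunc_le l₂ (by linarith) (by linarith)
    have hee : evar r ≤ evar r ^ 2 := by nlinarith
    have hVe : evar r * U ^ (l₁ + l₂ + 2) ≤ V := by rw [hV]; gcongr
    have g2 : |trunc l₁ a * (∑ p ∈ s, Real.log p / p * trunc l₂ (a - Real.log p)
        - trunc (l₂ + 1) a)| ≤ C₅ * V := by
      rw [abs_mul]
      calc _ ≤ U ^ (l₁ + 1) * (C₅ * evar r * U ^ (l₂ + 1)) :=
            mul_le_mul hT1 q2 (abs_nonneg _) (by positivity)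
        _ = C₅ * (evar r * U ^ (l₁ + l₂ + 2)) := by ring
        _ ≤ _ := by gcongr
    have g3 : |(∑ p ∈ s, Real.log p / p * trunc l₁ (a - Real.log p) - trunc (l₁ + 1) a)
        * trunc l₂ a| ≤ C₅ * V := by
      rw [abs_mul]
      calc _ ≤ (C₅ * evar r * U ^ (l₁ + 1)) * U ^ (l₂ + 1) :=
            mul_le_mul q1 hT2 (abs_nonneg _) (by positivity)
        _ = C₅ * (evar r * U ^ (l₁ + l₂ + 2)) := by ring
        _ ≤ _ := by gcongr
    have g4 : |c * (∑ p ∈ s, Real.log p / p * trunc (l₁ + l₂ + 1) (a - Real.log p)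
        - trunc (l₁ + l₂ + 2) a)| ≤ c * C₅ * V := by
      rw [abs_mul, abs_of_nonneg hc0]
      calc _ ≤ c * (C₅ * evar r * U ^ (l₁ + l₂ + 1 + 1)) := by gcongr
        _ = c * C₅ * (evar r * U ^ (l₁ + l₂ + 2)) := by ring
        _ ≤ _ := by gcongr
    have hfin : K * evar r ^ 2 * U ^ (l₁ + l₂ + 2)
        = 48 * (2 * C₁ + C₁ ^ 2) * (1 + C₃) * V
          + 2 * (((j + 2 : ℕ) : ℝ) * (((j + 2 : ℕ) : ℝ) + 1)) * C₄
            * (16 * (1 + 2 * C₁ + C₁ ^ 2)) * V + C₅ * V + C₅ * V + c * C₅ * V := by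
      rw [hK, hV]; ring
    rw [hfin]
    rw [abs_le] at g1 g2 g3 g4 ⊢
    constructor <;> linarith [g1.1, g1.2, g2.1, g2.2, g3.1, g3.2, g4.1, g4.2]


/-! ### The sieve weights in terms of the forms -/

theorem eq_pf_of_multiplicative {φ : ℕ → ℝ} (h1 : φ 1 = 1)
    (hm : ∀ m n : ℕ, m.Coprime n → φ (m * n) = φ m * φ n) {n : ℕ} (hn : Squarefree n) :
    φ n = pf φ n := by
  rw [Nat.multiplicative_factorization φ hm h1 hn.ne_zero, Finsupp.prod, Nat.support_factorization]
  refine prod_congr rfl fun p hp => ?_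
  have h2 : n.factorization p = 1 := by
    have h3 := (Nat.squarefree_iff_factorization_le_one hn.ne_zero).1 hn p
    have h4 := (Nat.prime_of_mem_primeFactors hp).factorization_pos_of_dvd hn.ne_zero
      (Nat.dvd_of_mem_primeFactors hp)
    omega
  rw [h2, pow_one]

theorem nu_mul (H : Finset ℤ) {m n : ℕ} (h : m.Coprime n) : nu H (m * n) = nu H m * nu H n := by
  unfold nu
  rw [← Nat.card_prod]
  let e := ZMod.chineseRemainder h
  have key : ∀ a : ZMod (m * n), ∏ x ∈ H, (a + (x : ZMod (m * n))) = 0 ↔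
      ∏ x ∈ H, ((e a).1 + (x : ZMod m)) = 0 ∧ ∏ x ∈ H, ((e a).2 + (x : ZMod n)) = 0 := by
    intro a
    rw [← e.map_eq_zero_iff, map_prod, Prod.ext_iff, Prod.fst_prod, Prod.snd_prod]
    simp
  refine Nat.card_congr ((e.toEquiv.subtypeEquiv (q := fun b : ZMod m × ZMod n =>
    ∏ x ∈ H, (b.1 + (x : ZMod m)) = 0 ∧ ∏ x ∈ H, (b.2 + (x : ZMod n)) = 0) key).trans ?_)
  exact Equiv.subtypeProdEquivProd (p := fun a : ZMod m => ∏ x ∈ H, (a + (x : ZMod m)) = 0)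
    (q := fun a : ZMod n => ∏ x ∈ H, (a + (x : ZMod n)) = 0)

theorem nu_one (H : Finset ℤ) : nu H 1 = 1 := by
  unfold nu
  have : ∀ a : ZMod 1, ∏ x ∈ H, (a + (x : ZMod 1)) = 0 := fun a => Subsingleton.elim _ _
  rw [Nat.card_eq_one_iff_unique]
  exact ⟨⟨fun a b => Subtype.ext (Subsingleton.elim _ _)⟩, ⟨⟨0, this 0⟩⟩⟩

theorem f_eq_pf (H : Finset ℤ) {d : ℕ} (hd : Squarefree d) : f H d = pf (fH H) d := by
  have h1 : f H d = pf (fun n => (n : ℝ) / nu H n) d := by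
    refine eq_pf_of_multiplicative (φ := fun n => (n : ℝ) / nu H n) ?_ ?_ hd
    · simp [nu_one]
    · intro m n h
      simp only [nu_mul H h]
      push_cast
      exact (div_mul_div_comm _ _ _ _).symm
  rw [h1]
  refine pf_congr fun p hp _ => ?_
  unfold fH
  rw [nu_prime H hp]

theorem f1_eq_pf (H : Finset ℤ) {d : ℕ} (hd : Squarefree d) :
    f1 H d = pf (fun p => fH H p - 1) d := by
  unfold f1
  rw [ArithmeticFunction.mul_apply, Nat.sum_divisorsAntidiagonal
    (f := fun i j => f H i * ((ArithmeticFunction.moebius : ArithmeticFunction ℤ) :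
      ArithmeticFunction ℝ) j)]
  have := sum_divisors_pf_mul_pf (fH H) (fun _ => -1) hd
  simp only [← sub_eq_add_neg] at this
  rw [← this]
  refine sum_congr rfl fun i hi => ?_
  have hi' := Nat.dvd_of_mem_divisors hi
  rw [f_eq_pf H (hd.squarefree_of_dvd hi'), ← moebius_eq_pf
    (hd.squarefree_of_dvd (Nat.div_dvd_of_dvd hi')), ArithmeticFunction.intCoe_apply]

section
variable {H : Finset ℤ}

theorem one_div_f1_eq (hν : ∀ p : ℕ, p.Prime → (1 : ℝ) ≤ nuP H p ∧ (nuP H p : ℝ) + 1 ≤ p)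
    {d : ℕ} (hd : Squarefree d) : 1 / f1 H d = pf (wH H) d := by
  rw [f1_eq_pf H hd]
  unfold pf
  rw [one_div, ← prod_inv_distrib]
  refine prod_congr rfl fun p hp => ?_
  obtain ⟨h1, h2⟩ := hν p (Nat.prime_of_mem_primeFactors hp)
  have h3 : (p : ℝ) - nuP H p ≠ 0 := by linarith
  have h5 : (nuP H p : ℝ) ≠ 0 := by linarith
  unfold fH wH
  rw [div_sub_one h5, inv_div]

theorem lam_eq_zero_of_not_squarefree (R : ℝ) (H : Finset ℤ) (ℓ : ℕ) {d : ℕ} (hd : ¬ Squarefree d) :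
    lam R H ℓ d = 0 := by
  unfold lam
  rw [ArithmeticFunction.moebius_eq_zero_of_not_squarefree hd]
  simp

/-- Substitute t = rd: coprimality of r and d gives w(t) = w(r)w(d), and f(d)/f₁(d) = F(d)w(d), so
the prescribed coefficients are 𝔖 times a linear form in the `Y` values, ready for diagonalization.
-/
theorem lam_eq (hν : ∀ p : ℕ, p.Prime → (1 : ℝ) ≤ nuP H p ∧ (nuP H p : ℝ) + 1 ≤ p)
    {R : ℝ} (hR : 1 ≤ R) (ℓ : ℕ) {d : ℕ} (hd : Squarefree d) :
    lam R H ℓ d = singularSeries H * lamForm (fH H) (wH H) R ℓ d := by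
  have hd0 : 0 < d := Nat.pos_of_ne_zero hd.ne_zero
  have hd0' : (0 : ℝ) < d := by exact_mod_cast hd0
  have hd1 : (1 : ℝ) ≤ d := by exact_mod_cast hd0
  have e1 : ∑ r ∈ Icc 1 ⌊R⌋₊ with (((r : ℕ) : ℝ) < R / (d : ℝ) ∧ Nat.Coprime r d),
        (ArithmeticFunction.moebius r : ℝ) ^ 2 / f1 H r * Real.log (R / ((r : ℝ) * (d : ℝ))) ^ ℓ
      = ∑ r ∈ (sqf ⌊R⌋₊).filter (fun r : ℕ => (r : ℝ) < R / d ∧ Nat.Coprime r d),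
        pf (wH H) r * Real.log (R / ((r : ℝ) * (d : ℝ))) ^ ℓ := by
    symm
    have : ∀ r ∈ (sqf ⌊R⌋₊).filter (fun r : ℕ => (r : ℝ) < R / d ∧ Nat.Coprime r d),
        pf (wH H) r * Real.log (R / ((r : ℝ) * (d : ℝ))) ^ ℓ
          = (ArithmeticFunction.moebius r : ℝ) ^ 2 / f1 H r
            * Real.log (R / ((r : ℝ) * (d : ℝ))) ^ ℓ := by
      intro r hr
      have hrs := (mem_sqf.1 (mem_filter.1 hr).1).2
      have : (ArithmeticFunction.moebius r : ℝ) ^ 2 = 1 := by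
        have := ArithmeticFunction.moebius_sq_eq_one_of_squarefree hrs
        exact_mod_cast this
      rw [this, one_div_f1_eq hν hrs]
    rw [sum_congr rfl this]
    refine sum_subset (fun r hr => ?_) fun r hr hr' => ?_
    · obtain ⟨h1, h2⟩ := mem_filter.1 hr
      refine mem_filter.2 ⟨?_, h2⟩
      exact (mem_filter.1 h1).1
    · obtain ⟨h1, h2⟩ := mem_filter.1 hr
      have : ¬ Squarefree r := fun h =>
        hr' (mem_filter.2 ⟨mem_sqf.2 ⟨(mem_Icc.1 h1).2, h⟩, h2⟩)
      rw [ArithmeticFunction.moebius_eq_zero_of_not_squarefree this]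
      simp
  have e2 : ∑ t ∈ (sqf ⌊R⌋₊).filter (fun t => d ∣ t), pf (wH H) t * Y R ℓ t
      = pf (wH H) d / (ℓ.factorial : ℝ) *
        ∑ r ∈ (sqf ⌊R⌋₊).filter (fun r : ℕ => (r : ℝ) < R / d ∧ Nat.Coprime r d),
        pf (wH H) r * Real.log (R / ((r : ℝ) * (d : ℝ))) ^ ℓ := by
    have e3 : ∑ t ∈ (sqf ⌊R⌋₊).filter (fun t => d ∣ t), pf (wH H) t * Y R ℓ t
        = ∑ t ∈ (sqf ⌊R⌋₊).filter (fun t => d ∣ t ∧ (t : ℝ) < R), pf (wH H) t * Y R ℓ t := by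
      symm
      refine sum_subset (fun t ht => ?_) fun t ht ht' => ?_
      · obtain ⟨h1, h2⟩ := mem_filter.1 ht
        exact mem_filter.2 ⟨h1, h2.1⟩
      · obtain ⟨h1, h2⟩ := mem_filter.1 ht
        have : ¬ (t : ℝ) < R := fun h => ht' (mem_filter.2 ⟨h1, h2, h⟩)
        unfold Y
        rw [if_neg this, mul_zero]
    rw [e3, mul_sum]
    refine sum_bij' (fun t _ => t / d) (fun r _ => r * d) ?_ ?_ ?_ ?_ ?_
    · intro t ht
      obtain ⟨h1, h2, h3⟩ := mem_filter.1 ht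
      obtain ⟨h4, h5⟩ := mem_sqf.1 h1
      rw [mem_filter]
      refine ⟨mem_sqf.2 ⟨(Nat.div_le_self t d).trans h4,
        h5.squarefree_of_dvd (Nat.div_dvd_of_dvd h2)⟩, ?_, (coprime_div_of_squarefree h5 h2).symm⟩
      rw [Nat.cast_div h2 hd0'.ne']
      exact div_lt_div_of_pos_right h3 hd0'
    · intro r hr
      obtain ⟨h1, h2, h3⟩ := mem_filter.1 hr
      obtain ⟨h4, h5⟩ := mem_sqf.1 h1
      have h6 : (r : ℝ) * d < R := (lt_div_iff₀ hd0').1 h2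
      rw [mem_filter]
      refine ⟨mem_sqf.2 ⟨?_, (Nat.squarefree_mul h3).2 ⟨h5, hd⟩⟩, dvd_mul_left d r, ?_⟩
      · exact Nat.le_floor (by push_cast; exact h6.le)
      · push_cast; exact h6
    · intro t ht
      exact Nat.div_mul_cancel (mem_filter.1 ht).2.1
    · intro r _
      exact Nat.mul_div_cancel r hd0
    · intro t ht
      obtain ⟨h1, h2, h3⟩ := mem_filter.1 ht
      obtain ⟨h4, h5⟩ := mem_sqf.1 h1
      have ht0 : (t : ℝ) ≠ 0 := by exact_mod_cast h5.ne_zero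
      unfold Y
      rw [if_pos h3, pf_div (wH H) h5 h2, Nat.cast_div h2 hd0'.ne', div_mul_cancel₀ _ hd0'.ne',
        Real.log_div (by linarith) ht0]
      ring
  have hμ := moebius_eq_pf hd
  unfold lam lamForm
  rw [e1, e2, f_eq_pf H hd, div_eq_mul_one_div, one_div_f1_eq hν hd, hμ]
  have h4 : pf (fun p => - fH H p) d = pf (fun _ => -1) d * pf (fH H) d := by
    rw [← pf_mul_fun]
    exact pf_congr fun p _ _ => by ring
  rw [h4]
  ring

theorem LambdaR_eq (hν : ∀ p : ℕ, p.Prime → (1 : ℝ) ≤ nuP H p ∧ (nuP H p : ℝ) + 1 ≤ p)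
    {R : ℝ} (hR : 1 ≤ R) (n : ℤ) (ℓ : ℕ) :
    LambdaR R n H ℓ = singularSeries H *
      ∑ d ∈ sqf ⌊R⌋₊, if (d : ℤ) ∣ P n H then lamForm (fH H) (wH H) R ℓ d else 0 := by
  unfold LambdaR
  rw [sum_filter, mul_sum]
  unfold sqf
  rw [sum_filter]
  refine sum_congr rfl fun d _ => ?_
  by_cases h : Squarefree d
  · rw [if_pos h, lam_eq hν hR ℓ h, mul_ite, mul_zero]
  · rw [if_neg h, lam_eq_zero_of_not_squarefree R H ℓ h, ite_self]

theorem sieveSum_eq (hν : ∀ p : ℕ, p.Prime → (1 : ℝ) ≤ nuP H p ∧ (nuP H p : ℝ) + 1 ≤ p)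
    {R : ℝ} (hR : 1 ≤ R) (N : ℝ) (h₀ : ℤ) (ℓ₁ ℓ₂ : ℕ) :
    sieveSum N R H h₀ ℓ₁ ℓ₂ = singularSeries H ^ 2 * ∑ d ∈ sqf ⌊R⌋₊, ∑ e ∈ sqf ⌊R⌋₊,
      lamForm (fH H) (wH H) R ℓ₁ d * lamForm (fH H) (wH H) R ℓ₂ e *
        ∑ n ∈ (Ioc ⌊N⌋₊ ⌊2 * N⌋₊).filter (fun n : ℕ => ((Nat.lcm d e : ℕ) : ℤ) ∣ P (n : ℤ) H),
          varpi2 ((n : ℤ) + h₀).toNat := by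
  unfold sieveSum
  have e1 : ∀ n : ℕ, varpi2 ((n : ℤ) + h₀).toNat * LambdaR R n H ℓ₁ * LambdaR R n H ℓ₂
      = singularSeries H ^ 2 * ∑ d ∈ sqf ⌊R⌋₊, ∑ e ∈ sqf ⌊R⌋₊,
        lamForm (fH H) (wH H) R ℓ₁ d * lamForm (fH H) (wH H) R ℓ₂ e *
        if ((Nat.lcm d e : ℕ) : ℤ) ∣ P (n : ℤ) H then varpi2 ((n : ℤ) + h₀).toNat else 0 := by
    intro n
    rw [LambdaR_eq hν hR, LambdaR_eq hν hR]
    have e2 : (∑ d ∈ sqf ⌊R⌋₊, if (d : ℤ) ∣ P n H then lamForm (fH H) (wH H) R ℓ₁ d else 0) *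
        (∑ e ∈ sqf ⌊R⌋₊, if (e : ℤ) ∣ P n H then lamForm (fH H) (wH H) R ℓ₂ e else 0)
        * varpi2 ((n : ℤ) + h₀).toNat
        = ∑ d ∈ sqf ⌊R⌋₊, ∑ e ∈ sqf ⌊R⌋₊,
        lamForm (fH H) (wH H) R ℓ₁ d * lamForm (fH H) (wH H) R ℓ₂ e *
        if ((Nat.lcm d e : ℕ) : ℤ) ∣ P (n : ℤ) H then varpi2 ((n : ℤ) + h₀).toNat else 0 := by
      rw [sum_mul_sum, sum_mul]
      refine sum_congr rfl fun d _ => ?_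
      rw [sum_mul]
      refine sum_congr rfl fun e _ => ?_
      have hiff : ((Nat.lcm d e : ℕ) : ℤ) ∣ P (n : ℤ) H ↔ (d : ℤ) ∣ P n H ∧ (e : ℤ) ∣ P n H := by
        rw [Int.natCast_dvd, Int.natCast_dvd, Int.natCast_dvd, Nat.lcm_dvd_iff]
      by_cases h1 : (d : ℤ) ∣ P n H <;> by_cases h2 : (e : ℤ) ∣ P n H <;> simp [hiff, h1, h2]
    rw [← e2]
    ring
  simp_rw [e1]
  rw [← mul_sum, sum_comm]
  congr 1
  refine sum_congr rfl fun d _ => ?_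
  rw [sum_comm]
  refine sum_congr rfl fun e _ => ?_
  rw [sum_filter, mul_sum]

/-- Removing p from D is the same as giving g the local value 1 at p, and that has no effect when p
∤ D. Sums over the primes of [d,e] thus become sums over all primes up to R of complete quadratic
forms. -/
theorem pf_update_eq (g : ℕ → ℝ) {D p : ℕ} (hD : Squarefree D) (hp : p.Prime) :
    pf (Function.update g p 1) D = if p ∣ D then pf g (D / p) else pf g D := by
  split_ifs with h
  · rw [pf_div _ hD h, pf_prime _ hp, Function.update_self, one_mul]
    refine pf_congr fun q hq hqD => ?_
    have hqp : q ≠ p := by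
      rintro rfl
      exact hq.one_lt.ne' (Nat.eq_one_of_dvd_coprimes (coprime_div_of_squarefree hD h) dvd_rfl hqD)
    rw [Function.update_of_ne hqp]
  · refine pf_congr fun q hq hqD => ?_
    have hqp : q ≠ p := by rintro rfl; exact h hqD
    rw [Function.update_of_ne hqp]

theorem sum_primeFactors_eq_sum_update (g : ℕ → ℝ) {M D : ℕ} (hD : Squarefree D)
    (hM : ∀ p ∈ D.primeFactors, p ≤ M) :
    ∑ p ∈ D.primeFactors, Real.log p / p * (pf g (D / p) - pf g D)
      = ∑ p ∈ pr M, Real.log p / p * (pf (Function.update g p 1) D - pf g D) := by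
  have e1 : ∀ p ∈ pr M, Real.log p / p * (pf (Function.update g p 1) D - pf g D)
      = if p ∣ D then Real.log p / p * (pf g (D / p) - pf g D) else 0 := by
    intro p hp
    rw [pf_update_eq g hD (mem_pr.1 hp).2]
    split_ifs <;> simp
  rw [sum_congr rfl e1, ← sum_filter]
  refine sum_congr ?_ fun _ _ => rfl
  ext p
  rw [mem_filter, mem_pr, Nat.mem_primeFactors]
  constructor
  · intro h
    exact ⟨⟨hM p (Nat.mem_primeFactors.2 h), h.1⟩, h.2.1⟩
  · rintro ⟨⟨_, h1⟩, h2⟩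
    exact ⟨h1, h2, hD.ne_zero⟩

theorem le_of_mem_primeFactors_lcm {M d e p : ℕ} (hd : d ∈ sqf M) (he : e ∈ sqf M)
    (hp : p ∈ (Nat.lcm d e).primeFactors) : p ≤ M := by
  obtain ⟨h1, h2, _⟩ := Nat.mem_primeFactors.1 hp
  obtain ⟨hd1, hd2⟩ := mem_sqf.1 hd
  obtain ⟨he1, he2⟩ := mem_sqf.1 he
  rcases (Nat.Prime.dvd_mul h1).1 (h2.trans (Nat.lcm_dvd_mul d e)) with h | h
  · exact (Nat.le_of_dvd (Nat.pos_of_ne_zero hd2.ne_zero) h).trans hd1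
  · exact (Nat.le_of_dvd (Nat.pos_of_ne_zero he2.ne_zero) h).trans he1

theorem sum_sum_lamForm_primeFactors (F w g : ℕ → ℝ) (R : ℝ) (ℓ₁ ℓ₂ : ℕ) :
    ∑ d ∈ sqf ⌊R⌋₊, ∑ e ∈ sqf ⌊R⌋₊, lamForm F w R ℓ₁ d * lamForm F w R ℓ₂ e *
        ∑ p ∈ (Nat.lcm d e).primeFactors,
          Real.log p / p * (pf g (Nat.lcm d e / p) - pf g (Nat.lcm d e))
      = ∑ p ∈ pr ⌊R⌋₊, Real.log p / p *
        (qform F w (Function.update g p 1) R ℓ₁ ℓ₂ - qform F w g R ℓ₁ ℓ₂) := by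
  have e1 : ∀ p : ℕ, Real.log p / p *
        (qform F w (Function.update g p 1) R ℓ₁ ℓ₂ - qform F w g R ℓ₁ ℓ₂)
      = ∑ d ∈ sqf ⌊R⌋₊, ∑ e ∈ sqf ⌊R⌋₊, lamForm F w R ℓ₁ d * lamForm F w R ℓ₂ e *
        (Real.log p / p * (pf (Function.update g p 1) (Nat.lcm d e) - pf g (Nat.lcm d e))) := by
    intro p
    unfold qform
    rw [← sum_sub_distrib, mul_sum]
    refine sum_congr rfl fun d _ => ?_
    rw [← sum_sub_distrib, mul_sum]
    exact sum_congr rfl fun e _ => by ring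
  simp_rw [e1]
  rw [sum_comm (s := pr ⌊R⌋₊)]
  refine sum_congr rfl fun d hd => ?_
  rw [sum_comm (s := pr ⌊R⌋₊)]
  refine sum_congr rfl fun e he => ?_
  rw [sum_primeFactors_eq_sum_update g (squarefree_lcm (mem_sqf.1 hd).2 (mem_sqf.1 he).2)
    (fun p hp => le_of_mem_primeFactors_lcm hd he hp), mul_sum]

end

/-- A crude bound for use in error terms only: F·w = p/(p - ν_p) ≤ k + 1 at each prime of d, and the
remaining sum of w has dimension k. -/
theorem exists_abs_lamForm_le (k : ℕ) (hk2 : 2 ≤ k) :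
    ∃ C : ℝ, 0 < C ∧ ∀ H : Finset ℤ, H.card = k → Admissible H → ∀ R : ℝ, 1 ≤ R → ∀ ℓ d : ℕ,
      |lamForm (fH H) (wH H) R ℓ d| ≤ C * (1 + Real.log R) ^ (k + ℓ) * pf (fun _ => (k : ℝ) + 1) d := by
  obtain ⟨C, hC, h⟩ := exists_sum_pf_le k (k * k * (k + 1)) (by positivity)
  refine ⟨C, hC, fun H hk hA R hR ℓ d => ?_⟩
  have hL : 0 ≤ Real.log R := Real.log_nonneg hR
  have hexp : Real.exp (Real.log R) = R := Real.exp_log (by linarith)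
  have hw0 : ∀ p : ℕ, p.Prime → 0 ≤ wH H p := fun p hp =>
    div_nonneg (Nat.cast_nonneg _) (sub_nuP_pos hA hp).le
  have hw1 : ∀ p : ℕ, p.Prime →
      wH H p ≤ (k : ℝ) / p + k * k * (k + 1) * (1 / ((p : ℝ) * Real.sqrt p)) := by
    intro p hp
    have h1 := one_div_sub_nuP_le hk hA hp
    have h2 := nuP_le_card' hk p
    have h3 := sub_nuP_pos hA hp
    have h4 : (0 : ℝ) < p := by exact_mod_cast hp.pos
    have h5 := one_div_sq_le hp
    have e : wH H p = (nuP H p : ℝ) / p + nuP H p * nuP H p * (1 / p) * (1 / ((p : ℝ) - nuP H p)) := by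
      unfold wH
      field_simp
      ring
    have h6 : 0 ≤ 1 / ((p : ℝ) - nuP H p) := (one_div_pos.2 h3).le
    rw [e]
    calc _ ≤ (k : ℝ) / p + k * k * (1 / p) * ((k + 1) * (1 / p)) := by gcongr
      _ = (k : ℝ) / p + k * k * (k + 1) * (1 / ((p : ℝ) * p)) := by
          field_simp
      _ ≤ _ := by gcongr
  have hS := h (wH H) hw0 hw1 (Real.log R) hL
  rw [hexp] at hS
  have hY : ∀ t ∈ sqf ⌊R⌋₊, 0 ≤ Y R ℓ t ∧ Y R ℓ t ≤ (1 + Real.log R) ^ ℓ := by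
    intro t ht
    have h1 : 0 ≤ Real.log t := Real.log_natCast_nonneg t
    unfold Y
    split_ifs with h2
    · have ht0 : (0 : ℝ) < t := by exact_mod_cast Nat.pos_of_ne_zero (mem_sqf.1 ht).2.ne_zero
      have h3 : Real.log t ≤ Real.log R := Real.log_le_log ht0 h2.le
      have h4 : 0 ≤ Real.log R - Real.log t := by linarith
      refine ⟨by positivity, ?_⟩
      refine (div_le_self (by positivity) (by exact_mod_cast Nat.factorial_pos _)).trans ?_
      gcongr
      linarith
    · exact ⟨le_rfl, by positivity⟩
  have hF : ∀ p : ℕ, p.Prime → 0 ≤ fH H p * wH H p ∧ fH H p * wH H p ≤ k + 1 := by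
    intro p hp
    have h3 := sub_nuP_pos hA hp
    have h4 := le_mul_sub_nuP hk hA hp
    have h5 := one_le_nuP' hk hk2 p
    have e : fH H p * wH H p = (p : ℝ) / ((p : ℝ) - nuP H p) := by
      unfold fH wH
      have : (nuP H p : ℝ) ≠ 0 := by linarith
      field_simp
    rw [e]
    exact ⟨div_nonneg (Nat.cast_nonneg p) h3.le, (div_le_iff₀ h3).2 h4⟩
  have hpw : ∀ t, 0 ≤ pf (wH H) t := pf_nonneg hw0
  unfold lamForm
  have e1 : pf (fun p => - fH H p) d * ∑ t ∈ (sqf ⌊R⌋₊).filter (fun t => d ∣ t), pf (wH H) t * Y R ℓ t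
      = pf (fun _ => -1) d * (pf (fun p => fH H p * wH H p) d *
        ∑ t ∈ (sqf ⌊R⌋₊).filter (fun t => d ∣ t), pf (wH H) (t / d) * Y R ℓ t) := by
    have h4 : pf (fun p => - fH H p) d = pf (fun _ => -1) d * pf (fH H) d := by
      rw [← pf_mul_fun]
      exact pf_congr fun p _ _ => by ring
    rw [h4, pf_mul_fun, mul_assoc, mul_assoc, mul_sum (a := pf (wH H) d)]
    congr 2
    refine sum_congr rfl fun t ht => ?_
    obtain ⟨h1, h2⟩ := mem_filter.1 ht
    rw [pf_div (wH H) (mem_sqf.1 h1).2 h2]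
    ring
  have h1 : |pf (fun _ => -1) d| = 1 := by
    unfold pf
    rw [abs_prod]
    simp
  have h2 : ∑ t ∈ (sqf ⌊R⌋₊).filter (fun t => d ∣ t), pf (wH H) (t / d) * Y R ℓ t
      ≤ C * (1 + Real.log R) ^ k * (1 + Real.log R) ^ ℓ := by
    calc _ ≤ ∑ t ∈ (sqf ⌊R⌋₊).filter (fun t => d ∣ t), pf (wH H) (t / d) * (1 + Real.log R) ^ ℓ :=
          sum_le_sum fun t ht => mul_le_mul_of_nonneg_left (hY t (mem_filter.1 ht).1).2 (hpw _)
      _ = (∑ t ∈ (sqf ⌊R⌋₊).filter (fun t => d ∣ t), pf (wH H) (t / d)) * (1 + Real.log R) ^ ℓ :=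
          (sum_mul _ _ _).symm
      _ ≤ (∑ t ∈ sqf ⌊R⌋₊, pf (wH H) t) * (1 + Real.log R) ^ ℓ := by
          refine mul_le_mul_of_nonneg_right ?_ (by positivity)
          have hinj : Set.InjOn (fun t => t / d) ((sqf ⌊R⌋₊).filter (fun t => d ∣ t) : Set ℕ) := by
            intro a ha b hb hab
            have ha' := (mem_filter.1 (mem_coe.1 ha)).2
            have hb' := (mem_filter.1 (mem_coe.1 hb)).2
            rw [← Nat.div_mul_cancel ha', ← Nat.div_mul_cancel hb']
            exact congrArg (· * d) hab
          rw [← sum_image (f := fun t => pf (wH H) t) (g := fun t => t / d) hinj]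
          refine sum_le_sum_of_subset_of_nonneg (fun s hs => ?_) fun t _ _ => hpw t
          obtain ⟨t, ht, rfl⟩ := mem_image.1 hs
          obtain ⟨h3, h4⟩ := mem_filter.1 ht
          obtain ⟨h5, h6⟩ := mem_sqf.1 h3
          exact mem_sqf.2 ⟨(Nat.div_le_self t d).trans h5, h6.squarefree_of_dvd (Nat.div_dvd_of_dvd h4)⟩
      _ ≤ _ := by gcongr
  have h3 : 0 ≤ ∑ t ∈ (sqf ⌊R⌋₊).filter (fun t => d ∣ t), pf (wH H) (t / d) * Y R ℓ t :=
    sum_nonneg fun t ht => mul_nonneg (hpw _) (hY t (mem_filter.1 ht).1).1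
  have h4 : 0 ≤ pf (fun p => fH H p * wH H p) d := pf_nonneg (fun p hp => (hF p hp).1) d
  have h5 : pf (fun p => fH H p * wH H p) d ≤ pf (fun _ => (k : ℝ) + 1) d :=
    pf_le_pf (fun p hp => (hF p hp).1) (fun p hp => (hF p hp).2) d
  rw [e1, abs_mul, h1, one_mul, abs_of_nonneg (mul_nonneg h4 h3)]
  calc _ ≤ pf (fun _ => (k : ℝ) + 1) d * (C * (1 + Real.log R) ^ k * (1 + Real.log R) ^ ℓ) :=
        mul_le_mul h5 h2 h3 (h4.trans h5)
    _ = _ := by ring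


/-! ### Reduced residue classes solving the congruence -/

/-- `a - h₀` is a zero of the polynomial attached to `H` mod `q`. -/
abbrev ShiftedRoot (H : Finset ℤ) (h₀ : ℤ) (q : ℕ) (a : ZMod q) : Prop :=
  ∏ h ∈ H, (a - (h₀ : ZMod q) + (h : ZMod q)) = 0

/-- The number of reduced residue classes `u` mod `q` such that `u - h₀` is a zero of `P`. -/
def nuStar (H : Finset ℤ) (h₀ : ℤ) (q : ℕ) : ℕ :=
  Nat.card {u : (ZMod q)ˣ // ShiftedRoot H h₀ q (u : ZMod q)}

theorem dvd_P_iff (H : Finset ℤ) (h₀ : ℤ) (q m : ℕ) :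
    (q : ℤ) ∣ P ((m : ℤ) - h₀) H ↔ ShiftedRoot H h₀ q (m : ZMod q) := by
  rw [← ZMod.intCast_zmod_eq_zero_iff_dvd]
  unfold P ShiftedRoot
  push_cast
  rfl

theorem nuStar_mul (H : Finset ℤ) (h₀ : ℤ) {m n : ℕ} (h : m.Coprime n) :
    nuStar H h₀ (m * n) = nuStar H h₀ m * nuStar H h₀ n := by
  unfold nuStar
  rw [← Nat.card_prod]
  let e := ZMod.chineseRemainder h
  let e' : (ZMod (m * n))ˣ ≃* (ZMod m)ˣ × (ZMod n)ˣ :=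
    (Units.mapEquiv e.toMulEquiv).trans MulEquiv.prodUnits
  have key : ∀ u : (ZMod (m * n))ˣ, ShiftedRoot H h₀ (m * n) (u : ZMod (m * n)) ↔
      ShiftedRoot H h₀ m ((e' u).1 : ZMod m) ∧ ShiftedRoot H h₀ n ((e' u).2 : ZMod n) := by
    intro u
    have h1 : ((e' u).1 : ZMod m) = (e (u : ZMod (m * n))).1 := rfl
    have h2 : ((e' u).2 : ZMod n) = (e (u : ZMod (m * n))).2 := rfl
    unfold ShiftedRoot
    rw [h1, h2, ← e.map_eq_zero_iff, map_prod, Prod.ext_iff, Prod.fst_prod, Prod.snd_prod]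
    simp
  refine Nat.card_congr ((e'.toEquiv.subtypeEquiv (q := fun b : (ZMod m)ˣ × (ZMod n)ˣ =>
    ShiftedRoot H h₀ m (b.1 : ZMod m) ∧ ShiftedRoot H h₀ n (b.2 : ZMod n)) key).trans ?_)
  exact Equiv.subtypeProdEquivProd (p := fun a : (ZMod m)ˣ => ShiftedRoot H h₀ m (a : ZMod m))
    (q := fun a : (ZMod n)ˣ => ShiftedRoot H h₀ n (a : ZMod n))

theorem nuStar_one (H : Finset ℤ) (h₀ : ℤ) : nuStar H h₀ 1 = 1 := by
  unfold nuStar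
  have : ShiftedRoot H h₀ 1 ((1 : (ZMod 1)ˣ) : ZMod 1) := Subsingleton.elim (α := ZMod 1) _ _
  rw [Nat.card_eq_one_iff_unique]
  exact ⟨⟨fun a b => Subtype.ext (Units.ext (Subsingleton.elim (α := ZMod 1) _ _))⟩, ⟨⟨1, this⟩⟩⟩

/-- Among the roots a of P mod p only a = -h₀ corresponds to the non-unit a + h₀ = 0, and it is a
root because h₀ ∈ H. -/
theorem nuStar_prime {H : Finset ℤ} {h₀ : ℤ} (hh : h₀ ∈ H) {p : ℕ} (hp : p.Prime) :
    nuStar H h₀ p + 1 = nu H p := by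
  have : Fact p.Prime := ⟨hp⟩
  have e1 : nu H p = Set.ncard {a : ZMod p | ∏ h ∈ H, (a + (h : ZMod p)) = 0} := rfl
  have e2 : nuStar H h₀ p = Set.ncard {u : (ZMod p)ˣ | ShiftedRoot H h₀ p (u : ZMod p)} := rfl
  have hinj : Function.Injective (fun u : (ZMod p)ˣ => (u : ZMod p) - (h₀ : ZMod p)) :=
    fun u v huv => Units.ext (sub_left_injective huv)
  have e3 : {a : ZMod p | ∏ h ∈ H, (a + (h : ZMod p)) = 0}
      = insert (-(h₀ : ZMod p)) ((fun u : (ZMod p)ˣ => (u : ZMod p) - (h₀ : ZMod p)) ''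
        {u : (ZMod p)ˣ | ShiftedRoot H h₀ p (u : ZMod p)}) := by
    ext a
    rw [Set.mem_insert_iff, Set.mem_image]
    constructor
    · intro ha
      by_cases h0 : a = -(h₀ : ZMod p)
      · exact Or.inl h0
      · right
        have hne : a + (h₀ : ZMod p) ≠ 0 := fun h => h0 (eq_neg_of_add_eq_zero_left h)
        refine ⟨Units.mk0 _ hne, ?_, by simp⟩
        change ∏ h ∈ H, ((a + (h₀ : ZMod p)) - (h₀ : ZMod p) + (h : ZMod p)) = 0
        rw [add_sub_cancel_right]
        exact ha
    · rintro (rfl | ⟨u, hu, rfl⟩)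
      · exact prod_eq_zero hh (by ring)
      · exact hu
  rw [e1, e3, Set.ncard_insert_of_notMem, Set.ncard_image_of_injective _ hinj, e2]
  rintro ⟨u, _, hu⟩
  have : (u : ZMod p) = 0 := by
    have h1 : (u : ZMod p) - (h₀ : ZMod p) = -(h₀ : ZMod p) := hu
    linear_combination h1
  exact u.ne_zero this

theorem nuStar_eq_pf {H : Finset ℤ} {h₀ : ℤ} (hh : h₀ ∈ H) {q : ℕ} (hq : Squarefree q) :
    (nuStar H h₀ q : ℝ) = pf (fun p => (nuP H p : ℝ) - 1) q := by
  rw [eq_pf_of_multiplicative (φ := fun n => (nuStar H h₀ n : ℝ)) (by simp [nuStar_one])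
    (fun m n h => by simp only [nuStar_mul H h₀ h]; push_cast; rfl) hq]
  refine pf_congr fun p hp _ => ?_
  have := nuStar_prime hh hp
  rw [nu_prime H hp] at this
  rw [← this]
  push_cast
  ring

theorem totient_eq_pf {q : ℕ} (hq : Squarefree q) :
    (Nat.totient q : ℝ) = pf (fun p => (p : ℝ) - 1) q := by
  rw [eq_pf_of_multiplicative (φ := fun n => (Nat.totient n : ℝ)) (by simp)
    (fun m n h => by simp only [Nat.totient_mul h]; push_cast; rfl) hq]
  refine pf_congr fun p hp _ => ?_
  rw [Nat.totient_prime hp, Nat.cast_sub hp.one_le, Nat.cast_one]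

theorem nuStar_div_totient {H : Finset ℤ} {h₀ : ℤ} (hh : h₀ ∈ H) {q : ℕ} (hq : Squarefree q) :
    (nuStar H h₀ q : ℝ) / (Nat.totient q : ℝ) = pf (gH H) q := by
  rw [nuStar_eq_pf hh hq, totient_eq_pf hq]
  unfold pf gH
  exact (prod_div_distrib (f := fun p : ℕ => (nuP H p : ℝ) - 1)
    (g := fun p : ℕ => (p : ℝ) - 1)).symm

theorem nuStar_le {H : Finset ℤ} {h₀ : ℤ} (hh : h₀ ∈ H) {k : ℕ} (hk : H.card = k) {q : ℕ}
    (hq : Squarefree q) : (nuStar H h₀ q : ℝ) ≤ pf (fun _ => (k : ℝ)) q := by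
  rw [nuStar_eq_pf hh hq]
  refine pf_le_pf (fun p _ => ?_) (fun p _ => ?_) q
  · have : (1 : ℝ) ≤ nuP H p := by exact_mod_cast one_le_nuP ⟨h₀, hh⟩ p
    linarith
  · linarith [nuP_le_card' hk p]

/-- Multiplication by the unit p permutes the reduced classes mod q. -/
theorem card_shiftedRoot_mul (H : Finset ℤ) (h₀ : ℤ) {p q : ℕ} (h : p.Coprime q) :
    Nat.card {u : (ZMod q)ˣ // ShiftedRoot H h₀ q ((p : ZMod q) * (u : ZMod q))}
      = nuStar H h₀ q := by
  refine Nat.card_congr ((Equiv.mulLeft (ZMod.unitOfCoprime p h)).subtypeEquiv fun u => ?_)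
  simp [ZMod.coe_unitOfCoprime]

/-! ### Sums over residue classes -/

theorem sum_coprime_eq_sum_units {q : ℕ} [NeZero q] (φ : ℕ → ℝ) (s : Finset ℕ)
    (Q : ZMod q → Prop) [DecidablePred Q] :
    ∑ n ∈ s.filter (fun n : ℕ => n.Coprime q ∧ Q (n : ZMod q)), φ n
      = ∑ u ∈ (univ : Finset (ZMod q)ˣ).filter (fun u : (ZMod q)ˣ => Q (u : ZMod q)),
        ∑ n ∈ s with (((n : ℕ) : ZMod q) = (u : ZMod q)), φ n := by
  have e : ∑ u ∈ (univ : Finset (ZMod q)ˣ).filter (fun u : (ZMod q)ˣ => Q (u : ZMod q)),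
        ∑ n ∈ s with (((n : ℕ) : ZMod q) = (u : ZMod q)), φ n
      = ∑ n ∈ s.filter (fun n : ℕ => n.Coprime q ∧ Q (n : ZMod q)),
        ∑ u ∈ (univ : Finset (ZMod q)ˣ).filter (fun u : (ZMod q)ˣ => (n : ZMod q) = (u : ZMod q)), φ n := by
    refine sum_comm' fun u n => ?_
    simp only [mem_filter, mem_univ, true_and]
    constructor
    · rintro ⟨h1, h2, h3⟩
      exact ⟨h3, h2, (ZMod.isUnit_iff_coprime n q).1 (h3 ▸ u.isUnit), h3 ▸ h1⟩
    · rintro ⟨h1, h2, _, h3⟩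
      exact ⟨h1 ▸ h3, h2, h1⟩
  rw [e]
  refine sum_congr rfl fun n hn => ?_
  have hc := (mem_filter.1 hn).2.1
  have : (univ : Finset (ZMod q)ˣ).filter (fun u : (ZMod q)ˣ => (n : ZMod q) = (u : ZMod q))
      = {ZMod.unitOfCoprime n hc} := by
    ext u
    simp only [mem_filter, mem_univ, true_and, mem_singleton]
    rw [Units.ext_iff, ZMod.coe_unitOfCoprime]
    exact eq_comm
  rw [this, sum_singleton]

theorem abs_sum_coprime_sub_le {q : ℕ} [NeZero q] (φ : ℕ → ℝ) (s : Finset ℕ)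
    (Q : ZMod q → Prop) [DecidablePred Q] {c : ℕ} (hc : Nat.card {u : (ZMod q)ˣ // Q (u : ZMod q)} = c)
    {m B : ℝ} (h : ∀ u : (ZMod q)ˣ,
      |(∑ n ∈ s with (((n : ℕ) : ZMod q) = (u : ZMod q)), φ n) - m| ≤ B) :
    |∑ n ∈ s.filter (fun n : ℕ => n.Coprime q ∧ Q (n : ZMod q)), φ n - c * m| ≤ c * B := by
  have hc' : ((univ : Finset (ZMod q)ˣ).filter (fun u : (ZMod q)ˣ => Q (u : ZMod q))).card = c := by
    rw [← hc, Nat.card_eq_fintype_card, Fintype.card_subtype]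
  rw [sum_coprime_eq_sum_units]
  have e : ∑ u ∈ (univ : Finset (ZMod q)ˣ).filter (fun u : (ZMod q)ˣ => Q (u : ZMod q)),
        ∑ n ∈ s with (((n : ℕ) : ZMod q) = (u : ZMod q)), φ n - c * m
      = ∑ u ∈ (univ : Finset (ZMod q)ˣ).filter (fun u : (ZMod q)ˣ => Q (u : ZMod q)),
        (∑ n ∈ s with (((n : ℕ) : ZMod q) = (u : ZMod q)), φ n - m) := by
    rw [sum_sub_distrib, sum_const, nsmul_eq_mul, hc']
  rw [e]
  refine (abs_sum_le_sum_abs _ _).trans ((sum_le_sum fun u _ => h u).trans (le_of_eq ?_))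
  rw [sum_const, nsmul_eq_mul, hc']

/-- A real supremum over an unbounded family has the default value 0, so this inequality rests on
the boundedness in `bddAbove_E`. -/
theorem abs_E_le_Estar {x N : ℝ} (hx : 1 ≤ x) (hxN : x ≤ N) (q : ℕ) (u : (ZMod q)ˣ) :
    |E x q (u : ZMod q)| ≤ Estar N q := by
  obtain ⟨B, hB⟩ := bddAbove_E N q
  have h1 : ∀ y : Set.Icc (1 : ℝ) N, BddAbove (Set.range fun a : (ZMod q)ˣ => |E y q (a : ZMod q)|) :=
    fun y => ⟨B, by rintro _ ⟨a, rfl⟩; exact hB y y.2 a⟩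
  have h2 : BddAbove (Set.range fun y : Set.Icc (1 : ℝ) N => Emax y q) :=
    ⟨B, by rintro _ ⟨y, rfl⟩; exact ciSup_le fun a => hB y y.2 a⟩
  exact (le_ciSup (h1 ⟨x, hx, hxN⟩) u).trans (le_ciSup h2 ⟨x, hx, hxN⟩)

theorem abs_E2_le_E2star {x N : ℝ} (hx : 1 ≤ x) (hxN : x ≤ N) (q : ℕ) (u : (ZMod q)ˣ) :
    |E2 x q (u : ZMod q)| ≤ E2star N q := by
  obtain ⟨B, hB⟩ := bddAbove_E2 N q
  have h1 : ∀ y : Set.Icc (1 : ℝ) N, BddAbove (Set.range fun a : (ZMod q)ˣ => |E2 y q (a : ZMod q)|) :=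
    fun y => ⟨B, by rintro _ ⟨a, rfl⟩; exact hB y y.2 a⟩
  have h2 : BddAbove (Set.range fun y : Set.Icc (1 : ℝ) N => E2max y q) :=
    ⟨B, by rintro _ ⟨y, rfl⟩; exact ciSup_le fun a => hB y y.2 a⟩
  exact (le_ciSup (h1 ⟨x, hx, hxN⟩) u).trans (le_ciSup h2 ⟨x, hx, hxN⟩)

theorem Estar_le {N B : ℝ} (hN : 1 ≤ N) {q : ℕ}
    (h : ∀ x ∈ Set.Icc (1 : ℝ) N, ∀ u : (ZMod q)ˣ, |E x q (u : ZMod q)| ≤ B) : Estar N q ≤ B := by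
  have : Nonempty (Set.Icc (1 : ℝ) N) := ⟨⟨1, le_rfl, hN⟩⟩
  exact ciSup_le fun y => ciSup_le fun u => h y y.2 u

theorem E2star_le {N B : ℝ} (hN : 1 ≤ N) {q : ℕ}
    (h : ∀ x ∈ Set.Icc (1 : ℝ) N, ∀ u : (ZMod q)ˣ, |E2 x q (u : ZMod q)| ≤ B) : E2star N q ≤ B := by
  have : Nonempty (Set.Icc (1 : ℝ) N) := ⟨⟨1, le_rfl, hN⟩⟩
  exact ciSup_le fun y => ciSup_le fun u => h y y.2 u

theorem Estar_nonneg (N : ℝ) (q : ℕ) : 0 ≤ Estar N q :=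
  Real.iSup_nonneg fun _ => Real.iSup_nonneg fun _ => abs_nonneg _

theorem E2star_nonneg (N : ℝ) (q : ℕ) : 0 ≤ E2star N q :=
  Real.iSup_nonneg fun _ => Real.iSup_nonneg fun _ => abs_nonneg _

/-! ### Values of `ϖ * ϖ` -/

theorem varpi_apply (n : ℕ) : varpi n = if n.Prime then Real.log n else 0 := rfl

theorem varpi_prime {p : ℕ} (hp : p.Prime) : varpi p = Real.log p := by
  rw [varpi_apply, if_pos hp]

/-- The only factorizations of pn with both factors prime can be (p, n) and (n, p), which are
distinct when n ≠ p; each contributes log p · ϖ(n). -/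
theorem varpi2_prime_mul {p n : ℕ} (hp : p.Prime) (hn : n ≠ p) (hn0 : n ≠ 0) :
    varpi2 (p * n) = 2 * Real.log p * varpi n := by
  unfold varpi2
  rw [ArithmeticFunction.mul_apply]
  have hsub : ({(p, n), (n, p)} : Finset (ℕ × ℕ)) ⊆ (p * n).divisorsAntidiagonal := by
    intro z hz
    rw [mem_insert, mem_singleton] at hz
    rw [Nat.mem_divisorsAntidiagonal]
    have : p * n ≠ 0 := mul_ne_zero hp.ne_zero hn0
    rcases hz with rfl | rfl
    · exact ⟨rfl, this⟩
    · exact ⟨mul_comm _ _, this⟩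
  rw [← sum_subset hsub, sum_pair, varpi_prime hp]
  · ring
  · intro h
    exact hn (Prod.ext_iff.1 h).2
  · rintro ⟨a, b⟩ hz hz'
    obtain ⟨hab, _⟩ := Nat.mem_divisorsAntidiagonal.1 hz
    simp only at hab ⊢
    by_contra hne
    have ha : a.Prime := by
      by_contra h
      exact hne (by rw [varpi_apply a, if_neg h, zero_mul])
    have hb : b.Prime := by
      by_contra h
      exact hne (by rw [varpi_apply b, if_neg h, mul_zero])
    apply hz'
    rw [mem_insert, mem_singleton, Prod.mk_inj, Prod.mk_inj]
    have hpab : p ∣ a * b := hab ▸ dvd_mul_right p n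
    rcases (Nat.Prime.dvd_mul hp).1 hpab with h | h
    · have hpa := (Nat.prime_dvd_prime_iff_eq hp ha).1 h
      subst hpa
      exact Or.inl ⟨rfl, Nat.eq_of_mul_eq_mul_left hp.pos hab⟩
    · have hpb := (Nat.prime_dvd_prime_iff_eq hp hb).1 h
      subst hpb
      refine Or.inr ⟨?_, rfl⟩
      rw [mul_comm] at hab
      exact Nat.eq_of_mul_eq_mul_left hp.pos hab

/-- As m > M², the cofactor m/p exceeds M and hence every prime of D. If it is prime, then p is the
only prime of D dividing m and the sum has one term; if not, ϖ*ϖ(m) and all terms vanish. -/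
theorem varpi2_eq_sum_of_not_coprime {M D m : ℕ} (hDM : ∀ p ∈ D.primeFactors, p ≤ M)
    (hD : D ≠ 0) (hm : M * M < m) (hc : ¬ m.Coprime D) :
    varpi2 m = ∑ p ∈ D.primeFactors.filter (fun p => p ∣ m), 2 * Real.log p * varpi (m / p) := by
  have hdiv : ∀ p ∈ D.primeFactors.filter (fun p => p ∣ m), p.Prime ∧ p ≤ M ∧ M < m / p ∧
      varpi2 m = 2 * Real.log p * varpi (m / p) := by
    intro p hp
    obtain ⟨h1, h2⟩ := mem_filter.1 hp
    have hpp := Nat.prime_of_mem_primeFactors h1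
    have hpM := hDM p h1
    have h3 : M < m / p := by
      by_contra h
      have h4 : m / p * p ≤ M * M := Nat.mul_le_mul (not_lt.1 h) hpM
      rw [Nat.div_mul_cancel h2] at h4
      omega
    refine ⟨hpp, hpM, h3, ?_⟩
    conv_lhs => rw [← Nat.mul_div_cancel' h2]
    exact varpi2_prime_mul hpp (by omega) (by omega)
  obtain ⟨p₀, hp₀, hp₀m, hp₀D⟩ := Nat.Prime.not_coprime_iff_dvd.1 hc
  have hmem : p₀ ∈ D.primeFactors.filter (fun p => p ∣ m) :=
    mem_filter.2 ⟨Nat.mem_primeFactors.2 ⟨hp₀, hp₀D, hD⟩, hp₀m⟩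
  obtain ⟨_, hp₀M, hlt, hval⟩ := hdiv p₀ hmem
  by_cases hq : (m / p₀).Prime
  · have : D.primeFactors.filter (fun p => p ∣ m) = {p₀} := by
      ext p
      rw [mem_singleton]
      constructor
      · intro hp
        obtain ⟨hpp, hpM, _, _⟩ := hdiv p hp
        have h2 := (mem_filter.1 hp).2
        rw [← Nat.mul_div_cancel' hp₀m] at h2
        rcases (Nat.Prime.dvd_mul hpp).1 h2 with h | h
        · exact (Nat.prime_dvd_prime_iff_eq hpp hp₀).1 h
        · have := (Nat.prime_dvd_prime_iff_eq hpp hq).1 h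
          omega
      · rintro rfl
        exact hmem
    rw [this, sum_singleton, hval]
  · have h0 : varpi2 m = 0 := by
      rw [hval, varpi_apply, if_neg hq, mul_zero]
    rw [h0]
    symm
    refine sum_eq_zero fun p hp => ?_
    rw [← (hdiv p hp).2.2.2, h0]


/-! ### Sums of `ϖ * ϖ` over the zeros of `P` mod `D` -/

theorem mem_Ioc_floor {x : ℝ} (hx : 0 ≤ x) {m : ℕ} :
    m ∈ Ioc ⌊x⌋₊ ⌊2 * x⌋₊ ↔ x < m ∧ (m : ℝ) ≤ 2 * x := by
  rw [mem_Ioc, Nat.floor_lt hx, Nat.le_floor_iff (by linarith)]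

/-- When p ∣ m the factor h = h₀ of P(m - h₀) is m itself, so the condition mod p is automatic and
only the modulus D/p remains. -/
theorem shiftedRoot_prime_mul {H : Finset ℤ} {h₀ : ℤ} (hh : h₀ ∈ H) {D p : ℕ} (hD : Squarefree D)
    (hpD : p ∣ D) (n : ℕ) :
    ShiftedRoot H h₀ D ((p * n : ℕ) : ZMod D)
      ↔ ShiftedRoot H h₀ (D / p) ((p : ZMod (D / p)) * (n : ZMod (D / p))) := by
  have h1 : ((p : ZMod (D / p)) * (n : ZMod (D / p))) = ((p * n : ℕ) : ZMod (D / p)) := by push_cast; rfl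
  rw [h1, ← dvd_P_iff, ← dvd_P_iff]
  have hp : (p : ℤ) ∣ P (((p * n : ℕ) : ℤ) - h₀) H := by
    have h2 : (p : ℤ) ∣ ((p * n : ℕ) : ℤ) - h₀ + h₀ := ⟨n, by push_cast; ring⟩
    exact h2.trans (dvd_prod_of_mem (fun h => ((p * n : ℕ) : ℤ) - h₀ + h) hh)
  have hc : IsCoprime (p : ℤ) ((D / p : ℕ) : ℤ) :=
    Nat.isCoprime_iff_coprime.2 (coprime_div_of_squarefree hD hpD)
  constructor
  · intro h
    refine Dvd.dvd.trans ?_ h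
    exact Int.natCast_dvd_natCast.2 (Nat.div_dvd_of_dvd hpD)
  · intro h
    have h3 := hc.mul_dvd hp h
    rw [← Nat.cast_mul, Nat.mul_div_cancel' hpD] at h3
    exact h3

/-- With m = pn, coprimality of n to D/p may be imposed freely: a prime n dividing D is at most M,
whereas np > x > M² ≥ Mp forces n > M. -/
theorem sum_dvd_prime_eq {H : Finset ℤ} {h₀ : ℤ} (hh : h₀ ∈ H) {x : ℝ} {M : ℕ}
    (hx : 0 ≤ x) (hM : (M : ℝ) ^ 2 < x) {D : ℕ} (hD : Squarefree D)
    (hDM : ∀ p ∈ D.primeFactors, p ≤ M) {p : ℕ} (hp : p ∈ D.primeFactors) :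
    ∑ m ∈ (Ioc ⌊x⌋₊ ⌊2 * x⌋₊).filter (fun m : ℕ => p ∣ m ∧ ShiftedRoot H h₀ D (m : ZMod D)),
        varpi (m / p)
      = ∑ n ∈ (Ioc ⌊x / p⌋₊ ⌊2 * (x / p)⌋₊).filter (fun n : ℕ => n.Coprime (D / p) ∧
          ShiftedRoot H h₀ (D / p) ((p : ZMod (D / p)) * (n : ZMod (D / p)))), varpi n := by
  obtain ⟨hpp, hpD, hD0⟩ := Nat.mem_primeFactors.1 hp
  have hp0 : (0 : ℝ) < p := by exact_mod_cast hpp.pos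
  have hpM := hDM p hp
  have hxp : 0 ≤ x / p := by positivity
  symm
  have e1 : ∑ n ∈ (Ioc ⌊x / p⌋₊ ⌊2 * (x / p)⌋₊).filter (fun n : ℕ => n.Coprime (D / p) ∧
          ShiftedRoot H h₀ (D / p) ((p : ZMod (D / p)) * (n : ZMod (D / p)))), varpi n
      = ∑ n ∈ (Ioc ⌊x / p⌋₊ ⌊2 * (x / p)⌋₊).filter (fun n : ℕ =>
          ShiftedRoot H h₀ (D / p) ((p : ZMod (D / p)) * (n : ZMod (D / p)))), varpi n := by
    refine sum_subset (fun n hn => ?_) fun n hn hn' => ?_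
    · obtain ⟨h1, h2⟩ := mem_filter.1 hn
      exact mem_filter.2 ⟨h1, h2.2⟩
    · obtain ⟨h1, h2⟩ := mem_filter.1 hn
      have hnc : ¬ n.Coprime (D / p) := fun h => hn' (mem_filter.2 ⟨h1, h, h2⟩)
      rw [varpi_apply, if_neg]
      intro hnp
      have h3 : n ∣ D / p := by
        by_contra h
        exact hnc ((Nat.Prime.coprime_iff_not_dvd hnp).2 h)
      have h4 : n ≤ M := hDM n (Nat.mem_primeFactors.2 ⟨hnp, h3.trans (Nat.div_dvd_of_dvd hpD), hD0⟩)
      have h5 := ((mem_Ioc_floor hxp).1 h1).1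
      rw [div_lt_iff₀ hp0] at h5
      have h6 : (n : ℝ) * p ≤ (M : ℝ) * M := by exact_mod_cast Nat.mul_le_mul h4 hpM
      nlinarith
  rw [e1]
  refine sum_bij' (fun n _ => p * n) (fun m _ => m / p) ?_ ?_ ?_ ?_ ?_
  · intro n hn
    obtain ⟨h1, h2⟩ := mem_filter.1 hn
    obtain ⟨h3, h4⟩ := (mem_Ioc_floor hxp).1 h1
    rw [mem_filter, mem_Ioc_floor hx]
    refine ⟨⟨?_, ?_⟩, dvd_mul_right p n, (shiftedRoot_prime_mul hh hD hpD n).2 h2⟩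
    · rw [div_lt_iff₀ hp0] at h3
      push_cast; linarith
    · rw [← mul_div_assoc, le_div_iff₀ hp0] at h4
      push_cast; linarith
  · intro m hm
    obtain ⟨h1, h2, h5⟩ := mem_filter.1 hm
    obtain ⟨h3, h4⟩ := (mem_Ioc_floor hx).1 h1
    rw [mem_filter, mem_Ioc_floor hxp]
    refine ⟨⟨?_, ?_⟩, ?_⟩
    · rw [Nat.cast_div h2 hp0.ne']
      exact div_lt_div_of_pos_right h3 hp0
    · rw [Nat.cast_div h2 hp0.ne', ← mul_div_assoc]
      exact div_le_div_of_nonneg_right h4 hp0.le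
    · rw [← shiftedRoot_prime_mul hh hD hpD, Nat.mul_div_cancel' h2]
      exact h5
  · intro n _
    exact Nat.mul_div_cancel_left n hpp.pos
  · intro m hm
    exact Nat.mul_div_cancel' (mem_filter.1 hm).2.1
  · intro n _
    rw [Nat.mul_div_cancel_left n hpp.pos]

/-- The expected value of the sum of `ϖ * ϖ` over `x < m ≤ 2x` with `D ∣ P(m - h₀)`. -/
def progressionMain (H : Finset ℤ) (x : ℝ) (D : ℕ) : ℝ :=
  x * pf (gH H) D * (Real.log x + C0 - 2 * ∑ p ∈ D.primeFactors, Real.log p / p)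
    + ∑ p ∈ D.primeFactors, 2 * Real.log p * (x / p * pf (gH H) (D / p))

/-- The error term for the sum of `ϖ * ϖ` over `x < m ≤ 2x` with `D ∣ P(m - h₀)`, `x ≤ X`. -/
def progressionError (X : ℝ) (D : ℕ) : ℝ :=
  E2star X D + ∑ p ∈ D.primeFactors, 2 * Real.log p * Estar (X / p) (D / p)

/-- The m coprime to D lie in ∏(ν_p - 1) reduced classes and are handled by E₂; the others are p
times a prime and are handled by E with modulus D/p at x/p. Both class counts are at most k^{ω(D)}.
-/
theorem abs_sum_varpi2_sub_le {H : Finset ℤ} {h₀ : ℤ} (hh : h₀ ∈ H) {k : ℕ} (hk : H.card = k)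
    {x X : ℝ} {M : ℕ}
    (hx1 : 1 ≤ x) (hxX : x ≤ X) (hM : (M : ℝ) ^ 2 < x) {D : ℕ} (hD : Squarefree D)
    (hDM : ∀ p ∈ D.primeFactors, p ≤ M) :
    |∑ m ∈ (Ioc ⌊x⌋₊ ⌊2 * x⌋₊).filter (fun m : ℕ => (D : ℤ) ∣ P ((m : ℤ) - h₀) H), varpi2 m
        - progressionMain H x D| ≤ pf (fun _ => (k : ℝ)) D * progressionError X D := by
  have hx0 : 0 ≤ x := by linarith
  have hk1 : (1 : ℝ) ≤ k := by
    have := card_pos.2 ⟨h₀, hh⟩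
    rw [hk] at this
    exact_mod_cast this
  have hDne : NeZero D := ⟨hD.ne_zero⟩
  set s := Ioc ⌊x⌋₊ ⌊2 * x⌋₊ with hs
  have hsplit : ∑ m ∈ s.filter (fun m : ℕ => (D : ℤ) ∣ P ((m : ℤ) - h₀) H), varpi2 m
      = ∑ m ∈ s.filter (fun m : ℕ => m.Coprime D ∧ ShiftedRoot H h₀ D (m : ZMod D)), varpi2 m
        + ∑ p ∈ D.primeFactors, 2 * Real.log p *
          ∑ m ∈ s.filter (fun m : ℕ => p ∣ m ∧ ShiftedRoot H h₀ D (m : ZMod D)), varpi (m / p) := by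
    have e1 : ∑ p ∈ D.primeFactors, 2 * Real.log p *
          ∑ m ∈ s.filter (fun m : ℕ => p ∣ m ∧ ShiftedRoot H h₀ D (m : ZMod D)), varpi (m / p)
        = ∑ m ∈ s.filter (fun m : ℕ => ShiftedRoot H h₀ D (m : ZMod D)),
          ∑ p ∈ D.primeFactors.filter (fun p => p ∣ m), 2 * Real.log p * varpi (m / p) := by
      simp_rw [mul_sum]
      refine sum_comm' fun p m => ?_
      simp only [mem_filter]
      tauto
    rw [e1, sum_filter, sum_filter, sum_filter, ← sum_add_distrib]
    refine sum_congr rfl fun m hm => ?_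
    have hroot := dvd_P_iff H h₀ D m
    by_cases h1 : ShiftedRoot H h₀ D (m : ZMod D)
    · rw [if_pos (hroot.2 h1), if_pos h1]
      by_cases h2 : m.Coprime D
      · rw [if_pos ⟨h2, h1⟩]
        have : D.primeFactors.filter (fun p => p ∣ m) = ∅ := by
          refine filter_eq_empty_iff.2 fun p hp hpm => ?_
          have hpp := Nat.prime_of_mem_primeFactors hp
          exact hpp.one_lt.ne' (Nat.eq_one_of_dvd_coprimes h2 hpm (Nat.dvd_of_mem_primeFactors hp))
        rw [this, sum_empty, add_zero]
      · rw [if_neg (fun h : m.Coprime D ∧ ShiftedRoot H h₀ D (m : ZMod D) => h2 h.1), zero_add]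
        refine varpi2_eq_sum_of_not_coprime hDM hD.ne_zero ?_ h2
        have h3 := ((mem_Ioc_floor hx0).1 hm).1
        have h4 : ((M * M : ℕ) : ℝ) < m := by push_cast; nlinarith
        exact_mod_cast h4
    · rw [if_neg (fun h => h1 (hroot.1 h)), if_neg h1,
        if_neg (fun h : m.Coprime D ∧ ShiftedRoot H h₀ D (m : ZMod D) => h1 h.2), add_zero]
  have b1 : |∑ m ∈ s.filter (fun m : ℕ => m.Coprime D ∧ ShiftedRoot H h₀ D (m : ZMod D)), varpi2 m
      - x * pf (gH H) D * (Real.log x + C0 - 2 * ∑ p ∈ D.primeFactors, Real.log p / p)|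
      ≤ pf (fun _ => (k : ℝ)) D * E2star X D := by
    have := abs_sum_coprime_sub_le (q := D) (fun m => varpi2 m) s (ShiftedRoot H h₀ D)
      (c := nuStar H h₀ D) rfl (fun u => abs_E2_le_E2star hx1 hxX D u)
    rw [show (nuStar H h₀ D : ℝ) * (x / (Nat.totient D : ℝ)
        * (Real.log x + C0 - 2 * ∑ p ∈ D.primeFactors, Real.log (p : ℝ) / (p : ℝ)))
        = x * pf (gH H) D * (Real.log x + C0 - 2 * ∑ p ∈ D.primeFactors, Real.log p / p) by
          rw [← nuStar_div_totient hh hD]; ring] at this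
    exact this.trans (mul_le_mul_of_nonneg_right (nuStar_le hh hk hD) (E2star_nonneg _ _))
  have b2 : ∀ p ∈ D.primeFactors, |2 * Real.log p *
        ∑ m ∈ s.filter (fun m : ℕ => p ∣ m ∧ ShiftedRoot H h₀ D (m : ZMod D)), varpi (m / p)
        - 2 * Real.log p * (x / p * pf (gH H) (D / p))|
      ≤ pf (fun _ => (k : ℝ)) D * (2 * Real.log p * Estar (X / p) (D / p)) := by
    intro p hp
    obtain ⟨hpp, hpD, hD0⟩ := Nat.mem_primeFactors.1 hp
    have hp0 : (0 : ℝ) < p := by exact_mod_cast hpp.pos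
    have hp1 : (1 : ℝ) ≤ p := by exact_mod_cast hpp.one_le
    have hpM : (p : ℝ) ≤ M := by exact_mod_cast hDM p hp
    have hDp : Squarefree (D / p) := hD.squarefree_of_dvd (Nat.div_dvd_of_dvd hpD)
    have hne : NeZero (D / p) := ⟨hDp.ne_zero⟩
    have hcop := coprime_div_of_squarefree hD hpD
    have hlog : 0 ≤ 2 * Real.log p := by
      have := Real.log_natCast_nonneg p
      linarith
    rw [hs, sum_dvd_prime_eq hh hx0 hM hD hDM hp]
    have hxp1 : 1 ≤ x / p := by
      rw [le_div_iff₀ hp0]; nlinarith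
    have hxpX : x / p ≤ X / p := by gcongr
    have := abs_sum_coprime_sub_le (q := D / p) (fun m => varpi m) (Ioc ⌊x / p⌋₊ ⌊2 * (x / p)⌋₊)
      (fun a => ShiftedRoot H h₀ (D / p) ((p : ZMod (D / p)) * a))
      (c := nuStar H h₀ (D / p)) (card_shiftedRoot_mul H h₀ hcop)
      (fun u => abs_E_le_Estar hxp1 hxpX (D / p) u)
    rw [show (nuStar H h₀ (D / p) : ℝ) * (x / p / (Nat.totient (D / p) : ℝ))
        = x / p * pf (gH H) (D / p) by rw [← nuStar_div_totient hh hDp]; ring] at this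
    rw [← mul_sub, abs_mul, abs_of_nonneg hlog]
    have h2 : (nuStar H h₀ (D / p) : ℝ) ≤ pf (fun _ => (k : ℝ)) D := by
      refine (nuStar_le hh hk hDp).trans ?_
      rw [pf_div _ hD hpD, pf_prime _ hpp]
      have := pf_nonneg (g := fun _ => (k : ℝ)) (fun p _ => by linarith) (D / p)
      nlinarith
    have h3 := this.trans (mul_le_mul_of_nonneg_right h2 (Estar_nonneg _ _))
    refine (mul_le_mul_of_nonneg_left h3 hlog).trans (le_of_eq ?_)
    ring
  rw [hsplit]
  unfold progressionMain progressionError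
  have e2 : ∑ m ∈ s.filter (fun m : ℕ => m.Coprime D ∧ ShiftedRoot H h₀ D (m : ZMod D)), varpi2 m
        + ∑ p ∈ D.primeFactors, 2 * Real.log p *
          ∑ m ∈ s.filter (fun m : ℕ => p ∣ m ∧ ShiftedRoot H h₀ D (m : ZMod D)), varpi (m / p)
        - (x * pf (gH H) D * (Real.log x + C0 - 2 * ∑ p ∈ D.primeFactors, Real.log p / p)
          + ∑ p ∈ D.primeFactors, 2 * Real.log p * (x / p * pf (gH H) (D / p)))
      = (∑ m ∈ s.filter (fun m : ℕ => m.Coprime D ∧ ShiftedRoot H h₀ D (m : ZMod D)), varpi2 m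
        - x * pf (gH H) D * (Real.log x + C0 - 2 * ∑ p ∈ D.primeFactors, Real.log p / p))
        + ∑ p ∈ D.primeFactors, (2 * Real.log p *
          ∑ m ∈ s.filter (fun m : ℕ => p ∣ m ∧ ShiftedRoot H h₀ D (m : ZMod D)), varpi (m / p)
          - 2 * Real.log p * (x / p * pf (gH H) (D / p))) := by
    rw [sum_sub_distrib]; ring
  rw [e2, mul_add (pf (fun _ => (k : ℝ)) D), mul_sum (a := pf (fun _ => (k : ℝ)) D)]
  exact (abs_add_le _ _).trans (add_le_add b1 ((abs_sum_le_sum_abs _ _).trans (sum_le_sum b2)))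

/-- The term -2Σ log p/p in the expected value of ϖ*ϖ pairs with the contribution of the m divisible
by p, so that only differences g(D/p) - g(D) remain. -/
theorem progressionMain_eq (H : Finset ℤ) (x : ℝ) (D : ℕ) :
    progressionMain H x D = x * (Real.log x + C0) * pf (gH H) D
      + 2 * x * ∑ p ∈ D.primeFactors, Real.log p / p * (pf (gH H) (D / p) - pf (gH H) D) := by
  have e1 : ∑ p ∈ D.primeFactors, Real.log p / p * (pf (gH H) (D / p) - pf (gH H) D)
      = ∑ p ∈ D.primeFactors, Real.log p / p * pf (gH H) (D / p)
        - (∑ p ∈ D.primeFactors, Real.log p / p) * pf (gH H) D := by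
    rw [sum_mul, ← sum_sub_distrib]
    exact sum_congr rfl fun p _ => by ring
  have e2 : ∑ p ∈ D.primeFactors, 2 * Real.log p * (x / p * pf (gH H) (D / p))
      = 2 * x * ∑ p ∈ D.primeFactors, Real.log p / p * pf (gH H) (D / p) := by
    rw [mul_sum]
    exact sum_congr rfl fun p _ => by ring
  unfold progressionMain
  rw [e1, e2]
  ring

/-- The main terms add up to the two forms. -/
theorem sum_sum_progressionMain (H : Finset ℤ) (x R : ℝ) (ℓ₁ ℓ₂ : ℕ) :
    ∑ d ∈ sqf ⌊R⌋₊, ∑ e ∈ sqf ⌊R⌋₊, lamForm (fH H) (wH H) R ℓ₁ d * lamForm (fH H) (wH H) R ℓ₂ e *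
        progressionMain H x (Nat.lcm d e)
      = x * (Real.log x + C0) * qform (fH H) (wH H) (gH H) R ℓ₁ ℓ₂
        + 2 * x * ∑ p ∈ pr ⌊R⌋₊, Real.log p / p *
            (qform (fH H) (wH H) (Function.update (gH H) p 1) R ℓ₁ ℓ₂
              - qform (fH H) (wH H) (gH H) R ℓ₁ ℓ₂) := by
  rw [← sum_sum_lamForm_primeFactors]
  unfold qform
  rw [mul_sum, mul_sum, ← sum_add_distrib]
  refine sum_congr rfl fun d _ => ?_
  rw [mul_sum, mul_sum, ← sum_add_distrib]
  refine sum_congr rfl fun e _ => ?_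
  rw [progressionMain_eq]
  ring


/-! ### Trivial bounds for the error terms -/

theorem varpi_le_log (n : ℕ) : varpi n ≤ Real.log n := by
  rw [varpi_apply]
  split_ifs
  · exact le_rfl
  · exact Real.log_natCast_nonneg n

theorem sum_divisors_varpi_le (n : ℕ) : ∑ d ∈ n.divisors, varpi d ≤ Real.log n := by
  rw [← ArithmeticFunction.vonMangoldt_sum]
  refine sum_le_sum fun d _ => ?_
  rw [varpi_apply]
  split_ifs with h
  · rw [ArithmeticFunction.vonMangoldt_apply_prime h]
  · exact ArithmeticFunction.vonMangoldt_nonneg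

theorem varpi2_le_sq_log {n : ℕ} (hn : n ≠ 0) : varpi2 n ≤ Real.log n ^ 2 := by
  unfold varpi2
  rw [ArithmeticFunction.mul_apply, Nat.sum_divisorsAntidiagonal (f := fun i j => varpi i * varpi j)]
  calc ∑ i ∈ n.divisors, varpi i * varpi (n / i) ≤ ∑ i ∈ n.divisors, varpi i * Real.log n := by
        refine sum_le_sum fun i hi => mul_le_mul_of_nonneg_left ?_ (varpi_nonneg i)
        refine (varpi_le_log _).trans ?_
        have h1 : 0 < n / i := Nat.div_pos (Nat.le_of_dvd (Nat.pos_of_ne_zero hn)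
          (Nat.dvd_of_mem_divisors hi)) (Nat.pos_of_mem_divisors hi)
        exact Real.log_le_log (by exact_mod_cast h1) (by exact_mod_cast Nat.div_le_self n i)
    _ = (∑ i ∈ n.divisors, varpi i) * Real.log n := (sum_mul _ _ _).symm
    _ ≤ Real.log n * Real.log n :=
        mul_le_mul_of_nonneg_right (sum_divisors_varpi_le n) (Real.log_natCast_nonneg n)
    _ = _ := by ring

theorem card_progression_le {q : ℕ} (hq : 0 < q) (a : ZMod q) {x X : ℝ} (hx : 1 ≤ x) (hxX : x ≤ X)
    (hqX : (q : ℝ) ≤ X) :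
    (((Ioc ⌊x⌋₊ ⌊2 * x⌋₊).filter (fun n : ℕ => (n : ZMod q) = a)).card : ℝ) ≤ 3 * (X / q) := by
  have : NeZero q := ⟨hq.ne'⟩
  have hq0 : (0 : ℝ) < q := by exact_mod_cast hq
  have e : (Ioc ⌊x⌋₊ ⌊2 * x⌋₊).filter (fun n : ℕ => (n : ZMod q) = a)
      = (Ioc ⌊x⌋₊ ⌊2 * x⌋₊).filter (fun n : ℕ => n ≡ a.val [MOD q]) := by
    refine filter_congr fun n _ => ?_
    rw [← ZMod.natCast_eq_natCast_iff, ZMod.natCast_zmod_val]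
  have h1 := Nat.Ioc_filter_modEq_card ⌊x⌋₊ ⌊2 * x⌋₊ hq a.val
  rw [← e] at h1
  set c := ((Ioc ⌊x⌋₊ ⌊2 * x⌋₊).filter (fun n : ℕ => (n : ZMod q) = a)).card
  have h2 := Nat.floor_le (show 0 ≤ 2 * x by linarith)
  have h3 := Nat.lt_floor_add_one x
  have hXq : 1 ≤ X / q := (one_le_div hq0).2 hqX
  have hqQ : (0 : ℚ) < q := by exact_mod_cast hq
  have hab : ⌊x⌋₊ ≤ ⌊2 * x⌋₊ := Nat.floor_le_floor (by linarith)
  have h4 : (c : ℚ) ≤ ((⌊2 * x⌋₊ : ℚ) - ⌊x⌋₊) / q + 1 := by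
    have h5 : (c : ℚ) = ((max (⌊((⌊2 * x⌋₊ : ℚ) - a.val) / q⌋ - ⌊((⌊x⌋₊ : ℚ) - a.val) / q⌋) 0 : ℤ) : ℚ) := by
      exact_mod_cast h1
    rw [h5]
    push_cast
    refine max_le ?_ ?_
    · have h6 := Int.floor_le (((⌊2 * x⌋₊ : ℚ) - a.val) / q)
      have h7 := Int.lt_floor_add_one (((⌊x⌋₊ : ℚ) - a.val) / q)
      have h8 : ((⌊2 * x⌋₊ : ℚ) - ⌊x⌋₊) / q
          = ((⌊2 * x⌋₊ : ℚ) - a.val) / q - ((⌊x⌋₊ : ℚ) - a.val) / q := by ring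
      rw [h8]
      linarith
    · have h9 : (⌊x⌋₊ : ℚ) ≤ ⌊2 * x⌋₊ := by exact_mod_cast hab
      have : 0 ≤ ((⌊2 * x⌋₊ : ℚ) - ⌊x⌋₊) / q := div_nonneg (by linarith) hqQ.le
      linarith
  have h5 : (c : ℝ) ≤ ((⌊2 * x⌋₊ : ℝ) - ⌊x⌋₊) / q + 1 := by exact_mod_cast h4
  have h6 : ((⌊2 * x⌋₊ : ℝ) - ⌊x⌋₊) / q ≤ 2 * X / q := by
    gcongr
    linarith
  calc (c : ℝ) ≤ 2 * X / q + X / q := by linarith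
    _ = 3 * (X / q) := by ring

theorem pf_natCast {n : ℕ} (hn : Squarefree n) : pf (fun p => (p : ℝ)) n = n := by
  conv_rhs => rw [← Nat.prod_primeFactors_of_squarefree hn]
  rw [Nat.cast_prod]
  rfl

theorem one_div_totient_le {q : ℕ} (hq : Squarefree q) :
    1 / (Nat.totient q : ℝ) ≤ pf (fun _ => 2) q / q := by
  rw [totient_eq_pf hq, ← pf_natCast hq]
  have h1 : 1 / pf (fun p : ℕ => (p : ℝ) - 1) q = pf (fun p : ℕ => 1 / ((p : ℝ) - 1)) q := by
    unfold pf; rw [prod_div_distrib, prod_const_one]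
  have h2 : pf (fun _ => (2 : ℝ)) q / pf (fun p : ℕ => (p : ℝ)) q = pf (fun p : ℕ => 2 / (p : ℝ)) q := by
    unfold pf; rw [prod_div_distrib]
  rw [h1, h2]
  refine pf_le_pf (fun p hp => ?_) (fun p hp => ?_) q
  · have : (2 : ℝ) ≤ p := by exact_mod_cast hp.two_le
    exact one_div_nonneg.2 (by linarith)
  · have : (2 : ℝ) ≤ p := by exact_mod_cast hp.two_le
    rw [div_le_div_iff₀ (by linarith) (by linarith)]
    linarith

theorem abs_sum_progression_le {φ : ℕ → ℝ} {B : ℝ} {q : ℕ} (hq : 0 < q) (a : ZMod q) {x X : ℝ}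
    (hx : 1 ≤ x) (hxX : x ≤ X) (hqX : (q : ℝ) ≤ X)
    (hφ : ∀ n : ℕ, 1 ≤ n → (n : ℝ) ≤ 2 * X → |φ n| ≤ B) :
    |∑ n ∈ Ioc ⌊x⌋₊ ⌊2 * x⌋₊ with (((n : ℕ) : ZMod q) = a), φ n| ≤ 3 * (X / q) * B := by
  have hB : 0 ≤ B := (abs_nonneg _).trans (hφ 1 le_rfl (by push_cast; linarith))
  calc _ ≤ ∑ n ∈ Ioc ⌊x⌋₊ ⌊2 * x⌋₊ with (((n : ℕ) : ZMod q) = a), B := by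
        refine (abs_sum_le_sum_abs _ _).trans (sum_le_sum fun n hn => ?_)
        have h1 := (mem_filter.1 hn).1
        have h2 := (mem_Ioc_floor (by linarith)).1 h1
        exact hφ n ((Nat.zero_le _).trans_lt (mem_Ioc.1 h1).1) (by linarith)
    _ = (((Ioc ⌊x⌋₊ ⌊2 * x⌋₊).filter (fun n : ℕ => (n : ZMod q) = a)).card : ℝ) * B := by
        rw [sum_const, nsmul_eq_mul]
    _ ≤ _ := mul_le_mul_of_nonneg_right (card_progression_le hq a hx hxX hqX) hB

theorem log_le_one_add_log {n : ℕ} {X : ℝ} (hX : 1 ≤ X) (h1 : 1 ≤ n) (h2 : (n : ℝ) ≤ 2 * X) :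
    Real.log n ≤ 1 + Real.log X := by
  have h3 : Real.log n ≤ Real.log (2 * X) := Real.log_le_log (by exact_mod_cast h1) h2
  rw [Real.log_mul (by norm_num) (by linarith)] at h3
  have := Real.log_two_lt_d9
  linarith

/-- A bound of the right order X/q up to logarithms and 2^{ω(q)}; it supplies one factor in the
Cauchy–Schwarz step that removes divisor-type weights. -/
theorem Estar_trivial {X : ℝ} (hX : 1 ≤ X) {q : ℕ} (hq : Squarefree q) (hqX : (q : ℝ) ≤ X) :
    Estar X q ≤ 4 * (1 + Real.log X) ^ 2 * (X / q) * pf (fun _ => 2) q := by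
  have hq0 : 0 < q := Nat.pos_of_ne_zero hq.ne_zero
  have hqr : (0 : ℝ) < q := by exact_mod_cast hq0
  have hL : 0 ≤ Real.log X := Real.log_nonneg hX
  have h2 : 1 ≤ pf (fun _ => (2 : ℝ)) q := one_le_pf (fun _ _ => by norm_num) q
  refine Estar_le hX fun x hx u => ?_
  have h3 := abs_sum_progression_le (φ := fun n => varpi n) (B := 1 + Real.log X) hq0 (u : ZMod q)
    hx.1 hx.2 hqX fun n h1 h2 => by
      rw [abs_of_nonneg (varpi_nonneg n)]
      exact (varpi_le_log n).trans (log_le_one_add_log hX h1 h2)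
  have h4 : |x / (Nat.totient q : ℝ)| ≤ X / q * pf (fun _ => 2) q := by
    have := one_div_totient_le hq
    rw [abs_of_nonneg (div_nonneg (by linarith [hx.1]) (Nat.cast_nonneg _)), div_eq_mul_one_div]
    calc _ ≤ X * (pf (fun _ => 2) q / q) :=
          mul_le_mul hx.2 this (by positivity) (by linarith)
      _ = _ := by ring
  have hXq : 0 ≤ X / q := by positivity
  unfold E
  refine (abs_sub _ _).trans ((add_le_add h3 h4).trans ?_)
  set U := 1 + Real.log X with hU
  have hU1 : 1 ≤ U := by linarith
  have a1 : 3 * (X / q) * U ≤ 3 * (X / q) * (U ^ 2 * pf (fun _ => 2) q) := by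
    gcongr; nlinarith
  have a2 : X / q * pf (fun _ => 2) q ≤ U ^ 2 * (X / q * pf (fun _ => 2) q) :=
    le_mul_of_one_le_left (by positivity) (one_le_pow₀ hU1)
  linarith

theorem E2star_trivial {X : ℝ} (hX : 1 ≤ X) {q : ℕ} (hq : Squarefree q) (hqX : (q : ℝ) ≤ X) :
    E2star X q ≤ (6 + |C0|) * (1 + Real.log X) ^ 2 * (X / q) * pf (fun _ => 2) q := by
  have hq0 : 0 < q := Nat.pos_of_ne_zero hq.ne_zero
  have hqr : (0 : ℝ) < q := by exact_mod_cast hq0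
  have hL : 0 ≤ Real.log X := Real.log_nonneg hX
  have h2 : 1 ≤ pf (fun _ => (2 : ℝ)) q := one_le_pf (fun _ _ => by norm_num) q
  refine E2star_le hX fun x hx u => ?_
  have h3 := abs_sum_progression_le (φ := fun n => varpi2 n) (B := (1 + Real.log X) ^ 2) hq0
    (u : ZMod q) hx.1 hx.2 hqX fun n h1 h2 => by
      rw [abs_of_nonneg (varpi2_nonneg n)]
      refine (varpi2_le_sq_log (by omega)).trans ?_
      exact pow_le_pow_left₀ (Real.log_natCast_nonneg n) (log_le_one_add_log hX h1 h2) 2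
  have h4 : |x / (Nat.totient q : ℝ)| ≤ X / q * pf (fun _ => 2) q := by
    have := one_div_totient_le hq
    rw [abs_of_nonneg (div_nonneg (by linarith [hx.1]) (Nat.cast_nonneg _)), div_eq_mul_one_div]
    calc _ ≤ X * (pf (fun _ => 2) q / q) :=
          mul_le_mul hx.2 this (by positivity) (by linarith)
      _ = _ := by ring
  have hs0 : 0 ≤ ∑ p ∈ q.primeFactors, Real.log p / p :=
    sum_nonneg fun p _ => div_nonneg (Real.log_natCast_nonneg p) (Nat.cast_nonneg p)
  have hs1 : ∑ p ∈ q.primeFactors, Real.log p / p ≤ Real.log X := by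
    calc _ ≤ ∑ p ∈ q.primeFactors, Real.log p := by
          refine sum_le_sum fun p hp => div_le_self (Real.log_natCast_nonneg p) ?_
          exact_mod_cast (Nat.prime_of_mem_primeFactors hp).one_le
      _ = Real.log q := sum_log_primeFactors hq
      _ ≤ _ := Real.log_le_log hqr hqX
  have hx0 : 0 ≤ Real.log x := Real.log_nonneg hx.1
  have hx1 : Real.log x ≤ Real.log X := Real.log_le_log (by linarith [hx.1]) hx.2
  have h5 : |Real.log x + C0 - 2 * ∑ p ∈ q.primeFactors, Real.log p / p|
      ≤ (3 + |C0|) * (1 + Real.log X) := by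
    have h6 := abs_nonneg C0
    have h7 := neg_abs_le C0
    have h8 := le_abs_self C0
    rw [abs_le]
    constructor <;> nlinarith
  have hXq : 0 ≤ X / q := by positivity
  unfold E2
  refine (abs_sub _ _).trans ?_
  rw [abs_mul]
  refine (add_le_add h3 (mul_le_mul h4 h5 (abs_nonneg _) (by positivity))).trans ?_
  set U := 1 + Real.log X with hU
  have hU1 : 1 ≤ U := by linarith
  have a1 : 3 * (X / q) * U ^ 2 ≤ 3 * (X / q) * (U ^ 2 * pf (fun _ => 2) q) := by
    gcongr; nlinarith [sq_nonneg U]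
  have a2 : X / q * pf (fun _ => 2) q * ((3 + |C0|) * U)
      ≤ X / q * pf (fun _ => 2) q * ((3 + |C0|) * U ^ 2) := by
    gcongr; nlinarith
  linarith

/-! ### Weighted sums of the error terms -/

theorem exists_sum_pf_div_le (c : ℕ) :
    ∃ C : ℝ, 0 < C ∧ ∀ X : ℝ, 1 ≤ X →
      ∑ q ∈ sqf ⌊X⌋₊, pf (fun _ => (c : ℝ)) q / q ≤ C * (1 + Real.log X) ^ c := by
  obtain ⟨C, hC, h⟩ := exists_sum_pf_le c 0 le_rfl
  refine ⟨C, hC, fun X hX => ?_⟩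
  have h1 := h (fun p => (c : ℝ) / p) (fun p _ => by positivity) (fun p _ => by simp)
    (Real.log X) (Real.log_nonneg hX)
  rw [Real.exp_log (by linarith)] at h1
  refine le_trans (le_of_eq (sum_congr rfl fun q hq => ?_)) h1
  conv_lhs => rw [← pf_natCast (mem_sqf.1 hq).2]
  unfold pf
  rw [prod_div_distrib]

/-- Cauchy–Schwarz splits c^{ω}F as (c^{2ω}F)^{1/2}·F^{1/2}. The trivial bound makes the first sum X
times a power of log X, and the Bombieri–Vinogradov hypothesis with a large exponent handles the
second. -/
theorem exists_weighted_sum_le {F : ℝ → ℕ → ℝ} (hF0 : ∀ X q, 0 ≤ F X q) {C : ℝ} (hC : 0 ≤ C)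
    (hF : ∀ X : ℝ, 1 ≤ X → ∀ q : ℕ, Squarefree q → (q : ℝ) ≤ X →
      F X q ≤ C * (1 + Real.log X) ^ 2 * (X / q) * pf (fun _ => 2) q)
    {τ : ℝ} (hτ : τ ≤ 1)
    (hBV : ∀ A : ℝ, 0 < A → (fun N : ℝ => ∑ q ∈ Icc 1 ⌊N ^ τ⌋₊, F N q)
      =O[Filter.atTop] (fun N : ℝ => N * Real.log N ^ (-A))) (c A : ℕ) :
    ∃ X₀ : ℝ, 1 ≤ X₀ ∧ ∀ X : ℝ, X₀ ≤ X →
      ∑ q ∈ sqf ⌊X ^ τ⌋₊, pf (fun _ => (c : ℝ)) q * F X q ≤ X / Real.log X ^ A := by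
  obtain ⟨C', hC', h1⟩ := exists_sum_pf_div_le (2 * c ^ 2)
  -- 2A for the square of the target, 2 + 2c² for the logarithms lost through the trivial bound, and
  -- one more to beat the constant D once log X ≥ D.
  set B : ℕ := 2 * A + 1 + (2 + 2 * c ^ 2) with hB
  obtain ⟨K, hK0, hK⟩ := (hBV B (by rw [hB]; positivity)).exists_pos
  rw [Asymptotics.isBigOWith_iff] at hK
  set D : ℝ := C * C' * 2 ^ (2 + 2 * c ^ 2) * K with hD
  have hev := hK.and ((Filter.eventually_ge_atTop (1 : ℝ)).and
    ((Real.tendsto_log_atTop.eventually_ge_atTop 1).and (Real.tendsto_log_atTop.eventually_ge_atTop D)))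
  obtain ⟨X₀, hX₀⟩ := Filter.eventually_atTop.1 hev
  refine ⟨max X₀ 1, le_max_right _ _, fun X hX => ?_⟩
  obtain ⟨hk, hX1, hl1, hlD⟩ := hX₀ X ((le_max_left _ _).trans hX)
  set L := Real.log X with hL
  have hL0 : 0 < L := by linarith
  have hXτ : X ^ τ ≤ X := by
    calc X ^ τ ≤ X ^ (1 : ℝ) := Real.rpow_le_rpow_of_exponent_le hX1 hτ
      _ = X := Real.rpow_one X
  have hsub : sqf ⌊X ^ τ⌋₊ ⊆ sqf ⌊X⌋₊ := fun q hq => by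
    rw [mem_sqf] at hq ⊢
    exact ⟨hq.1.trans (Nat.floor_le_floor hXτ), hq.2⟩
  have hcs := sum_sq_le_sum_mul_sum_of_sq_le_mul (sqf ⌊X ^ τ⌋₊)
    (r := fun q => pf (fun _ => (c : ℝ)) q * F X q)
    (f := fun q => pf (fun _ => (c : ℝ)) q ^ 2 * F X q) (g := fun q => F X q)
    (fun q _ => mul_nonneg (sq_nonneg _) (hF0 X q)) (fun q _ => hF0 X q) (fun q _ => le_of_eq (by ring))
  have s1 : ∑ q ∈ sqf ⌊X ^ τ⌋₊, pf (fun _ => (c : ℝ)) q ^ 2 * F X q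
      ≤ C * C' * X * (1 + L) ^ (2 + 2 * c ^ 2) := by
    calc _ ≤ ∑ q ∈ sqf ⌊X⌋₊, pf (fun _ => (c : ℝ)) q ^ 2 * F X q :=
          sum_le_sum_of_subset_of_nonneg hsub fun q _ _ => mul_nonneg (sq_nonneg _) (hF0 X q)
      _ ≤ ∑ q ∈ sqf ⌊X⌋₊, C * (1 + L) ^ 2 * X * (pf (fun _ => ((2 * c ^ 2 : ℕ) : ℝ)) q / q) := by
          refine sum_le_sum fun q hq => ?_
          obtain ⟨h2, h3⟩ := mem_sqf.1 hq
          have h4 : (q : ℝ) ≤ X := (Nat.le_floor_iff (by linarith)).1 h2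
          have h5 : pf (fun _ => ((2 * c ^ 2 : ℕ) : ℝ)) q
              = pf (fun _ => (c : ℝ)) q ^ 2 * pf (fun _ => 2) q := by
            rw [pow_two (pf (fun _ => (c : ℝ)) q), ← pf_mul_fun, ← pf_mul_fun]
            exact pf_congr fun _ _ _ => by push_cast; ring
          rw [h5]
          refine (mul_le_mul_of_nonneg_left (hF X hX1 q h3 h4) (sq_nonneg _)).trans (le_of_eq ?_)
          ring
      _ = C * (1 + L) ^ 2 * X * ∑ q ∈ sqf ⌊X⌋₊, pf (fun _ => ((2 * c ^ 2 : ℕ) : ℝ)) q / q :=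
          (mul_sum _ _ _).symm
      _ ≤ C * (1 + L) ^ 2 * X * (C' * (1 + L) ^ (2 * c ^ 2)) :=
          mul_le_mul_of_nonneg_left (h1 X hX1) (by positivity)
      _ = _ := by rw [pow_add]; ring
  have s2 : ∑ q ∈ sqf ⌊X ^ τ⌋₊, F X q ≤ K * (X / L ^ B) := by
    have h2 : ∑ q ∈ sqf ⌊X ^ τ⌋₊, F X q ≤ ∑ q ∈ Icc 1 ⌊X ^ τ⌋₊, F X q :=
      sum_le_sum_of_subset_of_nonneg (filter_subset _ _) fun q _ _ => hF0 X q
    rw [Real.norm_of_nonneg (sum_nonneg fun q _ => hF0 X q), Real.norm_of_nonneg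
      (mul_nonneg (by linarith) (Real.rpow_nonneg hL0.le _)), Real.rpow_neg hL0.le,
      Real.rpow_natCast] at hk
    exact h2.trans hk
  have s3 : (1 + L) ^ (2 + 2 * c ^ 2) ≤ 2 ^ (2 + 2 * c ^ 2) * L ^ (2 + 2 * c ^ 2) := by
    rw [← mul_pow]
    gcongr
    linarith
  have hr0 : 0 ≤ ∑ q ∈ sqf ⌊X ^ τ⌋₊, pf (fun _ => (c : ℝ)) q * F X q :=
    sum_nonneg fun q _ => mul_nonneg (pf_nonneg (fun _ _ => Nat.cast_nonneg c) q) (hF0 X q)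
  have hfin : (∑ q ∈ sqf ⌊X ^ τ⌋₊, pf (fun _ => (c : ℝ)) q * F X q) ^ 2 ≤ (X / L ^ A) ^ 2 := by
    refine hcs.trans ?_
    calc _ ≤ (C * C' * X * (1 + L) ^ (2 + 2 * c ^ 2)) * (K * (X / L ^ B)) :=
          mul_le_mul s1 s2 (sum_nonneg fun q _ => hF0 X q) (by positivity)
      _ ≤ (C * C' * X * (2 ^ (2 + 2 * c ^ 2) * L ^ (2 + 2 * c ^ 2))) * (K * (X / L ^ B)) := by gcongr
      _ = D * (X / L ^ A) ^ 2 / L := by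
          rw [hD, hB]
          field_simp
          ring
      _ ≤ L * (X / L ^ A) ^ 2 / L := by gcongr
      _ = _ := by field_simp
  exact abs_le_of_sq_le_sq' hfin (by positivity) |>.2


/-! ### The total error -/

theorem card_divisors_eq_pf {D : ℕ} (hD : Squarefree D) :
    (D.divisors.card : ℝ) = pf (fun _ => 2) D := by
  have h := sum_divisors_pf (fun _ => 1) hD
  have h1 : ∀ r, pf (fun _ => 1) r = 1 := fun r => by simp [pf]
  simp only [h1, sum_const, nsmul_eq_mul, mul_one] at h
  rw [h]
  exact pf_congr fun _ _ _ => by norm_num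

theorem pf_le_pf_of_dvd {c : ℝ} (hc : 1 ≤ c) {d D : ℕ} (hD : Squarefree D) (hd : d ∣ D) :
    pf (fun _ => c) d ≤ pf (fun _ => c) D := by
  rw [pf_div _ hD hd]
  exact le_mul_of_one_le_right (pf_nonneg (fun _ _ => by linarith) d) (one_le_pf (fun _ _ => hc) _)

/-- At most d(D)² = 4^{ω(D)} pairs have least common multiple D, and both weights are at most
c^{ω(D)}. The primes of D stay bounded by M, which keeps X/p large later. -/
theorem sum_sum_lcm_le {c : ℝ} (hc : 1 ≤ c) {G : ℕ → ℝ} (hG : ∀ D, 0 ≤ G D) (M : ℕ) :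
    ∑ d ∈ sqf M, ∑ e ∈ sqf M, pf (fun _ => c) d * pf (fun _ => c) e * G (Nat.lcm d e)
      ≤ ∑ D ∈ (sqf (M * M)).filter (fun D => ∀ p ∈ D.primeFactors, p ≤ M),
        pf (fun _ => 4 * c ^ 2) D * G D := by
  rw [← sum_product']
  rw [← sum_fiberwise_of_maps_to (s := sqf M ×ˢ sqf M)
    (t := (sqf (M * M)).filter (fun D => ∀ p ∈ D.primeFactors, p ≤ M))
    (g := fun z : ℕ × ℕ => Nat.lcm z.1 z.2)]
  · refine sum_le_sum fun D hD => ?_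
    have hDs := (mem_sqf.1 (mem_filter.1 hD).1).2
    have hp0 : 0 ≤ pf (fun _ => c) D := pf_nonneg (fun _ _ => by linarith) D
    calc _ ≤ ∑ z ∈ (sqf M ×ˢ sqf M).filter (fun z : ℕ × ℕ => Nat.lcm z.1 z.2 = D),
          pf (fun _ => c) D * pf (fun _ => c) D * G D := by
          refine sum_le_sum fun z hz => ?_
          have h1 := (mem_filter.1 hz).2
          rw [h1]
          have h2 := pf_le_pf_of_dvd hc hDs (h1 ▸ Nat.dvd_lcm_left z.1 z.2)
          have h3 := pf_le_pf_of_dvd hc hDs (h1 ▸ Nat.dvd_lcm_right z.1 z.2)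
          have h4 : 0 ≤ pf (fun _ => c) z.2 := pf_nonneg (fun _ _ => by linarith) _
          have h5 := hG D
          gcongr
      _ = (((sqf M ×ˢ sqf M).filter (fun z : ℕ × ℕ => Nat.lcm z.1 z.2 = D)).card : ℝ) *
          (pf (fun _ => c) D * pf (fun _ => c) D * G D) := by rw [sum_const, nsmul_eq_mul]
      _ ≤ (pf (fun _ => 2) D * pf (fun _ => 2) D) *
          (pf (fun _ => c) D * pf (fun _ => c) D * G D) := by
          refine mul_le_mul_of_nonneg_right ?_ (mul_nonneg (mul_nonneg hp0 hp0) (hG D))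
          rw [← card_divisors_eq_pf hDs, ← Nat.cast_mul, ← card_product]
          refine Nat.cast_le.2 (card_le_card fun z hz => ?_)
          have h1 := (mem_filter.1 hz).2
          rw [mem_product, Nat.mem_divisors, Nat.mem_divisors]
          exact ⟨⟨h1 ▸ Nat.dvd_lcm_left z.1 z.2, hDs.ne_zero⟩,
            ⟨h1 ▸ Nat.dvd_lcm_right z.1 z.2, hDs.ne_zero⟩⟩
      _ = _ := by
          have : pf (fun _ => 4 * c ^ 2) D = pf (fun _ => 2) D * pf (fun _ => 2) D *
              (pf (fun _ => c) D * pf (fun _ => c) D) := by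
            rw [← pf_mul_fun, ← pf_mul_fun, ← pf_mul_fun]
            exact pf_congr fun _ _ _ => by ring
          rw [this]
          ring
  · intro z hz
    obtain ⟨h1, h2⟩ := mem_product.1 hz
    have h3 := squarefree_lcm (mem_sqf.1 h1).2 (mem_sqf.1 h2).2
    refine mem_filter.2 ⟨mem_sqf.2 ⟨?_, h3⟩, fun p hp => le_of_mem_primeFactors_lcm h1 h2 hp⟩
    refine (Nat.le_of_dvd ?_ (Nat.lcm_dvd_mul z.1 z.2)).trans
      (Nat.mul_le_mul (mem_sqf.1 h1).1 (mem_sqf.1 h2).1)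
    exact Nat.pos_of_ne_zero (mul_ne_zero (mem_sqf.1 h1).2.ne_zero (mem_sqf.1 h2).2.ne_zero)

theorem progressionError_nonneg (X : ℝ) (D : ℕ) : 0 ≤ progressionError X D := by
  refine add_nonneg (E2star_nonneg _ _) (sum_nonneg fun p _ => ?_)
  have := Real.log_natCast_nonneg p
  exact mul_nonneg (by linarith) (Estar_nonneg _ _)

/-- Write D = pm. The constraint pm ≤ M² is retained because the modulus m must be small relative to
X/p, not merely to X. -/
theorem sum_progressionError_le {c : ℝ} (hc : 0 ≤ c) (X : ℝ) (M : ℕ) :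
    ∑ D ∈ (sqf (M * M)).filter (fun D => ∀ p ∈ D.primeFactors, p ≤ M),
        pf (fun _ => c) D * progressionError X D
      ≤ ∑ D ∈ sqf (M * M), pf (fun _ => c) D * E2star X D
        + ∑ p ∈ pr M, 2 * c * Real.log p *
          ∑ m ∈ (sqf (M * M)).filter (fun m => p * m ≤ M * M), pf (fun _ => c) m * Estar (X / p) m := by
  have hpc : ∀ D, 0 ≤ pf (fun _ => c) D := pf_nonneg fun _ _ => hc
  have e1 : ∀ D, pf (fun _ => c) D * progressionError X D = pf (fun _ => c) D * E2star X D
      + pf (fun _ => c) D * ∑ p ∈ D.primeFactors, 2 * Real.log p * Estar (X / p) (D / p) :=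
    fun D => mul_add _ _ _
  simp_rw [e1]
  rw [sum_add_distrib]
  refine add_le_add (sum_le_sum_of_subset_of_nonneg (filter_subset _ _)
    fun D _ _ => mul_nonneg (hpc D) (E2star_nonneg _ _)) ?_
  set G : ℕ → ℕ → ℝ := fun p m => if p ≤ M then
    2 * c * Real.log p * (pf (fun _ => c) m * Estar (X / p) m) else 0 with hG
  have hG0 : ∀ p m, 0 ≤ G p m := by
    intro p m
    have := Real.log_natCast_nonneg p
    have := hpc m
    have := Estar_nonneg (X / p) m
    simp only [hG]
    split_ifs <;> positivity
  calc _ ≤ ∑ D ∈ (sqf (M * M)).filter (fun D => ∀ p ∈ D.primeFactors, p ≤ M),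
        ∑ p ∈ D.primeFactors, G p (D / p) := by
        refine sum_le_sum fun D hD => ?_
        obtain ⟨h1, h2⟩ := mem_filter.1 hD
        rw [mul_sum]
        refine sum_le_sum fun p hp => le_of_eq ?_
        simp only [hG]
        rw [if_pos (h2 p hp), pf_div _ (mem_sqf.1 h1).2 (Nat.dvd_of_mem_primeFactors hp),
          pf_prime _ (Nat.prime_of_mem_primeFactors hp)]
        ring
    _ ≤ ∑ D ∈ sqf (M * M), ∑ p ∈ D.primeFactors, G p (D / p) :=
        sum_le_sum_of_subset_of_nonneg (filter_subset _ _)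
          fun D _ _ => sum_nonneg fun p _ => hG0 _ _
    _ = ∑ m ∈ sqf (M * M), ∑ p ∈ (pr (M * M)).filter (fun p => ¬ p ∣ m ∧ p * m ≤ M * M), G p m :=
        sum_sqf_sum_primeFactors (M * M) G
    _ ≤ ∑ m ∈ sqf (M * M), ∑ p ∈ (pr M).filter (fun p => p * m ≤ M * M), G p m := by
        refine sum_le_sum fun m _ => ?_
        have h1 : ∑ p ∈ (pr (M * M)).filter (fun p => ¬ p ∣ m ∧ p * m ≤ M * M), G p m
            = ∑ p ∈ ((pr (M * M)).filter (fun p => ¬ p ∣ m ∧ p * m ≤ M * M)).filter (fun p => p ≤ M),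
              G p m := by
          symm
          refine sum_subset (filter_subset _ _) fun p hp hp' => ?_
          have : ¬ p ≤ M := fun h => hp' (mem_filter.2 ⟨hp, h⟩)
          simp only [hG]
          rw [if_neg this]
        rw [h1]
        refine sum_le_sum_of_subset_of_nonneg (fun p hp => ?_) fun p _ _ => hG0 p m
        obtain ⟨h2, h3⟩ := mem_filter.1 hp
        obtain ⟨h4, _, h5⟩ := mem_filter.1 h2
        exact mem_filter.2 ⟨mem_pr.2 ⟨h3, (mem_pr.1 h4).2⟩, h5⟩
    _ = ∑ p ∈ pr M, ∑ m ∈ (sqf (M * M)).filter (fun m => p * m ≤ M * M), G p m := by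
        refine sum_comm' fun m p => ?_
        simp only [mem_filter]
        tauto
    _ = _ := by
        refine sum_congr rfl fun p hp => ?_
        rw [mul_sum]
        refine sum_congr rfl fun m _ => ?_
        simp only [hG]
        rw [if_pos (mem_pr.1 hp).1]

/-- The moduli satisfy [d,e] ≤ R² ≤ N^τ. Apply the weighted bound for E₂ at 2N and that for E at
2N/p for every p ≤ R; the average over p costs one logarithm by Mertens. -/
theorem exists_error_sum_le {τ : ℝ} (hτ0 : 0 < τ) (hτ : τ ≤ 1)
    (hBV : ∀ A : ℝ, 0 < A → (fun N : ℝ => ∑ q ∈ Icc 1 ⌊N ^ τ⌋₊, Estar N q)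
      =O[Filter.atTop] (fun N : ℝ => N * Real.log N ^ (-A)))
    (hBV2 : ∀ A : ℝ, 0 < A → (fun N : ℝ => ∑ q ∈ Icc 1 ⌊N ^ τ⌋₊, E2star N q)
      =O[Filter.atTop] (fun N : ℝ => N * Real.log N ^ (-A))) (k A : ℕ) :
    ∃ N₀ : ℝ, ∀ N : ℝ, N₀ ≤ N → ∀ R : ℝ, 1 ≤ R → R ≤ N ^ (τ / 2) →
      ∑ d ∈ sqf ⌊R⌋₊, ∑ e ∈ sqf ⌊R⌋₊, pf (fun _ => (k : ℝ) + 1) d * pf (fun _ => (k : ℝ) + 1) e *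
        (pf (fun _ => (k : ℝ)) (Nat.lcm d e) * progressionError (2 * N) (Nat.lcm d e))
        ≤ N / Real.log N ^ A := by
  -- From the pair count together with the two weights (k+1)^{ω}, times k^{ω} for the number of
  -- residue classes.
  set c : ℕ := 4 * (k + 1) ^ 2 * k with hc
  obtain ⟨X₁, hX₁, h1⟩ := exists_weighted_sum_le Estar_nonneg (by norm_num)
    (fun X hX q hq hqX => Estar_trivial hX hq hqX) hτ hBV c (A + 2)
  obtain ⟨X₂, hX₂, h2⟩ := exists_weighted_sum_le E2star_nonneg (by positivity)
    (fun X hX q hq hqX => E2star_trivial hX hq hqX) hτ hBV2 c (A + 1)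
  obtain ⟨C, hC, h3⟩ := exists_mertens
  set D : ℝ := 2 + 4 * c * 2 ^ (A + 2) * (1 + C) with hD
  -- The threshold X₁² suits all p at once: p ≤ R ≤ √N gives 2N/p ≥ √N ≥ X₁. The condition log N ≥ D
  -- spends one logarithm on the constants.
  have hev := (Filter.eventually_ge_atTop (1 : ℝ)).and
    ((Real.tendsto_log_atTop.eventually_ge_atTop 1).and
      ((Real.tendsto_log_atTop.eventually_ge_atTop D).and
      ((Filter.eventually_ge_atTop X₂).and (Filter.eventually_ge_atTop (X₁ ^ 2)))))
  obtain ⟨N₀, hN₀⟩ := Filter.eventually_atTop.1 hev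
  refine ⟨N₀, fun N hN R hR hRN => ?_⟩
  obtain ⟨hN1, hl1, hlD, hNX2, hNX1⟩ := hN₀ N hN
  set L := Real.log N with hL
  have hN0 : 0 < N := by linarith
  set M := ⌊R⌋₊ with hM
  have hMR : (M : ℝ) ≤ R := Nat.floor_le (by linarith)
  have hMM : ((M * M : ℕ) : ℝ) ≤ N ^ τ := by
    push_cast
    calc (M : ℝ) * M ≤ N ^ (τ / 2) * N ^ (τ / 2) :=
          mul_le_mul (hMR.trans hRN) (hMR.trans hRN) (Nat.cast_nonneg _) (by positivity)
      _ = N ^ τ := by rw [← Real.rpow_add hN0]; congr 1; ring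
  have hMhalf : (M : ℝ) ≤ N ^ (1 / 2 : ℝ) :=
    (hMR.trans hRN).trans (Real.rpow_le_rpow_of_exponent_le hN1 (by linarith))
  have hpk0 : ∀ D, 0 ≤ pf (fun _ => (k : ℝ)) D := pf_nonneg fun _ _ => Nat.cast_nonneg k
  have hstep := sum_sum_lcm_le (c := (k : ℝ) + 1) (by linarith [Nat.cast_nonneg (α := ℝ) k])
    (G := fun D => pf (fun _ => (k : ℝ)) D * progressionError (2 * N) D)
    (fun D => mul_nonneg (hpk0 D) (progressionError_nonneg _ _)) M
  have hcc : ∀ D, pf (fun _ => 4 * ((k : ℝ) + 1) ^ 2) D * (pf (fun _ => (k : ℝ)) D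
      * progressionError (2 * N) D) = pf (fun _ => (c : ℝ)) D * progressionError (2 * N) D := by
    intro D
    rw [← mul_assoc, ← pf_mul_fun]
    congr 1
    exact pf_congr fun _ _ _ => by rw [hc]; push_cast; ring
  simp_rw [hcc] at hstep
  refine hstep.trans ((sum_progressionError_le (Nat.cast_nonneg c) (2 * N) M).trans ?_)
  have hpc : ∀ D, 0 ≤ pf (fun _ => (c : ℝ)) D := pf_nonneg fun _ _ => Nat.cast_nonneg c
  have b1 : ∑ D ∈ sqf (M * M), pf (fun _ => (c : ℝ)) D * E2star (2 * N) D ≤ 2 * N / L ^ (A + 1) := by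
    have h4 := h2 (2 * N) (by linarith)
    have h5 : ∑ D ∈ sqf (M * M), pf (fun _ => (c : ℝ)) D * E2star (2 * N) D
        ≤ ∑ D ∈ sqf ⌊(2 * N) ^ τ⌋₊, pf (fun _ => (c : ℝ)) D * E2star (2 * N) D := by
      refine sum_le_sum_of_subset_of_nonneg (fun q hq => ?_)
        fun q _ _ => mul_nonneg (hpc q) (E2star_nonneg _ _)
      obtain ⟨h6, h7⟩ := mem_sqf.1 hq
      refine mem_sqf.2 ⟨Nat.le_floor ?_, h7⟩
      have h8 : (q : ℝ) ≤ ((M * M : ℕ) : ℝ) := by exact_mod_cast h6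
      exact (h8.trans hMM).trans (Real.rpow_le_rpow hN0.le (by linarith) hτ0.le)
    refine h5.trans (h4.trans ?_)
    have h6 : L ≤ Real.log (2 * N) := Real.log_le_log hN0 (by linarith)
    gcongr
  have b2 : ∀ p ∈ pr M, ∑ m ∈ (sqf (M * M)).filter (fun m => p * m ≤ M * M),
      pf (fun _ => (c : ℝ)) m * Estar (2 * N / p) m ≤ 2 * N / p / (L / 2) ^ (A + 2) := by
    intro p hp
    obtain ⟨hpM, hpp⟩ := mem_pr.1 hp
    have hp0 : (0 : ℝ) < p := by exact_mod_cast hpp.pos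
    have hp1 : (1 : ℝ) ≤ p := by exact_mod_cast hpp.one_le
    have hpM' : (p : ℝ) ≤ N ^ (1 / 2 : ℝ) := le_trans (by exact_mod_cast hpM) hMhalf
    have hXp : N ^ (1 / 2 : ℝ) ≤ 2 * N / p := by
      rw [le_div_iff₀ hp0]
      calc N ^ (1 / 2 : ℝ) * p ≤ N ^ (1 / 2 : ℝ) * N ^ (1 / 2 : ℝ) := by gcongr
        _ = N := by rw [← Real.rpow_add hN0]; norm_num
        _ ≤ 2 * N := by linarith
    have hX1N : X₁ ≤ N ^ (1 / 2 : ℝ) := by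
      rw [← Real.sqrt_eq_rpow]
      exact Real.le_sqrt_of_sq_le hNX1
    have hlog : L / 2 ≤ Real.log (2 * N / p) := by
      have h6 : Real.log (N ^ (1 / 2 : ℝ)) ≤ Real.log (2 * N / p) :=
        Real.log_le_log (by positivity) hXp
      rw [Real.log_rpow hN0] at h6
      linarith
    have h4 := h1 (2 * N / p) (hX1N.trans hXp)
    have h5 : ∑ m ∈ (sqf (M * M)).filter (fun m => p * m ≤ M * M),
          pf (fun _ => (c : ℝ)) m * Estar (2 * N / p) m
        ≤ ∑ m ∈ sqf ⌊(2 * N / p) ^ τ⌋₊, pf (fun _ => (c : ℝ)) m * Estar (2 * N / p) m := by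
      refine sum_le_sum_of_subset_of_nonneg (fun m hm => ?_)
        fun m _ _ => mul_nonneg (hpc m) (Estar_nonneg _ _)
      obtain ⟨h6, h7⟩ := mem_filter.1 hm
      refine mem_sqf.2 ⟨Nat.le_floor ?_, (mem_sqf.1 h6).2⟩
      -- Since τ ≤ 1 implies p^τ ≤ p, the bound pm ≤ N^τ gives m ≤ (N/p)^τ, within the range of the
      -- hypothesis at 2N/p.
      have h8 : (p : ℝ) * m ≤ N ^ τ := le_trans (by exact_mod_cast h7) hMM
      have h9 : (p : ℝ) ^ τ ≤ p := by
        calc (p : ℝ) ^ τ ≤ (p : ℝ) ^ (1 : ℝ) := Real.rpow_le_rpow_of_exponent_le hp1 hτ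
          _ = p := Real.rpow_one _
      have h10 : (m : ℝ) * (p : ℝ) ^ τ ≤ N ^ τ := by
        have : (m : ℝ) * (p : ℝ) ^ τ ≤ m * p := by gcongr
        linarith
      calc (m : ℝ) ≤ N ^ τ / (p : ℝ) ^ τ := (le_div_iff₀ (by positivity)).2 h10
        _ = (N / p) ^ τ := (Real.div_rpow hN0.le hp0.le τ).symm
        _ ≤ (2 * N / p) ^ τ := by
            refine Real.rpow_le_rpow (by positivity) ?_ hτ0.le
            gcongr; linarith
    refine h5.trans (h4.trans ?_)
    gcongr
  have b3 : ∑ p ∈ pr M, 2 * (c : ℝ) * Real.log p *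
      ∑ m ∈ (sqf (M * M)).filter (fun m => p * m ≤ M * M), pf (fun _ => (c : ℝ)) m * Estar (2 * N / p) m
      ≤ 4 * c * 2 ^ (A + 2) * (1 + C) * N / L ^ (A + 1) := by
    have hs : ∑ p ∈ pr M, Real.log p / p ≤ (1 + C) * L := by
      have h4 := (abs_le.1 (h3 (Real.log R) (Real.log_nonneg hR))).2
      rw [Real.exp_log (by linarith)] at h4
      have h5 : Real.log R ≤ L := by
        refine Real.log_le_log (by linarith) (hRN.trans ?_)
        calc N ^ (τ / 2) ≤ N ^ (1 : ℝ) := Real.rpow_le_rpow_of_exponent_le hN1 (by linarith)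
          _ = N := Real.rpow_one N
      nlinarith
    calc _ ≤ ∑ p ∈ pr M, 2 * (c : ℝ) * Real.log p * (2 * N / p / (L / 2) ^ (A + 2)) := by
          refine sum_le_sum fun p hp => mul_le_mul_of_nonneg_left (b2 p hp) ?_
          have := Real.log_natCast_nonneg p
          positivity
      _ = 4 * c * 2 ^ (A + 2) * N / L ^ (A + 2) * ∑ p ∈ pr M, Real.log p / p := by
          rw [mul_sum]
          refine sum_congr rfl fun p _ => ?_
          rw [div_pow]
          field_simp
          ring
      _ ≤ 4 * c * 2 ^ (A + 2) * N / L ^ (A + 2) * ((1 + C) * L) := by gcongr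
      _ = _ := by
          rw [pow_succ L (A + 1)]
          field_simp
  calc _ ≤ 2 * N / L ^ (A + 1) + 4 * c * 2 ^ (A + 2) * (1 + C) * N / L ^ (A + 1) := add_le_add b1 b3
    _ = D * (N / L ^ (A + 1)) := by rw [hD]; ring
    _ ≤ L * (N / L ^ (A + 1)) := by gcongr
    _ = N / L ^ A := by
        rw [pow_succ]
        field_simp


/-! ### Reduction of the sieve sum to the two forms -/

theorem abs_sum_Ioc_sub_sum_Ioc_le {φ : ℕ → ℝ} {B : ℝ} (hφ : ∀ n, 0 ≤ φ n) {a b c n : ℕ}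
    (hab : a ≤ b) (hac : a ≤ c) (hbn : b ≤ n) (hcn : c ≤ n) (hB : ∀ m, 1 ≤ m → m ≤ n → φ m ≤ B) :
    |∑ m ∈ Ioc a b, φ m - ∑ m ∈ Ioc a c, φ m| ≤ |(b : ℝ) - c| * B := by
  have key : ∀ b c : ℕ, a ≤ b → b ≤ c → c ≤ n →
      |∑ m ∈ Ioc a b, φ m - ∑ m ∈ Ioc a c, φ m| ≤ |(b : ℝ) - c| * B := by
    intro b c h1 h2 h3
    have h4 : ∑ m ∈ Ioc a c, φ m = ∑ m ∈ Ioc a b, φ m + ∑ m ∈ Ioc b c, φ m := by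
      rw [← sum_union]
      · rw [Ioc_union_Ioc_eq_Ioc h1 h2]
      · rw [disjoint_left]
        intro m hm hm'
        exact absurd (mem_Ioc.1 hm).2 (not_le.2 (mem_Ioc.1 hm').1)
    have h5 : (b : ℝ) ≤ c := by exact_mod_cast h2
    rw [h4, sub_add_cancel_left, abs_neg, abs_of_nonneg (sum_nonneg fun m _ => hφ m),
      abs_of_nonpos (by linarith), neg_sub]
    calc _ ≤ ∑ m ∈ Ioc b c, B := sum_le_sum fun m hm => by
            obtain ⟨h6, h7⟩ := mem_Ioc.1 hm
            exact hB m (by omega) (by omega)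
      _ = _ := by rw [sum_const, Nat.card_Ioc, nsmul_eq_mul, Nat.cast_sub h2]
  rcases le_total b c with h | h
  · exact key b c hab h hcn
  · rw [abs_sub_comm, abs_sub_comm (b : ℝ)]
    exact key c b hac h hbn

theorem sum_shift_eq (H : Finset ℤ) (h₀ : ℤ) (D : ℕ) {N : ℝ} (hN : 0 ≤ N) (hx : 0 ≤ N + h₀) :
    ∑ n ∈ (Ioc ⌊N⌋₊ ⌊2 * N⌋₊).filter (fun n : ℕ => (D : ℤ) ∣ P (n : ℤ) H),
        varpi2 ((n : ℤ) + h₀).toNat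
      = ∑ m ∈ (Ioc ⌊N + h₀⌋₊ ⌊2 * N + h₀⌋₊).filter (fun m : ℕ => (D : ℤ) ∣ P ((m : ℤ) - h₀) H),
        varpi2 m := by
  have hx2 : 0 ≤ 2 * N + h₀ := by linarith
  refine sum_bij' (fun n _ => ((n : ℤ) + h₀).toNat) (fun m _ => ((m : ℤ) - h₀).toNat) ?_ ?_ ?_ ?_ ?_
  · intro n hn
    obtain ⟨h1, h2⟩ := mem_filter.1 hn
    obtain ⟨h3, h4⟩ := (mem_Ioc_floor hN).1 h1
    have h5 : 0 ≤ (n : ℤ) + h₀ := by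
      have : (0 : ℝ) ≤ (n : ℝ) + h₀ := by linarith
      exact_mod_cast this
    have h6 : ((((n : ℤ) + h₀).toNat : ℤ)) = (n : ℤ) + h₀ := Int.toNat_of_nonneg h5
    have h7 : ((((n : ℤ) + h₀).toNat : ℝ)) = (n : ℝ) + h₀ := by exact_mod_cast h6
    rw [mem_filter, h6, add_sub_cancel_right, mem_Ioc, Nat.floor_lt hx, Nat.le_floor_iff hx2, h7]
    exact ⟨⟨by linarith, by linarith⟩, h2⟩
  · intro m hm
    obtain ⟨h1, h2⟩ := mem_filter.1 hm
    rw [mem_Ioc, Nat.floor_lt hx, Nat.le_floor_iff hx2] at h1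
    have h5 : 0 ≤ (m : ℤ) - h₀ := by
      have : (0 : ℝ) ≤ (m : ℝ) - h₀ := by linarith
      exact_mod_cast this
    have h6 : ((((m : ℤ) - h₀).toNat : ℤ)) = (m : ℤ) - h₀ := Int.toNat_of_nonneg h5
    have h7 : ((((m : ℤ) - h₀).toNat : ℝ)) = (m : ℝ) - h₀ := by exact_mod_cast h6
    rw [mem_filter, h6, mem_Ioc_floor hN, h7]
    exact ⟨⟨by linarith, by linarith⟩, h2⟩
  · intro n hn
    obtain ⟨h1, h2⟩ := mem_filter.1 hn
    obtain ⟨h3, h4⟩ := (mem_Ioc_floor hN).1 h1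
    have h5 : 0 ≤ (n : ℤ) + h₀ := by
      have : (0 : ℝ) ≤ (n : ℝ) + h₀ := by linarith
      exact_mod_cast this
    simp only [Int.toNat_of_nonneg h5]
    omega
  · intro m hm
    obtain ⟨h1, h2⟩ := mem_filter.1 hm
    rw [mem_Ioc, Nat.floor_lt hx, Nat.le_floor_iff hx2] at h1
    have h5 : 0 ≤ (m : ℤ) - h₀ := by
      have : (0 : ℝ) ≤ (m : ℝ) - h₀ := by linarith
      exact_mod_cast this
    simp only [Int.toNat_of_nonneg h5]
    omega
  · intro n _
    rfl

/-- Shifting n by h₀ gives the interval (N + h₀, 2N + h₀], whereas the hypotheses concern (x, 2x]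
with x = N + h₀. The two differ in at most 2 log N integers, each carrying at most (3 log N)². -/
theorem abs_sum_shift_sub_le {H : Finset ℤ} {h₀ : ℤ} (D : ℕ) {N : ℝ}
    (hl1 : 1 ≤ Real.log N) (hlN : Real.log N ≤ N / 2) (hh : |(h₀ : ℝ)| ≤ Real.log N) :
    |∑ n ∈ (Ioc ⌊N⌋₊ ⌊2 * N⌋₊).filter (fun n : ℕ => (D : ℤ) ∣ P (n : ℤ) H),
        varpi2 ((n : ℤ) + h₀).toNat
      - ∑ m ∈ (Ioc ⌊N + h₀⌋₊ ⌊2 * (N + h₀)⌋₊).filter (fun m : ℕ => (D : ℤ) ∣ P ((m : ℤ) - h₀) H),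
        varpi2 m| ≤ 18 * Real.log N ^ 3 := by
  set L := Real.log N with hL
  obtain ⟨ha, hb⟩ := abs_le.1 hh
  rw [sum_shift_eq H h₀ D (by linarith) (by linarith), sum_filter, sum_filter]
  have hN0 : 0 < N := by linarith
  have h4N : 0 ≤ 4 * N := by linarith
  have h1 := abs_sum_Ioc_sub_sum_Ioc_le
    (φ := fun m : ℕ => if (D : ℤ) ∣ P ((m : ℤ) - h₀) H then varpi2 m else 0) (B := (3 * L) ^ 2)
    (a := ⌊N + h₀⌋₊) (b := ⌊2 * N + h₀⌋₊) (c := ⌊2 * (N + h₀)⌋₊) (n := ⌊4 * N⌋₊)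
    (fun m => by
      split_ifs
      · exact varpi2_nonneg m
      · exact le_rfl)
    (Nat.floor_le_floor (by linarith)) (Nat.floor_le_floor (by linarith))
    (Nat.floor_le_floor (by linarith)) (Nat.floor_le_floor (by linarith))
    (fun m hm1 hm2 => by
      have h2 : varpi2 m ≤ (3 * L) ^ 2 := by
        refine (varpi2_le_sq_log (by omega)).trans ?_
        refine pow_le_pow_left₀ (Real.log_natCast_nonneg m) ?_ 2
        have h3 : (m : ℝ) ≤ 4 * N := (Nat.le_floor_iff h4N).1 hm2
        have h4 : Real.log m ≤ Real.log (2 * (2 * N)) :=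
          Real.log_le_log (by exact_mod_cast hm1) (by linarith)
        rw [Real.log_mul (by norm_num) (by linarith), Real.log_mul (by norm_num) (by linarith)] at h4
        have := Real.log_two_lt_d9
        linarith
      split_ifs
      · exact h2
      · positivity)
  refine h1.trans ?_
  have h5 : |((⌊2 * N + h₀⌋₊ : ℕ) : ℝ) - (⌊2 * (N + h₀)⌋₊ : ℕ)| ≤ 2 * L := by
    have f1 := Nat.floor_le (show 0 ≤ 2 * N + h₀ by linarith)
    have f2 := Nat.lt_floor_add_one (2 * N + h₀)
    have f3 := Nat.floor_le (show 0 ≤ 2 * (N + h₀) by linarith)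
    have f4 := Nat.lt_floor_add_one (2 * (N + h₀))
    rw [abs_le]
    constructor <;> linarith
  calc _ ≤ 2 * L * (3 * L) ^ 2 := by gcongr
    _ = _ := by ring

theorem eventually_log_pow_mul_rpow_le {τ : ℝ} (hτ : τ < 1) (K : ℝ) (j : ℕ) :
    ∀ᶠ N : ℝ in Filter.atTop, K * Real.log N ^ j * N ^ τ ≤ N / 4 := by
  have h := (isLittleO_log_rpow_rpow_atTop (s := 1 - τ) (j : ℝ) (by linarith)).bound
    (c := 1 / (4 * (|K| + 1))) (by positivity)
  filter_upwards [h, Filter.eventually_ge_atTop (1 : ℝ)] with N h1 hN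
  have hN0 : 0 < N := by linarith
  have hl : 0 ≤ Real.log N := Real.log_nonneg hN
  rw [Real.rpow_natCast, Real.norm_of_nonneg (by positivity), Real.norm_of_nonneg (by positivity)] at h1
  have h2 : N ^ (1 - τ) * N ^ τ = N := by
    rw [← Real.rpow_add hN0]; simp
  calc K * Real.log N ^ j * N ^ τ ≤ (|K| + 1) * Real.log N ^ j * N ^ τ := by
        gcongr
        linarith [le_abs_self K]
    _ ≤ (|K| + 1) * (1 / (4 * (|K| + 1)) * N ^ (1 - τ)) * N ^ τ := by gcongr
    _ = (1 / 4) * (N ^ (1 - τ) * N ^ τ) := by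
        field_simp
    _ = N / 4 := by rw [h2]; ring

theorem exists_sum_pf_const_le (c : ℕ) :
    ∃ C : ℝ, 0 < C ∧ ∀ R : ℝ, 1 ≤ R →
      ∑ q ∈ sqf ⌊R⌋₊, pf (fun _ => (c : ℝ)) q ≤ C * R * (1 + Real.log R) ^ c := by
  obtain ⟨C, hC, h⟩ := exists_sum_pf_div_le c
  refine ⟨C, hC, fun R hR => ?_⟩
  have hp : ∀ q, 0 ≤ pf (fun _ => (c : ℝ)) q := pf_nonneg fun _ _ => Nat.cast_nonneg c
  calc _ ≤ ∑ q ∈ sqf ⌊R⌋₊, R * (pf (fun _ => (c : ℝ)) q / q) := by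
        refine sum_le_sum fun q hq => ?_
        obtain ⟨h1, h2⟩ := mem_sqf.1 hq
        have h3 : (q : ℝ) ≤ R := (Nat.le_floor_iff (by linarith)).1 h1
        have h4 : (0 : ℝ) < q := by exact_mod_cast Nat.pos_of_ne_zero h2.ne_zero
        rw [← mul_div_assoc, le_div_iff₀ h4, mul_comm]
        exact mul_le_mul_of_nonneg_right h3 (hp q)
    _ = R * ∑ q ∈ sqf ⌊R⌋₊, pf (fun _ => (c : ℝ)) q / q := (mul_sum _ _ _).symm
    _ ≤ R * (C * (1 + Real.log R) ^ c) := mul_le_mul_of_nonneg_left (h R hR) (by linarith)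
    _ = _ := by ring

/-- Insert the evaluation of each inner sum into the expanded weights, bounding the coefficients by
a power of log N times (k+1)^{ω}. The progression errors and the boundary errors from the shift each
cost at most N/4; the latter because there are R² ≤ N^τ of them up to logarithms, with τ < 1. -/
theorem exists_sieveSum_approx {k : ℕ} (hk2 : 2 ≤ k) {τ : ℝ} (hτ0 : 0 < τ) (hτ : τ < 1)
    (hBV : ∀ A : ℝ, 0 < A → (fun N : ℝ => ∑ q ∈ Icc 1 ⌊N ^ τ⌋₊, Estar N q)
      =O[Filter.atTop] (fun N : ℝ => N * Real.log N ^ (-A)))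
    (hBV2 : ∀ A : ℝ, 0 < A → (fun N : ℝ => ∑ q ∈ Icc 1 ⌊N ^ τ⌋₊, E2star N q)
      =O[Filter.atTop] (fun N : ℝ => N * Real.log N ^ (-A))) :
    ∃ N₀ : ℝ, ∀ N : ℝ, N₀ ≤ N → ∀ R : ℝ, 1 ≤ R → R ≤ N ^ (τ / 2) →
      ∀ H : Finset ℤ, H.card = k → Admissible H → (∀ h ∈ H, |(h : ℝ)| ≤ Real.log N) →
      ∀ h₀ ∈ H, ∀ ℓ₁ ℓ₂ : ℕ, ℓ₁ ≤ k → ℓ₂ ≤ k →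
      |sieveSum N R H h₀ ℓ₁ ℓ₂ - singularSeries H ^ 2 *
        ((N + h₀) * (Real.log (N + h₀) + C0) * qform (fH H) (wH H) (gH H) R ℓ₁ ℓ₂
          + 2 * (N + h₀) * ∑ p ∈ pr ⌊R⌋₊, Real.log p / p *
            (qform (fH H) (wH H) (Function.update (gH H) p 1) R ℓ₁ ℓ₂
              - qform (fH H) (wH H) (gH H) R ℓ₁ ℓ₂))| ≤ singularSeries H ^ 2 * N := by
  obtain ⟨C₁, hC₁, h1⟩ := exists_abs_lamForm_le k hk2
  obtain ⟨C₂, hC₂, h2⟩ := exists_sum_pf_const_le (k + 1)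
  -- The exponent 4k + 1 pays for (log N)^{4k} from two coefficients with ℓ ≤ k, and one further
  -- logarithm absorbs the constants.
  obtain ⟨N₁, h3⟩ := exists_error_sum_le hτ0 hτ.le hBV hBV2 k (4 * k + 1)
  set K : ℝ := 18 * C₁ ^ 2 * 2 ^ (4 * k) * C₂ ^ 2 * 2 ^ (2 * (k + 1)) with hK
  have hev := (Filter.eventually_ge_atTop (2 : ℝ)).and
    ((Real.tendsto_log_atTop.eventually_ge_atTop 1).and
    ((Real.tendsto_log_atTop.eventually_ge_atTop (4 * C₁ ^ 2 * 2 ^ (4 * k))).and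
    ((eventually_log_pow_mul_rpow_le hτ 1 0).and
    ((eventually_log_pow_mul_rpow_le (τ := 0) (by norm_num) 1 1).and
    ((eventually_log_pow_mul_rpow_le hτ K (4 * k + 2 * (k + 1) + 3)).and
      (Filter.eventually_ge_atTop N₁))))))
  obtain ⟨N₀, hN₀⟩ := Filter.eventually_atTop.1 hev
  refine ⟨N₀, fun N hN R hR hRN H hk hA hHN h₀ hh₀ ℓ₁ ℓ₂ hℓ₁ hℓ₂ => ?_⟩
  obtain ⟨hN2, hl1, hlC, hNτ, hlN, hlK, hNN1⟩ := hN₀ N hN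
  rw [pow_zero, one_mul, one_mul] at hNτ
  rw [pow_one, one_mul, Real.rpow_zero, mul_one] at hlN
  have hν : ∀ p : ℕ, p.Prime → (1 : ℝ) ≤ nuP H p ∧ (nuP H p : ℝ) + 1 ≤ p := fun p hp =>
    ⟨one_le_nuP' hk hk2 p, nuP_add_one_le hA hp⟩
  have hN0 : 0 < N := by linarith
  set L := Real.log N with hL
  obtain ⟨hha, hhb⟩ := abs_le.1 (hHN h₀ hh₀)
  have hlR0 : 0 ≤ Real.log R := Real.log_nonneg hR
  have hlR : 1 + Real.log R ≤ 2 * L := by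
    have h4 : Real.log R ≤ Real.log (N ^ (τ / 2)) := Real.log_le_log (by linarith) hRN
    rw [Real.log_rpow hN0] at h4
    nlinarith
  have hR2 : R ^ 2 ≤ N ^ τ := by
    calc R ^ 2 ≤ (N ^ (τ / 2)) ^ 2 := by gcongr
      _ = N ^ τ := by rw [← Real.rpow_natCast, ← Real.rpow_mul hN0.le]; congr 1; push_cast; ring
  set M := ⌊R⌋₊ with hM
  have hMR : (M : ℝ) ≤ R := Nat.floor_le (by linarith)
  set x : ℝ := N + h₀ with hx
  have hMx : (M : ℝ) ^ 2 < x := by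
    have : (M : ℝ) ^ 2 ≤ R ^ 2 := by gcongr
    linarith
  have hx1 : 1 ≤ x := by linarith
  have hx2 : x ≤ 2 * N := by linarith
  set lf := lamForm (fH H) (wH H) R with hlf
  have hlam : ∀ ℓ, ℓ ≤ k → ∀ d, |lf ℓ d| ≤ C₁ * (2 * L) ^ (2 * k) * pf (fun _ => (k : ℝ) + 1) d := by
    intro ℓ hℓ d
    refine (h1 H hk hA R hR ℓ d).trans ?_
    have : 0 ≤ pf (fun _ => (k : ℝ) + 1) d := pf_nonneg (fun _ _ => by positivity) d
    have h5 : (1 + Real.log R) ^ (k + ℓ) ≤ (2 * L) ^ (2 * k) :=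
      (pow_le_pow_left₀ (by linarith) hlR _).trans (pow_le_pow_right₀ (by linarith) (by omega))
    gcongr
  rw [sieveSum_eq hν hR, ← sum_sum_progressionMain, ← mul_sub, abs_mul,
    abs_of_nonneg (sq_nonneg (singularSeries H))]
  refine mul_le_mul_of_nonneg_left ?_ (sq_nonneg _)
  rw [← sum_sub_distrib]
  have hterm : ∀ d ∈ sqf M, ∀ e ∈ sqf M,
      |lf ℓ₁ d * lf ℓ₂ e * ∑ n ∈ (Ioc ⌊N⌋₊ ⌊2 * N⌋₊).filter
          (fun n : ℕ => ((Nat.lcm d e : ℕ) : ℤ) ∣ P (n : ℤ) H), varpi2 ((n : ℤ) + h₀).toNat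
        - lf ℓ₁ d * lf ℓ₂ e * progressionMain H x (Nat.lcm d e)|
      ≤ C₁ ^ 2 * (2 * L) ^ (4 * k) * (pf (fun _ => (k : ℝ) + 1) d * pf (fun _ => (k : ℝ) + 1) e *
          (pf (fun _ => (k : ℝ)) (Nat.lcm d e) * progressionError (2 * N) (Nat.lcm d e)))
        + C₁ ^ 2 * (2 * L) ^ (4 * k) * (18 * L ^ 3) *
          (pf (fun _ => (k : ℝ) + 1) d * pf (fun _ => (k : ℝ) + 1) e) := by
    intro d hd e he
    have hDs := squarefree_lcm (mem_sqf.1 hd).2 (mem_sqf.1 he).2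
    have b1 := abs_sum_shift_sub_le (H := H) (h₀ := h₀) (Nat.lcm d e) (N := N) hl1
      (by linarith) (hHN h₀ hh₀)
    have b2 := abs_sum_varpi2_sub_le hh₀ hk hx1 hx2 hMx hDs
      (fun p hp => le_of_mem_primeFactors_lcm hd he hp)
    have b3 := (abs_sub_le _ _ _).trans (add_le_add b1 b2)
    rw [← mul_sub, abs_mul, abs_mul]
    have hd0 : 0 ≤ pf (fun _ => (k : ℝ) + 1) d := pf_nonneg (fun _ _ => by positivity) d
    calc _ ≤ (C₁ * (2 * L) ^ (2 * k) * pf (fun _ => (k : ℝ) + 1) d) *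
          (C₁ * (2 * L) ^ (2 * k) * pf (fun _ => (k : ℝ) + 1) e) *
          (18 * L ^ 3 + pf (fun _ => (k : ℝ)) (Nat.lcm d e) * progressionError (2 * N) (Nat.lcm d e)) := by
          refine mul_le_mul ?_ b3 (abs_nonneg _) ?_
          · exact mul_le_mul (hlam ℓ₁ hℓ₁ d) (hlam ℓ₂ hℓ₂ e) (abs_nonneg _) (by positivity)
          · exact mul_nonneg ((abs_nonneg _).trans (hlam ℓ₁ hℓ₁ d)) ((abs_nonneg _).trans (hlam ℓ₂ hℓ₂ e))
      _ = _ := by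
          rw [show 4 * k = 2 * k + 2 * k by ring, pow_add]
          ring
  have hsum := (abs_sum_le_sum_abs (fun d => ∑ e ∈ sqf M,
      lf ℓ₁ d * lf ℓ₂ e * ∑ n ∈ (Ioc ⌊N⌋₊ ⌊2 * N⌋₊).filter
          (fun n : ℕ => ((Nat.lcm d e : ℕ) : ℤ) ∣ P (n : ℤ) H), varpi2 ((n : ℤ) + h₀).toNat
        - ∑ e ∈ sqf M, lf ℓ₁ d * lf ℓ₂ e * progressionMain H x (Nat.lcm d e)) (sqf M))
  refine hsum.trans ?_
  have hstep : ∀ d ∈ sqf M, |∑ e ∈ sqf M,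
      lf ℓ₁ d * lf ℓ₂ e * ∑ n ∈ (Ioc ⌊N⌋₊ ⌊2 * N⌋₊).filter
          (fun n : ℕ => ((Nat.lcm d e : ℕ) : ℤ) ∣ P (n : ℤ) H), varpi2 ((n : ℤ) + h₀).toNat
        - ∑ e ∈ sqf M, lf ℓ₁ d * lf ℓ₂ e * progressionMain H x (Nat.lcm d e)|
      ≤ ∑ e ∈ sqf M, (C₁ ^ 2 * (2 * L) ^ (4 * k) * (pf (fun _ => (k : ℝ) + 1) d *
          pf (fun _ => (k : ℝ) + 1) e *
          (pf (fun _ => (k : ℝ)) (Nat.lcm d e) * progressionError (2 * N) (Nat.lcm d e)))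
        + C₁ ^ 2 * (2 * L) ^ (4 * k) * (18 * L ^ 3) *
          (pf (fun _ => (k : ℝ) + 1) d * pf (fun _ => (k : ℝ) + 1) e)) := by
    intro d hd
    rw [← sum_sub_distrib]
    exact (abs_sum_le_sum_abs _ _).trans (sum_le_sum fun e he => hterm d hd e he)
  refine (sum_le_sum hstep).trans ?_
  simp_rw [sum_add_distrib, ← mul_sum]
  have t1 := h3 N hNN1 R hR hRN
  have t2 : ∑ d ∈ sqf M, pf (fun _ => (k : ℝ) + 1) d * ∑ e ∈ sqf M, pf (fun _ => (k : ℝ) + 1) e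
      ≤ (C₂ * R * (2 * L) ^ (k + 1)) * (C₂ * R * (2 * L) ^ (k + 1)) := by
    have h5 := h2 R hR
    push_cast at h5
    have h6 : C₂ * R * (1 + Real.log R) ^ (k + 1) ≤ C₂ * R * (2 * L) ^ (k + 1) := by gcongr
    have h7 : 0 ≤ ∑ q ∈ sqf M, pf (fun _ => (k : ℝ) + 1) q :=
      sum_nonneg fun q _ => pf_nonneg (fun _ _ => by positivity) q
    rw [← sum_mul]
    exact mul_le_mul (h5.trans h6) (h5.trans h6) h7 (h7.trans (h5.trans h6))
  have t1' : ∑ d ∈ sqf M, ∑ e ∈ sqf M, pf (fun _ => (k : ℝ) + 1) d * pf (fun _ => (k : ℝ) + 1) e *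
        (pf (fun _ => (k : ℝ)) (Nat.lcm d e) * progressionError (2 * N) (Nat.lcm d e))
      ≤ N / L ^ (4 * k + 1) := t1
  have u1 : C₁ ^ 2 * (2 * L) ^ (4 * k) * (N / L ^ (4 * k + 1)) ≤ N / 4 := by
    have h5 : C₁ ^ 2 * (2 * L) ^ (4 * k) * (N / L ^ (4 * k + 1))
        = (4 * C₁ ^ 2 * 2 ^ (4 * k)) * (N / 4 / L) := by
      rw [mul_pow]
      field_simp
      ring
    rw [h5]
    calc _ ≤ L * (N / 4 / L) := by gcongr
      _ = N / 4 := by field_simp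
  have u2 : C₁ ^ 2 * (2 * L) ^ (4 * k) * (18 * L ^ 3) *
      ((C₂ * R * (2 * L) ^ (k + 1)) * (C₂ * R * (2 * L) ^ (k + 1))) ≤ N / 4 := by
    refine le_trans ?_ hlK
    have h5 : C₁ ^ 2 * (2 * L) ^ (4 * k) * (18 * L ^ 3) *
      ((C₂ * R * (2 * L) ^ (k + 1)) * (C₂ * R * (2 * L) ^ (k + 1)))
      = K * L ^ (4 * k + 2 * (k + 1) + 3) * R ^ 2 := by
      rw [hK]; ring
    rw [h5]
    gcongr
  have hc0 : 0 ≤ C₁ ^ 2 * (2 * L) ^ (4 * k) := by positivity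
  have v1 := mul_le_mul_of_nonneg_left t1' hc0
  have v2 := mul_le_mul_of_nonneg_left t2
    (show 0 ≤ C₁ ^ 2 * (2 * L) ^ (4 * k) * (18 * L ^ 3) by positivity)
  have v1' : C₁ ^ 2 * (2 * L) ^ (4 * k) * ∑ d ∈ sqf M, ∑ e ∈ sqf M,
        pf (fun _ => (k : ℝ) + 1) d * pf (fun _ => (k : ℝ) + 1) e *
        (pf (fun _ => (k : ℝ)) (Nat.lcm d e) * progressionError (2 * N) (Nat.lcm d e)) ≤ N / 4 :=
    v1.trans u1
  have v2' := v2.trans u2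
  linarith


/-! ### Comparison with the main term -/

/-- 𝔖·Σh(r) is asymptotic to u^{k-1}/(k-1)!, while Σh(r) is at most a constant times (1+u)^{k-1}
uniformly in the tuple. Comparing the two as u → ∞ bounds 𝔖 below. -/
theorem exists_le_singularSeries (j : ℕ) :
    ∃ c : ℝ, 0 < c ∧ ∀ H : Finset ℤ, H.card = j + 2 → Admissible H → c ≤ singularSeries H := by
  obtain ⟨C₁, hC₁, h1⟩ := exists_W_hH_asymptotic j
  obtain ⟨C₂, hC₂, h2⟩ := exists_sum_hH_evar_le j
  refine ⟨1 / (((j + 1).factorial : ℝ) * (C₂ * 2 ^ (j + 1))), by positivity, fun H hk hA => ?_⟩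
  obtain ⟨hS, hW⟩ := h1 H hk hA
  have hβ := log_two_div_two_le_beta hk (by omega) hA
  have hl2 : 0 < Real.log 2 := Real.log_pos (by norm_num)
  have hβ0 : 0 < beta H := by linarith
  set S := singularSeries H with hSdef
  have key : 1 / ((j + 1).factorial : ℝ) ≤ S * (C₂ * 2 ^ (j + 1)) := by
    refine le_of_forall_pos_le_add fun ε hε => ?_
    set D := C₁ * (S * beta H) * 2 ^ j with hD
    have hD0 : 0 < D := by positivity
    -- Here u may depend on the tuple: it is taken so large that the secondary term, which involves
    -- β and 𝔖, falls below ε.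
    set u : ℝ := max 1 (D / ε) with hu
    have hu1 : 1 ≤ u := le_max_left _ _
    have huD : D / u ≤ ε := by
      rw [div_le_iff₀ (by linarith), mul_comm, ← div_le_iff₀ hε]
      exact le_max_right _ _
    have hw := (abs_le.1 (hW 0 u (by linarith))).1
    rw [W_sqfun_zero] at hw
    simp only [add_zero] at hw
    have hsum : ∑ n ∈ sqf ⌊Real.exp u⌋₊, pf (hH H) n ≤ C₂ * (2 * u) ^ (j + 1) := by
      calc _ ≤ ∑ r ∈ sqf ⌊Real.exp u⌋₊, pf (hH H) r * evar r ^ 2 :=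
            sum_le_sum fun r _ => le_mul_of_one_le_right
              (pf_nonneg (fun p hp => hH_nonneg hk (by omega) hA hp) r)
              (one_le_pow₀ (one_le_evar r))
        _ ≤ C₂ * (1 + u) ^ (j + 1) := h2 H hk hA u (by linarith)
        _ ≤ _ := by gcongr; linarith
    have hsum' := mul_le_mul_of_nonneg_left hsum hS.le
    have he : C₁ * (S * beta H) * (1 + u) ^ j ≤ C₁ * (S * beta H) * (2 * u) ^ j := by
      gcongr; linarith
    have hmain : u ^ (j + 1) / ((j + 1).factorial : ℝ)
        ≤ S * (C₂ * (2 * u) ^ (j + 1)) + C₁ * (S * beta H) * (2 * u) ^ j := by linarith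
    have hup : 0 < u ^ (j + 1) := by positivity
    have e1 : S * (C₂ * (2 * u) ^ (j + 1)) + C₁ * (S * beta H) * (2 * u) ^ j
        = (S * (C₂ * 2 ^ (j + 1)) + D / u) * u ^ (j + 1) := by
      rw [hD, mul_pow, mul_pow]
      field_simp
      ring
    rw [e1, div_le_iff₀ (by positivity)] at hmain
    have h5 : 1 / ((j + 1).factorial : ℝ) ≤ S * (C₂ * 2 ^ (j + 1)) + D / u := by
      rw [div_le_iff₀ (by positivity)]
      nlinarith
    linarith
  rw [one_div, mul_inv, ← one_div, ← div_eq_mul_inv, div_le_iff₀ (by positivity)]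
  exact key

/-- With n = ℓ₁+ℓ₂+2 and b the binomial on the right, the two large binomials in T are (n+1)b/(ℓ₁+2)
and (n+1)b/(ℓ₂+2). Each is at most (n+1)b/2, so -T ≤ nb. -/
theorem neg_T_le (ℓ₁ ℓ₂ : ℕ) :
    - T ℓ₁ ℓ₂ ≤ (Nat.choose (ℓ₁ + ℓ₂ + 2) (ℓ₁ + 1) : ℝ) * ((ℓ₁ : ℝ) + ℓ₂ + 2) := by
  have h1 := Nat.add_one_mul_choose_eq (ℓ₁ + ℓ₂ + 2) (ℓ₁ + 1)
  have h2 := Nat.add_one_mul_choose_eq (ℓ₁ + ℓ₂ + 2) (ℓ₂ + 1)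
  have s1 : Nat.choose (ℓ₁ + ℓ₂ + 3) (ℓ₂ + 1) = Nat.choose (ℓ₁ + ℓ₂ + 3) (ℓ₁ + 2) :=
    Nat.choose_symm_of_eq_add (by ring)
  have s2 : Nat.choose (ℓ₁ + ℓ₂ + 3) (ℓ₁ + 1) = Nat.choose (ℓ₁ + ℓ₂ + 3) (ℓ₂ + 2) :=
    Nat.choose_symm_of_eq_add (by ring)
  have s3 : Nat.choose (ℓ₁ + ℓ₂ + 2) (ℓ₂ + 1) = Nat.choose (ℓ₁ + ℓ₂ + 2) (ℓ₁ + 1) :=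
    Nat.choose_symm_of_eq_add (by ring)
  have h1' : ((ℓ₁ : ℝ) + ℓ₂ + 3) * (Nat.choose (ℓ₁ + ℓ₂ + 2) (ℓ₁ + 1) : ℝ)
      = (Nat.choose (ℓ₁ + ℓ₂ + 3) (ℓ₁ + 2) : ℝ) * ((ℓ₁ : ℝ) + 2) := by
    exact_mod_cast h1
  have h2' : ((ℓ₁ : ℝ) + ℓ₂ + 3) * (Nat.choose (ℓ₁ + ℓ₂ + 2) (ℓ₁ + 1) : ℝ)
      = (Nat.choose (ℓ₁ + ℓ₂ + 3) (ℓ₂ + 2) : ℝ) * ((ℓ₂ : ℝ) + 2) := by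
    rw [← s3]
    exact_mod_cast h2
  unfold T
  rw [s1, s2]
  have n1 : (0 : ℝ) ≤ Nat.choose (ℓ₁ + ℓ₂ + 3) (ℓ₁ + 2) := Nat.cast_nonneg _
  have n2 : (0 : ℝ) ≤ Nat.choose (ℓ₁ + ℓ₂ + 3) (ℓ₂ + 2) := Nat.cast_nonneg _
  have n3 : (0 : ℝ) ≤ ℓ₁ := Nat.cast_nonneg _
  have n4 : (0 : ℝ) ≤ ℓ₂ := Nat.cast_nonneg _
  nlinarith [mul_nonneg n1 n3, mul_nonneg n2 n4]

/-- Over a common factorial the first term has coefficient b(k+ℓ₁+ℓ₂+2) log N, and the second is at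
worst -b(ℓ₁+ℓ₂+2)·2 log R. As 2 log R ≤ log N, at least bk log N ≥ log N remains. -/
theorem le_mainTerm {N R : ℝ} {H : Finset ℤ} (ℓ₁ ℓ₂ : ℕ) (hc : 1 ≤ H.card)
    (hS : 0 ≤ singularSeries H) (hN : 0 ≤ N) (hA : 0 ≤ Real.log R)
    (hAL : 2 * Real.log R ≤ Real.log N) :
    N * Real.log N * singularSeries H * Real.log R ^ (H.card + ℓ₁ + ℓ₂ + 1)
      / ((H.card + ℓ₁ + ℓ₂ + 2).factorial : ℝ) ≤ mainTerm N R H ℓ₁ ℓ₂ := by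
  set n := H.card + ℓ₁ + ℓ₂ with hn
  set b : ℝ := (Nat.choose (ℓ₁ + ℓ₂ + 2) (ℓ₁ + 1) : ℝ) with hb
  have hb1 : 1 ≤ b := by
    have : 0 < Nat.choose (ℓ₁ + ℓ₂ + 2) (ℓ₁ + 1) := Nat.choose_pos (by omega)
    rw [hb]; exact_mod_cast this
  have hT := neg_T_le ℓ₁ ℓ₂
  rw [← hb] at hT
  have hc' : (1 : ℝ) ≤ H.card := by exact_mod_cast hc
  have hL : 0 ≤ Real.log N := by linarith
  have e : mainTerm N R H ℓ₁ ℓ₂ = (N * singularSeries H * Real.log R ^ (n + 1)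
      / ((n + 2).factorial : ℝ)) * (b * ((n : ℝ) + 2) * Real.log N + 2 * T ℓ₁ ℓ₂ * Real.log R) := by
    unfold mainTerm
    rw [← hn, Nat.factorial_succ (n + 1)]
    push_cast
    field_simp
    ring
  rw [e]
  have key : Real.log N ≤ b * ((n : ℝ) + 2) * Real.log N + 2 * T ℓ₁ ℓ₂ * Real.log R := by
    have hnn : (n : ℝ) = H.card + ℓ₁ + ℓ₂ := by rw [hn]; push_cast; ring
    have h1 : -(2 * T ℓ₁ ℓ₂ * Real.log R) ≤ b * ((ℓ₁ : ℝ) + ℓ₂ + 2) * Real.log N := by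
      calc -(2 * T ℓ₁ ℓ₂ * Real.log R) = -T ℓ₁ ℓ₂ * (2 * Real.log R) := by ring
        _ ≤ b * ((ℓ₁ : ℝ) + ℓ₂ + 2) * (2 * Real.log R) :=
            mul_le_mul_of_nonneg_right hT (by linarith)
        _ ≤ _ := mul_le_mul_of_nonneg_left hAL (by positivity)
    have h2 : Real.log N ≤ b * H.card * Real.log N :=
      le_mul_of_one_le_left hL (by nlinarith)
    rw [hnn]
    linarith
  calc _ = (N * singularSeries H * Real.log R ^ (n + 1) / ((n + 2).factorial : ℝ)) * Real.log N := by
        ring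
    _ ≤ _ := mul_le_mul_of_nonneg_left key (by positivity)

-- Every error is at most a constant times 𝔖·Z with Z = 𝔖βN log N (log R)^n, and by `le_mainTerm`
-- this is a constant times β𝔖/log R times the main term. Here x stands for N + h₀ and V for the
-- sieve sum.
set_option maxHeartbeats 800000 in
theorem exists_abs_sub_mainTerm_le (j ℓ₁ ℓ₂ : ℕ) :
    ∃ C : ℝ, 0 < C ∧ ∀ H : Finset ℤ, H.card = j + 2 → Admissible H →
      ∀ N : ℝ, 1 ≤ N → 1 ≤ Real.log N → Real.log N ^ 2 ≤ N / 2 →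
      ∀ R : ℝ, 2 ≤ R → 2 * Real.log R ≤ Real.log N →
      ∀ x : ℝ, |x - N| ≤ Real.log N → ∀ V : ℝ,
      |V - singularSeries H ^ 2 *
        (x * (Real.log x + C0) * qform (fH H) (wH H) (gH H) R ℓ₁ ℓ₂
          + 2 * x * ∑ p ∈ pr ⌊R⌋₊, Real.log p / p *
            (qform (fH H) (wH H) (Function.update (gH H) p 1) R ℓ₁ ℓ₂
              - qform (fH H) (wH H) (gH H) R ℓ₁ ℓ₂))| ≤ singularSeries H ^ 2 * N →
      |V - mainTerm N R H ℓ₁ ℓ₂|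
        ≤ C * (beta H * singularSeries H / Real.log R) * |mainTerm N R H ℓ₁ ℓ₂| := by
  obtain ⟨C₁, hC₁, h1⟩ := exists_qform_asymptotic j ℓ₁ ℓ₂
  obtain ⟨C₂, hC₂, h2⟩ := exists_sum_qform_update_asymptotic j ℓ₁ ℓ₂
  obtain ⟨c, hc, hcS⟩ := exists_le_singularSeries j
  set n := j + 2 + ℓ₁ + ℓ₂ with hn
  set b : ℝ := (Nat.choose (ℓ₁ + ℓ₂ + 2) (ℓ₁ + 1) : ℝ) with hb
  have hb0 : 0 ≤ b := Nat.cast_nonneg _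
  -- Bounds (x(log x + C₀) - N log N)/N: 2 from x|log x - log N|, 1 from (log N)² ≤ N, and 2|C₀|
  -- from x ≤ 2N.
  set K₀ : ℝ := 3 + 2 * |C0| with hK₀
  have hK₀0 : 0 < K₀ := by have := abs_nonneg C0; linarith
  have hl2 : 0 < Real.log 2 := Real.log_pos (by norm_num)
  have hl2' := Real.log_two_gt_d9
  set K : ℝ := 4 * 2 ^ n + K₀ * b * (4 / c) + (1 + K₀) * C₁ * 3 ^ n + 2 * |T ℓ₁ ℓ₂| * (4 / c)
    + 4 * C₂ * 3 ^ (n + 1) with hK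
  have hK0 : 0 < K := by positivity
  refine ⟨K * ((n + 2).factorial : ℝ), by positivity, ?_⟩
  intro H hk hA N hN1 hl1 hlN R hR hRN x hx V hV
  have hβ := log_two_div_two_le_beta hk (by omega) hA
  have hS := hcS H hk hA
  set S := singularSeries H with hSdef
  have hS0 : 0 < S := by linarith
  set L := Real.log N with hL
  set A := Real.log R with hAdef
  set β := beta H with hβdef
  have hβ0 : 0 < β := by linarith
  have hA2 : Real.log 2 ≤ A := Real.log_le_log (by norm_num) hR
  have hA0 : 0 < A := by linarith
  have hAL : A ≤ L := by linarith
  set Q₀ := qform (fH H) (wH H) (gH H) R ℓ₁ ℓ₂ with hQ₀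
  set Q₁ := ∑ p ∈ pr ⌊R⌋₊, Real.log p / p *
            (qform (fH H) (wH H) (Function.update (gH H) p 1) R ℓ₁ ℓ₂
              - qform (fH H) (wH H) (gH H) R ℓ₁ ℓ₂) with hQ₁
  have q0 := h1 H hk hA R (by linarith)
  have q1 := h2 H hk hA R (by linarith)
  rw [← hSdef, ← hβdef, ← hAdef] at q0 q1
  set σ := S * β with hσ
  have hσ0 : 0 < σ := by positivity
  have hSσ : S ≤ 4 * σ := by
    rw [hσ]; nlinarith
  -- Because 𝔖 ≥ c and β ≥ (log 2)/2 > 1/4. It inserts the factor 𝔖β into the errors made when x and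
  -- log x + C₀ are replaced by N and log N.
  have hσc : 1 ≤ 4 / c * σ := by
    rw [div_mul_eq_mul_div, le_div_iff₀ hc]
    linarith
  set m₀ : ℝ := b * (A ^ (n + 1) / ((n + 1).factorial : ℝ)) with hm₀
  set m₁ : ℝ := T ℓ₁ ℓ₂ * (A ^ (n + 2) / ((n + 2).factorial : ℝ)) with hm₁
  have hmain : mainTerm N R H ℓ₁ ℓ₂ = S * (N * L * m₀) + 2 * S * (N * m₁) := by
    unfold mainTerm
    rw [hk, ← hn, ← hSdef, ← hb]
    ring
  have hlow := le_mainTerm (N := N) (R := R) (H := H) ℓ₁ ℓ₂ (by omega) hS0.le (by linarith)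
    hA0.le hRN
  rw [hk, ← hn] at hlow
  have hN0 : 0 < N := by linarith
  have hLN : L ≤ N / 2 := by nlinarith
  obtain ⟨hxa, hxb⟩ := abs_le.1 hx
  have hx0 : 0 < x := by linarith
  have hx2 : x ≤ 2 * N := by linarith
  have hlogx : |Real.log x - L| ≤ 1 := by
    have h5 : Real.log x ≤ Real.log (2 * N) := Real.log_le_log hx0 hx2
    have h6 : Real.log N ≤ Real.log (2 * x) := Real.log_le_log hN0 (by linarith)
    rw [Real.log_mul (by norm_num) (by linarith)] at h5 h6
    have := Real.log_two_lt_d9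
    rw [abs_le]
    constructor <;> linarith
  have d0 : |x * (Real.log x + C0) - N * L| ≤ K₀ * N := by
    have e : x * (Real.log x + C0) - N * L = x * (Real.log x - L) + (x - N) * L + x * C0 := by ring
    rw [e]
    refine (abs_add_three _ _ _).trans ?_
    rw [abs_mul, abs_mul, abs_mul, abs_of_pos hx0, abs_of_pos (by linarith : 0 < L)]
    have f1 : x * |Real.log x - L| ≤ 2 * N * 1 :=
      mul_le_mul hx2 hlogx (abs_nonneg _) (by linarith)
    have f2 : |x - N| * L ≤ L * L := by gcongr
    have f3 : x * |C0| ≤ 2 * N * |C0| := mul_le_mul_of_nonneg_right hx2 (abs_nonneg _)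
    have hLL : L * L ≤ N := by rw [sq] at hlN; linarith
    rw [hK₀]
    linarith
  have d1 : |x * (Real.log x + C0)| ≤ (1 + K₀) * (N * L) := by
    have h5 := abs_add_le (x * (Real.log x + C0) - N * L) (N * L)
    rw [sub_add_cancel, abs_of_pos (by positivity : 0 < N * L)] at h5
    have h6 : K₀ * N ≤ K₀ * (N * L) := by
      have : N ≤ N * L := le_mul_of_one_le_right hN0.le hl1
      gcongr
    linarith
  have hfac : ∀ i : ℕ, (1 : ℝ) ≤ (i.factorial : ℝ) := fun i => by exact_mod_cast Nat.factorial_pos i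
  have a0 : |m₀| ≤ b * A ^ (n + 1) := by
    rw [hm₀, abs_of_nonneg (by positivity)]
    have := div_le_self (by positivity : 0 ≤ A ^ (n + 1)) (hfac (n + 1))
    gcongr
  have a1 : |m₁| ≤ |T ℓ₁ ℓ₂| * A ^ (n + 2) := by
    rw [hm₁, abs_mul, abs_of_nonneg (by positivity : 0 ≤ A ^ (n + 2) / ((n + 2).factorial : ℝ))]
    have := div_le_self (by positivity : 0 ≤ A ^ (n + 2)) (hfac (n + 2))
    gcongr
  have p0 : (1 + A) ^ n ≤ 3 ^ n * A ^ n := by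
    rw [← mul_pow]; gcongr; linarith
  have p1 : (1 + A) ^ (n + 1) ≤ 3 ^ (n + 1) * (A ^ n * L) := by
    calc (1 + A) ^ (n + 1) ≤ (3 * A) ^ (n + 1) := by gcongr; linarith
      _ = 3 ^ (n + 1) * (A ^ n * A) := by rw [mul_pow, pow_succ A]
      _ ≤ _ := by gcongr
  have p2 : 1 ≤ 2 ^ n * A ^ n := by
    rw [← mul_pow]; exact one_le_pow₀ (by linarith)
  set Z := σ * N * L * A ^ n with hZ
  have hZ0 : 0 < Z := by positivity
  have r1 : S * N ≤ 4 * 2 ^ n * Z := by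
    calc S * N ≤ (4 * σ) * N := by gcongr
      _ = 4 * σ * N * 1 * 1 := by ring
      _ ≤ 4 * σ * N * L * (2 ^ n * A ^ n) := by gcongr
      _ = _ := by rw [hZ]; ring
  have r2 : |(x * (Real.log x + C0) - N * L) * m₀| ≤ K₀ * b * (4 / c) * Z := by
    rw [abs_mul]
    calc _ ≤ K₀ * N * (b * A ^ (n + 1)) := mul_le_mul d0 a0 (abs_nonneg _) (by positivity)
      _ = K₀ * N * (b * (A ^ n * A)) * 1 := by rw [pow_succ]; ring
      _ ≤ K₀ * N * (b * (A ^ n * L)) * (4 / c * σ) := by gcongr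
      _ = _ := by rw [hZ]; ring
  have r3 : |x * (Real.log x + C0) * (S * Q₀ - m₀)| ≤ (1 + K₀) * C₁ * 3 ^ n * Z := by
    rw [abs_mul]
    calc _ ≤ (1 + K₀) * (N * L) * (C₁ * σ * (1 + A) ^ n) :=
          mul_le_mul d1 q0 (abs_nonneg _) (by positivity)
      _ ≤ (1 + K₀) * (N * L) * (C₁ * σ * (3 ^ n * A ^ n)) := by gcongr
      _ = _ := by rw [hZ]; ring
  have r4 : |(x - N) * m₁| ≤ |T ℓ₁ ℓ₂| * (4 / c) * Z := by
    rw [abs_mul]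
    calc _ ≤ L * (|T ℓ₁ ℓ₂| * A ^ (n + 2)) := mul_le_mul hx a1 (abs_nonneg _) (by positivity)
      _ = L * |T ℓ₁ ℓ₂| * A ^ n * A ^ 2 * 1 := by ring
      _ ≤ L * |T ℓ₁ ℓ₂| * A ^ n * N * (4 / c * σ) := by
          have : A ^ 2 ≤ N := by nlinarith
          gcongr
      _ = _ := by rw [hZ]; ring
  have r5 : |x * (S * Q₁ - m₁)| ≤ 2 * C₂ * 3 ^ (n + 1) * Z := by
    rw [abs_mul, abs_of_pos hx0]
    calc _ ≤ 2 * N * (C₂ * σ * (1 + A) ^ (n + 1)) :=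
          mul_le_mul hx2 q1 (abs_nonneg _) (by positivity)
      _ ≤ 2 * N * (C₂ * σ * (3 ^ (n + 1) * (A ^ n * L))) := by gcongr
      _ = _ := by rw [hZ]; ring
  have htot : |V - mainTerm N R H ℓ₁ ℓ₂| ≤ S * (K * Z) := by
    rw [hmain]
    have e : V - (S * (N * L * m₀) + 2 * S * (N * m₁))
        = (V - S ^ 2 * (x * (Real.log x + C0) * Q₀ + 2 * x * Q₁))
          + S * ((x * (Real.log x + C0) - N * L) * m₀ + x * (Real.log x + C0) * (S * Q₀ - m₀)
            + 2 * ((x - N) * m₁) + 2 * (x * (S * Q₁ - m₁))) := by ring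
    have g1 : |(x * (Real.log x + C0) - N * L) * m₀ + x * (Real.log x + C0) * (S * Q₀ - m₀)
            + 2 * ((x - N) * m₁) + 2 * (x * (S * Q₁ - m₁))|
        ≤ (K - 4 * 2 ^ n) * Z := by
      rw [hK]
      rw [abs_le] at r2 r3 r4 r5 ⊢
      constructor <;> linarith [r2.1, r2.2, r3.1, r3.2, r4.1, r4.2, r5.1, r5.2]
    rw [e]
    refine (abs_add_le _ _).trans ?_
    rw [abs_mul, abs_of_pos hS0]
    have g2 := mul_le_mul_of_nonneg_left g1 hS0.le
    have g3 := mul_le_mul_of_nonneg_left r1 hS0.le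
    have g4 : S ^ 2 * N = S * (S * N) := by ring
    linarith
  have hM0 : 0 ≤ mainTerm N R H ℓ₁ ℓ₂ := le_trans (by positivity) hlow
  refine htot.trans ?_
  rw [abs_of_nonneg hM0]
  have hfin : S * (K * Z) = K * ((n + 2).factorial : ℝ) * (β * S / A) *
      (N * L * S * A ^ (n + 1) / ((n + 2).factorial : ℝ)) := by
    have : ((n + 2).factorial : ℝ) ≠ 0 := by positivity
    rw [hZ, hσ, pow_succ]
    field_simp
  rw [hfin]
  exact mul_le_mul_of_nonneg_left hlow (by positivity)

theorem exists_uniform_abs_sub_mainTerm_le (j : ℕ) :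
    ∃ C : ℝ, 0 < C ∧ ∀ ℓ₁ ℓ₂ : ℕ, ℓ₁ ≤ j + 2 → ℓ₂ ≤ j + 2 →
      ∀ H : Finset ℤ, H.card = j + 2 → Admissible H →
      ∀ N : ℝ, 1 ≤ N → 1 ≤ Real.log N → Real.log N ^ 2 ≤ N / 2 →
      ∀ R : ℝ, 2 ≤ R → 2 * Real.log R ≤ Real.log N →
      ∀ x : ℝ, |x - N| ≤ Real.log N → ∀ V : ℝ,
      |V - singularSeries H ^ 2 *
        (x * (Real.log x + C0) * qform (fH H) (wH H) (gH H) R ℓ₁ ℓ₂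
          + 2 * x * ∑ p ∈ pr ⌊R⌋₊, Real.log p / p *
            (qform (fH H) (wH H) (Function.update (gH H) p 1) R ℓ₁ ℓ₂
              - qform (fH H) (wH H) (gH H) R ℓ₁ ℓ₂))| ≤ singularSeries H ^ 2 * N →
      |V - mainTerm N R H ℓ₁ ℓ₂|
        ≤ C * (beta H * singularSeries H / Real.log R) * |mainTerm N R H ℓ₁ ℓ₂| := by
  choose C hC h using exists_abs_sub_mainTerm_le j
  obtain ⟨c, hc, hcS⟩ := exists_le_singularSeries j
  -- Only finitely many pairs with ℓ₁, ℓ₂ ≤ k occur, so the sum of their constants serves for all.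
  refine ⟨∑ a ∈ range (j + 3), ∑ b ∈ range (j + 3), C a b,
    sum_pos (fun a _ => sum_pos (fun b _ => hC a b) (by simp)) (by simp), ?_⟩
  intro ℓ₁ ℓ₂ h₁ h₂ H hk hA N hN1 hl1 hlN R hR hRN x hx V hV
  refine (h ℓ₁ ℓ₂ H hk hA N hN1 hl1 hlN R hR hRN x hx V hV).trans ?_
  have hβ := log_two_div_two_le_beta hk (by omega) hA
  have hl2 : 0 < Real.log 2 := Real.log_pos (by norm_num)
  have hS := hcS H hk hA
  have hA0 : 0 ≤ Real.log R := Real.log_nonneg (by linarith)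
  have hle : C ℓ₁ ℓ₂ ≤ ∑ a ∈ range (j + 3), ∑ b ∈ range (j + 3), C a b :=
    (single_le_sum (f := fun b => C ℓ₁ b) (fun b _ => (hC ℓ₁ b).le)
      (mem_range.2 (by omega))).trans
    (single_le_sum (f := fun a => ∑ b ∈ range (j + 3), C a b)
      (fun a _ => sum_nonneg fun b _ => (hC a b).le) (mem_range.2 (by omega)))
  have h0 : 0 ≤ beta H * singularSeries H / Real.log R :=
    div_nonneg (mul_nonneg (by linarith) (by linarith)) hA0
  gcongr

end
end SmallGaps

/-! ### The theorem -/

theorem theorem7 (k : ℕ) (hk : 2 ≤ k) :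
    ∃ C : ℝ, 0 < C ∧
      ∀ θ : ℝ, 0 < θ → θ ≤ 1 → SmallGaps.BV θ → SmallGaps.BV2 θ →
      ∀ ε : ℝ, 0 < ε →
      ∃ N₀ : ℝ, ∀ N : ℝ, N₀ ≤ N → ∀ R : ℝ, 2 ≤ R → R ≤ N ^ ((θ - ε) / 2) →
      ∀ H : Finset ℤ, H.card = k → SmallGaps.Admissible H →
        (∀ h ∈ H, |(h : ℝ)| ≤ Real.log N) →
      ∀ h₀ ∈ H, ∀ ℓ₁ ℓ₂ : ℕ, ℓ₁ ≤ k → ℓ₂ ≤ k →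
        |SmallGaps.sieveSum N R H h₀ ℓ₁ ℓ₂ - SmallGaps.mainTerm N R H ℓ₁ ℓ₂|
          ≤ C * (SmallGaps.beta H * SmallGaps.singularSeries H / Real.log R)
            * |SmallGaps.mainTerm N R H ℓ₁ ℓ₂| := by
  obtain ⟨j, rfl⟩ : ∃ j, k = j + 2 := ⟨k - 2, by omega⟩
  obtain ⟨C, hC, h1⟩ := SmallGaps.exists_uniform_abs_sub_mainTerm_le j
  refine ⟨C, hC, fun θ _ hθ hBV hBV2 ε hε => ?_⟩
  -- If θ ≤ ε and N ≥ 1, then N^{(θ-ε)/2} ≤ 1 contradicts R ≥ 2, so the claim is vacuous. Otherwise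
  -- the exponent τ = θ - ε lies strictly between 0 and 1.
  rcases le_or_gt (θ - ε) 0 with hτ | hτ
  · refine ⟨1, fun N hN R hR hRN => ?_⟩
    have : N ^ ((θ - ε) / 2) ≤ 1 := Real.rpow_le_one_of_one_le_of_nonpos hN (by linarith)
    linarith
  · obtain ⟨N₁, h2⟩ := SmallGaps.exists_sieveSum_approx hk hτ (by linarith)
      (fun A hA => hBV A hA ε hε) (fun A hA => hBV2 A hA ε hε)
    have hev := (Filter.eventually_ge_atTop (1 : ℝ)).and
      ((Real.tendsto_log_atTop.eventually_ge_atTop 1).and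
      ((SmallGaps.eventually_log_pow_mul_rpow_le (τ := 0) (by norm_num) 1 2).and
        (Filter.eventually_ge_atTop N₁)))
    obtain ⟨N₀, hN₀⟩ := Filter.eventually_atTop.1 hev
    refine ⟨N₀, fun N hN R hR hRN H hH hA hHN h₀ hh₀ ℓ₁ ℓ₂ hℓ₁ hℓ₂ => ?_⟩
    obtain ⟨hN1, hl1, hlN, hNN⟩ := hN₀ N hN
    rw [one_mul, Real.rpow_zero, mul_one] at hlN
    have hN0 : 0 < N := by linarith
    -- This is where θ ≤ 1 protects the main term from cancellation.
    have hlogR : 2 * Real.log R ≤ Real.log N := by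
      have h3 : Real.log R ≤ Real.log (N ^ ((θ - ε) / 2)) := Real.log_le_log (by linarith) hRN
      rw [Real.log_rpow hN0] at h3
      nlinarith
    have h3 := h2 N hNN R (by linarith) hRN H hH hA hHN h₀ hh₀ ℓ₁ ℓ₂ hℓ₁ hℓ₂
    exact h1 ℓ₁ ℓ₂ hℓ₁ hℓ₂ H hH hA N hN1 hl1 (by linarith) R hR hlogR (N + h₀)
      (by rw [add_sub_cancel_left]; exact hHN h₀ hh₀) _ h3
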